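/- **Setting.** Let $F$ be a local field of characteristic zero, $|\cdot|$ its normalized absolute value (the factor by which multiplication scales Haar measure, so $|z|=z\bar z$ on $\mathbb{C}$), and $\psi:F\to\mathbb{C}^\times$ a nontrivial continuous unitary character. Let $d_1,d_2,d_3$ be positive even integers, $V_i=F^{d_i}$, $V(F)=V_1\times V_2\times V_3$, and let $\mathcal{Q}_i(x)=\tfrac12\,{}^txJ_ix$ with $J_i\in\mathrm{GL}_{d_i}(F)$ symmetric. For $x\in F^{d}$ put $|x|=\max_j|x_j|$. Let $V'(F)\subset V(F)$ be the set of $(v_1,v_2,v_3)$ with at least two $v_i\neq0$, and $Y^{\mathrm{sm}}(F)=\{v\in V'(F):\mathcal{Q}_1(v_1)=\mathcal{Q}_2(v_2)=\mathcal{Q}_3(v_3)\}$. Let $\mathrm{Sp}_6(F)$ be the symplectic group of $\sum_{i=1}^3(x_iy_{i+3}-y_ix_{i+3})$, $G(F)=\mathrm{SL}_2(F)^3$, embedded by $(\begin{smallmatrix}a_i&b_i\\c_i&d_i\end{smallmatrix})_i\mapsto\left(\begin{smallmatrix}\mathrm{diag}(a_i)&\mathrm{diag}(b_i)\\\mathrm{diag}(c_i)&\mathrm{diag}(d_i)\end{smallmatrix}\right)$,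 and $$\gamma_0=\left(\begin{smallmatrix}0&0&0&-1&0&0\\0&1&0&0&0&0\\0&0&1&0&0&0\\1&1&1&0&0&0\\0&0&0&-1&1&0\\0&0&0&-1&0&1\end{smallmatrix}\right),\qquad N_0(F)=\left\{\left(\begin{smallmatrix}1&t_i\\&1\end{smallmatrix}\right)_{1\le i\le3}:t_1+t_2+t_3=0\right\}.$$ Let $dg$ be the quotient on $N_0(F)\backslash G(F)$ of Haar measures on $G(F)$ and $N_0(F)$. The Weil representation $\rho=\rho_\psi$ of $G(F)$ on the Schwartz space $\mathcal{S}(V(F))$ (locally constant and compactly supported functions if $F$ is non-Archimedean) is given in the $i$th variable by $\rho(\begin{smallmatrix}1&t\\&1\end{smallmatrix})f(v)=\psi(t\mathcal{Q}_i(v))f(v)$, $\rho(\begin{smallmatrix}a&\\&a^{-1}\end{smallmatrix})f(v)=(a,(-1)^{d_i/2}\det J_i)\,|a|^{d_i/2}f(av)$ and $\rho(\begin{smallmatrix}&1\\-1&\end{smallmatrix})f(v)=\gamma(\mathcal{Q}_i)\int_{V_i}f(t)\psi({}^tvJ_it)\,dt$, where $(\cdot,\cdot)$ is the Hilbert symbol,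 $\gamma(\mathcal{Q}_i)$ the Weil number and $dt$ the self-dual measure. Let $P=\left\{\left(\begin{smallmatrix}A&\\&{}^tA^{-1}\end{smallmatrix}\right)\left(\begin{smallmatrix}I_3&Z\\&I_3\end{smallmatrix}\right):{}^tZ=Z\right\}$ be the Siegel parabolic subgroup, $N$ its unipotent radical, $[P,P]$ its commutator subgroup ($\det A=1$), $X=[P,P]\backslash\mathrm{Sp}_6$, $m_a=\mathrm{diag}(a,1,1,a^{-1},1,1)$ and $w_0=\left(\begin{smallmatrix}&-w\\w&\end{smallmatrix}\right)$ with $w$ the $3\times3$ antidiagonal permutation matrix. For a character $\chi$ of $F^\times$ set $f_{\chi_s}(g)=\int_{F^\times}|a|^{2}\chi(a)|a|^sf(m_a^{-1}g)\,d^\times a$ and $M_{w_0}f_{\chi_s}(g)=\int_{N(F)}f_{\chi_s}(w_0^{-1}ng)\,dn$. The Schwartz space $\mathcal{S}_{BK}(X(F),K)$ consists of the smooth, right $K$-finite functions $f$ on $X(F)$ such that, for every $\chi$, both integrals converge absolutely for all $g$ when $\mathrm{Re}(s)$ is sufficiently large, and the quotients $$\frac{f_{\chi_s}(g)}{a_{\mathrm{Id}}(s,\chi)}\quad\text{and}\quad\frac{M_{w_0}f_{\chi_s}(g)}{a_{w_0}(s,\chi)},\qquad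 a_{\mathrm{Id}}=L(s+2,\chi)L(2s+2,\chi^2),\quad a_{w_0}=L(s-1,\chi)L(2s-1,\chi^2),$$ are, for every $g$, in $\mathbb{C}[q^s,q^{-s}]$ (non-Archimedean $F$ with residue field of order $q$), respectively continue to entire functions of $s$ (Archimedean $F$); in the Archimedean case one also requires that on every strip $A\le\mathrm{Re}(s)\le B$ the products $p(s)f_{\chi_s}(g)$ (resp. $p(s)M_{w_0}f_{\chi_s}(g)$) are bounded for every polynomial $p$ such that $p(s)a_{\mathrm{Id}}(s,\chi)$ (resp. $p(s)a_{w_0}(s,\chi)$) has no poles in the strip. Fix $f_1\in\mathcal{S}_{BK}(X(F),K)$ and $f_2\in\mathcal{S}(V(F))$, where $K=\mathrm{Sp}_6(\mathcal{O})$ if $F$ is non-Archimedean and $K\le\mathrm{Sp}_6(F)$ is any maximal compact subgroup if $F$ is Archimedean. For $v\in V'(F)$ let $$\mathcal{I}(v)=\int_{N_0(F)\backslash G(F)}|f_1(\gamma_0g)\rho(g)f_2(v)|\,dg,$$ and for $v\in Y^{\mathrm{sm}}(F)$ let $I(f_1,f_2)(v)=\int_{N_0(F)\backslash G(F)}f_1(\gamma_0g)\rho(g)f_2(v)\,dg$.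 Implicit constants below do not depend on $v$. **Theorem.** (1) Let $F$ be non-Archimedean. For $v\in V'(F)$, $$\mathcal{I}(v)\ll\begin{cases}\prod_{i=1}^3|v_i|^{-1-d_i/2}&\text{if all }v_i\ne0,\\|v_2|^{-d_2/2-d_1/2}|v_3|^{-d_3/2-d_1/2}&\text{if }v_1=0,\end{cases}$$ and there is a compact subset of $V(F)$ outside which $\mathcal{I}$ vanishes on $V'(F)$. (2) Let $F$ be Archimedean. For all $N_1,N_2,N_3\in\mathbb{Z}_{\ge0}$ and all $v\in V'(F)$ with no $v_i=0$, $$\mathcal{I}(v)\ll_{N_1,N_2,N_3}\prod_{i=1}^3\max(|v_i|,1)^{-N_i}\min(|v_i|,1)^{-1-d_i/2}.$$ (3) Let $F$ be Archimedean. For all $N_2,N_3\in\mathbb{Z}_{\ge0}$ and all $v\in V'(F)$ with $v_1=0$, $$\mathcal{I}(v)\ll_{N_2,N_3}\prod_{i=2}^3\max(|v_i|,1)^{-N_i}\min(|v_i|,1)^{-d_1/2-d_i/2}.$$ In each case, for such $v$ lying in $Y^{\mathrm{sm}}(F)$ the integral $I(f_1,f_2)(v)$ converges absolutely and its absolute value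 satisfies the same bound; in case (1) $I(f_1,f_2)$ also vanishes outside a compact subset of $V(F)$. -/

import Mathlib

open MeasureTheory Matrix
open scoped ENNReal NNReal ContDiff

noncomputable section

namespace TripleQuad

/-! ### Local fields -/

instance properSpaceRCLike (F : Type*) [RCLike F] : ProperSpace F :=
  FiniteDimensional.proper_rclike F F

section Field

variable (F : Type*) [NontriviallyNormedField F] [ProperSpace F] [MeasurableSpace F] [BorelSpace F]

variable {F} in
open Classical in
/-- The normalized absolute value of a local field: the factor by which multiplication by `x`
scales an additive Haar measure (so it is the square of the usual one on `ℂ`, and `q⁻¹` on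
uniformizers of a non-Archimedean field with residue field of order `q`). -/
def nabs (x : F) : ℝ :=
  if hx : x = 0 then 0 else (distribHaarChar F (Units.mk0 x hx) : ℝ)

/-- The Haar measure `d^×a = da / |a|` on the multiplicative group. -/
def mulHaar : Measure Fˣ :=
  ((Measure.addHaar : Measure F).withDensity fun x => ENNReal.ofReal (nabs x)⁻¹).comap
    (Units.val : Fˣ → F)

variable {F} in
/-- The maximum of the absolute values of the coordinates of a vector. -/
def vabs {n : Type*} [Fintype n] (x : n → F) : ℝ := ⨆ j, nabs (x j)

end Field

/-! ### The groups -/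

section Groups

variable (F : Type*) [Field F]

/-- `Sp₆(F)`, as matrices in `3 × 3` blocks. -/
abbrev Sp6 : Type _ := Matrix.symplecticGroup (Fin 3) F

/-- `G(F) = SL₂(F)³`. -/
abbrev G : Type _ := Fin 3 → Matrix.SpecialLinearGroup (Fin 2) F

variable {F} in
theorem fromBlocks_mem {A B C D : Matrix (Fin 3) (Fin 3) F}
    (h1 : A * Bᵀ = B * Aᵀ) (h2 : A * Dᵀ - B * Cᵀ = 1) (h3 : C * Dᵀ = D * Cᵀ) :
    Matrix.fromBlocks A B C D ∈ Matrix.symplecticGroup (Fin 3) F := by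
  have h2' : D * Aᵀ - C * Bᵀ = 1 := by
    have := congrArg Matrix.transpose h2
    simpa using this
  rw [SymplecticGroup.mem_iff]
  simp only [Matrix.J, Matrix.fromBlocks_transpose, Matrix.fromBlocks_multiply]
  congr 1
  · simp [h1]
  · simpa [sub_eq_add_neg, add_comm] using congrArg Neg.neg h2
  · simpa [sub_eq_add_neg] using h2'
  · simp [h3]

/-- The embedding of `SL₂(F)³` in `Sp₆(F)` by diagonal blocks. -/
def embG (g : G F) : Sp6 F :=
  ⟨Matrix.fromBlocks (diagonal fun i => g i 0 0) (diagonal fun i => g i 0 1)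
      (diagonal fun i => g i 1 0) (diagonal fun i => g i 1 1), by
    apply fromBlocks_mem
    · simp [mul_comm]
    · rw [diagonal_transpose, diagonal_transpose, diagonal_mul_diagonal, diagonal_mul_diagonal,
        diagonal_sub, ← diagonal_one]
      congr 1
      funext i
      have := (g i).det_coe
      rw [Matrix.det_fin_two] at this
      exact this
    · simp [mul_comm]⟩

/-- The representative `γ₀` of the open orbit. -/
def gamma0 : Sp6 F :=
  ⟨Matrix.fromBlocks !![0, 0, 0; 0, 1, 0; 0, 0, 1] !![-1, 0, 0; 0, 0, 0; 0, 0, 0]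
      !![1, 1, 1; 0, 0, 0; 0, 0, 0] !![0, 0, 0; -1, 1, 0; -1, 0, 1], by
    apply fromBlocks_mem <;> ext i j <;> fin_cases i <;> fin_cases j <;>
      simp [Matrix.mul_apply, Fin.sum_univ_three, Matrix.vecMul, dotProduct]⟩

/-- The long Weyl element `w₀` used in the intertwining operator. -/
def w0 : Sp6 F :=
  ⟨Matrix.fromBlocks 0 !![0, 0, -1; 0, -1, 0; -1, 0, 0] !![0, 0, 1; 0, 1, 0; 1, 0, 0] 0, by
    apply fromBlocks_mem <;> ext i j <;> fin_cases i <;> fin_cases j <;>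
      simp [Matrix.mul_apply, Fin.sum_univ_three, Matrix.vecMul, dotProduct]⟩

variable {F} in
/-- The element `diag(a, 1, 1, a⁻¹, 1, 1)` of the Levi subgroup `M(F)` of the Siegel parabolic; it
represents the class of `M^ab(F) ≅ F^×` on which `ω = det A` takes the value `a`. -/
def levi (a : Fˣ) : Sp6 F :=
  ⟨Matrix.fromBlocks (diagonal ![(a : F), 1, 1]) 0 0 (diagonal ![(a : F)⁻¹, 1, 1]), by
    apply fromBlocks_mem
    · simp
    · ext i j
      fin_cases i <;> fin_cases j <;> simp
    · simp⟩

variable {F} in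
/-- The element `(I Z; 0 I)` of the unipotent radical `N(F)`, the symmetric matrix `Z` having the
entries `Z i j = z {i, j}`. -/
def unip (z : Sym2 (Fin 3) → F) : Sp6 F :=
  ⟨Matrix.fromBlocks 1 (Matrix.of fun i j => z s(i, j)) 0 1, by
    apply fromBlocks_mem
    · ext i j
      simp [Sym2.eq_swap]
    · simp
    · simp⟩

/-- The points of the commutator subgroup `[P,P]` of the Siegel parabolic subgroup. -/
def commP : Set (Sp6 F) :=
  {p | ∃ A Z : Matrix (Fin 3) (Fin 3) F, A.det = 1 ∧ Zᵀ = Z ∧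
    (p : Matrix (Fin 3 ⊕ Fin 3) (Fin 3 ⊕ Fin 3) F) =
      Matrix.fromBlocks A 0 0 (Aᵀ)⁻¹ * Matrix.fromBlocks 1 Z 0 1}

variable {F} in
/-- The matrix `(1 t; 0 1)`. -/
def upper (t : F) : Matrix.SpecialLinearGroup (Fin 2) F :=
  ⟨!![1, t; 0, 1], by simp [Matrix.det_fin_two]⟩

variable {F} in
theorem upper_mul (s t : F) : upper s * upper t = upper (s + t) := by
  apply Subtype.ext
  rw [Matrix.SpecialLinearGroup.coe_mul]
  simp [upper, add_comm]

variable {F} in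
theorem upper_zero : upper (0 : F) = 1 := by
  ext i j
  fin_cases i <;> fin_cases j <;> simp [upper]

/-- The unipotent group `N₀(F)` of triples `(1 tᵢ; 0 1)` with `t₁ + t₂ + t₃ = 0`. -/
def N0 : Subgroup (G F) where
  carrier := {g | ∃ t : Fin 3 → F, ∑ i, t i = 0 ∧ ∀ i, g i = upper (t i)}
  mul_mem' := by
    rintro a b ⟨s, hs, ha⟩ ⟨t, ht, hb⟩
    refine ⟨s + t, by simp [Finset.sum_add_distrib, hs, ht], fun i => ?_⟩
    simp [ha, hb, upper_mul]
  one_mem' := ⟨0, by simp, fun i => by simp [upper_zero]⟩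
  inv_mem' := by
    rintro a ⟨s, hs, ha⟩
    refine ⟨-s, by simp [hs], fun i => ?_⟩
    rw [Pi.inv_apply, ha, inv_eq_iff_mul_eq_one, upper_mul]
    simp [upper_zero]

/-- The space of right cosets `N₀(F)\G(F)`. -/
abbrev N0G : Type _ := Quotient (QuotientGroup.rightRel (N0 F))

end Groups

/-! ### Measures on the groups -/

section GroupMeasures

variable (F : Type*) [NontriviallyNormedField F]

/-- `SL₂(F)` carries its Borel σ-algebra. The group `G(F)` carries the product σ-algebra, and
`N₀(F)\G(F)` the quotient σ-algebra. -/
instance measurableSpaceSL2 : MeasurableSpace (Matrix.SpecialLinearGroup (Fin 2) F) := borel _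

instance borelSpaceSL2 : BorelSpace (Matrix.SpecialLinearGroup (Fin 2) F) := ⟨rfl⟩

variable {F} in
/-- `μ` is the quotient, on `N₀(F)\G(F)`, of the Haar measures `μG` and `μN`. The inner integral
depends only on the coset. -/
def IsQuotientMeasure (μG : Measure (G F)) (μN : Measure (N0 F)) (μ : Measure (N0G F)) : Prop :=
  ∀ φ : G F → ℝ≥0∞, Measurable φ →
    ∫⁻ g, φ g ∂μG = ∫⁻ x, (∫⁻ n, φ ((n : G F) * x.out) ∂μN) ∂μ

end GroupMeasures

/-! ### The Weil representation -/

section Weil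

variable {F : Type*} [NontriviallyNormedField F] [ProperSpace F] [MeasurableSpace F] [BorelSpace F]

section OneForm

variable {n : Type*} [Fintype n]

/-- The inner product `ᵗx J y`. -/
def bil (J : Matrix n n F) (x y : n → F) : F := x ⬝ᵥ (J *ᵥ y)

/-- The quadratic form `½ ᵗx J x`. -/
def quad (J : Matrix n n F) (x : n → F) : F := 2⁻¹ * bil J x x

/-- The Fourier transform for the pairing `ψ(ᵗv J t)` and the measure `ν`. -/
def fourier (ψ : AddChar F Circle) (J : Matrix n n F) (ν : Measure (n → F))
    (f : (n → F) → ℂ) (v : n → F) : ℂ :=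
  ∫ t, f t * (ψ (bil J v t) : ℂ) ∂ν

/-- `ν` is a Haar measure for which Fourier inversion holds. -/
def IsSelfDual (ψ : AddChar F Circle) (J : Matrix n n F) (ν : Measure (n → F)) : Prop :=
  ν.IsAddHaarMeasure ∧
    ∀ f : (n → F) → ℂ, Continuous f → Integrable f ν → Integrable (fourier ψ J ν f) ν →
      ∀ v, fourier ψ J ν (fourier ψ J ν f) v = f (-v)

open Classical in
/-- The self-dual measure with respect to the pairing `ψ(ᵗv J t)`. -/
def selfDual (ψ : AddChar F Circle) (J : Matrix n n F) : Measure (n → F) :=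
  if h : ∃ ν, IsSelfDual ψ J ν then h.choose else 0

/-- The defining property of the Weil number: the Fourier transform of the distribution `ψ ∘ Q` is
`γ` times `ψ ∘ (-Q)`. -/
def IsWeilNumber (ψ : AddChar F Circle) (J : Matrix n n F) (γ : ℂ) : Prop :=
  ∀ f : (n → F) → ℂ, Continuous f → Integrable f (selfDual ψ J) →
    Integrable (fourier ψ J (selfDual ψ J) f) (selfDual ψ J) →
      ∫ v, fourier ψ J (selfDual ψ J) f v * (ψ (quad J v) : ℂ) ∂(selfDual ψ J) =
        γ * ∫ t, f t * (ψ (-quad J t) : ℂ) ∂(selfDual ψ J)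

open Classical in
/-- The Weil number `γ(Q)`. -/
def weilNumber (ψ : AddChar F Circle) (J : Matrix n n F) : ℂ :=
  if h : ∃ γ, IsWeilNumber ψ J γ then h.choose else 0

end OneForm

open Classical in
/-- The Hilbert symbol `(a, b)`. -/
def hilbertSymbol {F : Type*} [Field F] (a b : F) : ℂ :=
  if ∃ x y z : F, (x ≠ 0 ∨ y ≠ 0 ∨ z ≠ 0) ∧ a * x ^ 2 + b * y ^ 2 = z ^ 2 then 1 else -1

/-- `V(F) = V₁(F) × V₂(F) × V₃(F)` with `Vᵢ(F) = F^{dᵢ}`. -/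
abbrev V (F : Type*) (d : Fin 3 → ℕ) : Type _ := ∀ i : Fin 3, Fin (d i) → F

variable {d : Fin 3 → ℕ}

/-- The character `χ_{Qᵢ}(a) = (a, (-1)^{dᵢ/2} det Jᵢ)`. -/
def chiQ (J : ∀ i, Matrix (Fin (d i)) (Fin (d i)) F) (i : Fin 3) (a : F) : ℂ :=
  hilbertSymbol a ((-1) ^ (d i / 2) * (J i).det)

/-- The action of `(1 t; 0 1)` in the `i`-th variable. -/
def weilUpper (ψ : AddChar F Circle) (J : ∀ i, Matrix (Fin (d i)) (Fin (d i)) F) (i : Fin 3)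
    (t : F) (f : V F d → ℂ) : V F d → ℂ :=
  fun v => (ψ (t * quad (J i) (v i)) : ℂ) * f v

/-- The action of `(a 0; 0 a⁻¹)` in the `i`-th variable. -/
def weilDiag (J : ∀ i, Matrix (Fin (d i)) (Fin (d i)) F) (i : Fin 3)
    (a : F) (f : V F d → ℂ) : V F d → ℂ :=
  fun v => chiQ J i a * ((nabs a ^ ((d i : ℝ) / 2) : ℝ) : ℂ) * f (Function.update v i (a • v i))

/-- The action of `(0 1; -1 0)` in the `i`-th variable. -/
def weilFlip (ψ : AddChar F Circle) (J : ∀ i, Matrix (Fin (d i)) (Fin (d i)) F) (i : Fin 3)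
    (f : V F d → ℂ) : V F d → ℂ :=
  fun v => weilNumber ψ (J i) *
    fourier ψ (J i) (selfDual ψ (J i)) (fun t => f (Function.update v i t)) (v i)

open Classical in
/-- The action of `g ∈ SL₂(F)` in the `i`-th variable, by the Bruhat decomposition: writing
`g = (a b; c d)`, one has `g = (1 ab; 0 1) (a 0; 0 a⁻¹)` if `c = 0`, and otherwise
`g = (1 a/c; 0 1) (-1/c 0; 0 -c) (0 1; -1 0) (1 d/c; 0 1)`. -/
def weilOne (ψ : AddChar F Circle) (J : ∀ i, Matrix (Fin (d i)) (Fin (d i)) F) (i : Fin 3)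
    (g : Matrix.SpecialLinearGroup (Fin 2) F) (f : V F d → ℂ) : V F d → ℂ :=
  if g 1 0 = 0 then weilUpper ψ J i (g 0 0 * g 0 1) (weilDiag J i (g 0 0) f)
  else weilUpper ψ J i (g 0 0 / g 1 0) (weilDiag J i (-(g 1 0)⁻¹)
    (weilFlip ψ J i (weilUpper ψ J i (g 1 1 / g 1 0) f)))

/-- The Weil representation `ρ = ρ_ψ` of `G(F) = SL₂(F)³` on functions on `V(F)`. -/
def weil (ψ : AddChar F Circle) (J : ∀ i, Matrix (Fin (d i)) (Fin (d i)) F)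
    (g : G F) (f : V F d → ℂ) : V F d → ℂ :=
  weilOne ψ J 0 (g 0) (weilOne ψ J 1 (g 1) (weilOne ψ J 2 (g 2) f))

/-- `V'(F)`: at least two of the `vᵢ` are nonzero. -/
def Vprime (F : Type*) [Zero F] (d : Fin 3 → ℕ) : Set (V F d) :=
  {v | ∃ i j : Fin 3, i ≠ j ∧ v i ≠ 0 ∧ v j ≠ 0}

/-- `Y^sm(F)`: the points of `V'(F)` with `Q₁(v₁) = Q₂(v₂) = Q₃(v₃)`. -/
def Ysm (J : ∀ i, Matrix (Fin (d i)) (Fin (d i)) F) : Set (V F d) :=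
  {v | v ∈ Vprime F d ∧ quad (J 0) (v 0) = quad (J 1) (v 1) ∧
    quad (J 1) (v 1) = quad (J 2) (v 2)}

/-- The integrand `f₁(γ₀ g) ρ(g)f₂(v)`. -/
def integrand (ψ : AddChar F Circle) (J : ∀ i, Matrix (Fin (d i)) (Fin (d i)) F)
    (f₁ : Sp6 F → ℂ) (f₂ : V F d → ℂ) (v : V F d) (g : G F) : ℂ :=
  f₁ (gamma0 F * embG F g) * weil ψ J g f₂ v

/-- The integral of `|f₁(γ₀ g) ρ(g)f₂(v)|` over `N₀(F)\G(F)`. The absolute value depends only on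
the coset of `g`, so that any representative may be used. -/
def absInt (ψ : AddChar F Circle) (J : ∀ i, Matrix (Fin (d i)) (Fin (d i)) F)
    (μ : Measure (N0G F)) (f₁ : Sp6 F → ℂ) (f₂ : V F d → ℂ) (v : V F d) : ℝ≥0∞ :=
  ∫⁻ x, ‖integrand ψ J f₁ f₂ v x.out‖ₑ ∂μ

/-- Absolute convergence of the integral `I(f₁, f₂)(v)`, for `v ∈ Y^sm(F)`. -/
def IConverges (ψ : AddChar F Circle) (J : ∀ i, Matrix (Fin (d i)) (Fin (d i)) F)
    (μ : Measure (N0G F)) (f₁ : Sp6 F → ℂ) (f₂ : V F d → ℂ) (v : V F d) : Prop :=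
  Integrable (fun x : N0G F => integrand ψ J f₁ f₂ v x.out) μ

/-- `I(f₁, f₂)(v)`, for `v ∈ Y^sm(F)`; then the integrand depends only on the coset of `g`. -/
def intI (ψ : AddChar F Circle) (J : ∀ i, Matrix (Fin (d i)) (Fin (d i)) F)
    (μ : Measure (N0G F)) (f₁ : Sp6 F → ℂ) (f₂ : V F d → ℂ) (v : V F d) : ℂ :=
  ∫ x, integrand ψ J f₁ f₂ v x.out ∂μ

end Weil

/-! ### The Schwartz space of Braverman and Kazhdan on `X = [P,P]\Sp₆` -/

section Schwartz

/-- Functions on `X(F) = [P,P](F)\Sp₆(F)`, as functions on `Sp₆(F)`. -/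
def IsFunctionOnX {F : Type*} [Field F] (f : Sp6 F → ℂ) : Prop :=
  ∀ p ∈ commP F, ∀ g, f (p * g) = f g

/-- The right translates of `f` by `K` span a finite-dimensional space. -/
def IsKFinite {F : Type*} [Field F] (K : Set (Sp6 F)) (f : Sp6 F → ℂ) : Prop :=
  FiniteDimensional ℂ
    (Submodule.span ℂ (Set.range fun (k : K) (g : Sp6 F) => f (g * (k : Sp6 F))))

section Mellin

variable {F : Type*} [NontriviallyNormedField F] [ProperSpace F] [MeasurableSpace F] [BorelSpace F]

/-- The integrand of the Mellin transform. One has `δ_P^{1/2}(m) = |ω(m)|²`. -/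
def mellinIntegrand (f : Sp6 F → ℂ) (χ : Fˣ → ℂ) (s : ℂ) (g : Sp6 F) (a : Fˣ) : ℂ :=
  ((nabs (a : F) ^ 2 : ℝ) : ℂ) * (χ a * (nabs (a : F) : ℂ) ^ s) * f ((levi a)⁻¹ * g)

/-- The Mellin transform `f_{χ_s}(g) = ∫ δ_P(m)^{1/2} χ_s(ω(m)) f(m⁻¹ g) dm` over `M^ab(F) ≅ F^×`,
a section of the normalized induction of `χ_s = χ|·|^s` from the Siegel parabolic. -/
def mellin (f : Sp6 F → ℂ) (χ : Fˣ → ℂ) (s : ℂ) (g : Sp6 F) : ℂ :=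
  ∫ a, mellinIntegrand f χ s g a ∂(mulHaar F)

/-- The intertwining operator `M_{w₀}` applied to `f_{χ_s}`: the integral of `f_{χ_s}(w₀⁻¹ n g)`
over `n ∈ N(F)`. -/
def intertwine (f : Sp6 F → ℂ) (χ : Fˣ → ℂ) (s : ℂ) (g : Sp6 F) : ℂ :=
  ∫ z : Sym2 (Fin 3) → F, mellin f χ s ((w0 F)⁻¹ * unip z * g) ∂Measure.addHaar

/-- The integrals defining `f_{χ_s}` and `M_{w₀} f_{χ_s}` converge absolutely for `Re s > σ`. -/
def ConvergesRightOf (f : Sp6 F → ℂ) (χ : Fˣ → ℂ) (σ : ℝ) : Prop :=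
  ∀ s : ℂ, σ < s.re → ∀ g : Sp6 F,
    Integrable (mellinIntegrand f χ s g) (mulHaar F) ∧
      Integrable (fun z : Sym2 (Fin 3) → F => mellin f χ s ((w0 F)⁻¹ * unip z * g))
        Measure.addHaar

end Mellin

section NonArchimedean

variable {F : Type*} [NontriviallyNormedField F] [ProperSpace F] [MeasurableSpace F] [BorelSpace F]

/-- `ϖ` generates the maximal ideal of the ring of integers. -/
def IsUniformizer (ϖ : F) : Prop := ϖ ≠ 0 ∧ ‖ϖ‖ < 1 ∧ ∀ x : F, ‖x‖ < 1 → ‖x‖ ≤ ‖ϖ‖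

/-- `Sp₆(𝒪)`. -/
def sp6Int (F : Type*) [NontriviallyNormedField F] : Set (Sp6 F) :=
  {k | ∀ i j, ‖(k : Matrix (Fin 3 ⊕ Fin 3) (Fin 3 ⊕ Fin 3) F) i j‖ ≤ 1}

open Classical in
/-- The local `L`-factor `L(s, χ)`: it is `(1 - χ(ϖ) q^{-s})⁻¹` for unramified `χ`, and `1`
otherwise. Here `q^{-1} = |ϖ|`. -/
def LNA (ϖ : F) (χ : Fˣ → ℂ) (s : ℂ) : ℂ :=
  if hϖ : ϖ ≠ 0 then
    if ∀ u : Fˣ, ‖(u : F)‖ = 1 → χ u = 1 then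
      (1 - χ (Units.mk0 ϖ hϖ) * (nabs ϖ : ℂ) ^ s)⁻¹
    else 1
  else 1

/-- `a_Id(s, χ) = L(s + 2, χ) L(2s + 2, χ²)`. -/
def aIdNA (ϖ : F) (χ : Fˣ → ℂ) (s : ℂ) : ℂ :=
  LNA ϖ χ (s + 2) * LNA ϖ (fun a => χ a ^ 2) (2 * s + 2)

/-- `a_{w₀}(s, χ) = L(s - 1, χ) L(2s - 1, χ²)`. -/
def aW0NA (ϖ : F) (χ : Fˣ → ℂ) (s : ℂ) : ℂ :=
  LNA ϖ χ (s - 1) * LNA ϖ (fun a => χ a ^ 2) (2 * s - 1)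

/-- `Φ(s)` for `Re s > σ` is the product of `a(s)` and an element of `ℂ[q^s, q^{-s}]`. -/
def IsLaurentMultiple (ϖ : F) (σ : ℝ) (a Φ : ℂ → ℂ) : Prop :=
  ∃ (p : Polynomial ℂ) (m : ℕ), ∀ s : ℂ, σ < s.re →
    Φ s = p.eval ((nabs ϖ : ℂ) ^ s) / ((nabs ϖ : ℂ) ^ s) ^ m * a s

/-- The Schwartz space `S_BK(X(F), K)` for non-Archimedean `F`: smooth `K`-finite functions on
`X(F)` such that `f_{χ_s}` is an excellent section for every character `χ` of `F^×`. -/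
structure IsSchwartzBKNA (ϖ : F) (K : Set (Sp6 F)) (f : Sp6 F → ℂ) : Prop where
  onX : IsFunctionOnX f
  smooth : IsLocallyConstant f
  kFinite : IsKFinite K f
  excellent : ∀ χ : Fˣ →* ℂˣ, Continuous χ → ∃ σ : ℝ,
    ConvergesRightOf f (fun a => (χ a : ℂ)) σ ∧ ∀ g : Sp6 F,
      IsLaurentMultiple ϖ σ (aIdNA ϖ fun a => (χ a : ℂ))
        (fun s => mellin f (fun a => (χ a : ℂ)) s g) ∧
      IsLaurentMultiple ϖ σ (aW0NA ϖ fun a => (χ a : ℂ))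
        (fun s => intertwine f (fun a => (χ a : ℂ)) s g)

end NonArchimedean

section Archimedean

variable {F : Type*} [RCLike F]

/-- The character `a ↦ (a/‖a‖)^k |a|^τ` of `F^×`; for `F = ℝ` and `F = ℂ` these are all the
characters. -/
def archChar (F : Type*) [RCLike F] (k : ℤ) (τ : ℂ) (a : Fˣ) : ℂ :=
  (((RCLike.re (a : F) : ℝ) + (RCLike.im (a : F) : ℝ) * Complex.I) / (‖(a : F)‖ : ℂ)) ^ k *
    (nabs (a : F) : ℂ) ^ τ

/-- The local `L`-factor of `archChar F k τ`. -/
def LArch (F : Type*) [RCLike F] (k : ℤ) (τ s : ℂ) : ℂ :=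
  if Module.finrank ℝ F = 1 then Complex.Gammaℝ (s + τ + ((k % 2 : ℤ) : ℂ))
  else Complex.Gammaℂ (s + τ + ((|k| : ℤ) : ℂ) / 2)

/-- `a_Id(s, χ) = L(s + 2, χ) L(2s + 2, χ²)` for `χ = archChar F k τ`. -/
def aIdArch (F : Type*) [RCLike F] (k : ℤ) (τ s : ℂ) : ℂ :=
  LArch F k τ (s + 2) * LArch F (2 * k) (2 * τ) (2 * s + 2)

/-- `a_{w₀}(s, χ) = L(s - 1, χ) L(2s - 1, χ²)` for `χ = archChar F k τ`. -/
def aW0Arch (F : Type*) [RCLike F] (k : ℤ) (τ s : ℂ) : ℂ :=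
  LArch F k τ (s - 1) * LArch F (2 * k) (2 * τ) (2 * s - 1)

/-- `Φ(s)`, given for `Re s > σ`, continues to the product of `a(s)` and an entire function, and is
rapidly decreasing in vertical strips: its product with any polynomial that cancels the poles of
`a` in the strip is bounded there. -/
def IsExcellentContinuation (σ : ℝ) (a Φ : ℂ → ℂ) : Prop :=
  ∃ h : ℂ → ℂ, Differentiable ℂ h ∧ (∀ s : ℂ, σ < s.re → Φ s = h s * a s) ∧
    ∀ (A B : ℝ) (p : Polynomial ℂ),
      (∀ s : ℂ, A ≤ s.re → s.re ≤ B → 0 ≤ meromorphicOrderAt (fun z => p.eval z * a z) s) →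
      ∃ C : ℝ, ∀ s : ℂ, A ≤ s.re → s.re ≤ B → ‖p.eval s * (h s * a s)‖ ≤ C

/-- A function on the real submanifold `Sp₆(F)` of the space of matrices is smooth: locally it
extends to a smooth function of the matrix entries. -/
def IsSmoothArch (f : Sp6 F → ℂ) : Prop :=
  ∀ g : Sp6 F, ∃ (U : Set (Fin 3 ⊕ Fin 3 → Fin 3 ⊕ Fin 3 → F))
    (φ : (Fin 3 ⊕ Fin 3 → Fin 3 ⊕ Fin 3 → F) → ℂ),
    IsOpen U ∧ (fun i j => g.1 i j) ∈ U ∧ ContDiffOn ℝ ∞ φ U ∧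
      ∀ h : Sp6 F, (fun i j => h.1 i j) ∈ U → f h = φ (fun i j => h.1 i j)

/-- The Schwartz space `S_BK(X(F), K)` for Archimedean `F`: smooth `K`-finite functions on `X(F)`
such that `f_{χ_s}` is an excellent section for every character `χ` of `F^×`. -/
structure IsSchwartzBKArch (K : Set (Sp6 F)) (f : Sp6 F → ℂ) : Prop where
  onX : IsFunctionOnX f
  smooth : IsSmoothArch f
  kFinite : IsKFinite K f
  excellent : ∀ (k : ℤ) (τ : ℂ), ∃ σ : ℝ,
    ConvergesRightOf f (archChar F k τ) σ ∧ ∀ g : Sp6 F,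
      IsExcellentContinuation σ (aIdArch F k τ) (fun s => mellin f (archChar F k τ) s g) ∧
      IsExcellentContinuation σ (aW0Arch F k τ) (fun s => intertwine f (archChar F k τ) s g)

end Archimedean

end Schwartz

end TripleQuad

end

open TripleQuad

set_option linter.unusedSectionVars false
set_option linter.unusedSimpArgs false

noncomputable section

namespace TripleQuad

open scoped Pointwise

section NabsBasics

variable {F : Type*} [NontriviallyNormedField F] [ProperSpace F] [MeasurableSpace F] [BorelSpace F]

@[simp] theorem nabs_zero : nabs (0 : F) = 0 := by simp [nabs]

theorem nabs_of_ne {x : F} (hx : x ≠ 0) :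
    nabs x = (distribHaarChar F (Units.mk0 x hx) : ℝ) := by simp [nabs, hx]

theorem nabs_unit (u : Fˣ) : nabs (u : F) = (distribHaarChar F u : ℝ) := by
  rw [nabs_of_ne u.ne_zero, Units.mk0_val]

theorem nabs_pos {x : F} (hx : x ≠ 0) : 0 < nabs x := by
  rw [nabs_of_ne hx]
  exact_mod_cast distribHaarChar_pos

theorem nabs_nonneg (x : F) : 0 ≤ nabs x := by
  by_cases hx : x = 0
  · simp [hx]
  · exact (nabs_pos hx).le

@[simp] theorem nabs_one : nabs (1 : F) = 1 := by
  simpa using nabs_unit (1 : Fˣ)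

theorem nabs_mul (x y : F) : nabs (x * y) = nabs x * nabs y := by
  by_cases hx : x = 0
  · simp [hx]
  by_cases hy : y = 0
  · simp [hy]
  have := nabs_unit (Units.mk0 x hx * Units.mk0 y hy)
  rw [map_mul, NNReal.coe_mul, ← nabs_unit, ← nabs_unit] at this
  simpa using this

variable (F) in
/-- The normalized absolute value as a homomorphism of monoids with zero. -/
def nabsHom : F →*₀ ℝ where
  toFun := nabs
  map_zero' := nabs_zero
  map_one' := nabs_one
  map_mul' := nabs_mul

theorem nabs_inv (x : F) : nabs x⁻¹ = (nabs x)⁻¹ := map_inv₀ (nabsHom F) x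

theorem nabs_div (x y : F) : nabs (x / y) = nabs x / nabs y := map_div₀ (nabsHom F) x y

theorem nabs_pow (x : F) (n : ℕ) : nabs (x ^ n) = nabs x ^ n := map_pow (nabsHom F) x n

theorem nabs_zpow (x : F) (n : ℤ) : nabs (x ^ n) = nabs x ^ n := map_zpow₀ (nabsHom F) x n

theorem nabs_prod {ι : Type*} (s : Finset ι) (x : ι → F) :
    nabs (∏ i ∈ s, x i) = ∏ i ∈ s, nabs (x i) := map_prod (nabsHom F) x s

theorem nabs_eq_zero {x : F} : nabs x = 0 ↔ x = 0 :=
  ⟨fun h => by by_contra hx; exact (nabs_pos hx).ne' h, fun h => by simp [h]⟩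

theorem measure_smul_set (ν : Measure F) [ν.IsAddHaarMeasure] {a : F} (ha : a ≠ 0) (s : Set F) :
    ν (a • s) = ENNReal.ofReal (nabs a) * ν s := by
  have h := distribHaarChar_mul (μ := ν) (Units.mk0 a ha) s
  rw [nabs_of_ne ha, ENNReal.ofReal_coe_nnreal]
  exact h.symm

theorem nabs_neg (x : F) : nabs (-x) = nabs x := by
  have h : nabs (-1 : F) = 1 := by
    have h2 : nabs (-1 : F) * nabs (-1 : F) = 1 := by rw [← nabs_mul]; simp
    nlinarith [nabs_nonneg (-1 : F)]
  rw [neg_eq_neg_one_mul, nabs_mul, h, one_mul]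

theorem nabs_le_one_of_norm_le {x : F} (hx : ‖x‖ ≤ 1) : nabs x ≤ 1 := by
  by_cases h0 : x = 0
  · simp [h0]
  have h := measure_smul_set (Measure.addHaar : Measure F) h0 (Metric.closedBall 0 1)
  have hsub : x • Metric.closedBall (0 : F) 1 ⊆ Metric.closedBall 0 1 := by
    rintro _ ⟨y, hy, rfl⟩
    simp only [mem_closedBall_zero_iff, smul_eq_mul, norm_mul] at hy ⊢
    nlinarith [norm_nonneg x, norm_nonneg y]
  have hle := measure_mono (μ := (Measure.addHaar : Measure F)) hsub
  rw [h] at hle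
  have hpos : (Measure.addHaar : Measure F) (Metric.closedBall 0 1) ≠ 0 :=
    (Metric.measure_closedBall_pos _ _ one_pos).ne'
  have hfin : (Measure.addHaar : Measure F) (Metric.closedBall 0 1) ≠ ⊤ :=
    (isCompact_closedBall (0:F) _).measure_ne_top
  have : ENNReal.ofReal (nabs x) ≤ 1 := by
    by_contra hc
    push Not at hc
    have := ENNReal.mul_lt_mul_left hpos hfin hc
    rw [one_mul] at this
    exact absurd hle (not_le.mpr this)
  simpa using this

theorem nabs_le_of_norm_le {x y : F} (h : ‖x‖ ≤ ‖y‖) : nabs x ≤ nabs y := by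
  by_cases hy : y = 0
  · have : x = 0 := by simpa [hy] using h
    simp [this, hy]
  have h1 : nabs (x / y) ≤ 1 := nabs_le_one_of_norm_le (by
    rw [norm_div]; exact div_le_one_of_le₀ h (norm_nonneg _))
  rwa [nabs_div, div_le_one (nabs_pos hy)] at h1

theorem nabs_lt_one_of_norm_lt {x : F} (hx : ‖x‖ < 1) : nabs x < 1 := by
  by_cases h0 : x = 0
  · simp [h0]
  refine lt_of_le_of_ne (nabs_le_one_of_norm_le hx.le) fun h1 => ?_
  have hn : ∀ n : ℕ, (Measure.addHaar : Measure F) (Metric.closedBall 0 1) ≤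
      (Measure.addHaar : Measure F) (Metric.closedBall 0 (‖x‖ ^ n)) := by
    intro n
    have h := measure_smul_set (Measure.addHaar : Measure F) (pow_ne_zero n h0)
      (Metric.closedBall 0 1)
    rw [nabs_pow, h1, one_pow, ENNReal.ofReal_one, one_mul] at h
    rw [← h]
    apply measure_mono
    rintro _ ⟨y, hy, rfl⟩
    simp only [mem_closedBall_zero_iff, smul_eq_mul, norm_mul, norm_pow] at hy ⊢
    exact mul_le_of_le_one_right (by positivity) hy
  have hlim : Filter.Tendsto
      (fun n : ℕ => (Measure.addHaar : Measure F) (Metric.closedBall 0 (‖x‖ ^ n)))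
      Filter.atTop (nhds ((Measure.addHaar : Measure F) (⋂ n : ℕ, Metric.closedBall 0 (‖x‖ ^ n)))) := by
    apply tendsto_measure_iInter_atTop
    · intro n; exact Metric.isClosed_closedBall.measurableSet.nullMeasurableSet
    · intro m n hmn
      exact Metric.closedBall_subset_closedBall (pow_le_pow_of_le_one (norm_nonneg _) hx.le hmn)
    · exact ⟨0, (isCompact_closedBall (0:F) _).measure_ne_top⟩
  have hI : (⋂ n : ℕ, Metric.closedBall (0 : F) (‖x‖ ^ n)) = {0} := by
    ext y
    simp only [Set.mem_iInter, mem_closedBall_zero_iff, Set.mem_singleton_iff]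
    constructor
    · intro h
      have := ge_of_tendsto' (tendsto_pow_atTop_nhds_zero_of_lt_one (norm_nonneg x) hx) h
      simpa using this
    · rintro rfl; simp
  rw [hI, measure_singleton] at hlim
  have := ge_of_tendsto' hlim hn
  exact absurd this (not_le.mpr (Metric.measure_closedBall_pos _ _ one_pos))

theorem norm_le_of_nabs_le {x y : F} (h : nabs x ≤ nabs y) : ‖x‖ ≤ ‖y‖ := by
  by_contra hlt
  push Not at hlt
  have hx : x ≠ 0 := by rintro rfl; simp at hlt; linarith [norm_nonneg y]
  have : nabs (y / x) < 1 := nabs_lt_one_of_norm_lt (by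
    rw [norm_div]; exact (div_lt_one (norm_pos_iff.mpr hx)).mpr hlt)
  rw [nabs_div, div_lt_one (nabs_pos hx)] at this
  linarith

theorem measurable_nabs : Measurable (nabs : F → ℝ) := by
  refine measurable_of_Iio fun c => ?_
  have : nabs ⁻¹' Set.Iio c = (fun x : F => ‖x‖) ⁻¹' {r | ∃ y : F, nabs y < c ∧ r ≤ ‖y‖} := by
    ext x
    constructor
    · intro hx
      exact ⟨x, hx, le_rfl⟩
    · rintro ⟨y, hy, hxy⟩
      exact (nabs_le_of_norm_le hxy).trans_lt hy
  rw [this]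
  apply measurable_norm
  apply Set.OrdConnected.measurableSet
  constructor
  rintro a ha b ⟨y, hy, hb⟩ r hr
  exact ⟨y, hy, hr.2.trans hb⟩

variable (F) in
theorem exists_one_lt_nabs : ∃ x : F, 1 < ‖x‖ ∧ 1 < nabs x := by
  obtain ⟨x, hx⟩ := NormedField.exists_one_lt_norm F
  refine ⟨x, hx, ?_⟩
  have hx0 : x ≠ 0 := by rintro rfl; simp at hx; linarith
  have : nabs x⁻¹ < 1 := nabs_lt_one_of_norm_lt (by rw [norm_inv]; exact inv_lt_one_of_one_lt₀ hx)
  rw [nabs_inv] at this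
  exact (inv_lt_one₀ (nabs_pos hx0)).mp this

theorem exists_norm_bound_of_nabs_le (C : ℝ) : ∃ R : ℝ, 0 < R ∧ ∀ x : F, nabs x ≤ C → ‖x‖ ≤ R := by
  obtain ⟨x, hx, hx'⟩ := exists_one_lt_nabs F
  obtain ⟨n, hn⟩ := pow_unbounded_of_one_lt C hx'
  refine ⟨‖x ^ n‖, ?_, fun y hy => norm_le_of_nabs_le ?_⟩
  · rw [norm_pow]; positivity
  · rw [nabs_pow]; linarith

theorem map_mul_left_addHaar (ν : Measure F) [ν.IsAddHaarMeasure] {a : F} (ha : a ≠ 0) :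
    ν.map (fun x => a * x) = ENNReal.ofReal (nabs a)⁻¹ • ν := by
  ext s hs
  have hm : Measurable fun x : F => a * x := (continuous_const_mul a).measurable
  rw [Measure.map_apply hm hs, Measure.smul_apply, smul_eq_mul, ← nabs_inv,
    ← measure_smul_set ν (inv_ne_zero ha) s]
  congr 1
  ext x
  rw [Set.mem_smul_set_iff_inv_smul_mem₀ (inv_ne_zero ha)]
  simp

theorem lintegral_mul_left_addHaar (ν : Measure F) [ν.IsAddHaarMeasure] {a : F} (ha : a ≠ 0)
    (φ : F → ℝ≥0∞) :
    ∫⁻ x, φ (a * x) ∂ν = ENNReal.ofReal (nabs a)⁻¹ * ∫⁻ x, φ x ∂ν := by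
  have hm : MeasurableEmbedding fun x : F => a * x :=
    (Homeomorph.mulLeft₀ a ha).measurableEmbedding
  rw [← hm.lintegral_map, map_mul_left_addHaar ν ha, lintegral_smul_measure, smul_eq_mul]

theorem lintegral_prod_mul_left_addHaar (ν : Measure F) [ν.IsAddHaarMeasure] {a : F} (ha : a ≠ 0)
    {φ : F × F → ℝ≥0∞} (hφ : Measurable φ) :
    ∫⁻ p : F × F, φ (a * p.1, a * p.2) ∂(ν.prod ν) =
      ENNReal.ofReal ((nabs a)⁻¹ ^ 2) * ∫⁻ p, φ p ∂(ν.prod ν) := by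
  have hm : Measurable fun p : F × F => (a * p.1, a * p.2) := by fun_prop
  rw [lintegral_prod (fun p : F × F => φ (a * p.1, a * p.2)) (hφ.comp hm).aemeasurable,
    lintegral_prod _ hφ.aemeasurable]
  have h1 : ∀ x : F, ∫⁻ y, φ (a * x, a * y) ∂ν =
      ENNReal.ofReal (nabs a)⁻¹ * ∫⁻ y, φ (a * x, y) ∂ν := fun x =>
    lintegral_mul_left_addHaar ν ha (fun y => φ (a * x, y))
  simp only [h1]
  rw [lintegral_const_mul _ (by
    have : Measurable fun x : F => ∫⁻ y, φ (x, y) ∂ν := hφ.lintegral_prod_right'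
    exact this.comp (continuous_const_mul a).measurable),
    lintegral_mul_left_addHaar ν ha (fun x => ∫⁻ y, φ (x, y) ∂ν), ← mul_assoc,
    ← ENNReal.ofReal_mul (inv_nonneg.mpr (nabs_nonneg a)), sq]

/-- Inhomogeneous powers of exponent `> 1` are integrable. -/
theorem lintegral_max_one_rpow_lt_top (ν : Measure F) [ν.IsAddHaarMeasure] {q : ℝ} (hq : 1 < q) :
    ∫⁻ x, ENNReal.ofReal (max 1 (nabs x) ^ (-q)) ∂ν < ⊤ := by
  obtain ⟨l, hl, hl'⟩ := exists_one_lt_nabs F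
  have hl0 : l ≠ 0 := by rintro rfl; simp at hl'; linarith
  set B : ℕ → Set F := fun k => l ^ k • Metric.closedBall (0 : F) 1 with hB
  have hBm : ∀ k x, x ∈ B k ↔ ‖x‖ ≤ ‖l‖ ^ k := by
    intro k x
    rw [hB, Set.mem_smul_set_iff_inv_smul_mem₀ (pow_ne_zero k hl0)]
    simp only [smul_eq_mul, mem_closedBall_zero_iff, norm_mul, norm_inv, norm_pow]
    rw [inv_mul_le_iff₀ (by positivity), mul_one]
  have hbound : ∀ x : F, ENNReal.ofReal (max 1 (nabs x) ^ (-q)) ≤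
      ∑' k : ℕ, (B k).indicator (fun _ => ENNReal.ofReal ((nabs l ^ q) * (nabs l ^ (-q)) ^ k)) x := by
    intro x
    have hex : ∃ k, x ∈ B k := by
      obtain ⟨k, hk⟩ := pow_unbounded_of_one_lt ‖x‖ hl
      exact ⟨k, (hBm k x).mpr hk.le⟩
    classical
    set k := Nat.find hex with hk
    refine le_trans ?_ (ENNReal.le_tsum k)
    rw [Set.indicator_of_mem (Nat.find_spec hex)]
    apply ENNReal.ofReal_le_ofReal
    have hmax : nabs l ^ ((k : ℝ) - 1) ≤ max 1 (nabs x) := by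
      rcases Nat.eq_zero_or_pos k with h0 | hpos
      · rw [h0]
        refine le_trans ?_ (le_max_left _ _)
        apply Real.rpow_le_one_of_one_le_of_nonpos hl'.le
        norm_num
      · have hnot := Nat.find_min hex (m := k - 1) (by omega)
        rw [hBm, ← norm_pow, not_le] at hnot
        refine le_trans ?_ (le_max_right _ _)
        have := nabs_le_of_norm_le hnot.le
        rw [nabs_pow, ← Real.rpow_natCast, Nat.cast_sub hpos] at this
        simpa using this
    have h0 : 0 < nabs l := by linarith
    calc max 1 (nabs x) ^ (-q) ≤ (nabs l ^ ((k : ℝ) - 1)) ^ (-q) :=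
          Real.rpow_le_rpow_of_nonpos (by positivity) hmax (by linarith)
      _ = nabs l ^ q * (nabs l ^ (-q)) ^ k := by
          rw [← Real.rpow_mul h0.le, ← Real.rpow_natCast, ← Real.rpow_mul h0.le,
            ← Real.rpow_add h0]
          congr 1; ring
  refine (lintegral_mono hbound).trans_lt ?_
  rw [lintegral_tsum (fun k => (measurable_const.indicator (by
    rw [show B k = Metric.closedBall 0 (‖l‖ ^ k) from Set.ext fun x => by rw [hBm k x]; simp]
    exact Metric.isClosed_closedBall.measurableSet)).aemeasurable)]
  have hBmeas : ∀ k, MeasurableSet (B k) := fun k => by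
    rw [show B k = Metric.closedBall 0 (‖l‖ ^ k) from Set.ext fun x => by rw [hBm k x]; simp]
    exact Metric.isClosed_closedBall.measurableSet
  have hterm : ∀ k : ℕ, ∫⁻ x, (B k).indicator
      (fun _ => ENNReal.ofReal ((nabs l ^ q) * (nabs l ^ (-q)) ^ k)) x ∂ν =
      ENNReal.ofReal (nabs l ^ q) * ν (Metric.closedBall 0 1) *
        ENNReal.ofReal (nabs l ^ (1 - q)) ^ k := by
    intro k
    have h0 : 0 < nabs l := by linarith
    rw [lintegral_indicator (hBmeas k), lintegral_const, Measure.restrict_apply_univ, hB,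
      measure_smul_set ν (pow_ne_zero k hl0), nabs_pow, ENNReal.ofReal_mul (by positivity),
      Real.rpow_sub h0, Real.rpow_one, div_eq_mul_inv, ← Real.rpow_neg h0.le,
      ENNReal.ofReal_mul h0.le, mul_pow, ENNReal.ofReal_pow (by positivity),
      ENNReal.ofReal_pow (by positivity)]
    ring
  simp only [hterm]
  rw [ENNReal.tsum_mul_left, ENNReal.tsum_geometric]
  apply ENNReal.mul_lt_top
  · exact ENNReal.mul_lt_top ENNReal.ofReal_lt_top (isCompact_closedBall _ _).measure_lt_top
  · rw [ENNReal.inv_lt_top, tsub_pos_iff_lt]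
    rw [← ENNReal.ofReal_one]
    apply (ENNReal.ofReal_lt_ofReal_iff one_pos).mpr
    exact Real.rpow_lt_one_of_one_lt_of_neg hl' (by linarith)

end NabsBasics

end TripleQuad
end

noncomputable section

namespace TripleQuad

section LowerRows

variable {F : Type*} [Field F]

/-- The symplectic matrix with its first three rows replaced by zero. -/
def lowerRows (g : Sp6 F) : Matrix (Fin 3 ⊕ Fin 3) (Fin 3 ⊕ Fin 3) F := fromBlocks 0 0 0 1 * g.1

theorem lowerRows_mul (g h : Sp6 F) : lowerRows (g * h) = lowerRows g * h.1 := by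
  rw [lowerRows, lowerRows, Matrix.mul_assoc]
  rfl

theorem lowerRows_mul_inv (g : Sp6 F) : lowerRows g * (g⁻¹).1 = lowerRows 1 := by
  rw [← lowerRows_mul, mul_inv_cancel]

theorem lowerRows_one : lowerRows (1 : Sp6 F) = fromBlocks 0 0 0 1 := mul_one _

theorem lowerRows_eq (g : Sp6 F) :
    lowerRows g = fromBlocks 0 0 g.1.toBlocks₂₁ g.1.toBlocks₂₂ := by
  rw [lowerRows]
  conv_lhs => rw [← fromBlocks_toBlocks g.1]
  rw [fromBlocks_multiply]
  simp

theorem mem_commP_of_lowerRows {p : Sp6 F} {A : Matrix (Fin 3) (Fin 3) F} (hA : A.det = 1)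
    (h : lowerRows p = fromBlocks 0 0 0 A * lowerRows 1) : p ∈ commP F := by
  have h1 : p.1 = fromBlocks p.1.toBlocks₁₁ p.1.toBlocks₁₂ 0 A := by
    rw [lowerRows_one, lowerRows_eq, fromBlocks_multiply, fromBlocks_inj] at h
    obtain ⟨-, -, h3, h4⟩ := h
    conv_lhs => rw [← fromBlocks_toBlocks p.1]
    rw [h3, h4]
    simp
  set B := p.1.toBlocks₁₁
  set E := p.1.toBlocks₁₂
  have hp := p.2
  rw [SymplecticGroup.mem_iff, h1] at hp
  simp only [Matrix.J, Matrix.fromBlocks_transpose, Matrix.fromBlocks_multiply] at hp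
  rw [Matrix.fromBlocks_inj] at hp
  obtain ⟨e1, e2, e3, -⟩ := hp
  simp only [mul_zero, zero_add, mul_one, transpose_zero, add_zero, mul_neg, neg_mul,
    zero_mul, neg_zero] at e1 e2 e3
  have hBA : B * Aᵀ = 1 := neg_injective e2
  have hAt : IsUnit Aᵀ.det := by rw [det_transpose, hA]; exact isUnit_one
  have hB : B = (Aᵀ)⁻¹ := by
    rw [← mul_one B, ← Matrix.mul_nonsing_inv _ hAt, ← mul_assoc, hBA, one_mul]
  have hdB : B.det = 1 := by
    have := congrArg Matrix.det hBA
    rwa [det_mul, det_transpose, hA, mul_one, det_one] at this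
  have hBu : IsUnit B.det := by rw [hdB]; exact isUnit_one
  have hEB : E * Bᵀ = B * Eᵀ := by
    have : E * Bᵀ + -(B * Eᵀ) = 0 := e1
    rwa [← sub_eq_add_neg, sub_eq_zero] at this
  refine ⟨B, B⁻¹ * E, hdB, ?_, ?_⟩
  · rw [Matrix.transpose_mul, Matrix.transpose_nonsing_inv]
    have hBtu : IsUnit Bᵀ.det := by rwa [det_transpose]
    calc Eᵀ * (Bᵀ)⁻¹ = B⁻¹ * (B * Eᵀ) * (Bᵀ)⁻¹ := by
          rw [← mul_assoc, Matrix.nonsing_inv_mul _ hBu, one_mul]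
      _ = B⁻¹ * E := by
          rw [← hEB, mul_assoc, mul_assoc, Matrix.mul_nonsing_inv _ hBtu, mul_one]
  · rw [h1, Matrix.fromBlocks_multiply]
    have hA2 : (Bᵀ)⁻¹ = A := by
      rw [hB, Matrix.transpose_nonsing_inv, Matrix.transpose_transpose,
        Matrix.nonsing_inv_nonsing_inv _ (by rw [hA]; exact isUnit_one)]
    rw [hA2]
    simp [Matrix.mul_nonsing_inv_cancel_left _ _ hBu]

theorem lowerRows_levi_inv (a : Fˣ) :
    lowerRows (levi a)⁻¹ = fromBlocks 0 0 0 (diagonal ![(a : F), 1, 1]) * lowerRows 1 := by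
  have h : lowerRows (1 : Sp6 F) =
      fromBlocks 0 0 0 (diagonal ![(a : F), 1, 1]) * lowerRows (levi a) := by
    rw [lowerRows_one, lowerRows_eq, fromBlocks_multiply]
    congr 1
    · simp
    · simp
    · simp [levi]
    · ext i j
      fin_cases i <;> fin_cases j <;> simp [levi]
  calc lowerRows (levi a)⁻¹ = lowerRows 1 * ((levi a)⁻¹).1 := by rw [← lowerRows_mul, one_mul]
    _ = fromBlocks 0 0 0 (diagonal ![(a : F), 1, 1]) * (lowerRows (levi a) * ((levi a)⁻¹).1) := by
        rw [h, Matrix.mul_assoc]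
    _ = _ := by rw [lowerRows_mul_inv]

/-- Two symplectic matrices whose last three rows span the same Lagrangian subspace differ by an
element of the Siegel parabolic subgroup. -/
theorem exists_commP_mul_levi {g h : Sp6 F} {A : Matrix (Fin 3) (Fin 3) F} {a : Fˣ}
    (hA : A.det = ((a⁻¹ : Fˣ) : F)) (hgh : lowerRows g = fromBlocks 0 0 0 A * lowerRows h) :
    ∃ p ∈ commP F, g = p * (levi a * h) := by
  refine ⟨g * (levi a * h)⁻¹, ?_, (inv_mul_cancel_right _ _).symm⟩
  apply mem_commP_of_lowerRows (A := A * diagonal ![(a : F), 1, 1])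
  · rw [det_mul, hA, det_diagonal]
    simp [Fin.prod_univ_three]
  · rw [_root_.mul_inv_rev, ← mul_assoc, lowerRows_mul, lowerRows_mul, hgh, Matrix.mul_assoc (fromBlocks 0 0 0 A),
      lowerRows_mul_inv, Matrix.mul_assoc (fromBlocks 0 0 0 A), ← lowerRows_mul, one_mul,
      lowerRows_levi_inv, ← Matrix.mul_assoc, fromBlocks_multiply]
    simp

theorem embG_mul (g h : G F) : embG F (g * h) = embG F g * embG F h := by
  apply Subtype.ext
  change fromBlocks _ _ _ _ = fromBlocks _ _ _ _ * fromBlocks _ _ _ _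
  rw [Matrix.fromBlocks_multiply]
  simp only [diagonal_mul_diagonal, diagonal_add, Pi.mul_apply]
  congr 2 <;> funext i <;> simp [Matrix.mul_apply, Fin.sum_univ_two]

/-- The lower unipotent element attached to a symmetric matrix. -/
def lowerUnip (Z : Matrix (Fin 3) (Fin 3) F) (hZ : Z.IsSymm) : Sp6 F :=
  ⟨fromBlocks 1 0 Z 1, by
    apply fromBlocks_mem
    · simp
    · simp
    · simp [hZ.eq]⟩

/-- The diagonal element of `SL₂`. -/
def diagSL (a : Fˣ) : SpecialLinearGroup (Fin 2) F :=
  ⟨!![(a : F), 0; 0, ((a⁻¹ : Fˣ) : F)], by simp [det_fin_two]⟩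

/-- The Weyl element of `SL₂`. -/
def weylSL : SpecialLinearGroup (Fin 2) F := ⟨!![0, 1; -1, 0], by simp [det_fin_two]⟩

variable (t : Fin 3 → F) (a : Fin 3 → Fˣ)

/-- The element `(upper tᵢ · diag aᵢ)ᵢ` of the Borel subgroup of `G`. -/
def borelElt : G F := fun i => upper (t i) * diagSL (a i)

theorem borelElt_apply (i : Fin 3) (j k : Fin 2) : borelElt t a i j k =
    !![(a i : F), t i * (a i : F)⁻¹; 0, (a i : F)⁻¹] j k := by
  change ∑ l, upper (t i) j l * diagSL (a i) l k = _
  rw [Fin.sum_univ_two]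
  fin_cases j <;> fin_cases k <;> simp [upper, diagSL]

theorem lowerRows_gamma0_borelElt :
    lowerRows (gamma0 F * embG F (borelElt t a)) =
      fromBlocks 0 0 !![(a 0 : F), a 1, a 2; 0, 0, 0; 0, 0, 0]
        !![t 0 * (a 0 : F)⁻¹, t 1 * (a 1 : F)⁻¹, t 2 * (a 2 : F)⁻¹;
          -(a 0 : F)⁻¹, (a 1 : F)⁻¹, 0; -(a 0 : F)⁻¹, 0, (a 2 : F)⁻¹] := by
  rw [lowerRows_mul, lowerRows, gamma0, embG]
  simp only [borelElt_apply, fromBlocks_multiply]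
  congr 1 <;> ext i j <;> fin_cases i <;> fin_cases j <;>
    simp [Matrix.vecMul_diagonal]

theorem lowerRows_lowerUnip_embG (Z : Matrix (Fin 3) (Fin 3) F) (hZ : Z.IsSymm) (k : G F) :
    lowerRows (lowerUnip Z hZ * embG F k) =
      fromBlocks 0 0 (Z * diagonal (fun i => k i 0 0) + diagonal fun i => k i 1 0)
        (Z * diagonal (fun i => k i 0 1) + diagonal fun i => k i 1 1) := by
  rw [lowerRows_mul, lowerRows, lowerUnip, embG]
  simp [fromBlocks_multiply]

/-- The element of `G` with Weyl element in position `i`. -/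
def weylAt (i : Fin 3) : G F := fun j => if j = i then weylSL else 1

theorem lowerRows_chart (Z : Matrix (Fin 3) (Fin 3) F) (hZ : Z.IsSymm) (i : Fin 3) :
    lowerRows (lowerUnip Z hZ * embG F (weylAt i)) =
      fromBlocks 0 0 (Matrix.of fun j k => if k = i then (if j = i then -1 else 0) else Z j k)
        (Matrix.of fun j k => if k = i then Z j k else (if j = k then 1 else 0)) := by
  rw [lowerRows_lowerUnip_embG]
  congr 1
  · ext j k
    simp only [Matrix.add_apply, Matrix.mul_diagonal, Matrix.diagonal_apply, weylAt, of_apply]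
    by_cases hk : k = i
    · subst hk
      by_cases hj : j = k <;> simp [hj, weylSL]
    · by_cases hj : j = k
      · subst hj
        simp [hk]
      · simp [hj, hk]
  · ext j k
    simp only [Matrix.add_apply, Matrix.mul_diagonal, Matrix.diagonal_apply, weylAt, of_apply]
    by_cases hk : k = i
    · subst hk
      by_cases hj : j = k <;> simp [hj, weylSL]
    · by_cases hj : j = k
      · subst hj
        simp [hk]
      · simp [hj, hk]

/-- The symmetric matrix `(aᵢ aⱼ / T)`. -/
def outerMat (T : F) : Matrix (Fin 3) (Fin 3) F := Matrix.of fun i j => (a i : F) * a j / T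

theorem outerMat_apply (T : F) (i j : Fin 3) : outerMat a T i j = (a i : F) * a j / T := rfl

theorem outerMat_isSymm (T : F) : (outerMat a T).IsSymm := by
  ext i j
  simp [outerMat_apply, mul_comm]

/-- The symmetric matrix attached to the chart centred at the `i`-th coordinate. -/
def chartMat (T : F) (i : Fin 3) : Matrix (Fin 3) (Fin 3) F :=
  Matrix.of fun j k =>
    if j = i then (if k = i then -T / (a i : F) ^ 2 else -(a k : F) / a i)
    else if k = i then -(a j : F) / a i else 0

theorem chartMat_isSymm (T : F) (i : Fin 3) : (chartMat a T i).IsSymm := by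
  ext j k
  simp only [chartMat, transpose_apply, of_apply]
  split_ifs <;> simp_all

theorem gamma0_decomp_sum (hT : ∑ i, t i ≠ 0) :
    ∃ p ∈ commP F, gamma0 F * embG F (borelElt t a) =
      p * (levi ((∏ i, a i) * (Units.mk0 _ hT)⁻¹) * lowerUnip _ (outerMat_isSymm a (∑ i, t i))) := by
  have h0 := (a 0).ne_zero
  have h1 := (a 1).ne_zero
  have h2 := (a 2).ne_zero
  have hT' : t 0 + t 1 + t 2 ≠ 0 := by rwa [Fin.sum_univ_three] at hT
  apply exists_commP_mul_levi (A := !![t 0 * (a 0 : F)⁻¹, t 1 * (a 1 : F)⁻¹, t 2 * (a 2 : F)⁻¹;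
          -(a 0 : F)⁻¹, (a 1 : F)⁻¹, 0; -(a 0 : F)⁻¹, 0, (a 2 : F)⁻¹])
  · rw [det_fin_three]
    simp [Fin.prod_univ_three, Fin.sum_univ_three]
    field_simp
  · have hone : lowerUnip _ (outerMat_isSymm a (∑ i, t i)) =
        lowerUnip _ (outerMat_isSymm a (∑ i, t i)) * embG F 1 := by
      have : embG F 1 = 1 := by
        have := embG_mul (1 : G F) 1
        rw [mul_one] at this
        exact (left_eq_mul.mp this)
      rw [this, mul_one]
    rw [hone, lowerRows_gamma0_borelElt, lowerRows_lowerUnip_embG, fromBlocks_multiply]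
    simp only [Fin.sum_univ_three]
    congr 1
    · simp
    · simp
    · ext i j
      fin_cases i <;> fin_cases j <;>
        simp [Matrix.mul_apply, Fin.sum_univ_three, Matrix.vecMul, dotProduct, outerMat_apply] <;> (try field_simp) <;> (try ring)
    · ext i j
      fin_cases i <;> fin_cases j <;> simp [Matrix.mul_apply, Fin.sum_univ_three]

theorem gamma0_decomp_chart (i : Fin 3) :
    ∃ p ∈ commP F, gamma0 F * embG F (borelElt t a) =
      p * (levi (-((∏ j, a j) * (a i ^ 2)⁻¹)) *
        (lowerUnip _ (chartMat_isSymm a (∑ j, t j) i) *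
          embG F (weylAt i))) := by
  have h0 := (a 0).ne_zero
  have h1 := (a 1).ne_zero
  have h2 := (a 2).ne_zero
  fin_cases i
  · apply exists_commP_mul_levi (A := !![-(a 0 : F), t 1 * (a 1 : F)⁻¹, t 2 * (a 2 : F)⁻¹;
          0, (a 1 : F)⁻¹, 0; 0, 0, (a 2 : F)⁻¹])
    · rw [det_fin_three]
      simp [Fin.prod_univ_three]
      field_simp
    · rw [lowerRows_gamma0_borelElt, lowerRows_chart, fromBlocks_multiply]
      congr 1
      · simp
      · simp
      all_goals
        simp only [zero_mul, zero_add]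
        ext i j
        fin_cases i <;> fin_cases j <;>
          simp [Matrix.mul_apply, Fin.sum_univ_three, chartMat] <;> (try field_simp) <;> (try ring)
  · apply exists_commP_mul_levi (A := !![t 0 * (a 0 : F)⁻¹, -(a 1 : F), t 2 * (a 2 : F)⁻¹;
          -(a 0 : F)⁻¹, 0, 0; -(a 0 : F)⁻¹, 0, (a 2 : F)⁻¹])
    · rw [det_fin_three]
      simp [Fin.prod_univ_three]
      field_simp
    · rw [lowerRows_gamma0_borelElt, lowerRows_chart, fromBlocks_multiply]
      congr 1
      · simp
      · simp
      all_goals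
        simp only [zero_mul, zero_add]
        ext i j
        fin_cases i <;> fin_cases j <;>
          simp [Matrix.mul_apply, Fin.sum_univ_three, chartMat] <;> (try field_simp) <;> (try ring)
  · apply exists_commP_mul_levi (A := !![t 0 * (a 0 : F)⁻¹, t 1 * (a 1 : F)⁻¹, -(a 2 : F);
          -(a 0 : F)⁻¹, (a 1 : F)⁻¹, 0; -(a 0 : F)⁻¹, 0, 0])
    · rw [det_fin_three]
      simp [Fin.prod_univ_three]
      field_simp
    · rw [lowerRows_gamma0_borelElt, lowerRows_chart, fromBlocks_multiply]
      congr 1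
      · simp
      · simp
      all_goals
        simp only [zero_mul, zero_add]
        ext i j
        fin_cases i <;> fin_cases j <;>
          simp [Matrix.mul_apply, Fin.sum_univ_three, chartMat] <;> (try field_simp) <;> (try ring)

end LowerRows

end TripleQuad
end

noncomputable section

namespace TripleQuad

section Coordinates

variable {F : Type*} [NontriviallyNormedField F]

local notation "SL2F" => SpecialLinearGroup (Fin 2) F

open Classical in
/-- The entry of larger norm in a vector of length two. -/
def big (p : F × F) : F := if ‖p.2‖ ≤ ‖p.1‖ then p.1 else p.2

theorem norm_big (p : F × F) : ‖big p‖ = max ‖p.1‖ ‖p.2‖ := by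
  unfold big
  split_ifs with h
  · rw [max_eq_left h]
  · rw [max_eq_right (not_le.mp h).le]

theorem big_ne_zero {p : F × F} (hp : p ≠ 0) : big p ≠ 0 := by
  rw [← norm_pos_iff, norm_big]
  by_contra h
  push Not at h
  have h1 : p.1 = 0 := norm_le_zero_iff.mp ((le_max_left _ _).trans h)
  have h2 : p.2 = 0 := norm_le_zero_iff.mp ((le_max_right _ _).trans h)
  exact hp (Prod.ext h1 h2)

/-- The last row of an element of `SL₂`. -/
def rowSL (g : SL2F) : F × F := (g 1 0, g 1 1)

theorem det_eq (g : SL2F) : g 0 0 * g 1 1 - g 0 1 * g 1 0 = 1 := by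
  have := g.det_coe
  rwa [det_fin_two] at this

theorem rowSL_ne_zero (g : SL2F) : rowSL g ≠ 0 := by
  intro h
  have h1 : g 1 0 = 0 := congrArg Prod.fst h
  have h2 : g 1 1 = 0 := congrArg Prod.snd h
  have := det_eq g
  rw [h1, h2] at this
  simp at this

open Classical in
/-- The unipotent coordinate of an element of `SL₂`. -/
def unipCoord (g : SL2F) : F := if ‖g 1 1‖ ≤ ‖g 1 0‖ then g 0 0 / g 1 0 else g 0 1 / g 1 1

/-- The diagonal coordinate of an element of `SL₂`. -/
def diagCoord (g : SL2F) : Fˣ := (Units.mk0 (big (rowSL g)) (big_ne_zero (rowSL_ne_zero g)))⁻¹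

theorem diagCoord_val (g : SL2F) : (diagCoord g : F) = (big (rowSL g))⁻¹ := rfl

open Classical in
/-- The bounded part of an element of `SL₂`. -/
def boundedPart (g : SL2F) : SL2F :=
  if ‖g 1 1‖ ≤ ‖g 1 0‖ then ⟨!![0, -1; 1, g 1 1 / g 1 0], by simp [det_fin_two]⟩
  else ⟨!![1, 0; g 1 0 / g 1 1, 1], by simp [det_fin_two]⟩

theorem upper_mul_diag_mul_bounded (g : SL2F) :
    upper (unipCoord g) * diagSL (diagCoord g) * boundedPart g = g := by
  have hd := det_eq g
  apply Matrix.SpecialLinearGroup.ext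
  intro i j
  change ∑ l, (∑ l', upper (unipCoord g) i l' * diagSL (diagCoord g) l' l) * boundedPart g l j = _
  simp only [Fin.sum_univ_two]
  have hne := big_ne_zero (rowSL_ne_zero g)
  by_cases h : ‖g 1 1‖ ≤ ‖g 1 0‖
  · have hb : big (rowSL g) = g 1 0 := by simp [big, rowSL, h]
    rw [hb] at hne
    simp only [upper, diagSL, diagCoord, boundedPart, unipCoord, h, if_true]
    fin_cases i <;> fin_cases j <;> simp [hb] <;> field_simp
    linear_combination hd
  · have hb : big (rowSL g) = g 1 1 := by simp [big, rowSL, h]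
    rw [hb] at hne
    simp only [upper, diagSL, diagCoord, boundedPart, unipCoord, h, if_false]
    fin_cases i <;> fin_cases j <;> simp [hb] <;> field_simp
    linear_combination -hd

theorem norm_boundedPart_le (g : SL2F) (i j : Fin 2) : ‖boundedPart g i j‖ ≤ 1 := by
  by_cases h : ‖g 1 1‖ ≤ ‖g 1 0‖
  · simp only [boundedPart, h, if_true]
    fin_cases i <;> fin_cases j <;> simp
    exact div_le_one_of_le₀ h (norm_nonneg _)
  · simp only [boundedPart, h, if_false]
    fin_cases i <;> fin_cases j <;> simp
    exact div_le_one_of_le₀ (not_le.mp h).le (norm_nonneg _)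

theorem rowSL_upper_mul (t : F) (g : SL2F) : rowSL (upper t * g) = rowSL g := by
  have h : ∀ j, (upper t * g : SL2F) 1 j = g 1 j := by
    intro j
    change ∑ l, upper t 1 l * g l j = _
    simp [upper]
  rw [rowSL, h, h, rowSL]

theorem upper_mul_apply_zero (t : F) (g : SL2F) (j : Fin 2) :
    (upper t * g : SL2F) 0 j = g 0 j + t * g 1 j := by
  change ∑ l, upper t 0 l * g l j = _
  simp [upper]

theorem upper_mul_apply_one (t : F) (g : SL2F) (j : Fin 2) :
    (upper t * g : SL2F) 1 j = g 1 j := by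
  change ∑ l, upper t 1 l * g l j = _
  simp [upper]

theorem unipCoord_upper_mul (t : F) (g : SL2F) : unipCoord (upper t * g) = t + unipCoord g := by
  have hne := big_ne_zero (rowSL_ne_zero g)
  simp only [unipCoord, upper_mul_apply_zero, upper_mul_apply_one]
  by_cases h : ‖g 1 1‖ ≤ ‖g 1 0‖
  · have hb : big (rowSL g) = g 1 0 := by simp [big, rowSL, h]
    rw [hb] at hne
    simp only [h, if_true]
    field_simp
    ring
  · have hb : big (rowSL g) = g 1 1 := by simp [big, rowSL, h]
    rw [hb] at hne
    simp only [h, if_false]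
    field_simp
    ring

theorem norm_weylAt_mul_le (i : Fin 3) (k : G F) (hk : ∀ i j l, ‖k i j l‖ ≤ 1) (i' : Fin 3)
    (j l : Fin 2) : ‖(weylAt i * k : G F) i' j l‖ ≤ 1 := by
  by_cases h : i' = i
  · have : (weylAt i * k : G F) i' j l = ∑ r, weylSL (F := F) j r * k i' r l := by
      simp only [Pi.mul_apply, weylAt, h, if_true]
      rfl
    rw [this, Fin.sum_univ_two]
    fin_cases j <;> simp [weylSL, hk]
  · have : (weylAt i * k : G F) i' = k i' := by simp [weylAt, h]
    rw [this]
    exact hk _ _ _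

/-- Every `γ₀ g` is the product of an element of the Siegel parabolic, whose size is controlled by
the coordinates of `g`, and of a bounded element. -/
theorem exists_gamma0_decomp (g : G F) :
    ∃ p ∈ commP F, ∃ (δ D : Fˣ) (Z : Matrix (Fin 3) (Fin 3) F) (hZ : Z.IsSymm) (k : G F),
      gamma0 F * embG F g = p * (levi δ * (lowerUnip Z hZ * embG F k)) ∧
      (∀ i j, ‖Z i j‖ ≤ 1) ∧ (∀ i j l, ‖k i j l‖ ≤ 1) ∧
      (δ = (∏ i, diagCoord (g i)) * D⁻¹ ∨ δ = -((∏ i, diagCoord (g i)) * D⁻¹)) ∧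
      ‖∑ i, unipCoord (g i)‖ ≤ ‖(D : F)‖ ∧ ∀ i, ‖((diagCoord (g i) ^ 2 : Fˣ) : F)‖ ≤ ‖(D : F)‖ := by
  set t := fun i => unipCoord (g i) with ht
  set a := fun i => diagCoord (g i) with ha
  set k : G F := fun i => boundedPart (g i)
  have hk : ∀ i j l, ‖k i j l‖ ≤ 1 := fun i => norm_boundedPart_le (g i)
  have hg : g = borelElt t a * k := by
    funext i
    exact (upper_mul_diag_mul_bounded (g i)).symm
  obtain ⟨i, hi⟩ : ∃ i, ∀ j, ‖(a j : F)‖ ≤ ‖(a i : F)‖ := by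
    obtain ⟨i, -, hi⟩ := Finset.exists_max_image Finset.univ (fun j => ‖(a j : F)‖) ⟨0, by simp⟩
    exact ⟨i, fun j => hi j (Finset.mem_univ j)⟩
  have hi2 : ∀ j, ‖((a j ^ 2 : Fˣ) : F)‖ ≤ ‖((a i ^ 2 : Fˣ) : F)‖ := by
    intro j
    simp only [Units.val_pow_eq_pow_val, norm_pow]
    exact pow_le_pow_left₀ (norm_nonneg _) (hi j) 2
  by_cases hT : ‖((a i ^ 2 : Fˣ) : F)‖ ≤ ‖∑ j, t j‖
  · have hT0 : ∑ j, t j ≠ 0 := by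
      rw [← norm_pos_iff]
      exact (norm_pos_iff.mpr (Units.ne_zero _)).trans_le hT
    obtain ⟨p, hp, h⟩ := gamma0_decomp_sum t a hT0
    refine ⟨p, hp, _, Units.mk0 _ hT0, _, outerMat_isSymm a (∑ j, t j), k, ?_, ?_, hk, Or.inl rfl, le_rfl,
      fun j => (hi2 j).trans hT⟩
    · rw [hg, embG_mul, ← mul_assoc, h]
      simp only [mul_assoc]
    · intro j l
      rw [outerMat_apply, norm_div, norm_mul]
      apply div_le_one_of_le₀ _ (norm_nonneg _)
      refine le_trans ?_ hT
      rw [Units.val_pow_eq_pow_val, norm_pow, sq]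
      exact mul_le_mul (hi j) (hi l) (norm_nonneg _) (norm_nonneg _)
  · obtain ⟨p, hp, h⟩ := gamma0_decomp_chart t a i
    refine ⟨p, hp, _, a i ^ 2, _, chartMat_isSymm a (∑ j, t j) i, weylAt i * k, ?_, ?_,
      norm_weylAt_mul_le i k hk, Or.inr rfl, (not_le.mp hT).le, hi2⟩
    · rw [hg, embG_mul, embG_mul, ← mul_assoc, h]
      simp only [mul_assoc]
    · intro j l
      simp only [chartMat, of_apply]
      split_ifs
      · rw [norm_div, norm_neg]
        apply div_le_one_of_le₀ _ (norm_nonneg _)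
        rw [← Units.val_pow_eq_pow_val]
        exact (not_le.mp hT).le
      · rw [norm_div, norm_neg]
        exact div_le_one_of_le₀ (hi _) (norm_nonneg _)
      · rw [norm_div, norm_neg]
        exact div_le_one_of_le₀ (hi _) (norm_nonneg _)
      · simp

end Coordinates

end TripleQuad
end

noncomputable section

namespace TripleQuad

section HaarSL

variable {F : Type*} [NontriviallyNormedField F] [ProperSpace F]

local notation "SL2F" => Matrix.SpecialLinearGroup (Fin 2) F

variable (F) in
theorem isClosedEmbedding_entries :
    Topology.IsClosedEmbedding (fun (g : SL2F) (i j : Fin 2) => g i j) :=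
  (Matrix.SpecialLinearGroup.isClosedEmbedding_val (n := Fin 2) (R := F))

theorem continuous_entry (i j : Fin 2) : Continuous fun g : SL2F => g i j :=
  (continuous_apply j).comp ((continuous_apply i).comp (isClosedEmbedding_entries F).continuous)

instance secondCountableSL2 : SecondCountableTopology SL2F :=
  (isClosedEmbedding_entries F).isEmbedding.secondCountableTopology

instance locallyCompactSL2 : LocallyCompactSpace SL2F :=
  (isClosedEmbedding_entries F).locallyCompactSpace

variable [MeasurableSpace F] [BorelSpace F]

theorem measurable_to_SL2 {α : Type*} [MeasurableSpace α] {f : α → SL2F}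
    (h : ∀ i j, Measurable fun a => f a i j) : Measurable f := by
  rw [← (isClosedEmbedding_entries F).measurableEmbedding.measurable_comp_iff]
  exact measurable_pi_lambda _ fun i => measurable_pi_lambda _ fun j => h i j

theorem measurable_entry (i j : Fin 2) : Measurable fun g : SL2F => g i j :=
  (continuous_entry i j).measurable

/-- The matrix `(1 0; t 1)`. -/
def lower (t : F) : SL2F := ⟨!![1, 0; t, 1], by simp [det_fin_two]⟩

theorem SL2_induction {P : SL2F → Prop} (hmul : ∀ g h, P g → P h → P (g * h))
    (hu : ∀ t, P (upper t)) (hl : ∀ t, P (lower t)) (g : SL2F) : P g := by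
  refine SL2.transvection_induction P (fun i j h c => ?_) hmul g
  fin_cases i <;> fin_cases j
  · exact absurd rfl h
  · convert hu c
    ext i j
    fin_cases i <;> fin_cases j <;>
      simp [upper, Matrix.SpecialLinearGroup.transvection, Matrix.transvection, Matrix.single]
  · convert hl c
    ext i j
    fin_cases i <;> fin_cases j <;>
      simp [lower, Matrix.SpecialLinearGroup.transvection, Matrix.transvection, Matrix.single]
  · exact absurd rfl h

open Classical in
/-- The section of the projection to the last row. -/
def rowSection (p : F × F) : SL2F :=
  if h : p = 0 then 1
  else diagSL ((Units.mk0 (big p) (big_ne_zero h))⁻¹) *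
    (if ‖p.2‖ ≤ ‖p.1‖ then ⟨!![0, -1; 1, p.2 / p.1], by simp [det_fin_two]⟩
      else ⟨!![1, 0; p.1 / p.2, 1], by simp [det_fin_two]⟩)

theorem upper_mul_rowSection (g : SL2F) : upper (unipCoord g) * rowSection (rowSL g) = g := by
  rw [rowSection, dif_neg (rowSL_ne_zero g), ← mul_assoc]
  exact upper_mul_diag_mul_bounded g

theorem rowSection_apply {p : F × F} (hp : p ≠ 0) (i j : Fin 2) :
    rowSection p i j = if ‖p.2‖ ≤ ‖p.1‖ then !![0, -(p.1)⁻¹; p.1, p.2] i j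
      else !![p.2⁻¹, 0; p.1, p.2] i j := by
  have hne := big_ne_zero hp
  rw [rowSection, dif_neg hp]
  change ∑ l, diagSL _ i l * (ite _ _ _ : SL2F) l j = _
  rw [Fin.sum_univ_two]
  by_cases h : ‖p.2‖ ≤ ‖p.1‖
  · have hb : big p = p.1 := by simp [big, h]
    rw [hb] at hne
    simp only [h, if_true]
    fin_cases i <;> fin_cases j <;> simp [diagSL, hb, hne]
    field_simp
  · have hb : big p = p.2 := by simp [big, h]
    rw [hb] at hne
    simp only [h, if_false]
    fin_cases i <;> fin_cases j <;> simp [diagSL, hb, hne]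
    field_simp

theorem rowSL_rowSection {p : F × F} (hp : p ≠ 0) : rowSL (rowSection p) = p := by
  rw [rowSL, rowSection_apply hp, rowSection_apply hp]
  split_ifs <;> rfl

theorem unipCoord_rowSection {p : F × F} (hp : p ≠ 0) : unipCoord (rowSection p) = 0 := by
  have h0 : rowSection p 1 0 = p.1 := congrArg Prod.fst (rowSL_rowSection hp)
  have h1 : rowSection p 1 1 = p.2 := congrArg Prod.snd (rowSL_rowSection hp)
  rw [unipCoord, h0, h1, rowSection_apply hp, rowSection_apply hp]
  split_ifs <;> simp

/-- The coordinates on `SL₂`: a unipotent coordinate and the last row. -/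
def param (y : F × (F × F)) : SL2F := upper y.1 * rowSection y.2

theorem rowSL_param {y : F × (F × F)} (hy : y.2 ≠ 0) : rowSL (param y) = y.2 := by
  rw [param, rowSL_upper_mul, rowSL_rowSection hy]

theorem unipCoord_param {y : F × (F × F)} (hy : y.2 ≠ 0) : unipCoord (param y) = y.1 := by
  rw [param, unipCoord_upper_mul, unipCoord_rowSection hy, add_zero]

theorem measurable_rowSection : Measurable (rowSection : F × F → SL2F) := by
  classical
  have h0 : MeasurableSet {p : F × F | p = 0} := measurableSet_singleton 0
  have h1 : MeasurableSet {p : F × F | ‖p.2‖ ≤ ‖p.1‖} := by measurability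
  apply measurable_to_SL2
  intro i j
  have : (fun p : F × F => rowSection p i j) = fun p => if p = 0 then (1 : SL2F) i j else
      if ‖p.2‖ ≤ ‖p.1‖ then !![0, -(p.1)⁻¹; p.1, p.2] i j else !![p.2⁻¹, 0; p.1, p.2] i j := by
    funext p
    by_cases hp : p = 0
    · simp [hp, rowSection]
    · rw [rowSection_apply hp, if_neg hp]
  rw [this]
  refine Measurable.ite h0 measurable_const (Measurable.ite h1 ?_ ?_)
  · fin_cases i <;> fin_cases j <;> simp <;> fun_prop
  · fin_cases i <;> fin_cases j <;> simp <;> fun_prop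

theorem continuous_upper : Continuous (upper : F → SL2F) := by
  rw [(isClosedEmbedding_entries F).isEmbedding.continuous_iff]
  refine continuous_pi fun i => continuous_pi fun j => ?_
  fin_cases i <;> fin_cases j <;> simp [upper] <;> fun_prop

theorem measurable_param : Measurable (param : F × (F × F) → SL2F) :=
  (continuous_upper.measurable.comp measurable_fst).mul
    (measurable_rowSection.comp measurable_snd)

theorem measurable_unipCoord : Measurable (unipCoord : SL2F → F) := by
  classical
  have h1 : MeasurableSet {g : SL2F | ‖g 1 1‖ ≤ ‖g 1 0‖} :=
    measurableSet_le (measurable_entry 1 1).norm (measurable_entry 1 0).norm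
  exact Measurable.ite h1 ((measurable_entry 0 0).div (measurable_entry 1 0))
    ((measurable_entry 0 1).div (measurable_entry 1 1))

theorem measurable_rowSL : Measurable (rowSL : SL2F → F × F) :=
  (measurable_entry 1 0).prodMk (measurable_entry 1 1)

variable (F) in
/-- The measure `dt dc dd` on the coordinates of `SL₂`. -/
def coordMeasure : Measure (F × (F × F)) :=
  (Measure.addHaar).prod ((Measure.addHaar).prod (Measure.addHaar))

instance : SigmaFinite (coordMeasure F) := by unfold coordMeasure; infer_instance

instance : (coordMeasure F).IsAddHaarMeasure := by unfold coordMeasure; infer_instance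

variable (F) in
theorem ae_coord_ne_zero : ∀ᵐ y ∂(coordMeasure F), y.2.1 ≠ 0 := by
  have h : ∀ᵐ c ∂(Measure.addHaar : Measure F), c ≠ 0 := by
    simp [ae_iff]
  have h2 : ∀ᵐ p ∂((Measure.addHaar : Measure F).prod (Measure.addHaar : Measure F)), p.1 ≠ 0 :=
    Measure.quasiMeasurePreserving_fst.ae h
  exact Measure.quasiMeasurePreserving_snd.ae h2

/-- Transport of the action on the last row. -/
theorem lintegral_row_mul {φ : F × F → ℝ≥0∞} (hφ : Measurable φ) (g : SL2F) :
    ∫⁻ p, φ (p.1 * g 0 0 + p.2 * g 1 0, p.1 * g 0 1 + p.2 * g 1 1)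
      ∂((Measure.addHaar : Measure F).prod Measure.addHaar) =
    ∫⁻ p, φ p ∂((Measure.addHaar : Measure F).prod Measure.addHaar) := by
  revert φ
  refine SL2_induction (P := fun g : SL2F => ∀ {φ : F × F → ℝ≥0∞}, Measurable φ →
    ∫⁻ p, φ (p.1 * g 0 0 + p.2 * g 1 0, p.1 * g 0 1 + p.2 * g 1 1)
      ∂((Measure.addHaar : Measure F).prod Measure.addHaar) =
    ∫⁻ p, φ p ∂((Measure.addHaar : Measure F).prod Measure.addHaar)) ?_ ?_ ?_ g
  · intro g h hg hh φ hφ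
    rw [← hh hφ]
    have hm : Measurable fun p : F × F =>
        φ (p.1 * h 0 0 + p.2 * h 1 0, p.1 * h 0 1 + p.2 * h 1 1) := hφ.comp (by fun_prop)
    rw [← hg hm]
    apply lintegral_congr
    intro p
    have e : ∀ i j, (g * h : SL2F) i j = g i 0 * h 0 j + g i 1 * h 1 j := by
      intro i j
      change ∑ l, g i l * h l j = _
      rw [Fin.sum_univ_two]
    simp only [e]
    congr 2 <;> ring
  · intro t φ hφ
    simp only [upper, of_apply, cons_val', cons_val_zero, cons_val_one, cons_val_fin_one, mul_one,
      mul_zero, add_zero]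
    rw [lintegral_prod (fun p : F × F => φ (p.1, p.1 * t + p.2))
      (hφ.comp (by fun_prop)).aemeasurable, lintegral_prod _ hφ.aemeasurable]
    apply lintegral_congr
    intro c
    exact lintegral_add_left_eq_self (fun d => φ (c, d)) (c * t)
  · intro t φ hφ
    simp only [lower, of_apply, cons_val', cons_val_zero, cons_val_one, cons_val_fin_one, mul_one,
      mul_zero, zero_add]
    rw [lintegral_prod_symm (fun p : F × F => φ (p.1 + p.2 * t, p.2))
      (hφ.comp (by fun_prop)).aemeasurable, lintegral_prod_symm _ hφ.aemeasurable]
    apply lintegral_congr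
    intro d
    exact lintegral_add_right_eq_self (fun c => φ (c, d)) (d * t)

variable (F) in
/-- The measure on `SL₂` with density `dt dc dd` in the coordinates `param`. -/
def paramMeasure : Measure SL2F := (coordMeasure F).map param

instance : (paramMeasure F).IsMulRightInvariant := by
  constructor
  intro g
  refine Measure.ext_of_lintegral _ fun φ hφ => ?_
  rw [lintegral_map hφ (measurable_mul_const g), paramMeasure,
    lintegral_map (f := fun a => φ (a * g)) (hφ.comp (measurable_mul_const g)) measurable_param,
    lintegral_map hφ measurable_param, coordMeasure,
    lintegral_prod_symm (fun y => φ (param y * g)) ((hφ.comp (measurable_mul_const g)).comp measurable_param).aemeasurable,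
    lintegral_prod_symm (fun y => φ (param y)) (hφ.comp measurable_param).aemeasurable]
  have hm : Measurable fun p : F × F => ∫⁻ t, φ (param (t, p)) ∂(Measure.addHaar : Measure F) :=
    (hφ.comp measurable_param).lintegral_prod_left'
  rw [← lintegral_row_mul hm g]
  have hne : ∀ᵐ p ∂((Measure.addHaar : Measure F).prod (Measure.addHaar : Measure F)), p ≠ 0 := by
    have h : ∀ᵐ c ∂(Measure.addHaar : Measure F), c ≠ 0 := by
      simp [ae_iff]
    filter_upwards [Measure.quasiMeasurePreserving_fst.ae h] with p hp h0
    exact hp (by rw [h0]; rfl)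
  apply lintegral_congr_ae
  filter_upwards [hne] with p hp
  have hrow : rowSL (rowSection p * g) =
      (p.1 * g 0 0 + p.2 * g 1 0, p.1 * g 0 1 + p.2 * g 1 1) := by
    have e : ∀ j, (rowSection p * g : SL2F) 1 j = rowSection p 1 0 * g 0 j + rowSection p 1 1 * g 1 j := by
      intro j
      change ∑ l, rowSection p 1 l * g l j = _
      rw [Fin.sum_univ_two]
    have h0 : rowSection p 1 0 = p.1 := congrArg Prod.fst (rowSL_rowSection hp)
    have h1 : rowSection p 1 1 = p.2 := congrArg Prod.snd (rowSL_rowSection hp)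
    rw [rowSL, e, e, h0, h1]
  have heq : ∀ t, param (t, p) * g = param (t + unipCoord (rowSection p * g),
      (p.1 * g 0 0 + p.2 * g 1 0, p.1 * g 0 1 + p.2 * g 1 1)) := by
    intro t
    rw [param, param, ← hrow, ← upper_mul, mul_assoc, mul_assoc, upper_mul_rowSection]
  simp only [Function.comp, heq]
  exact lintegral_add_right_eq_self (fun t => φ (param (t,
    (p.1 * g 0 0 + p.2 * g 1 0, p.1 * g 0 1 + p.2 * g 1 1)))) _

instance : IsFiniteMeasureOnCompacts (paramMeasure F) := by
  constructor
  intro K hK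
  obtain ⟨R, hR⟩ : ∃ R : ℝ, ∀ g ∈ K, ∀ i j, ‖g i j‖ ≤ R := by
    have hc : ∀ i j : Fin 2, ∃ R : ℝ, ∀ g ∈ K, ‖g i j‖ ≤ R := fun i j => by
      obtain ⟨R, hR⟩ := (hK.image (continuous_entry i j)).isBounded.exists_norm_le
      exact ⟨R, fun g hg => hR _ ⟨g, hg, rfl⟩⟩
    choose R hR using hc
    refine ⟨∑ i, ∑ j, |R i j|, fun g hg i j => (hR i j g hg).trans ((le_abs_self _).trans ?_)⟩
    refine le_trans (Finset.single_le_sum (f := fun j => |R i j|) (fun _ _ => abs_nonneg _)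
      (Finset.mem_univ j)) ?_
    exact Finset.single_le_sum (f := fun i => ∑ j, |R i j|)
      (fun _ _ => Finset.sum_nonneg fun _ _ => abs_nonneg _) (Finset.mem_univ i)
  obtain ⟨ε, hε, hεK⟩ : ∃ ε : ℝ, 0 < ε ∧ ∀ g ∈ K, ε ≤ max ‖g 1 0‖ ‖g 1 1‖ := by
    rcases K.eq_empty_or_nonempty with rfl | hne
    · exact ⟨1, one_pos, by simp⟩
    have hcont : ContinuousOn (fun g : SL2F => max ‖g 1 0‖ ‖g 1 1‖) K :=
      ((continuous_entry 1 0).norm.max (continuous_entry 1 1).norm).continuousOn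
    obtain ⟨g₀, hg₀, hmin⟩ := hK.exists_isMinOn hne hcont
    refine ⟨_, ?_, fun g hg => hmin hg⟩
    have := norm_pos_iff.mpr (big_ne_zero (rowSL_ne_zero g₀))
    rwa [norm_big] at this
  have hsub : param ⁻¹' K ⊆ (Metric.closedBall (0 : F) (R / ε) ×ˢ
      (Metric.closedBall (0 : F) R ×ˢ Metric.closedBall (0 : F) R)) ∪ {y | ¬ y.2.1 ≠ 0} := by
    intro y hy
    by_cases h : y.2.1 = 0
    · right; simpa using h
    left
    have hy2 : y.2 ≠ 0 := fun h0 => h (by rw [h0]; rfl)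
    have h0 : param y 1 0 = y.2.1 := congrArg Prod.fst (rowSL_param hy2)
    have h1 : param y 1 1 = y.2.2 := congrArg Prod.snd (rowSL_param hy2)
    have hb := hεK _ hy
    have hu := unipCoord_param hy2
    refine ⟨?_, ?_, ?_⟩
    · rw [mem_closedBall_zero_iff, ← hu, unipCoord]
      split_ifs with hc
      · rw [max_eq_left hc] at hb
        rw [norm_div]
        exact div_le_div₀ ((norm_nonneg _).trans (hR _ hy 0 0)) (hR _ hy 0 0) hε hb
      · rw [max_eq_right (not_le.mp hc).le] at hb
        rw [norm_div]
        exact div_le_div₀ ((norm_nonneg _).trans (hR _ hy 0 0)) (hR _ hy 0 1) hε hb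
    · rw [mem_closedBall_zero_iff, ← h0]; exact hR _ hy _ _
    · rw [mem_closedBall_zero_iff, ← h1]; exact hR _ hy _ _
  rw [paramMeasure, Measure.map_apply measurable_param hK.measurableSet]
  refine (measure_mono hsub).trans_lt ((measure_union_le _ _).trans_lt ?_)
  rw [ae_iff.mp (ae_coord_ne_zero F), add_zero]
  exact ((isCompact_closedBall _ _).prod ((isCompact_closedBall _ _).prod
    (isCompact_closedBall _ _))).measure_lt_top

theorem paramMeasure_ne_zero : paramMeasure F ≠ 0 := by
  intro h
  have : paramMeasure F Set.univ = 0 := by rw [h]; rfl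
  rw [paramMeasure, Measure.map_apply measurable_param MeasurableSet.univ, Set.preimage_univ,
    Measure.measure_univ_eq_zero] at this
  exact (NeZero.ne (coordMeasure F)) this

theorem modularCharacterFun_SL2_eq_one [CharZero F] (g : SL2F) :
    Measure.modularCharacterFun g = 1 := by
  have hperf := SL2.commutator_eq_top (F := F) (a := 2) two_ne_zero (by norm_num)
  have hker := Abelianization.commutator_subset_ker (Measure.modularCharacter (G := SL2F)).toHomUnits
  rw [hperf] at hker
  exact congrArg Units.val (MonoidHom.mem_ker.mp (hker (Subgroup.mem_top g)))

theorem isMulRightInvariant_haar [CharZero F] (μ : Measure SL2F) [μ.IsHaarMeasure] :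
    μ.IsMulRightInvariant := by
  constructor
  intro g
  have h := Measure.isMulLeftInvariant_eq_smul (μ.map (· * g)) μ
  rwa [← Measure.modularCharacterFun_eq_haarScalarFactor, modularCharacterFun_SL2_eq_one,
    one_smul] at h

instance isHaarMeasure_paramMeasure [CharZero F] : (paramMeasure F).IsHaarMeasure := by
  set l : Measure SL2F := Measure.haar
  have : l.IsMulRightInvariant := isMulRightInvariant_haar l
  have : IsFiniteMeasureOnCompacts (paramMeasure F).inv :=
    Measure.IsFiniteMeasureOnCompacts.map _ (Homeomorph.inv SL2F)
  have : IsFiniteMeasureOnCompacts l.inv :=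
    Measure.IsFiniteMeasureOnCompacts.map _ (Homeomorph.inv SL2F)
  have h1 := Measure.isMulLeftInvariant_eq_smul (paramMeasure F).inv l
  have h2 := Measure.isMulLeftInvariant_eq_smul l.inv l
  set c := (paramMeasure F).inv.haarScalarFactor l
  set c' := l.inv.haarScalarFactor l
  have h3 : paramMeasure F = (c * c') • l := by
    rw [← Measure.inv_inv (paramMeasure F), h1, mul_smul, ← h2]
    simp [Measure.inv, Measure.map_smul]
  have hc : c * c' ≠ 0 := by
    intro h
    rw [h, zero_smul] at h3
    exact paramMeasure_ne_zero h3
  rw [h3]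
  exact Measure.IsHaarMeasure.nnreal_smul l hc

theorem lintegral_haar_eq [CharZero F] (μG : Measure (G F)) [μG.IsHaarMeasure] :
    ∃ c : ℝ≥0, ∀ φ : G F → ℝ≥0∞, Measurable φ →
      ∫⁻ g, φ g ∂μG = c * ∫⁻ y : Fin 3 → F × (F × F), φ (fun i => param (y i))
        ∂(Measure.pi fun _ => coordMeasure F) := by
  obtain ⟨c, h⟩ : ∃ c : ℝ≥0, μG = c • Measure.pi fun _ : Fin 3 => paramMeasure F :=
    ⟨_, Measure.isMulLeftInvariant_eq_smul μG (Measure.pi fun _ : Fin 3 => paramMeasure F)⟩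
  refine ⟨c, fun φ hφ => ?_⟩
  have hpi : (Measure.pi fun _ : Fin 3 => paramMeasure F) =
      (Measure.pi fun _ : Fin 3 => coordMeasure F).map (fun y i => param (y i)) := by
    have : ∀ _ : Fin 3, SigmaFinite ((coordMeasure F).map param) := fun _ => by
      change SigmaFinite (paramMeasure F); infer_instance
    rw [Measure.pi_map_pi (hμ := this) (f := fun _ => param)
      fun _ => measurable_param.aemeasurable]
    rfl
  rw [h, lintegral_smul_measure, hpi]
  have hm : Measurable fun (y : Fin 3 → F × (F × F)) (i : Fin 3) => param (y i) :=
    measurable_pi_lambda _ fun i => measurable_param.comp (measurable_pi_apply i)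
  rw [lintegral_map hφ hm]
  rfl

end HaarSL

end TripleQuad
end

noncomputable section

namespace TripleQuad

section QuotientIntegral

variable {F : Type*} [NontriviallyNormedField F] [ProperSpace F] [MeasurableSpace F] [BorelSpace F]

variable (F) in
/-- The measure on triples of last rows. -/
def rowsMeasure : Measure (Fin 3 → F × F) :=
  Measure.pi fun _ => (Measure.addHaar : Measure F).prod Measure.addHaar

instance : SigmaFinite (rowsMeasure F) := by unfold rowsMeasure; infer_instance

theorem out_mk_eq (g : G F) :
    ∃ n ∈ N0 F, (Quotient.mk (QuotientGroup.rightRel (N0 F)) g).out = n * g := by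
  have h := Quotient.mk_out (s := QuotientGroup.rightRel (N0 F)) g
  have h' : (QuotientGroup.rightRel (N0 F)) (Quotient.mk (QuotientGroup.rightRel (N0 F)) g).out g := h
  rw [QuotientGroup.rightRel_apply] at h'
  refine ⟨_, (N0 F).inv_mem h', ?_⟩
  group

theorem rowSL_N0_mul {n : G F} (hn : n ∈ N0 F) (g : G F) (i : Fin 3) :
    rowSL ((n * g) i) = rowSL (g i) := by
  obtain ⟨t, -, ht⟩ := hn
  rw [Pi.mul_apply, ht, rowSL_upper_mul]

theorem sum_unipCoord_N0_mul {n : G F} (hn : n ∈ N0 F) (g : G F) :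
    ∑ i, unipCoord ((n * g) i) = ∑ i, unipCoord (g i) := by
  obtain ⟨t, h0, ht⟩ := hn
  simp only [Pi.mul_apply, ht, unipCoord_upper_mul, Finset.sum_add_distrib, h0, zero_add]

/-- Coordinates on `N₀(F)`. -/
def n0Coord (n : N0 F) : F × F := ((n : G F) 0 0 1, (n : G F) 1 0 1)

theorem unipCoord_N0_mul (n : N0 F) (g : G F) :
    unipCoord (((n : G F) * g) 0) = (n0Coord n).1 + unipCoord (g 0) ∧
    unipCoord (((n : G F) * g) 1) = (n0Coord n).2 + unipCoord (g 1) := by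
  obtain ⟨n, t, h0, ht⟩ := n
  have h : ∀ i, unipCoord (n i * g i) = n i 0 1 + unipCoord (g i) := fun i => by
    rw [ht, unipCoord_upper_mul]; simp [upper]
  exact ⟨h 0, h 1⟩

theorem continuous_n0Coord : Continuous (n0Coord : N0 F → F × F) := by
  have h : ∀ i : Fin 3, Continuous fun n : N0 F => (n : G F) i 0 1 := fun i =>
    (continuous_entry 0 1).comp ((continuous_apply i).comp continuous_subtype_val)
  exact (h 0).prodMk (h 1)

/-- The element of `N₀(F)` with given coordinates. -/
def n0Of (s : F × F) : N0 F :=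
  ⟨fun i => upper (![s.1, s.2, -s.1 - s.2] i), ![s.1, s.2, -s.1 - s.2], by
    simp [Fin.sum_univ_three], fun _ => rfl⟩

theorem continuous_n0Of : Continuous (n0Of : F × F → N0 F) := by
  refine Continuous.subtype_mk (continuous_pi fun i => continuous_upper.comp ?_) _
  fin_cases i <;> simp <;> fun_prop

theorem n0Of_n0Coord (n : N0 F) : n0Of (n0Coord n) = n := by
  obtain ⟨n, t, h0, ht⟩ := n
  rw [Fin.sum_univ_three] at h0
  have h2 : t 2 = -t 0 - t 1 := by linear_combination h0
  apply Subtype.ext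
  funext i
  change upper _ = n i
  rw [ht]
  congr 1
  fin_cases i <;> simp [n0Coord, ht, upper, h2]

theorem n0Coord_n0Of (s : F × F) : n0Coord (n0Of s) = s := by
  simp [n0Coord, n0Of, upper]

theorem n0Coord_mul (m n : N0 F) : n0Coord (m * n) = n0Coord m + n0Coord n := by
  obtain ⟨m, s, hs0, hs⟩ := m
  obtain ⟨n, t, ht0, ht⟩ := n
  have h : ∀ i, ((m * n : G F) i) 0 1 = s i + t i := by
    intro i
    rw [Pi.mul_apply, hs, ht, upper_mul]
    simp [upper]
  have h' : ∀ i, (m i) 0 1 = s i := by intro i; rw [hs]; simp [upper]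
  have h'' : ∀ i, (n i) 0 1 = t i := by intro i; rw [ht]; simp [upper]
  simp only [n0Coord, Prod.mk_add_mk, h', h'']
  exact Prod.ext (h 0) (h 1)

/-- The unit square in the coordinates of `N₀(F)`. -/
def n0Box (F : Type*) [NontriviallyNormedField F] : Set (F × F) :=
  Metric.closedBall 0 1 ×ˢ Metric.closedBall 0 1

theorem measurableSet_n0Box : MeasurableSet (n0Box F) :=
  Metric.isClosed_closedBall.measurableSet.prod Metric.isClosed_closedBall.measurableSet

theorem measure_n0Box (μN : Measure (N0 F)) [μN.IsHaarMeasure] :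
    μN (n0Coord ⁻¹' n0Box F) ≠ 0 ∧ μN (n0Coord ⁻¹' n0Box F) ≠ ⊤ := by
  constructor
  · have hopen : IsOpen (n0Coord ⁻¹' (Metric.ball (0 : F) 1 ×ˢ Metric.ball (0 : F) 1)) :=
      (Metric.isOpen_ball.prod Metric.isOpen_ball).preimage continuous_n0Coord
    have hne : (n0Coord ⁻¹' (Metric.ball (0 : F) 1 ×ˢ Metric.ball (0 : F) 1)).Nonempty :=
      ⟨n0Of 0, by simp [n0Coord_n0Of]⟩
    have := hopen.measure_pos μN hne
    refine (this.trans_le (measure_mono ?_)).ne'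
    exact Set.preimage_mono (Set.prod_mono Metric.ball_subset_closedBall Metric.ball_subset_closedBall)
  · have hc : IsCompact (n0Of '' n0Box F) :=
      ((isCompact_closedBall _ _).prod (isCompact_closedBall _ _)).image continuous_n0Of
    refine ne_top_of_le_ne_top hc.measure_ne_top (measure_mono fun n hn => ?_)
    exact ⟨n0Coord n, hn, n0Of_n0Coord n⟩

theorem lintegral_n0Box_translate (μN : Measure (N0 F)) [μN.IsHaarMeasure] (s : F × F) :
    ∫⁻ n, (n0Box F).indicator 1 (n0Coord n + s) ∂μN = μN (n0Coord ⁻¹' n0Box F) := by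
  have hmeas : Measurable (n0Coord : N0 F → F × F) := by
    have h : ∀ i : Fin 3, Measurable fun n : N0 F => (n : G F) i 0 1 := fun i =>
      (measurable_entry 0 1).comp ((measurable_pi_apply i).comp measurable_subtype_coe)
    exact (h 0).prodMk (h 1)
  have h : ∀ n : N0 F, (n0Box F).indicator (1 : F × F → ℝ≥0∞) (n0Coord n + s) =
      (fun m => (n0Box F).indicator (1 : F × F → ℝ≥0∞) (n0Coord m)) (n0Of s * n) := by
    intro n
    simp only [n0Coord_mul, n0Coord_n0Of, add_comm]
  simp only [h]
  have h2 := lintegral_mul_left_eq_self (μ := μN)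
    (fun m => (n0Box F).indicator (1 : F × F → ℝ≥0∞) (n0Coord m)) (n0Of s)
  refine h2.trans ?_
  have : (fun m => (n0Box F).indicator (1 : F × F → ℝ≥0∞) (n0Coord m)) =
      (n0Coord ⁻¹' n0Box F).indicator 1 := rfl
  rw [this, lintegral_indicator_one (hmeas measurableSet_n0Box)]

/-- An integral over triples of coordinates in which only the sum of the unipotent coordinates
occurs. -/
theorem lintegral_coords_box {H : F → (Fin 3 → F × F) → ℝ≥0∞} (hH : Measurable (Function.uncurry H)) :
    ∫⁻ y : Fin 3 → F × (F × F), H (∑ i, (y i).1) (fun i => (y i).2) *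
        (n0Box F).indicator 1 ((y 0).1, (y 1).1) ∂(Measure.pi fun _ => coordMeasure F) =
      ((Measure.addHaar : Measure F) (Metric.closedBall 0 1)) ^ 2 *
        ∫⁻ p, ∫⁻ t, H t p ∂(Measure.addHaar : Measure F) ∂(rowsMeasure F) := by
  set ν : Measure F := Measure.addHaar with hν
  have hmp : MeasurePreserving (MeasurableEquiv.arrowProdEquivProdArrow F (F × F) (Fin 3))
      (Measure.pi fun _ => coordMeasure F) ((Measure.pi fun _ => ν).prod (rowsMeasure F)) :=
    measurePreserving_arrowProdEquivProdArrow F (F × F) (Fin 3) (fun _ => ν) (fun _ => ν.prod ν)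
  have hbox : Measurable ((n0Box F).indicator (1 : F × F → ℝ≥0∞)) :=
    measurable_one.indicator measurableSet_n0Box
  have hm : Measurable fun q : (Fin 3 → F) × (Fin 3 → F × F) =>
      H (∑ i, q.1 i) q.2 * (n0Box F).indicator (1 : F × F → ℝ≥0∞) (q.1 0, q.1 1) := by
    have hs : Measurable fun q : (Fin 3 → F) × (Fin 3 → F × F) => ∑ i, q.1 i := by fun_prop
    refine Measurable.mul (hH.comp (hs.prodMk measurable_snd)) (hbox.comp ?_)
    · exact ((measurable_pi_apply 0).comp measurable_fst).prodMk
        ((measurable_pi_apply 1).comp measurable_fst)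
  have h1 := hmp.lintegral_comp hm
  refine Eq.trans h1 ?_
  have hin : Measurable fun p => ∫⁻ t, H t p ∂ν := hH.lintegral_prod_left'
  rw [lintegral_prod_symm _ hm.aemeasurable, ← lintegral_const_mul _ hin]
  apply lintegral_congr
  intro p
  have hmp2 := measurePreserving_piFinSuccAbove (n := 2) (α := fun _ => F) (fun _ => ν) 2
  have hm2 : Measurable fun q : F × (Fin 2 → F) =>
      H (q.1 + ∑ i, q.2 i) p * (n0Box F).indicator (1 : F × F → ℝ≥0∞) (q.2 0, q.2 1) := by
    have hs : Measurable fun q : F × (Fin 2 → F) => q.1 + ∑ i, q.2 i := by fun_prop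
    refine Measurable.mul (hH.comp (hs.prodMk measurable_const)) (hbox.comp ?_)
    · exact ((measurable_pi_apply 0).comp measurable_snd).prodMk
        ((measurable_pi_apply 1).comp measurable_snd)
  have h2 := hmp2.lintegral_comp hm2
  have e : ∀ t : Fin 3 → F, H (∑ i, t i) p * (n0Box F).indicator (1 : F × F → ℝ≥0∞) (t 0, t 1) =
      (fun q : F × (Fin 2 → F) =>
      H (q.1 + ∑ i, q.2 i) p * (n0Box F).indicator (1 : F × F → ℝ≥0∞) (q.2 0, q.2 1))
      (MeasurableEquiv.piFinSuccAbove (fun _ : Fin 3 => F) 2 t) := by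
    intro t
    have hs : ∑ i, t i = t 2 + ∑ i, Fin.removeNth (2 : Fin 3) t i :=
      Fin.sum_univ_succAbove t 2
    simp only [MeasurableEquiv.piFinSuccAbove_apply, Fin.insertNthEquiv_symm_apply]
    rw [hs]
    rfl
  simp only [e]
  rw [h2, lintegral_prod_symm _ hm2.aemeasurable]
  have h3 : ∀ s : Fin 2 → F, ∫⁻ t, H (t + ∑ i, s i) p *
      (n0Box F).indicator (1 : F × F → ℝ≥0∞) (s 0, s 1) ∂ν =
      (∫⁻ t, H t p ∂ν) * (n0Box F).indicator (1 : F × F → ℝ≥0∞) (s 0, s 1) := by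
    intro s
    rw [lintegral_mul_const']
    · congr 1
      exact lintegral_add_right_eq_self (fun t => H t p) _
    · simp only [Set.indicator]; split_ifs <;> simp
  simp only [h3]
  have hm4 : Measurable fun s : Fin 2 → F => (n0Box F).indicator (1 : F × F → ℝ≥0∞) (s 0, s 1) :=
    hbox.comp ((measurable_pi_apply 0).prodMk (measurable_pi_apply 1))
  rw [lintegral_const_mul _ hm4, mul_comm]
  congr 1
  have h5 : (fun s : Fin 2 → F => (n0Box F).indicator (1 : F × F → ℝ≥0∞) (s 0, s 1)) =
      (Set.pi Set.univ fun _ : Fin 2 => Metric.closedBall (0 : F) 1).indicator 1 := by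
    funext s
    have hiff : (s 0, s 1) ∈ n0Box F ↔
        s ∈ Set.pi Set.univ fun _ : Fin 2 => Metric.closedBall (0 : F) 1 := by
      simp [n0Box, Set.mem_pi, Fin.forall_fin_two]
    by_cases hm : (s 0, s 1) ∈ n0Box F
    · rw [Set.indicator_of_mem hm, Set.indicator_of_mem (hiff.mp hm)]; rfl
    · rw [Set.indicator_of_notMem hm, Set.indicator_of_notMem (mt hiff.mpr hm)]
  rw [h5, lintegral_indicator_one (MeasurableSet.univ_pi fun _ =>
    Metric.isClosed_closedBall.measurableSet), Measure.pi_pi]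
  simp

variable [CharZero F]

open Classical in
/-- Integrals over `N₀\G` are bounded by integrals in coordinates. -/
theorem lintegral_quotient_le {μG : Measure (G F)} [μG.IsHaarMeasure] {μN : Measure (N0 F)}
    [μN.IsHaarMeasure] {μ : Measure (N0G F)} (hμ : IsQuotientMeasure μG μN μ) :
    ∃ C : ℝ≥0∞, C ≠ ⊤ ∧ ∀ (h : N0G F → ℝ≥0∞) (H : F → (Fin 3 → F × F) → ℝ≥0∞),
      Measurable (Function.uncurry H) →
      (∀ x : N0G F, (∀ i, x.out i 1 0 ≠ 0) →
        h x ≤ H (∑ i, unipCoord (x.out i)) fun i => rowSL (x.out i)) →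
      ∫⁻ x, h x ∂μ ≤ C * ∫⁻ p, ∫⁻ t, H t p ∂(Measure.addHaar : Measure F) ∂(rowsMeasure F) := by
  obtain ⟨c, hc⟩ := lintegral_haar_eq μG
  obtain ⟨hE0, hEtop⟩ := measure_n0Box μN
  set E := μN (n0Coord ⁻¹' n0Box F) with hE
  refine ⟨E⁻¹ * (c * ((Measure.addHaar : Measure F) (Metric.closedBall 0 1)) ^ 2), ?_, ?_⟩
  · refine ENNReal.mul_ne_top (ENNReal.inv_ne_top.mpr hE0) (ENNReal.mul_ne_top ENNReal.coe_ne_top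
      (ENNReal.pow_ne_top (isCompact_closedBall _ _).measure_ne_top))
  intro h H hH hle
  let H' : G F → ℝ≥0∞ := fun g =>
    if ∀ i, (rowSL (g i)).1 ≠ 0 then H (∑ i, unipCoord (g i)) fun i => rowSL (g i) else ⊤
  have hrow : Measurable fun g : G F => fun i => rowSL (g i) :=
    measurable_pi_lambda _ fun i => measurable_rowSL.comp (measurable_pi_apply i)
  have hH' : Measurable H' := by
    have hs : Measurable fun g : G F => ∑ i, unipCoord (g i) :=
      Finset.measurable_fun_sum _ fun i _ => measurable_unipCoord.comp (measurable_pi_apply i)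
    refine Measurable.ite ?_ (hH.comp (hs.prodMk hrow)) measurable_const
    · simp only [Set.ofPred_forall]
      refine MeasurableSet.iInter fun i => ?_
      have hi : Measurable fun g : G F => (rowSL (g i)).1 :=
        measurable_fst.comp (measurable_rowSL.comp (measurable_pi_apply i))
      exact (hi (measurableSet_singleton (0 : F))).compl
  have hinv : ∀ n ∈ N0 F, ∀ g, H' (n * g) = H' g := by
    intro n hn g
    simp only [H', rowSL_N0_mul hn, sum_unipCoord_N0_mul hn]
  let φ : G F → ℝ≥0∞ := fun g => H' g *
    (n0Box F).indicator 1 (unipCoord (g 0), unipCoord (g 1))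
  have hφ : Measurable φ := hH'.mul ((measurable_one.indicator measurableSet_n0Box).comp
    ((measurable_unipCoord.comp (measurable_pi_apply 0)).prodMk
      (measurable_unipCoord.comp (measurable_pi_apply 1))))
  have key := hμ φ hφ
  have hinner : ∀ x : N0G F, ∫⁻ n, φ ((n : G F) * x.out) ∂μN = H' x.out * E := by
    intro x
    have : ∀ n : N0 F, φ ((n : G F) * x.out) = H' x.out *
        (n0Box F).indicator 1 (n0Coord n + (unipCoord (x.out 0), unipCoord (x.out 1))) := by
      intro n
      simp only [φ, hinv n n.2]
      rw [(unipCoord_N0_mul n x.out).1, (unipCoord_N0_mul n x.out).2]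
      rfl
    simp only [this]
    rw [lintegral_const_mul, lintegral_n0Box_translate]
    refine (measurable_one.indicator measurableSet_n0Box).comp (Measurable.add_const ?_ _)
    have h : ∀ i : Fin 3, Measurable fun n : N0 F => (n : G F) i 0 1 := fun i =>
      (measurable_entry 0 1).comp ((measurable_pi_apply i).comp measurable_subtype_coe)
    exact (h 0).prodMk (h 1)
  simp only [hinner] at key
  rw [lintegral_mul_const' _ _ hEtop, hc φ hφ] at key
  have hcoords : ∫⁻ y : Fin 3 → F × (F × F), φ (fun i => param (y i))
        ∂(Measure.pi fun _ => coordMeasure F) =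
      ∫⁻ y : Fin 3 → F × (F × F), H (∑ i, (y i).1) (fun i => (y i).2) *
        (n0Box F).indicator 1 ((y 0).1, (y 1).1) ∂(Measure.pi fun _ => coordMeasure F) := by
    apply lintegral_congr_ae
    have hae : ∀ᵐ y ∂(Measure.pi fun _ : Fin 3 => coordMeasure F), ∀ i, (y i).2.1 ≠ 0 :=
      ae_all_iff.mpr fun i => (Measure.tendsto_eval_ae_ae (μ := fun _ : Fin 3 => coordMeasure F)
        (i := i)).eventually (ae_coord_ne_zero F)
    filter_upwards [hae] with y hy
    have hy2 : ∀ i, (y i).2 ≠ 0 := fun i h0 => hy i (by rw [h0]; rfl)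
    simp only [φ, H', rowSL_param (hy2 _), unipCoord_param (hy2 _)]
    rw [if_pos hy]
  rw [hcoords, lintegral_coords_box hH] at key
  calc ∫⁻ x, h x ∂μ ≤ ∫⁻ x : N0G F, H' x.out ∂μ := by
        apply lintegral_mono
        intro x
        by_cases hx : ∀ i, (rowSL (x.out i)).1 ≠ 0
        · simp only [H', if_pos hx]
          exact hle x hx
        · simp only [H', if_neg hx]
          exact le_top
    _ = E⁻¹ * ((∫⁻ x : N0G F, H' x.out ∂μ) * E) := by
        rw [mul_comm, mul_assoc, ENNReal.mul_inv_cancel hE0 hEtop, mul_one]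
    _ = _ := by rw [← key, mul_assoc, mul_assoc]

end QuotientIntegral

end TripleQuad
end

noncomputable section

namespace TripleQuad

section WeilFormula

variable {F : Type*} [NontriviallyNormedField F] [ProperSpace F] [MeasurableSpace F] [BorelSpace F]
variable {d : Fin 3 → ℕ}

variable (F) in
/-- The product of the Haar measures on a coordinate space. -/
def piHaar (n : Type*) [Fintype n] : Measure (n → F) := Measure.pi fun _ => Measure.addHaar

instance (n : Type*) [Fintype n] : SigmaFinite (piHaar F n) := by
  unfold piHaar; infer_instance

instance (n : Type*) [Fintype n] : (piHaar F n).IsAddHaarMeasure := by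
  unfold piHaar; infer_instance

variable (F d) in
/-- The product of the Haar measures on the coordinates of `V`. -/
def vHaar : Measure (V F d) := Measure.pi fun i => piHaar F (Fin (d i))

instance : SigmaFinite (vHaar F d) := by
  unfold vHaar; infer_instance

instance : (vHaar F d).IsAddHaarMeasure := by
  unfold vHaar; infer_instance

theorem exists_selfDual_eq_smul {n : Type*} [Fintype n] (ψ : AddChar F Circle) (J : Matrix n n F) :
    ∃ c : ℝ≥0, selfDual ψ J = c • piHaar F n := by
  by_cases h : ∃ ν, IsSelfDual ψ J ν
  · have : (selfDual ψ J).IsAddHaarMeasure := by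
      rw [selfDual, dif_pos h]; exact h.choose_spec.1
    exact ⟨_, Measure.isAddLeftInvariant_eq_smul (selfDual ψ J) (piHaar F n)⟩
  · exact ⟨0, by rw [selfDual, dif_neg h, zero_smul]⟩

/-- The exponent in the oscillatory integrals of the Weil representation. -/
def phase (J : ∀ i, Matrix (Fin (d i)) (Fin (d i)) F) (x : Fin 3 → F) (y t : V F d) : F :=
  ∑ i, (x i * quad (J i) (t i) + y i ⬝ᵥ t i)

/-- The oscillatory integrals of the Weil representation. -/
def oscInt (ψ : AddChar F Circle) (J : ∀ i, Matrix (Fin (d i)) (Fin (d i)) F) (f : V F d → ℂ)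
    (x : Fin 3 → F) (y : V F d) : ℂ :=
  ∫ t, f t * (ψ (phase J x y t) : ℂ) ∂(vHaar F d)

theorem continuous_phase (J : ∀ i, Matrix (Fin (d i)) (Fin (d i)) F) :
    Continuous fun q : (Fin 3 → F) × V F d × V F d => phase J q.1 q.2.1 q.2.2 := by
  unfold phase quad bil dotProduct mulVec dotProduct
  fun_prop

theorem continuous_phase_right (J : ∀ i, Matrix (Fin (d i)) (Fin (d i)) F) (x : Fin 3 → F)
    (y : V F d) : Continuous (phase J x y) :=
  (continuous_phase J).comp (by fun_prop : Continuous fun t : V F d => (x, y, t))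

theorem continuous_psi {ψ : AddChar F Circle} (hψ : Continuous ψ) :
    Continuous fun z => (ψ z : ℂ) := continuous_subtype_val.comp hψ

theorem norm_psi (ψ : AddChar F Circle) (z : F) : ‖(ψ z : ℂ)‖ = 1 := Circle.norm_coe _

theorem integrable_mul_psi {ψ : AddChar F Circle} (hψ : Continuous ψ)
    {X : Type*} [TopologicalSpace X] [MeasurableSpace X] [OpensMeasurableSpace X] {μ : Measure X}
    {f : X → ℂ} (hf : Integrable f μ) {p : X → F} (hp : Continuous p) :
    Integrable (fun t => f t * (ψ (p t) : ℂ)) μ := by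
  refine hf.mul_bdd (c := 1) ((continuous_psi hψ).comp hp).measurable.aestronglyMeasurable ?_
  exact Filter.Eventually.of_forall fun t => (norm_psi ψ _).le

theorem continuous_oscInt {ψ : AddChar F Circle} (hψ : Continuous ψ)
    (J : ∀ i, Matrix (Fin (d i)) (Fin (d i)) F) {f : V F d → ℂ} (hf : Integrable f (vHaar F d)) :
    Continuous fun q : (Fin 3 → F) × V F d => oscInt ψ J f q.1 q.2 := by
  refine continuous_of_dominated (bound := fun t => ‖f t‖) ?_ ?_ hf.norm ?_
  · intro q
    exact (integrable_mul_psi hψ hf (continuous_phase_right J q.1 q.2)).aestronglyMeasurable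
  · intro q
    exact Filter.Eventually.of_forall fun t => by rw [norm_mul, norm_psi, mul_one]
  · refine Filter.Eventually.of_forall fun t => continuous_const.mul ((continuous_psi hψ).comp ?_)
    exact (continuous_phase J).comp (by fun_prop : Continuous fun q : (Fin 3 → F) × V F d =>
      (q.1, q.2, t))

/-- The vector of `V` with given components. -/
def mkV (t : (Fin (d 0) → F) × (Fin (d 1) → F) × (Fin (d 2) → F)) : V F d :=
  Function.update (Function.update (Function.update 0 0 t.1) 1 t.2.1) 2 t.2.2

theorem mkV_zero (t : (Fin (d 0) → F) × (Fin (d 1) → F) × (Fin (d 2) → F)) : mkV t 0 = t.1 := by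
  simp [mkV, Function.update_of_ne]

theorem mkV_one (t : (Fin (d 0) → F) × (Fin (d 1) → F) × (Fin (d 2) → F)) : mkV t 1 = t.2.1 := by
  simp [mkV, Function.update_of_ne]

theorem mkV_two (t : (Fin (d 0) → F) × (Fin (d 1) → F) × (Fin (d 2) → F)) : mkV t 2 = t.2.2 := by
  simp [mkV]

theorem update_eq_mkV (v : V F d) (t : (Fin (d 0) → F) × (Fin (d 1) → F) × (Fin (d 2) → F)) :
    Function.update (Function.update (Function.update v 0 t.1) 1 t.2.1) 2 t.2.2 = mkV t := by
  funext i
  fin_cases i <;> simp [mkV, Function.update_of_ne]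

theorem continuous_mkV : Continuous (mkV : _ → V F d) := by
  unfold mkV
  fun_prop

theorem integral_vHaar {h : V F d → ℂ} (hh : Integrable h (vHaar F d)) :
    ∫ t, h t ∂(vHaar F d) = ∫ t₀, ∫ t₁, ∫ t₂, h (mkV (t₀, t₁, t₂))
      ∂(piHaar F (Fin (d 2))) ∂(piHaar F (Fin (d 1))) ∂(piHaar F (Fin (d 0))) := by
  have hm : vHaar F d = ((piHaar F (Fin (d 0))).prod ((piHaar F (Fin (d 1))).prod
      (piHaar F (Fin (d 2))))).map mkV := by
    refine Measure.pi_eq fun s hs => ?_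
    rw [Measure.map_apply continuous_mkV.measurable (MeasurableSet.univ_pi hs)]
    have : mkV ⁻¹' (Set.univ.pi s) = s 0 ×ˢ (s 1 ×ˢ s 2) := by
      ext t
      simp [Set.mem_pi, Fin.forall_fin_succ, mkV_zero, mkV_one, mkV_two]
    rw [this, Measure.prod_prod, Measure.prod_prod, Fin.prod_univ_three, mul_assoc]
  rw [hm] at hh
  have hi := (integrable_map_measure hh.aestronglyMeasurable continuous_mkV.aemeasurable).mp hh
  rw [hm, integral_map continuous_mkV.aemeasurable hh.aestronglyMeasurable]
  rw [integral_prod (fun t => h (mkV t)) hi]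
  apply integral_congr_ae
  filter_upwards [hi.prod_right_ae] with t₀ ht₀
  exact integral_prod (fun t => h (mkV (t₀, t))) ht₀

theorem weilOne_of_ne (ψ : AddChar F Circle) (J : ∀ i, Matrix (Fin (d i)) (Fin (d i)) F) (i : Fin 3)
    {g : Matrix.SpecialLinearGroup (Fin 2) F} (hg : g 1 0 ≠ 0) (f : V F d → ℂ) (v : V F d) :
    weilOne ψ J i g f v = (ψ (g 0 0 / g 1 0 * quad (J i) (v i)) : ℂ) *
      (chiQ J i (-(g 1 0)⁻¹) * ((nabs (-(g 1 0)⁻¹) ^ ((d i : ℝ) / 2) : ℝ) : ℂ) *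
        weilNumber ψ (J i)) *
      ∫ t, f (Function.update v i t) * (ψ (g 1 1 / g 1 0 * quad (J i) t +
        (-(g 1 0)⁻¹ • v i) ᵥ* J i ⬝ᵥ t) : ℂ) ∂(selfDual ψ (J i)) := by
  rw [weilOne, if_neg hg]
  simp only [weilUpper, weilDiag, weilFlip, fourier, Function.update_self, Function.update_idem]
  have e : ∀ t, (ψ (g 1 1 / g 1 0 * quad (J i) t) : ℂ) * f (Function.update v i t) *
      (ψ (bil (J i) (-(g 1 0)⁻¹ • v i) t) : ℂ) = f (Function.update v i t) *
      (ψ (g 1 1 / g 1 0 * quad (J i) t + (-(g 1 0)⁻¹ • v i) ᵥ* J i ⬝ᵥ t) : ℂ) := by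
    intro t
    simp only [bil, dotProduct_mulVec, AddChar.map_add_eq_mul, Circle.coe_mul]
    ring
  simp only [e]
  ring

/-- The scalar factor of the Weil representation on the big cell. -/
def weilFactor (ψ : AddChar F Circle) (J : ∀ i, Matrix (Fin (d i)) (Fin (d i)) F) (g : G F)
    (v : V F d) : ℂ :=
  ∏ i, ((ψ (g i 0 0 / g i 1 0 * quad (J i) (v i)) : ℂ) *
    (chiQ J i (-(g i 1 0)⁻¹) * ((nabs (-(g i 1 0)⁻¹) ^ ((d i : ℝ) / 2) : ℝ) : ℂ) *
      weilNumber ψ (J i)))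

/-- The linear term of the phase occurring in the Weil representation. -/
def weilY (J : ∀ i, Matrix (Fin (d i)) (Fin (d i)) F) (g : G F) (v : V F d) : V F d :=
  fun i => (-(g i 1 0)⁻¹ • v i) ᵥ* J i

theorem exists_weil_eq {ψ : AddChar F Circle} (hψ : Continuous ψ)
    (J : ∀ i, Matrix (Fin (d i)) (Fin (d i)) F) :
    ∃ c : ℝ, ∀ f : V F d → ℂ, Integrable f (vHaar F d) → ∀ g : G F, (∀ i, g i 1 0 ≠ 0) → ∀ v,
      weil ψ J g f v = c * weilFactor ψ J g v *
        oscInt ψ J f (fun i => g i 1 1 / g i 1 0) (weilY J g v) := by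
  choose c hc using fun i => exists_selfDual_eq_smul ψ (J i)
  refine ⟨c 0 * c 1 * c 2, fun f hf g hg v => ?_⟩
  rw [oscInt, integral_vHaar (integrable_mul_psi hψ hf (continuous_phase_right J _ _))]
  have h2 : ∀ w : V F d, weilOne ψ J 2 (g 2) f w = _ := weilOne_of_ne ψ J 2 (hg 2) f
  rw [weil, weilOne_of_ne ψ J 0 (hg 0)]
  simp only [weilOne_of_ne ψ J 1 (hg 1), weilOne_of_ne ψ J 2 (hg 2)]
  simp only [Function.update_of_ne (show (1 : Fin 3) ≠ 0 by decide),
    Function.update_of_ne (show (2 : Fin 3) ≠ 0 by decide),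
    Function.update_of_ne (show (2 : Fin 3) ≠ 1 by decide)]
  simp only [hc, integral_smul_nnreal_measure]
  rw [weilFactor, Fin.prod_univ_three]
  simp only [NNReal.smul_def, Complex.real_smul]
  simp only [← integral_const_mul, ← integral_mul_const]
  congr 1
  funext t₀
  congr 1
  funext t₁
  congr 1
  funext t₂
  have hu := update_eq_mkV v (t₀, t₁, t₂)
  simp only at hu
  rw [hu]
  simp only [phase, Fin.sum_univ_three, mkV_zero, mkV_one, mkV_two, weilY, AddChar.map_add_eq_mul,
    Circle.coe_mul]
  push_cast
  ring

theorem norm_hilbertSymbol (a b : F) : ‖hilbertSymbol a b‖ = 1 := by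
  unfold hilbertSymbol
  split_ifs <;> simp

theorem norm_weilFactor (ψ : AddChar F Circle) (J : ∀ i, Matrix (Fin (d i)) (Fin (d i)) F) (g : G F)
    (v : V F d) : ‖weilFactor ψ J g v‖ =
      (∏ i, (nabs (g i 1 0))⁻¹ ^ ((d i : ℝ) / 2)) * ∏ i, ‖weilNumber ψ (J i)‖ := by
  rw [weilFactor, norm_prod, ← Finset.prod_mul_distrib]
  refine Finset.prod_congr rfl fun i _ => ?_
  rw [norm_mul, norm_psi, one_mul, norm_mul, norm_mul, chiQ, norm_hilbertSymbol, one_mul,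
    nabs_neg, nabs_inv, Complex.norm_real, Real.norm_of_nonneg]
  exact Real.rpow_nonneg (inv_nonneg.mpr (nabs_nonneg _)) _

theorem weil_N0_mul {ψ : AddChar F Circle} (hψ : Continuous ψ)
    {J : ∀ i, Matrix (Fin (d i)) (Fin (d i)) F} {f : V F d → ℂ} (hf : Integrable f (vHaar F d))
    {v : V F d} (hv : v ∈ Ysm J) {n : G F} (hn : n ∈ N0 F) {g : G F} (hg : ∀ i, g i 1 0 ≠ 0) :
    weil ψ J (n * g) f v = weil ψ J g f v := by
  obtain ⟨t, ht0, ht⟩ := hn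
  obtain ⟨c, hc⟩ := exists_weil_eq hψ J
  have h1 : ∀ i j, (n * g : G F) i 1 j = g i 1 j := fun i j => by
    rw [Pi.mul_apply, ht, upper_mul_apply_one]
  have h0 : ∀ i j, (n * g : G F) i 0 j = g i 0 j + t i * g i 1 j := fun i j => by
    rw [Pi.mul_apply, ht, upper_mul_apply_zero]
  rw [hc f hf _ (fun i => by rw [h1]; exact hg i), hc f hf g hg]
  have hy : weilY J (n * g) v = weilY J g v := by
    funext i; simp only [weilY, h1]
  rw [hy]
  simp only [h1]
  congr 2
  simp only [weilFactor, h0, h1]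
  have hq1 : quad (J 1) (v 1) = quad (J 0) (v 0) := hv.2.1.symm
  have hq2 : quad (J 2) (v 2) = quad (J 0) (v 0) := (hv.2.1.trans hv.2.2).symm
  have hq : ∀ i, quad (J i) (v i) = quad (J 0) (v 0) := by
    intro i; fin_cases i
    · rfl
    · exact hq1
    · exact hq2
  simp only [hq, Finset.prod_mul_distrib]
  congr 1
  have hsum : ∀ i, (g i 0 0 + t i * g i 1 0) / g i 1 0 * quad (J 0) (v 0) =
      t i * quad (J 0) (v 0) + g i 0 0 / g i 1 0 * quad (J 0) (v 0) := by
    intro i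
    have := hg i
    field_simp
    ring
  simp only [hsum, AddChar.map_add_eq_mul, Circle.coe_mul, Finset.prod_mul_distrib]
  have : ∏ i, (ψ (t i * quad (J 0) (v 0)) : ℂ) = 1 := by
    rw [Fin.prod_univ_three, ← Circle.coe_mul, ← Circle.coe_mul, ← AddChar.map_add_eq_mul,
      ← AddChar.map_add_eq_mul, ← add_mul, ← add_mul, ← Fin.sum_univ_three, ht0, zero_mul,
      AddChar.map_zero_eq_one, Circle.coe_one]
  rw [this, one_mul]

/-- The elements at which the Hilbert symbol is trivial form a closed set. -/
theorem measurable_hilbertSymbol (b : F) : Measurable fun a : F => hilbertSymbol a b := by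
  obtain ⟨π, hπ, -⟩ := exists_one_lt_nabs F
  have hπ0 : π ≠ 0 := by rintro rfl; simp at hπ; linarith
  let A : Set (F × F × F) := Metric.closedBall 0 ‖π‖ \ Metric.ball 0 1
  have hA : IsCompact A := (isCompact_closedBall _ _).diff Metric.isOpen_ball
  have hset : {a : F | ∃ x y z : F, (x ≠ 0 ∨ y ≠ 0 ∨ z ≠ 0) ∧ a * x ^ 2 + b * y ^ 2 = z ^ 2} =
      Prod.snd '' ((A ×ˢ Set.univ) ∩ {q : (F × F × F) × F |
        q.2 * q.1.1 ^ 2 + b * q.1.2.1 ^ 2 = q.1.2.2 ^ 2}) := by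
    ext a
    constructor
    · rintro ⟨x, y, z, h0, h⟩
      have hne : (x, y, z) ≠ (0 : F × F × F) := by
        intro h'
        simp only [Prod.mk_eq_zero] at h'
        tauto
      obtain ⟨k, hk1, hk2⟩ := exists_mem_Ico_zpow (norm_pos_iff.mpr hne) hπ
      refine ⟨(((π ^ k)⁻¹ • (x, y, z)), a), ⟨⟨⟨?_, ?_⟩, trivial⟩, ?_⟩, rfl⟩
      · rw [mem_closedBall_zero_iff, norm_smul, norm_inv, norm_zpow, inv_mul_le_iff₀ (by positivity),
          ← zpow_add_one₀ (by positivity)]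
        exact hk2.le
      · rw [mem_ball_zero_iff, not_lt, norm_smul, norm_inv, norm_zpow, le_inv_mul_iff₀ (by positivity),
          mul_one]
        exact hk1
      · simp only [Set.mem_ofPred_eq, Prod.smul_mk, smul_eq_mul]
        linear_combination ((π ^ k)⁻¹) ^ 2 * h
    · rintro ⟨⟨⟨x, y, z⟩, a'⟩, ⟨⟨⟨-, h1⟩, -⟩, h2⟩, rfl⟩
      refine ⟨x, y, z, ?_, h2⟩
      by_contra h0
      push Not at h0
      obtain ⟨rfl, rfl, rfl⟩ := h0
      exact h1 (by simp)
  have hclosed : IsClosed {a : F | ∃ x y z : F, (x ≠ 0 ∨ y ≠ 0 ∨ z ≠ 0) ∧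
      a * x ^ 2 + b * y ^ 2 = z ^ 2} := by
    rw [hset]
    have hc : IsClosed {q : (F × F × F) × F | q.2 * q.1.1 ^ 2 + b * q.1.2.1 ^ 2 = q.1.2.2 ^ 2} :=
      isClosed_eq (by fun_prop) (by fun_prop)
    rw [← isSeqClosed_iff_isClosed]
    intro a l ha hl
    choose q hq hqa using ha
    obtain ⟨w, hw, φ, hφ, hφw⟩ := hA.tendsto_subseq fun n => (hq n).1.1
    refine ⟨(w, l), ⟨⟨hw, trivial⟩, ?_⟩, rfl⟩
    refine hc.mem_of_tendsto (b := Filter.atTop) (f := fun n => q (φ n)) ?_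
      (Filter.Eventually.of_forall fun n => (hq (φ n)).2)
    refine Filter.Tendsto.prodMk_nhds hφw ?_ |>.congr fun n => rfl
    simpa only [Function.comp_def, hqa] using hl.comp hφ.tendsto_atTop
  unfold hilbertSymbol
  exact Measurable.ite hclosed.measurableSet measurable_const measurable_const

theorem measurable_chiQ (J : ∀ i, Matrix (Fin (d i)) (Fin (d i)) F) (i : Fin 3) :
    Measurable (chiQ J i) := measurable_hilbertSymbol _

theorem measurable_entryG (i : Fin 3) (j k : Fin 2) : Measurable fun g : G F => g i j k :=
  (measurable_entry j k).comp (measurable_pi_apply i)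

theorem measurable_weilFactor {ψ : AddChar F Circle} (hψ : Continuous ψ)
    (J : ∀ i, Matrix (Fin (d i)) (Fin (d i)) F) (v : V F d) :
    Measurable fun g : G F => weilFactor ψ J g v := by
  have he := measurable_entryG (F := F)
  refine Finset.measurable_fun_prod _ fun i _ => Measurable.mul ?_ (Measurable.mul (Measurable.mul ?_ ?_) measurable_const)
  · exact (continuous_psi hψ).measurable.comp (((he i 0 0).div (he i 1 0)).mul_const _)
  · exact (measurable_chiQ J i).comp (he i 1 0).inv.neg
  · exact Complex.measurable_ofReal.comp ((measurable_nabs.comp (he i 1 0).inv.neg).pow_const _)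

theorem measurable_weilY (J : ∀ i, Matrix (Fin (d i)) (Fin (d i)) F) (v : V F d) :
    Measurable fun g : G F => weilY J g v := by
  refine measurable_pi_lambda _ fun i => measurable_pi_lambda _ fun j => ?_
  have h : Continuous fun c : F => (((-c) • v i) ᵥ* J i) j := by
    unfold vecMul dotProduct
    fun_prop
  exact h.measurable.comp (measurable_entryG i 1 0).inv

theorem measurable_oscInt_comp {ψ : AddChar F Circle} (hψ : Continuous ψ)
    (J : ∀ i, Matrix (Fin (d i)) (Fin (d i)) F) {f : V F d → ℂ} (hf : Integrable f (vHaar F d))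
    {X : Type*} [MeasurableSpace X] {x : X → Fin 3 → F} (hx : Measurable x) {y : X → V F d}
    (hy : Measurable y) : Measurable fun g => oscInt ψ J f (x g) (y g) := by
  have h := (continuous_oscInt hψ J hf).measurable.comp (hx.prodMk hy)
  simp only [Function.comp_def] at h
  exact h

theorem measurable_weil_formula {ψ : AddChar F Circle} (hψ : Continuous ψ)
    (J : ∀ i, Matrix (Fin (d i)) (Fin (d i)) F) {f : V F d → ℂ} (hf : Integrable f (vHaar F d))
    (v : V F d) : Measurable fun g : G F => weilFactor ψ J g v *
      oscInt ψ J f (fun i => g i 1 1 / g i 1 0) (weilY J g v) := by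
  have hx : Measurable fun (g : G F) (i : Fin 3) => g i 1 1 / g i 1 0 :=
    measurable_pi_lambda _ fun i => (measurable_entryG i 1 1).div (measurable_entryG i 1 0)
  have h2 := measurable_oscInt_comp hψ J hf hx (measurable_weilY J v)
  exact (measurable_weilFactor hψ J v).mul h2

end WeilFormula

end TripleQuad
end

noncomputable section

namespace TripleQuad

section Vabs

variable {F : Type*} [NontriviallyNormedField F] [ProperSpace F] [MeasurableSpace F] [BorelSpace F]
variable {n : Type*} [Fintype n]

theorem nabs_le_vabs (x : n → F) (j : n) : nabs (x j) ≤ vabs x :=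
  le_ciSup (f := fun j => nabs (x j)) (Set.finite_range _).bddAbove j

theorem vabs_nonneg (x : n → F) : 0 ≤ vabs x := Real.iSup_nonneg fun _ => nabs_nonneg _

theorem vabs_le {x : n → F} {C : ℝ} (hC : 0 ≤ C) (h : ∀ j, nabs (x j) ≤ C) : vabs x ≤ C :=
  Real.iSup_le h hC

theorem vabs_smul (a : F) (x : n → F) : vabs (a • x) = nabs a * vabs x := by
  simp only [vabs, Pi.smul_apply, smul_eq_mul, nabs_mul]
  exact (Real.mul_iSup_of_nonneg (nabs_nonneg a) _).symm

theorem vabs_eq_zero {x : n → F} : vabs x = 0 ↔ x = 0 := by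
  constructor
  · intro h
    funext j
    exact nabs_eq_zero.mp (le_antisymm ((nabs_le_vabs x j).trans h.le) (nabs_nonneg _))
  · rintro rfl
    exact le_antisymm (vabs_le le_rfl fun j => by simp) (vabs_nonneg _)

theorem vabs_pos {x : n → F} (hx : x ≠ 0) : 0 < vabs x :=
  lt_of_le_of_ne (vabs_nonneg x) fun h => hx (vabs_eq_zero.mp h.symm)

theorem exists_nabs_sum_le (F : Type*) [NontriviallyNormedField F] [ProperSpace F]
    [MeasurableSpace F] [BorelSpace F] (n : Type*) [Fintype n] :
    ∃ K : ℝ, 0 < K ∧ ∀ z : n → F, nabs (∑ i, z i) ≤ K * vabs z := by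
  obtain ⟨l, hl, hl'⟩ := exists_one_lt_nabs F
  obtain ⟨N, hN⟩ := pow_unbounded_of_one_lt (Fintype.card n : ℝ) hl
  refine ⟨nabs l ^ N, by positivity, fun z => ?_⟩
  rcases isEmpty_or_nonempty n with h | h
  · simp only [Finset.univ_eq_empty, Finset.sum_empty, nabs_zero]
    exact mul_nonneg (by positivity) (vabs_nonneg z)
  obtain ⟨j, -, hj⟩ := Finset.exists_max_image Finset.univ (fun i => ‖z i‖) Finset.univ_nonempty
  have h1 : ‖∑ i, z i‖ ≤ ‖l ^ N * z j‖ := by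
    calc ‖∑ i, z i‖ ≤ ∑ i, ‖z i‖ := norm_sum_le _ _
      _ ≤ ∑ _i : n, ‖z j‖ := Finset.sum_le_sum fun i _ => hj i (Finset.mem_univ i)
      _ = Fintype.card n * ‖z j‖ := by simp
      _ ≤ ‖l ^ N * z j‖ := by
        rw [norm_mul, norm_pow]
        exact mul_le_mul_of_nonneg_right hN.le (norm_nonneg _)
  calc nabs (∑ i, z i) ≤ nabs (l ^ N * z j) := nabs_le_of_norm_le h1
    _ = nabs l ^ N * nabs (z j) := by rw [nabs_mul, nabs_pow]
    _ ≤ _ := mul_le_mul_of_nonneg_left (nabs_le_vabs z j) (by positivity)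

theorem exists_vabs_vecMul_le [DecidableEq n] (J : Matrix n n F) :
    ∃ K : ℝ, 0 < K ∧ ∀ x : n → F, vabs (x ᵥ* J) ≤ K * vabs x := by
  obtain ⟨K, hK, h⟩ := exists_nabs_sum_le F n
  let M : ℝ := ∑ i, ∑ j, nabs (J i j)
  have hM : ∀ i j, nabs (J i j) ≤ M := fun i j =>
    (Finset.single_le_sum (f := fun j => nabs (J i j)) (fun _ _ => nabs_nonneg _)
      (Finset.mem_univ j)).trans (Finset.single_le_sum (f := fun i => ∑ j, nabs (J i j))
      (fun _ _ => Finset.sum_nonneg fun _ _ => nabs_nonneg _) (Finset.mem_univ i))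
  have hM0 : 0 ≤ M := Finset.sum_nonneg fun _ _ => Finset.sum_nonneg fun _ _ => nabs_nonneg _
  refine ⟨K * (M + 1), by positivity, fun x => vabs_le (by have := vabs_nonneg x; positivity) fun j => ?_⟩
  refine (h fun i => x i * J i j).trans ?_
  rw [mul_assoc]
  refine mul_le_mul_of_nonneg_left (vabs_le (by have := vabs_nonneg x; positivity) fun i => ?_) hK.le
  rw [nabs_mul, mul_comm]
  exact mul_le_mul ((hM i j).trans (by linarith)) (nabs_le_vabs x i) (nabs_nonneg _) (by linarith)

theorem exists_vabs_le_vecMul [DecidableEq n] {J : Matrix n n F} (hJ : J.det ≠ 0) :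
    ∃ K : ℝ, 0 < K ∧ ∀ x : n → F, vabs x ≤ K * vabs (x ᵥ* J) := by
  obtain ⟨K, hK, h⟩ := exists_vabs_vecMul_le J⁻¹
  refine ⟨K, hK, fun x => ?_⟩
  have := h (x ᵥ* J)
  rwa [vecMul_vecMul, Matrix.mul_nonsing_inv _ (isUnit_iff_ne_zero.mpr hJ), vecMul_one] at this

end Vabs

section TTStar

variable {F : Type*} [NontriviallyNormedField F] [ProperSpace F] [MeasurableSpace F] [BorelSpace F]
variable {d : Fin 3 → ℕ}

/-- The Fourier transform of the product of a function with a conjugate translate of another. -/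
def corr (ψ : AddChar F Circle) (f g : V F d → ℂ) (u ξ : V F d) : ℂ :=
  ∫ s, f (s + u) * starRingEnd ℂ (g s) * (ψ (∑ i, ξ i ⬝ᵥ s i) : ℂ) ∂(vHaar F d)

theorem bil_symm {n : Type*} [Fintype n] {J : Matrix n n F} (hJ : J.IsSymm) (x y : n → F) :
    bil J x y = bil J y x := by
  rw [bil, bil, dotProduct_mulVec, dotProduct_comm, ← mulVec_transpose, hJ.eq]

theorem quad_add [CharZero F] {n : Type*} [Fintype n] {J : Matrix n n F} (hJ : J.IsSymm)
    (s u : n → F) : quad J (s + u) = quad J s + quad J u + u ᵥ* J ⬝ᵥ s := by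
  have h1 : bil J (s + u) (s + u) = bil J s s + bil J u u + 2 * bil J u s := by
    have : bil J (s + u) (s + u) = bil J s s + bil J s u + (bil J u s + bil J u u) := by
      simp only [bil, mulVec_add, dotProduct_add, add_dotProduct]
      ring
    rw [this, bil_symm hJ s u]
    ring
  have h2 : (2 : F) ≠ 0 := two_ne_zero
  rw [quad, h1, quad, quad, ← dotProduct_mulVec]
  change _ = _ + bil J u s
  field_simp

theorem phase_add [CharZero F] {J : ∀ i, Matrix (Fin (d i)) (Fin (d i)) F} (hJ : ∀ i, (J i).IsSymm)
    (x : Fin 3 → F) (y s u : V F d) :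
    phase J x y (s + u) = phase J x y s + phase J x y u +
      ∑ i, (x i • (u i ᵥ* J i)) ⬝ᵥ s i := by
  simp only [phase, ← Finset.sum_add_distrib]
  refine Finset.sum_congr rfl fun i _ => ?_
  rw [Pi.add_apply, quad_add (hJ i), dotProduct_add, smul_dotProduct, smul_eq_mul]
  ring

theorem enorm_sq_oscInt_le [CharZero F] {ψ : AddChar F Circle} (hψ : Continuous ψ)
    {J : ∀ i, Matrix (Fin (d i)) (Fin (d i)) F} (hJ : ∀ i, (J i).IsSymm) {f : V F d → ℂ}
    (hf : Integrable f (vHaar F d)) (x : Fin 3 → F) (y : V F d) :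
    ‖oscInt ψ J f x y‖ₑ ^ 2 ≤
      ∫⁻ u, ‖corr ψ f f u (fun i => x i • (u i ᵥ* J i))‖ₑ ∂(vHaar F d) := by
  set h : V F d → ℂ := fun t => f t * (ψ (phase J x y t) : ℂ) with hh
  have hi : Integrable h (vHaar F d) := integrable_mul_psi hψ hf (continuous_phase_right J x y)
  have hic : Integrable (fun s => starRingEnd ℂ (h s)) (vHaar F d) :=
    (Complex.conjLIE.toContinuousLinearEquiv.integrable_comp_iff).mpr hi
  have hprod : Integrable (Function.uncurry fun s u => starRingEnd ℂ (h s) * h (s + u))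
      ((vHaar F d).prod (vHaar F d)) := by
    have := (measurePreserving_prod_add (vHaar F d) (vHaar F d)).integrable_comp_of_integrable
      (hic.mul_prod hi)
    exact this
  have key : starRingEnd ℂ (oscInt ψ J f x y) * oscInt ψ J f x y =
      ∫ u, (ψ (phase J x y u) : ℂ) * corr ψ f f u (fun i => x i • (u i ᵥ* J i)) ∂(vHaar F d) := by
    calc starRingEnd ℂ (oscInt ψ J f x y) * oscInt ψ J f x y =
        ∫ s, starRingEnd ℂ (h s) * oscInt ψ J f x y ∂(vHaar F d) := by
          rw [integral_mul_const, integral_conj]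
          rfl
      _ = ∫ s, ∫ u, starRingEnd ℂ (h s) * h (s + u) ∂(vHaar F d) ∂(vHaar F d) := by
          congr 1
          funext s
          rw [integral_const_mul, integral_add_left_eq_self (fun u => h u) s]
          rfl
      _ = ∫ u, ∫ s, starRingEnd ℂ (h s) * h (s + u) ∂(vHaar F d) ∂(vHaar F d) :=
          integral_integral_swap hprod
      _ = _ := by
          congr 1
          funext u
          rw [corr, ← integral_const_mul]
          congr 1
          funext s
          simp only [hh, phase_add hJ, AddChar.map_add_eq_mul, Circle.coe_mul, map_mul]
          have hs : (ψ (phase J x y s) : ℂ) * starRingEnd ℂ (ψ (phase J x y s) : ℂ) = 1 := by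
            rw [Complex.mul_conj, Circle.normSq_coe, Complex.ofReal_one]
          linear_combination (starRingEnd ℂ (f s) * f (s + u) * (ψ (phase J x y u) : ℂ) *
            (ψ (∑ i, (x i • (u i ᵥ* J i)) ⬝ᵥ s i) : ℂ)) * hs
  calc ‖oscInt ψ J f x y‖ₑ ^ 2 = ‖starRingEnd ℂ (oscInt ψ J f x y) * oscInt ψ J f x y‖ₑ := by
        rw [enorm_mul, sq]
        congr 1
        rw [← ofReal_norm, ← ofReal_norm, RCLike.norm_conj]
    _ ≤ ∫⁻ u, ‖(ψ (phase J x y u) : ℂ) * corr ψ f f u (fun i => x i • (u i ᵥ* J i))‖ₑ ∂(vHaar F d) := by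
        rw [key]
        exact enorm_integral_le_lintegral_enorm _
    _ = _ := by
        congr 1
        funext u
        rw [enorm_mul, ← ofReal_norm (ψ _ : ℂ), norm_psi, ENNReal.ofReal_one, one_mul]

end TTStar

end TripleQuad
end

noncomputable section

namespace TripleQuad

section TTStarBound

variable {F : Type*} [NontriviallyNormedField F] [ProperSpace F] [MeasurableSpace F] [BorelSpace F]
variable {d : Fin 3 → ℕ}

theorem integrable_max_one_sq : Integrable (fun t : F => ((max 1 (nabs t)) ^ 2)⁻¹) Measure.addHaar := by
  refine ⟨(((measurable_const.max measurable_nabs).pow_const 2).inv).aestronglyMeasurable, ?_⟩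
  have h := lintegral_max_one_rpow_lt_top (Measure.addHaar : Measure F) (q := 2) (by norm_num)
  refine lt_of_le_of_lt (le_of_eq (lintegral_congr fun t => ?_)) h
  have h0 : 0 < max 1 (nabs t) := lt_max_of_lt_left one_pos
  rw [← ofReal_norm, Real.norm_of_nonneg (by positivity), Real.rpow_neg h0.le]
  norm_cast

theorem integral_max_one_sq_mul {a : F} (ha : a ≠ 0) :
    Integrable (fun t : F => ((max 1 (nabs a * nabs t)) ^ 2)⁻¹) Measure.addHaar ∧
    ∫ t : F, ((max 1 (nabs a * nabs t)) ^ 2)⁻¹ ∂Measure.addHaar =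
      (nabs a)⁻¹ * ∫ t : F, ((max 1 (nabs t)) ^ 2)⁻¹ ∂Measure.addHaar := by
  have hm : MeasurableEmbedding fun x : F => a * x :=
    (Homeomorph.mulLeft₀ a ha).measurableEmbedding
  have hmap := map_mul_left_addHaar (Measure.addHaar : Measure F) ha
  simp only [← nabs_mul]
  constructor
  · have h1 : Integrable (fun t : F => ((max 1 (nabs t)) ^ 2)⁻¹)
        ((Measure.addHaar : Measure F).map fun x => a * x) := by
      rw [hmap]
      exact integrable_max_one_sq.smul_measure ENNReal.ofReal_ne_top
    exact (hm.integrable_map_iff).mp h1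
  · have h2 := hm.integral_map (μ := (Measure.addHaar : Measure F))
      (fun t : F => ((max 1 (nabs t)) ^ 2)⁻¹)
    rw [← h2, hmap, integral_smul_measure, ENNReal.toReal_ofReal (inv_nonneg.mpr (nabs_nonneg a)),
      smul_eq_mul]

/-- The integral over `V` of a product of scaled decaying functions of the coordinates. -/
theorem lintegral_prod_max_one {a : Fin 3 → F} (ha : ∀ i, a i ≠ 0) :
    ∫⁻ u : V F d, ENNReal.ofReal (∏ i, ∏ j, ((max 1 (nabs (a i) * nabs (u i j))) ^ 2)⁻¹) ∂(vHaar F d) =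
      ENNReal.ofReal (∏ i, ((nabs (a i))⁻¹ *
        ∫ t : F, ((max 1 (nabs t)) ^ 2)⁻¹ ∂Measure.addHaar) ^ d i) := by
  have h1 : ∀ i, Integrable (fun w : Fin (d i) → F =>
      ∏ j, ((max 1 (nabs (a i) * nabs (w j))) ^ 2)⁻¹) (piHaar F (Fin (d i))) := fun i =>
    Integrable.fintype_prod_dep fun _ => (integral_max_one_sq_mul (ha i)).1
  have h2 : Integrable (fun u : V F d => ∏ i, ∏ j, ((max 1 (nabs (a i) * nabs (u i j))) ^ 2)⁻¹)
      (vHaar F d) := Integrable.fintype_prod_dep h1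
  rw [← ofReal_integral_eq_lintegral_ofReal h2 (Filter.Eventually.of_forall fun u =>
    Finset.prod_nonneg fun i _ => Finset.prod_nonneg fun j _ => by positivity)]
  congr 1
  have h3 := integral_fintype_prod_eq_prod (𝕜 := ℝ) (μ := fun i => piHaar F (Fin (d i)))
    (fun i (w : Fin (d i) → F) => ∏ j, ((max 1 (nabs (a i) * nabs (w j))) ^ 2)⁻¹)
  refine h3.trans (Finset.prod_congr rfl fun i _ => ?_)
  have h4 := integral_fintype_prod_eq_prod (𝕜 := ℝ) (μ := fun _ : Fin (d i) => (Measure.addHaar : Measure F))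
    (fun _ t => ((max 1 (nabs (a i) * nabs t)) ^ 2)⁻¹)
  refine h4.trans ?_
  rw [Finset.prod_const, Finset.card_univ, Fintype.card_fin, (integral_max_one_sq_mul (ha i)).2]

theorem exists_weight_le {n : ℕ} {J : Matrix (Fin n) (Fin n) F} (hJ : J.det ≠ 0) :
    ∃ K : ℝ, 0 ≤ K ∧ ∀ (a b : F), nabs b = max 1 (nabs a) → ∀ u : Fin n → F,
      ((max 1 (vabs u)) ^ (2 * n))⁻¹ * ((max 1 (vabs (a • (u ᵥ* J)))) ^ (2 * n))⁻¹ ≤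
        K * ∏ j, ((max 1 (nabs b * nabs (u j))) ^ 2)⁻¹ := by
  obtain ⟨K, hK, h⟩ := exists_vabs_le_vecMul hJ
  set K' := max 1 K
  refine ⟨K' ^ (2 * n), by positivity, fun a b hb u => ?_⟩
  set A := max 1 (vabs u)
  set B := max 1 (vabs (a • (u ᵥ* J)))
  have hA1 : 1 ≤ A := le_max_left _ _
  have hB1 : 1 ≤ B := le_max_left _ _
  have hK1 : 1 ≤ K' := le_max_left _ _
  have hm : ∀ j, max 1 (nabs b * nabs (u j)) ≤ K' * (A * B) := by
    intro j
    have hAB : 1 ≤ A * B := one_le_mul_of_one_le_of_one_le hA1 hB1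
    refine max_le (one_le_mul_of_one_le_of_one_le hK1 hAB) ?_
    refine (mul_le_mul_of_nonneg_left (nabs_le_vabs u j) (nabs_nonneg b)).trans ?_
    rcases le_total (nabs a) 1 with ha | ha
    · rw [hb, max_eq_left ha, one_mul]
      calc vabs u ≤ A := le_max_right _ _
        _ ≤ A * B := le_mul_of_one_le_right (by positivity) hB1
        _ ≤ K' * (A * B) := le_mul_of_one_le_left (by positivity) hK1
    · rw [hb, max_eq_right ha]
      calc nabs a * vabs u ≤ nabs a * (K * vabs (u ᵥ* J)) :=
            mul_le_mul_of_nonneg_left (h u) (nabs_nonneg a)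
        _ = K * vabs (a • (u ᵥ* J)) := by rw [vabs_smul]; ring
        _ ≤ K' * (A * B) := by
          refine mul_le_mul (le_max_right _ _) ?_ (vabs_nonneg _) (by positivity)
          exact (le_max_right _ _).trans (le_mul_of_one_le_left (by positivity) hA1)
  have hprod : (K' ^ (2 * n))⁻¹ * ((A ^ (2 * n))⁻¹ * (B ^ (2 * n))⁻¹) ≤
      ∏ j, ((max 1 (nabs b * nabs (u j))) ^ 2)⁻¹ := by
    calc (K' ^ (2 * n))⁻¹ * ((A ^ (2 * n))⁻¹ * (B ^ (2 * n))⁻¹) =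
        ∏ _j : Fin n, ((K' * (A * B)) ^ 2)⁻¹ := by
          rw [Finset.prod_const, Finset.card_univ, Fintype.card_fin, inv_pow, ← pow_mul, mul_pow,
            mul_pow, mul_inv, mul_inv]
      _ ≤ _ := by
          refine Finset.prod_le_prod (fun _ _ => by positivity) fun j _ => ?_
          have h0 : 0 < max 1 (nabs b * nabs (u j)) := lt_max_of_lt_left one_pos
          exact inv_anti₀ (by positivity) (pow_le_pow_left₀ h0.le (hm j) 2)
  have hpos : 0 < K' ^ (2 * n) := by positivity
  calc (A ^ (2 * n))⁻¹ * (B ^ (2 * n))⁻¹ =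
      K' ^ (2 * n) * ((K' ^ (2 * n))⁻¹ * ((A ^ (2 * n))⁻¹ * (B ^ (2 * n))⁻¹)) := by
        rw [mul_inv_cancel_left₀ hpos.ne']
    _ ≤ _ := mul_le_mul_of_nonneg_left hprod hpos.le

/-- Square root cancellation in oscillatory integrals whose correlations decay. -/
theorem exists_norm_oscInt_le [CharZero F] {ψ : AddChar F Circle} (hψ : Continuous ψ)
    {J : ∀ i, Matrix (Fin (d i)) (Fin (d i)) F} (hJ : ∀ i, (J i).IsSymm ∧ (J i).det ≠ 0)
    {f : V F d → ℂ} (hf : Integrable f (vHaar F d))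
    (hG : ∃ C : ℝ, 0 ≤ C ∧ ∀ u ξ, ‖corr ψ f f u ξ‖ ≤ C * ∏ i, (((max 1 (vabs (u i))) ^ (2 * d i))⁻¹ *
      ((max 1 (vabs (ξ i))) ^ (2 * d i))⁻¹)) :
    ∃ C : ℝ, 0 ≤ C ∧ ∀ x y, ‖oscInt ψ J f x y‖ ≤
      C * ∏ i, (max 1 (nabs (x i))) ^ (-((d i : ℝ) / 2)) := by
  obtain ⟨C, hC, hG⟩ := hG
  choose K hK hKle using fun i => exists_weight_le (hJ i).2
  set L := ∫ t : F, ((max 1 (nabs t)) ^ 2)⁻¹ ∂Measure.addHaar with hL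
  have hL0 : 0 ≤ L := integral_nonneg fun t => by positivity
  set C' := C * ∏ i, (K i * L ^ d i) with hC'
  have hC'0 : 0 ≤ C' := mul_nonneg hC (Finset.prod_nonneg fun i _ => by have := hK i; positivity)
  refine ⟨Real.sqrt C', Real.sqrt_nonneg _, fun x y => ?_⟩
  obtain ⟨a, ha⟩ : ∃ a : Fin 3 → F, ∀ i, nabs (a i) = max 1 (nabs (x i)) := by
    refine ⟨fun i => if nabs (x i) ≤ 1 then 1 else x i, fun i => ?_⟩
    dsimp only
    split_ifs with h
    · rw [max_eq_left h, nabs_one]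
    · rw [max_eq_right (not_le.mp h).le]
  have hapos : ∀ i, 0 < nabs (a i) := fun i => by rw [ha]; exact lt_max_of_lt_left one_pos
  have ha0 : ∀ i, a i ≠ 0 := fun i h0 => by have := hapos i; rw [h0, nabs_zero] at this; exact this.false
  have h1 : ‖oscInt ψ J f x y‖ₑ ^ 2 ≤ ENNReal.ofReal (C' * ∏ i, (nabs (a i))⁻¹ ^ d i) := by
    refine (enorm_sq_oscInt_le hψ (fun i => (hJ i).1) hf x y).trans ?_
    calc _ ≤ ∫⁻ u : V F d, ENNReal.ofReal (C * ∏ i, K i) *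
          ENNReal.ofReal (∏ i, ∏ j, ((max 1 (nabs (a i) * nabs (u i j))) ^ 2)⁻¹) ∂(vHaar F d) := by
          refine lintegral_mono fun u => ?_
          rw [← ofReal_norm, ← ENNReal.ofReal_mul (mul_nonneg hC (Finset.prod_nonneg fun i _ => hK i))]
          refine ENNReal.ofReal_le_ofReal ((hG u _).trans ?_)
          rw [mul_assoc, ← Finset.prod_mul_distrib]
          refine mul_le_mul_of_nonneg_left (Finset.prod_le_prod (fun i _ => by positivity) fun i _ =>
            hKle i (x i) (a i) (ha i) (u i)) hC
      _ = ENNReal.ofReal (C' * ∏ i, (nabs (a i))⁻¹ ^ d i) := by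
          rw [lintegral_const_mul' _ _ ENNReal.ofReal_ne_top, lintegral_prod_max_one ha0,
            ← ENNReal.ofReal_mul (mul_nonneg hC (Finset.prod_nonneg fun i _ => hK i))]
          congr 1
          simp only [hC', mul_pow, Finset.prod_mul_distrib]
          ring
  have h2 : ‖oscInt ψ J f x y‖ ^ 2 ≤ C' * ∏ i, (nabs (a i))⁻¹ ^ d i := by
    rw [← ofReal_norm, ← ENNReal.ofReal_pow (norm_nonneg _)] at h1
    exact (ENNReal.ofReal_le_ofReal_iff (mul_nonneg hC'0 (Finset.prod_nonneg fun i _ =>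
      pow_nonneg (inv_nonneg.mpr (nabs_nonneg _)) _))).mp h1
  have h3 : (Real.sqrt C' * ∏ i, (max 1 (nabs (x i))) ^ (-((d i : ℝ) / 2))) ^ 2 =
      C' * ∏ i, (nabs (a i))⁻¹ ^ d i := by
    rw [mul_pow, Real.sq_sqrt hC'0, ← Finset.prod_pow]
    congr 1
    refine Finset.prod_congr rfl fun i _ => ?_
    rw [← ha, ← Real.rpow_natCast, ← Real.rpow_mul (hapos i).le, ← Real.rpow_natCast,
      Real.inv_rpow (hapos i).le, ← Real.rpow_neg (hapos i).le]
    congr 1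
    push_cast
    ring
  rw [← h3] at h2
  refine (pow_le_pow_iff_left₀ (norm_nonneg _) ?_ two_ne_zero).mp h2
  exact (mul_nonneg (Real.sqrt_nonneg _) (Finset.prod_nonneg fun i _ =>
    Real.rpow_nonneg (le_trans zero_le_one (le_max_left _ _)) _))

end TTStarBound

end TripleQuad
end

noncomputable section

namespace TripleQuad

section WeilBound

variable {F : Type*} [NontriviallyNormedField F] [ProperSpace F] [MeasurableSpace F] [BorelSpace F]
variable {d : Fin 3 → ℕ}

theorem nabs_big (g : Matrix.SpecialLinearGroup (Fin 2) F) (hg : g 1 0 ≠ 0) :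
    nabs (big (rowSL g)) = nabs (g 1 0) * max 1 (nabs (g 1 1 / g 1 0)) := by
  have hc := nabs_pos hg
  rw [nabs_div, mul_max_of_nonneg _ _ hc.le, mul_one, mul_div_cancel₀ _ hc.ne']
  unfold big rowSL
  dsimp only
  split_ifs with h
  · rw [max_eq_left (nabs_le_of_norm_le h)]
  · rw [max_eq_right (nabs_le_of_norm_le (not_le.mp h).le)]

theorem exists_norm_weil_le {ψ : AddChar F Circle} (hψ : Continuous ψ)
    {J : ∀ i, Matrix (Fin (d i)) (Fin (d i)) F} (hJ : ∀ i, (J i).det ≠ 0)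
    {f : V F d → ℂ} (hf : Integrable f (vHaar F d)) (m : ℕ)
    (h : ∃ C : ℝ, 0 ≤ C ∧ ∀ x y, ‖oscInt ψ J f x y‖ * ∏ i, (1 + vabs (y i) / max 1 (nabs (x i))) ^ m ≤
      C * ∏ i, (max 1 (nabs (x i))) ^ (-((d i : ℝ) / 2))) :
    ∃ C : ℝ, 0 ≤ C ∧ ∀ g : G F, (∀ i, g i 1 0 ≠ 0) → ∀ v, ‖weil ψ J g f v‖ ≤
      C * ∏ i, ((nabs (big (rowSL (g i)))) ^ (-((d i : ℝ) / 2)) *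
        ((1 + vabs (v i) / nabs (big (rowSL (g i)))) ^ m)⁻¹) := by
  obtain ⟨C, hC, h⟩ := h
  obtain ⟨c, hc⟩ := exists_weil_eq hψ J
  choose K hK hKle using fun i => exists_vabs_le_vecMul (hJ i)
  refine ⟨|c| * (∏ i, ‖weilNumber ψ (J i)‖) * C * ∏ i, (max 1 (K i)) ^ m, by positivity, fun g hg v => ?_⟩
  set x : Fin 3 → F := fun i => g i 1 1 / g i 1 0 with hx
  have hR : ∀ i, nabs (big (rowSL (g i))) = nabs (g i 1 0) * max 1 (nabs (x i)) := fun i =>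
    nabs_big (g i) (hg i)
  have hcpos : ∀ i, 0 < nabs (g i 1 0) := fun i => nabs_pos (hg i)
  have hw : ∀ i, 0 < max 1 (nabs (x i)) := fun i => lt_max_of_lt_left one_pos
  have hv := fun i => vabs_nonneg (v i)
  have hy : ∀ i, vabs (weilY J g v i) = (nabs (g i 1 0))⁻¹ * vabs (v i ᵥ* J i) := fun i => by
    rw [weilY, smul_vecMul, vabs_smul, nabs_neg, nabs_inv]
  have hvy : ∀ i, 1 + vabs (v i) / nabs (big (rowSL (g i))) ≤
      max 1 (K i) * (1 + vabs (weilY J g v i) / max 1 (nabs (x i))) := by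
    intro i
    rw [mul_add, mul_one]
    refine add_le_add (le_max_left _ _) ?_
    rw [hy, hR]
    have h2 := (hKle i (v i)).trans (mul_le_mul_of_nonneg_right (le_max_right 1 (K i)) (vabs_nonneg _))
    have := hcpos i
    have := hw i
    calc vabs (v i) / (nabs (g i 1 0) * max 1 (nabs (x i))) ≤
        (max 1 (K i) * vabs (v i ᵥ* J i)) / (nabs (g i 1 0) * max 1 (nabs (x i))) := by gcongr
      _ = _ := by field_simp
  have hpos : ∀ i, 0 < 1 + vabs (v i) / nabs (big (rowSL (g i))) := fun i => by
    have := hcpos i; have := hw i; have := hv i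
    rw [hR]; positivity
  have hpos' : ∀ i, 0 < 1 + vabs (weilY J g v i) / max 1 (nabs (x i)) := fun i => by
    have := vabs_nonneg (weilY J g v i); have := hw i
    positivity
  have hosc : ‖oscInt ψ J f x (weilY J g v)‖ ≤ C * (∏ i, (max 1 (nabs (x i))) ^ (-((d i : ℝ) / 2))) *
      ∏ i, ((max 1 (K i)) ^ m * ((1 + vabs (v i) / nabs (big (rowSL (g i)))) ^ m)⁻¹) := by
    have h1 := h x (weilY J g v)
    rw [← le_div_iff₀ (Finset.prod_pos fun i _ => pow_pos (hpos' i) m)] at h1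
    refine h1.trans ?_
    rw [div_eq_mul_inv, ← Finset.prod_inv_distrib]
    refine mul_le_mul_of_nonneg_left (Finset.prod_le_prod (fun i _ => inv_nonneg.mpr (pow_pos (hpos' i) m).le) fun i _ => ?_)
      (mul_nonneg hC (Finset.prod_nonneg fun i _ => Real.rpow_nonneg (hw i).le _))
    rw [← div_eq_mul_inv, inv_le_comm₀ (pow_pos (hpos' i) m) (div_pos (by positivity) (pow_pos (hpos i) m)),
      inv_div, div_le_iff₀ (by positivity), ← mul_pow, mul_comm]
    exact pow_le_pow_left₀ (hpos i).le (hvy i) m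
  rw [hc f hf g hg v, norm_mul, norm_mul, norm_weilFactor, Complex.norm_real, Real.norm_eq_abs]
  have hW : 0 ≤ ∏ i, ‖weilNumber ψ (J i)‖ := Finset.prod_nonneg fun i _ => norm_nonneg _
  have hP : 0 ≤ ∏ i, (nabs (g i 1 0))⁻¹ ^ ((d i : ℝ) / 2) := Finset.prod_nonneg fun i _ =>
    Real.rpow_nonneg (inv_nonneg.mpr (hcpos i).le) _
  refine (mul_le_mul_of_nonneg_left hosc (mul_nonneg (abs_nonneg c) (mul_nonneg hP hW))).trans (le_of_eq ?_)
  have hrp : ∀ i, (nabs (g i 1 0))⁻¹ ^ ((d i : ℝ) / 2) * (max 1 (nabs (x i))) ^ (-((d i : ℝ) / 2)) =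
      (nabs (big (rowSL (g i)))) ^ (-((d i : ℝ) / 2)) := by
    intro i
    rw [hR, Real.mul_rpow (hcpos i).le (hw i).le, Real.inv_rpow (hcpos i).le,
      Real.rpow_neg (hcpos i).le]
  simp only [← hrp, Finset.prod_mul_distrib]
  ring

theorem sum_dotProduct_single (y : V F d) (i : Fin 3) (j : Fin (d i)) (z : F) :
    ∑ k, y k ⬝ᵥ (Pi.single i (Pi.single j z) : V F d) k = y i j * z := by
  rw [Finset.sum_eq_single i]
  · rw [Pi.single_eq_same, dotProduct_single]
  · intro k _ hk
    rw [Pi.single_eq_of_ne hk, dotProduct_zero]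
  · simp

theorem norm_single_single_le (i : Fin 3) (j : Fin (d i)) (z : F) :
    ‖(Pi.single i (Pi.single j z) : V F d)‖ ≤ ‖z‖ := by
  rw [Pi.norm_single, Pi.norm_single]

end WeilBound

section NonArchimedean

variable {F : Type*} [NontriviallyNormedField F] [ProperSpace F] [IsUltrametricDist F]
  [MeasurableSpace F] [BorelSpace F]
variable {d : Fin 3 → ℕ}

theorem circle_eq_one_of_forall_pow {z : Circle} (h : ∀ k : ℕ, ‖((z ^ 2 ^ k : Circle) : ℂ) - 1‖ ≤ 1) :
    z = 1 := by
  by_contra hz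
  have hz' : 0 < ‖(z : ℂ) - 1‖ := by
    rw [norm_pos_iff, sub_ne_zero]
    exact fun h' => hz (Circle.ext h')
  have hgrow : ∀ k : ℕ, ‖(z : ℂ) - 1‖ * (3 / 2 : ℝ) ^ k ≤ ‖((z ^ 2 ^ k : Circle) : ℂ) - 1‖ := by
    intro k
    induction k with
    | zero => simp
    | succ k ih =>
      set w : ℂ := ((z ^ 2 ^ k : Circle) : ℂ) with hw
      have hsq : ((z ^ 2 ^ (k + 1) : Circle) : ℂ) = w ^ 2 := by
        rw [hw, pow_succ, pow_mul, ← Circle.coe_pow]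
      have h1 : ‖w - 1‖ ≤ 1 := h k
      have h2 : (3 / 2 : ℝ) ≤ ‖w + 1‖ := by
        have hn : ‖w‖ = 1 := Circle.norm_coe _
        have par := parallelogram_law_with_norm ℝ w 1
        rw [hn, norm_one] at par
        by_contra hlt
        push Not at hlt
        have : ‖w + 1‖ * ‖w + 1‖ < (3 / 2) * (3 / 2) := by
          have := norm_nonneg (w + 1); nlinarith
        have : ‖w - 1‖ * ‖w - 1‖ ≤ 1 := by have := norm_nonneg (w - 1); nlinarith
        linarith
      rw [hsq, show w ^ 2 - 1 = (w - 1) * (w + 1) by ring, norm_mul, pow_succ, ← mul_assoc]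
      exact mul_le_mul ih h2 (by norm_num) (norm_nonneg _)
  obtain ⟨k, hk⟩ := pow_unbounded_of_one_lt (‖(z : ℂ) - 1‖)⁻¹ (by norm_num : (1 : ℝ) < 3 / 2)
  have h1 := (hgrow k).trans (h k)
  rw [inv_lt_iff_one_lt_mul₀ hz'] at hk
  linarith

theorem exists_psi_trivial {ψ : AddChar F Circle} (hψ : Continuous ψ) :
    ∃ ε : ℝ, 0 < ε ∧ ∀ z : F, ‖z‖ ≤ ε → ψ z = 1 := by
  have : ∀ᶠ z in nhds (0 : F), ‖(ψ z : ℂ) - 1‖ < 1 := by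
    have h1 : Filter.Tendsto (fun z => ‖(ψ z : ℂ) - 1‖) (nhds 0) (nhds 0) := by
      refine Continuous.tendsto' ?_ _ _ (by simp)
      exact ((continuous_psi hψ).sub continuous_const).norm
    exact h1.eventually (gt_mem_nhds one_pos)
  obtain ⟨ε, hε, h⟩ := Metric.eventually_nhds_iff.mp this
  refine ⟨ε / 2, by positivity, fun z hz => circle_eq_one_of_forall_pow fun k => ?_⟩
  rw [← AddChar.map_nsmul_eq_pow]
  refine (h ?_).le
  rw [dist_zero_right, nsmul_eq_mul, norm_mul]
  have h1 : ‖((2 ^ k : ℕ) : F)‖ ≤ 1 := IsUltrametricDist.norm_natCast_le_one F _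
  calc _ ≤ 1 * ‖z‖ := mul_le_mul_of_nonneg_right h1 (norm_nonneg _)
    _ < ε := by linarith

theorem exists_translation_invariant {f : V F d → ℂ} (hf : IsLocallyConstant f)
    (hc : HasCompactSupport f) :
    ∃ ε : ℝ, 0 < ε ∧ ∀ l : V F d, ‖l‖ ≤ ε → ∀ t, f (t + l) = f t := by
  obtain ⟨R, hR⟩ := hc.isBounded.exists_norm_le
  have hR' : ∀ t, R < ‖t‖ → f t = 0 := fun t ht => by
    by_contra h0
    exact absurd (hR t (subset_tsupport f h0)) (not_le.mpr ht)
  obtain ⟨δ, hδ, h⟩ := lebesgue_number_lemma_of_metric (isCompact_closedBall (0 : V F d) (R + 1))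
    (c := fun z : ℂ => f ⁻¹' {z}) (fun z => hf.isOpen_fiber z) (fun t _ => Set.mem_iUnion.mpr ⟨f t, rfl⟩)
  refine ⟨min (δ / 2) (1 / 2), by positivity, fun l hl t => ?_⟩
  by_cases ht : ‖t‖ ≤ R + 1
  · obtain ⟨z, hz⟩ := h t (mem_closedBall_zero_iff.mpr ht)
    have h1 : f t = z := hz (Metric.mem_ball_self hδ)
    have h2 : f (t + l) = z := hz (by
      rw [Metric.mem_ball, dist_self_add_left]
      have := hl.trans (min_le_left _ _)
      linarith)
    rw [h1, h2]
  · push Not at ht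
    rw [hR' t (by linarith), hR']
    have h1 := hl.trans (min_le_right _ _)
    have h2 : ‖t‖ ≤ ‖t + l‖ + ‖l‖ := by
      calc ‖t‖ = ‖(t + l) - l‖ := by rw [add_sub_cancel_right]
        _ ≤ _ := norm_sub_le _ _
    linarith

theorem integrable_of_locallyConstant {f : V F d → ℂ} (hf : IsLocallyConstant f)
    (hc : HasCompactSupport f) : Integrable f (vHaar F d) :=
  hf.continuous.integrable_of_hasCompactSupport hc

theorem norm_le_of_psi_mul_eq_one {ψ : AddChar F Circle} {z₀ : F} (hz₀ : ψ z₀ ≠ 1) {η : ℝ}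
    (hη : 0 < η) {y : F} (h : ∀ z : F, ‖z‖ ≤ η → ψ (y * z) = 1) : ‖y‖ ≤ ‖z₀‖ / η := by
  by_contra hlt
  push Not at hlt
  have hy : 0 < ‖y‖ := lt_of_le_of_lt (by positivity) hlt
  have hy0 : y ≠ 0 := norm_pos_iff.mp hy
  apply hz₀
  have := h (z₀ / y) (by
    rw [norm_div, div_le_iff₀ hy, mul_comm]
    exact ((div_lt_iff₀ hη).mp hlt).le)
  rwa [mul_div_cancel₀ _ hy0] at this

theorem vabs_le_of_norm_le_mul {n : Type*} [Fintype n] {b x : F} {y : n → F}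
    (h : ∀ j, ‖y j‖ ≤ ‖b‖ * max 1 ‖x‖) : vabs y ≤ nabs b * max 1 (nabs x) := by
  refine vabs_le (mul_nonneg (nabs_nonneg b) (le_trans zero_le_one (le_max_left _ _))) fun j => ?_
  rcases le_total ‖x‖ 1 with hx | hx
  · have := h j
    rw [max_eq_left hx, mul_one] at this
    refine (nabs_le_of_norm_le this).trans ?_
    exact le_mul_of_one_le_right (nabs_nonneg b) (le_max_left _ _)
  · have := h j
    rw [max_eq_right hx, ← norm_mul] at this
    refine (nabs_le_of_norm_le this).trans ?_
    rw [nabs_mul]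
    exact mul_le_mul_of_nonneg_left (le_max_right _ _) (nabs_nonneg b)

variable (F) in
theorem exists_le_norm (C : ℝ) : ∃ b : F, C ≤ ‖b‖ := by
  obtain ⟨l, hl, -⟩ := exists_one_lt_nabs F
  obtain ⟨N, hN⟩ := pow_unbounded_of_one_lt C hl
  exact ⟨l ^ N, by rw [norm_pow]; exact hN.le⟩

theorem exists_oscInt_support [CharZero F] {ψ : AddChar F Circle} (hψ : Continuous ψ) (hψ1 : ψ ≠ 1)
    {J : ∀ i, Matrix (Fin (d i)) (Fin (d i)) F} (hJ : ∀ i, (J i).IsSymm)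
    {f : V F d → ℂ} (hf : IsLocallyConstant f) (hc : HasCompactSupport f) :
    ∃ C : ℝ, 0 < C ∧ ∀ x y, oscInt ψ J f x y ≠ 0 → ∀ i, vabs (y i) ≤ C * max 1 (nabs (x i)) := by
  obtain ⟨z₀, hz₀⟩ : ∃ z₀, ψ z₀ ≠ 1 := by
    by_contra h
    push Not at h
    exact hψ1 (by ext z; simp [h])
  obtain ⟨ε, hε, htriv⟩ := exists_psi_trivial hψ
  obtain ⟨ε', hε', hinv⟩ := exists_translation_invariant hf hc
  obtain ⟨R, hR0, hR⟩ := hc.isBounded.exists_pos_norm_le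
  set B : ℝ := 1 + ∑ i, ∑ j, (‖(2 : F)⁻¹ * J i j j‖ + ∑ k, ‖J i j k‖) with hB
  have hB1 : 1 ≤ B := by
    rw [hB]
    have : 0 ≤ ∑ i, ∑ j, (‖(2 : F)⁻¹ * J i j j‖ + ∑ k, ‖J i j k‖) :=
      Finset.sum_nonneg fun i _ => Finset.sum_nonneg fun j _ => by positivity
    linarith
  have hBle : ∀ i j, ‖(2 : F)⁻¹ * J i j j‖ + ∑ k, ‖J i j k‖ ≤ B := fun i j => by
    have h1 := Finset.single_le_sum (f := fun j => ‖(2 : F)⁻¹ * J i j j‖ + ∑ k, ‖J i j k‖)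
      (fun _ _ => by positivity) (Finset.mem_univ j)
    have h2 := Finset.single_le_sum (f := fun i => ∑ j, (‖(2 : F)⁻¹ * J i j j‖ + ∑ k, ‖J i j k‖))
      (fun _ _ => Finset.sum_nonneg fun j _ => by positivity) (Finset.mem_univ i)
    linarith
  set η : ℝ := min (min 1 ε') (ε / (B * (1 + R))) with hη
  have hη0 : 0 < η := by positivity
  have hη1 : η ≤ 1 := (min_le_left _ _).trans (min_le_left _ _)
  have hη2 : η ≤ ε' := (min_le_left _ _).trans (min_le_right _ _)
  have hη3 : η * (B * (1 + R)) ≤ ε := by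
    rw [← le_div_iff₀ (by positivity)]; exact min_le_right _ _
  have key : ∀ x y, oscInt ψ J f x y ≠ 0 → ∀ i j z, ‖z‖ ≤ η / max 1 ‖x i‖ → ψ (y i j * z) = 1 := by
    intro x y h0 i j z hz
    have hw : 1 ≤ max 1 ‖x i‖ := le_max_left _ _
    have hzη : ‖z‖ ≤ η := hz.trans (div_le_self hη0.le hw)
    have hxz : ‖x i‖ * ‖z‖ ≤ η := by
      rw [le_div_iff₀ (by positivity)] at hz
      refine le_trans ?_ hz
      rw [mul_comm]
      exact mul_le_mul_of_nonneg_left (le_max_right _ _) (norm_nonneg z)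
    set l : V F d := Pi.single i (Pi.single j z) with hl
    have hln : ‖l‖ ≤ ε' := (norm_single_single_le i j z).trans (hzη.trans hη2)
    have hph : ∀ t, f t ≠ 0 → ψ (phase J x y (t + l)) = ψ (phase J x y t) * ψ (y i j * z) := by
      intro t ht
      have htR : ‖t i‖ ≤ R := (norm_le_pi_norm t i).trans (hR t (subset_tsupport f ht))
      have e1 : phase J x y l = x i * (z * ((2 : F)⁻¹ * J i j j) * z) + y i j * z := by
        rw [phase, Finset.sum_add_distrib, sum_dotProduct_single]
        congr 1
        rw [Finset.sum_eq_single i]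
        · rw [hl, Pi.single_eq_same, quad, bil]
          simp
          left
          ring
        · intro k _ hk
          rw [hl, Pi.single_eq_of_ne hk]
          simp [quad, bil]
        · simp
      have e2 : ∑ k, (x k • (l k ᵥ* J k)) ⬝ᵥ t k = x i * (z * ∑ k, J i j k * t i k) := by
        rw [Finset.sum_eq_single i]
        · rw [hl, Pi.single_eq_same, smul_dotProduct, smul_eq_mul, single_vecMul, smul_dotProduct]
          rfl
        · intro k _ hk
          rw [hl, Pi.single_eq_of_ne hk]
          simp
        · simp
      rw [phase_add hJ, e1, e2]
      have hsmall : ‖x i * (z * ((2 : F)⁻¹ * J i j j) * z) + x i * (z * ∑ k, J i j k * t i k)‖ ≤ ε := by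
        have s1 : ‖∑ k, J i j k * t i k‖ ≤ (∑ k, ‖J i j k‖) * R := by
          rw [Finset.sum_mul]
          refine (norm_sum_le _ _).trans (Finset.sum_le_sum fun k _ => ?_)
          rw [norm_mul]
          exact mul_le_mul_of_nonneg_left ((norm_le_pi_norm (t i) k).trans htR) (norm_nonneg _)
        calc _ ≤ ‖x i‖ * (‖z‖ * ‖(2 : F)⁻¹ * J i j j‖ * ‖z‖) + ‖x i‖ * (‖z‖ * ((∑ k, ‖J i j k‖) * R)) := by
              refine (norm_add_le _ _).trans (add_le_add (le_of_eq ?_) ?_)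
              · simp only [norm_mul]
              · rw [norm_mul, norm_mul]
                gcongr
          _ = (‖x i‖ * ‖z‖) * (‖(2 : F)⁻¹ * J i j j‖ * ‖z‖ + (∑ k, ‖J i j k‖) * R) := by ring
          _ ≤ η * (B * (1 + R)) := by
              refine mul_le_mul hxz ?_ (by positivity) hη0.le
              have b := hBle i j
              have b1 : 0 ≤ ∑ k, ‖J i j k‖ := Finset.sum_nonneg fun _ _ => norm_nonneg _
              have b2 : 0 ≤ ‖(2 : F)⁻¹ * J i j j‖ := norm_nonneg _
              have b3 : ‖z‖ ≤ 1 := hzη.trans hη1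
              have b4 : ‖(2 : F)⁻¹ * J i j j‖ * ‖z‖ ≤ B * 1 := mul_le_mul (by linarith) b3 (norm_nonneg _) (by linarith)
              have b5 : (∑ k, ‖J i j k‖) * R ≤ B * R := mul_le_mul_of_nonneg_right (by linarith) hR0.le
              linarith
          _ ≤ ε := hη3
      rw [show phase J x y t + (x i * (z * ((2 : F)⁻¹ * J i j j) * z) + y i j * z) +
        x i * (z * ∑ k, J i j k * t i k) = phase J x y t + y i j * z +
        (x i * (z * ((2 : F)⁻¹ * J i j j) * z) + x i * (z * ∑ k, J i j k * t i k)) by ring,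
        AddChar.map_add_eq_mul, htriv _ hsmall, mul_one, AddChar.map_add_eq_mul]
    have hinvol : oscInt ψ J f x y = oscInt ψ J f x y * (ψ (y i j * z) : ℂ) := by
      conv_lhs => rw [oscInt, ← integral_add_right_eq_self _ l]
      rw [oscInt, ← integral_mul_const]
      congr 1
      funext t
      rw [hinv l hln]
      by_cases ht : f t = 0
      · rw [ht]; ring
      · rw [hph t ht, Circle.coe_mul]; ring
    have := mul_left_cancel₀ h0 ((mul_one _).trans hinvol)
    exact (Circle.ext this).symm
  obtain ⟨b, hb⟩ := exists_le_norm F (‖z₀‖ / η)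
  refine ⟨nabs b + 1, by have := nabs_nonneg b; positivity, fun x y h0 i => ?_⟩
  have hw : 0 < max 1 ‖x i‖ := lt_max_of_lt_left one_pos
  refine (vabs_le_of_norm_le_mul (b := b) (x := x i) fun j => ?_).trans ?_
  · refine (norm_le_of_psi_mul_eq_one hz₀ (div_pos hη0 hw) (key x y h0 i j)).trans ?_
    rw [div_div_eq_mul_div, mul_div_right_comm]
    exact mul_le_mul_of_nonneg_right hb hw.le
  · exact mul_le_mul_of_nonneg_right (by linarith) (le_trans zero_le_one (le_max_left _ _))

theorem exists_corr_support {ψ : AddChar F Circle} (hψ1 : ψ ≠ 1) {f : V F d → ℂ}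
    (hf : IsLocallyConstant f) (hc : HasCompactSupport f) :
    ∃ C : ℝ, 0 < C ∧ ∀ u ξ, corr ψ f f u ξ ≠ 0 → ∀ i, vabs (u i) ≤ C ∧ vabs (ξ i) ≤ C := by
  obtain ⟨z₀, hz₀⟩ : ∃ z₀, ψ z₀ ≠ 1 := by
    by_contra h
    push Not at h
    exact hψ1 (by ext z; simp [h])
  obtain ⟨η, hη, hinv⟩ := exists_translation_invariant hf hc
  obtain ⟨R, hR0, hR⟩ := hc.isBounded.exists_pos_norm_le
  obtain ⟨b, hb⟩ := exists_le_norm F (max (‖z₀‖ / η) (2 * R))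
  refine ⟨nabs b + 1, by have := nabs_nonneg b; positivity, fun u ξ h0 i => ?_⟩
  have hle : ∀ {y : Fin (d i) → F}, (∀ j, ‖y j‖ ≤ ‖b‖) → vabs y ≤ nabs b + 1 := fun h =>
    (vabs_le (nabs_nonneg b) fun j => nabs_le_of_norm_le (h j)).trans (by linarith)
  constructor
  · obtain ⟨s, hs⟩ : ∃ s, f (s + u) * starRingEnd ℂ (f s) ≠ 0 := by
      by_contra h
      push Not at h
      apply h0
      simp [corr, h]
    have h1 := hR _ (subset_tsupport f (left_ne_zero_of_mul hs))
    have h2 := hR s (subset_tsupport f fun h => right_ne_zero_of_mul hs (by rw [h, map_zero]))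
    have hu : ‖u‖ ≤ 2 * R := by
      calc ‖u‖ = ‖(s + u) - s‖ := by rw [add_sub_cancel_left]
        _ ≤ ‖s + u‖ + ‖s‖ := norm_sub_le _ _
        _ ≤ 2 * R := by linarith
    exact hle fun j => ((norm_le_pi_norm (u i) j).trans (norm_le_pi_norm u i)).trans
      (hu.trans ((le_max_right _ _).trans hb))
  · refine hle fun j => (norm_le_of_psi_mul_eq_one hz₀ hη fun z hz => ?_).trans
      ((le_max_left _ _).trans hb)
    set l : V F d := Pi.single i (Pi.single j z) with hl
    have hln : ‖l‖ ≤ η := (norm_single_single_le i j z).trans hz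
    have hinvol : corr ψ f f u ξ = corr ψ f f u ξ * (ψ (ξ i j * z) : ℂ) := by
      conv_lhs => rw [corr, ← integral_add_right_eq_self _ l]
      rw [corr, ← integral_mul_const]
      congr 1
      funext s
      rw [hinv l hln, add_right_comm, hinv l hln]
      simp only [Pi.add_apply, dotProduct_add, Finset.sum_add_distrib]
      rw [hl, sum_dotProduct_single, AddChar.map_add_eq_mul, Circle.coe_mul]
      ring
    have := mul_left_cancel₀ h0 ((mul_one _).trans hinvol)
    exact (Circle.ext this).symm

theorem exists_norm_corr_le {ψ : AddChar F Circle} (hψ1 : ψ ≠ 1) {f : V F d → ℂ}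
    (hf : IsLocallyConstant f) (hc : HasCompactSupport f) :
    ∃ C : ℝ, 0 ≤ C ∧ ∀ u ξ, ‖corr ψ f f u ξ‖ ≤ C * ∏ i, (((max 1 (vabs (u i))) ^ (2 * d i))⁻¹ *
      ((max 1 (vabs (ξ i))) ^ (2 * d i))⁻¹) := by
  obtain ⟨C, hC, h⟩ := exists_corr_support hψ1 hf hc
  obtain ⟨M, hM⟩ := hf.continuous.bounded_above_of_compact_support hc
  have hM0 : 0 ≤ M := (norm_nonneg _).trans (hM 0)
  set I := ∫ s, ‖f s‖ ∂(vHaar F d)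
  have hI : 0 ≤ I := integral_nonneg fun _ => norm_nonneg _
  set D := max 1 C
  have hD : 0 < D := lt_max_of_lt_left one_pos
  refine ⟨M * I * ∏ i, (D ^ (2 * d i) * D ^ (2 * d i)), by positivity, fun u ξ => ?_⟩
  by_cases h0 : corr ψ f f u ξ = 0
  · rw [h0, norm_zero]
    positivity
  have hb : ‖corr ψ f f u ξ‖ ≤ M * I := by
    refine (norm_integral_le_integral_norm _).trans ?_
    rw [← integral_const_mul]
    refine integral_mono_of_nonneg (Filter.Eventually.of_forall fun _ => norm_nonneg _)
      ((integrable_of_locallyConstant hf hc).norm.const_mul M) (Filter.Eventually.of_forall fun s => ?_)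
    dsimp only
    rw [norm_mul, norm_mul, norm_psi, mul_one, RCLike.norm_conj]
    exact mul_le_mul_of_nonneg_right (hM _) (norm_nonneg _)
  have h1 : (1 : ℝ) ≤ ∏ i, (D ^ (2 * d i) * D ^ (2 * d i) * (((max 1 (vabs (u i))) ^ (2 * d i))⁻¹ *
      ((max 1 (vabs (ξ i))) ^ (2 * d i))⁻¹)) := by
    rw [← Finset.prod_const_one (s := (Finset.univ : Finset (Fin 3)))]
    refine Finset.prod_le_prod (fun _ _ => zero_le_one) fun i _ => ?_
    have k : ∀ z, z ≤ C → 1 ≤ D ^ (2 * d i) * ((max 1 z) ^ (2 * d i))⁻¹ := fun z hz => by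
      have hz0 : 0 < max 1 z := lt_max_of_lt_left one_pos
      rw [← div_eq_mul_inv, one_le_div (by positivity)]
      exact pow_le_pow_left₀ hz0.le (max_le_max_left 1 hz) _
    have := one_le_mul_of_one_le_of_one_le (k _ (h u ξ h0 i).1) (k _ (h u ξ h0 i).2)
    linarith
  rw [mul_assoc, ← Finset.prod_mul_distrib]
  exact hb.trans (le_mul_of_one_le_right (by positivity) h1)

theorem exists_norm_weil_le_nonarch [CharZero F] {ψ : AddChar F Circle} (hψ : Continuous ψ)
    (hψ1 : ψ ≠ 1) {J : ∀ i, Matrix (Fin (d i)) (Fin (d i)) F} (hJ : ∀ i, (J i).IsSymm ∧ (J i).det ≠ 0)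
    {f : V F d → ℂ} (hf : IsLocallyConstant f) (hc : HasCompactSupport f) (m : ℕ) :
    ∃ C : ℝ, 0 ≤ C ∧ ∀ g : G F, (∀ i, g i 1 0 ≠ 0) → ∀ v, ‖weil ψ J g f v‖ ≤
      C * ∏ i, ((nabs (big (rowSL (g i)))) ^ (-((d i : ℝ) / 2)) *
        ((1 + vabs (v i) / nabs (big (rowSL (g i)))) ^ m)⁻¹) := by
  have hi := integrable_of_locallyConstant hf hc
  obtain ⟨C₁, hC₁, h1⟩ := exists_oscInt_support hψ hψ1 (fun i => (hJ i).1) hf hc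
  obtain ⟨C₂, hC₂, h2⟩ := exists_norm_oscInt_le hψ hJ hi (exists_norm_corr_le hψ1 hf hc)
  refine exists_norm_weil_le hψ (fun i => (hJ i).2) hi m ⟨C₂ * ∏ _i : Fin 3, (1 + C₁) ^ m,
    by positivity, fun x y => ?_⟩
  by_cases h0 : oscInt ψ J f x y = 0
  · rw [h0, norm_zero, zero_mul]
    refine mul_nonneg (by positivity) (Finset.prod_nonneg fun i _ => Real.rpow_nonneg
      (le_trans zero_le_one (le_max_left _ _)) _)
  calc _ ≤ (C₂ * ∏ i, (max 1 (nabs (x i))) ^ (-((d i : ℝ) / 2))) * ∏ _i : Fin 3, (1 + C₁) ^ m := by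
        refine mul_le_mul (h2 x y) (Finset.prod_le_prod (fun i _ => ?_) fun i _ => ?_)
          (Finset.prod_nonneg fun i _ => ?_) ((norm_nonneg _).trans (h2 x y))
        · have := vabs_nonneg (y i); positivity
        · have := vabs_nonneg (y i)
          refine pow_le_pow_left₀ (by positivity) (add_le_add_right ?_ 1) m
          rw [div_le_iff₀ (lt_max_of_lt_left one_pos)]
          exact h1 x y h0 i
        · have := vabs_nonneg (y i); positivity
    _ = _ := by ring

theorem exists_weil_support [CharZero F] {ψ : AddChar F Circle} (hψ : Continuous ψ)
    (hψ1 : ψ ≠ 1) {J : ∀ i, Matrix (Fin (d i)) (Fin (d i)) F} (hJ : ∀ i, (J i).IsSymm ∧ (J i).det ≠ 0)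
    {f : V F d → ℂ} (hf : IsLocallyConstant f) (hc : HasCompactSupport f) :
    ∃ C : ℝ, 0 < C ∧ ∀ g : G F, (∀ i, g i 1 0 ≠ 0) → ∀ v, weil ψ J g f v ≠ 0 →
      ∀ i, vabs (v i) ≤ C * nabs (big (rowSL (g i))) := by
  have hi := integrable_of_locallyConstant hf hc
  obtain ⟨C₁, hC₁, h1⟩ := exists_oscInt_support hψ hψ1 (fun i => (hJ i).1) hf hc
  obtain ⟨c, hc'⟩ := exists_weil_eq hψ J
  choose K hK hKle using fun i => exists_vabs_le_vecMul (hJ i).2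
  refine ⟨(∑ i, K i) * C₁, mul_pos (Finset.sum_pos (fun i _ => hK i) ⟨0, by simp⟩) hC₁,
    fun g hg v h0 i => ?_⟩
  rw [hc' f hi g hg] at h0
  have h2 := h1 _ _ (right_ne_zero_of_mul h0) i
  have hcp := nabs_pos (hg i)
  rw [weilY, smul_vecMul, vabs_smul, nabs_neg, nabs_inv, inv_mul_le_iff₀ hcp] at h2
  have hKi : K i ≤ ∑ i, K i := Finset.single_le_sum (fun i _ => (hK i).le) (Finset.mem_univ i)
  calc vabs (v i) ≤ K i * vabs (v i ᵥ* J i) := hKle i (v i)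
    _ ≤ (∑ i, K i) * (nabs (g i 1 0) * (C₁ * max 1 (nabs (g i 1 1 / g i 1 0)))) :=
        mul_le_mul hKi h2 (vabs_nonneg _) ((hK i).le.trans hKi)
    _ = _ := by rw [nabs_big (g i) (hg i)]; ring

end NonArchimedean

end TripleQuad
end

noncomputable section

namespace TripleQuad

section Exponential

/-- Continuous one-parameter groups in `ℂ` are exponentials. -/
theorem exists_eq_exp_of_map_add {φ : ℝ → ℂ} (hc : Continuous φ) (h0 : φ 0 = 1)
    (hadd : ∀ s t, φ (s + t) = φ s * φ t) : ∃ κ : ℂ, ∀ s : ℝ, φ s = Complex.exp (s * κ) := by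
  have hint : ∀ a b, IntervalIntegrable φ volume a b := fun a b => hc.intervalIntegrable a b
  have hder : ∀ x, HasDerivAt (fun c => ∫ s in (0 : ℝ)..c, φ s) (φ x) x := fun x =>
    intervalIntegral.integral_hasDerivAt_right (hint _ _) (hc.stronglyMeasurableAtFilter _ _) hc.continuousAt
  obtain ⟨c, hcne⟩ : ∃ c : ℝ, ∫ s in (0 : ℝ)..c, φ s ≠ 0 := by
    by_contra h
    push Not at h
    have h1 := hder 0
    simp only [h] at h1
    have := h1.unique (hasDerivAt_const (0 : ℝ) (0 : ℂ))
    rw [h0] at this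
    exact one_ne_zero this
  set I := ∫ s in (0 : ℝ)..c, φ s with hI
  have hφ : ∀ t, φ t = ((∫ s in (0 : ℝ)..(t + c), φ s) - ∫ s in (0 : ℝ)..t, φ s) / I := by
    intro t
    rw [eq_div_iff hcne, intervalIntegral.integral_interval_sub_left (hint _ _) (hint _ _), hI,
      ← intervalIntegral.integral_const_mul]
    simp only [← hadd]
    rw [intervalIntegral.integral_comp_add_left (fun s => φ s) t, add_zero]
  set κ := (φ c - 1) / I with hκ
  have hφ' : ∀ t, HasDerivAt φ (κ * φ t) t := by
    intro t
    have h1 : HasDerivAt (fun t => ∫ s in (0 : ℝ)..(t + c), φ s) (φ (t + c)) t := by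
      simpa using (hder (t + c)).comp_add_const t c
    have h2 := (h1.sub (hder t)).div_const I
    have hd : (φ (t + c) - φ t) / I = κ * φ t := by rw [hadd, hκ]; ring
    rw [← hd]
    exact h2.congr_of_eventuallyEq (Filter.Eventually.of_forall hφ)
  refine ⟨κ, fun s => ?_⟩
  have hconst : ∀ x y : ℝ, φ x * Complex.exp (-(x * κ)) = φ y * Complex.exp (-(y * κ)) := by
    refine is_const_of_deriv_eq_zero (f := fun x : ℝ => φ x * Complex.exp (-(x * κ))) ?_ ?_
    · intro x
      refine (hφ' x).differentiableAt.mul ?_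
      fun_prop
    · intro x
      have h3 : HasDerivAt (fun x : ℝ => Complex.exp (-(x * κ))) (Complex.exp (-(x * κ)) * (-(1 * κ))) x :=
        ((Complex.ofRealCLM.hasDerivAt (x := x)).mul_const κ).neg.cexp
      exact (((hφ' x).mul h3).congr_deriv (by ring)).deriv
  have := hconst s 0
  simp only [h0, Complex.ofReal_zero, zero_mul, neg_zero, Complex.exp_zero, mul_one] at this
  rw [Complex.exp_neg, mul_inv_eq_one₀ (Complex.exp_ne_zero _)] at this
  exact this

variable {F : Type*} [RCLike F]

theorem exists_psi_eq_exp {ψ : AddChar F Circle} (hψ : Continuous ψ) :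
    ∃ L : F →L[ℝ] ℂ, ∀ z, (ψ z : ℂ) = Complex.exp (L z) := by
  have h : ∀ w : F, ∃ κ : ℂ, ∀ s : ℝ, (ψ ((s : F) * w) : ℂ) = Complex.exp (s * κ) := by
    intro w
    refine exists_eq_exp_of_map_add (φ := fun s : ℝ => (ψ ((s : F) * w) : ℂ)) ?_ ?_ ?_
    · exact continuous_subtype_val.comp (hψ.comp (by fun_prop))
    · simp
    · intro s t
      simp only [RCLike.ofReal_add, add_mul, AddChar.map_add_eq_mul, Circle.coe_mul]
  obtain ⟨κ₁, h1⟩ := h 1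
  obtain ⟨κ₂, h2⟩ := h RCLike.I
  refine ⟨RCLike.reCLM.smulRight κ₁ + RCLike.imCLM.smulRight κ₂, fun z => ?_⟩
  have hz : z = (RCLike.re z : F) * 1 + (RCLike.im z : F) * RCLike.I := by
    rw [mul_one, RCLike.re_add_im]
  conv_lhs => rw [hz]
  rw [AddChar.map_add_eq_mul, Circle.coe_mul, h1, h2, ← Complex.exp_add]
  simp

/-- A nonzero real-linear form and its product with `I` detect the size of a number. -/
theorem exists_norm_le_of_ne_zero {L : F →L[ℝ] ℂ} (hL : L ≠ 0) :
    ∃ C : ℝ, 0 ≤ C ∧ ∀ y : F, ‖y‖ ≤ C * (‖L y‖ + ‖L (RCLike.I * y)‖) := by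
  obtain ⟨a, ha⟩ : ∃ a, L a ≠ 0 := by
    by_contra h
    push Not at h
    exact hL (by ext z; simp [h])
  have hLa : 0 < ‖L a‖ := norm_pos_iff.mpr ha
  refine ⟨‖a‖ / ‖L a‖, by positivity, fun y => ?_⟩
  by_cases hy : y = 0
  · simp [hy]
  have hyn : 0 < ‖y‖ := norm_pos_iff.mpr hy
  have e : a = (RCLike.re (a / y)) • y + (RCLike.im (a / y)) • (RCLike.I * y) := by
    rw [RCLike.real_smul_eq_coe_mul, RCLike.real_smul_eq_coe_mul, ← mul_assoc, ← add_mul, RCLike.re_add_im,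
      div_mul_cancel₀ _ hy]
  have h1 : ‖L a‖ ≤ ‖a‖ / ‖y‖ * (‖L y‖ + ‖L (RCLike.I * y)‖) := by
    conv_lhs => rw [e]
    rw [map_add, map_smul, map_smul, mul_add]
    refine (norm_add_le _ _).trans (add_le_add ?_ ?_) <;> rw [norm_smul, ← norm_div]
    · exact mul_le_mul_of_nonneg_right (RCLike.norm_re_le_norm _) (norm_nonneg _)
    · exact mul_le_mul_of_nonneg_right (RCLike.norm_im_le_norm _) (norm_nonneg _)
  rw [div_mul_eq_mul_div, le_div_iff₀ hLa]
  rw [div_mul_eq_mul_div, le_div_iff₀ hyn] at h1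
  linarith

open scoped Pointwise in
theorem nabs_eq_norm_pow (z : F) : nabs z = ‖z‖ ^ Module.finrank ℝ F := by
  have hr : ∀ r : ℝ, 0 ≤ r → nabs (r : F) = r ^ Module.finrank ℝ F := by
    intro r hr
    rcases hr.eq_or_lt with rfl | hr
    · rw [RCLike.ofReal_zero, nabs_zero, zero_pow Module.finrank_pos.ne']
    have hne : (r : F) ≠ 0 := by exact_mod_cast hr.ne'
    have h1 := measure_smul_set (Measure.addHaar : Measure F) hne (Metric.ball 0 1)
    have h2 := Measure.addHaar_smul (Measure.addHaar : Measure F) r (Metric.ball 0 1)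
    have h3 : r • Metric.ball (0 : F) 1 = (r : F) • Metric.ball (0 : F) 1 := by
      ext x
      simp only [Set.mem_smul_set, RCLike.real_smul_eq_coe_mul, smul_eq_mul]
    rw [h3, h1, abs_of_pos (pow_pos hr _)] at h2
    have h4 := (ENNReal.mul_left_inj (Metric.measure_ball_pos _ _ one_pos).ne'
      Metric.isBounded_ball.measure_lt_top.ne).mp h2
    rwa [ENNReal.ofReal_eq_ofReal_iff (nabs_nonneg _) (pow_pos hr _).le] at h4
  rw [← hr _ (norm_nonneg z)]
  exact le_antisymm (nabs_le_of_norm_le (by simp)) (nabs_le_of_norm_le (by simp))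

end Exponential

section AbstractDecay

variable {T P : Type*}

/-- `A` is bounded by `W` even after multiplication with the weight `E`. -/
def WeightBound (A : T → P → ℝ) (W E : P → ℝ) : Prop :=
  ∀ τ, ∃ C : ℝ, 0 ≤ C ∧ ∀ p, A τ p * E p ≤ C * W p

theorem WeightBound.mul_pow {A : T → P → ℝ} {W : P → ℝ} {R : P → ℝ}
    (hstep : ∀ E : P → ℝ, (∀ p, 0 ≤ E p) → WeightBound A W E → WeightBound A W fun p => E p * R p)
    (hR : ∀ p, 0 ≤ R p) {E : P → ℝ} (hE : ∀ p, 0 ≤ E p) (h : WeightBound A W E) (m : ℕ) :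
    WeightBound A W fun p => E p * R p ^ m := by
  induction m with
  | zero => simpa using h
  | succ m ih =>
    have := hstep _ (fun p => mul_nonneg (hE p) (pow_nonneg (hR p) m)) ih
    simpa only [pow_succ, mul_assoc] using this

theorem WeightBound.prod {A : T → P → ℝ} {W : P → ℝ} {R : Fin 3 → P → ℝ}
    (hstep : ∀ i, ∀ E : P → ℝ, (∀ p, 0 ≤ E p) → WeightBound A W E →
      WeightBound A W fun p => E p * R i p)
    (hR : ∀ i p, 0 ≤ R i p) (h : WeightBound A W fun _ => 1) (m : Fin 3 → ℕ) :
    WeightBound A W fun p => ∏ i, R i p ^ m i := by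
  have h0 := WeightBound.mul_pow (hstep 0) (hR 0) (fun _ => zero_le_one) h (m 0)
  have h1 := WeightBound.mul_pow (hstep 1) (hR 1) (fun p => mul_nonneg zero_le_one (pow_nonneg (hR 0 p) _)) h0 (m 1)
  have h2 := WeightBound.mul_pow (hstep 2) (hR 2) (fun p => mul_nonneg (mul_nonneg zero_le_one
    (pow_nonneg (hR 0 p) _)) (pow_nonneg (hR 1 p) _)) h1 (m 2)
  simpa only [one_mul, Fin.prod_univ_three] using h2

/-- A weight that is a sum of weights can be treated termwise. -/
theorem WeightBound.of_sum {A : T → P → ℝ} {W E R : P → ℝ} (hA : ∀ τ p, 0 ≤ A τ p)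
    (hE : ∀ p, 0 ≤ E p) (h : WeightBound A W E) {κ : Type*} [Fintype κ]
    {S : κ → P → ℝ} {K : ℝ} (hK : 0 ≤ K) (hR : ∀ p, R p ≤ 1 + K * ∑ k, S k p)
    (hS : ∀ k τ, ∃ C : ℝ, 0 ≤ C ∧ ∀ p, S k p * A τ p * E p ≤ C * W p) :
    WeightBound A W fun p => E p * R p := by
  intro τ
  obtain ⟨C, hC, h⟩ := h τ
  choose C' hC' h' using fun k => hS k τ
  refine ⟨C + K * ∑ k, C' k, add_nonneg hC (mul_nonneg hK (Finset.sum_nonneg fun k _ => hC' k)), fun p => ?_⟩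
  calc A τ p * (E p * R p) ≤ A τ p * (E p * (1 + K * ∑ k, S k p)) :=
        mul_le_mul_of_nonneg_left (mul_le_mul_of_nonneg_left (hR p) (hE p)) (hA τ p)
    _ = A τ p * E p + K * ∑ k, S k p * A τ p * E p := by
        simp only [← Finset.sum_mul]
        ring
    _ ≤ C * W p + K * ∑ k, C' k * W p :=
        add_le_add (h p) (mul_le_mul_of_nonneg_left (Finset.sum_le_sum fun k _ => h' k p) hK)
    _ = _ := by rw [← Finset.sum_mul]; ring

end AbstractDecay

end TripleQuad
end

noncomputable section

namespace TripleQuad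

section ArchWeil

open scoped SchwartzMap LineDeriv

variable {F : Type*} [RCLike F] {d : Fin 3 → ℕ}

theorem vabs_le_norm_pow {n : Type*} [Fintype n] (x : n → F) :
    vabs x ≤ ‖x‖ ^ Module.finrank ℝ F := by
  refine vabs_le (by positivity) fun j => ?_
  rw [nabs_eq_norm_pow]
  exact pow_le_pow_left₀ (norm_nonneg _) (norm_le_pi_norm x j) _

theorem integral_lineDeriv_mul_psi {ψ : AddChar F Circle} (hψ : Continuous ψ) {L : F →L[ℝ] ℂ}
    (hL : ∀ z, (ψ z : ℂ) = Complex.exp (L z)) {f f' : V F d → ℂ} {p D : V F d → F} (hp : Continuous p)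
    {h : V F d} {q : F} (hexp : ∀ (s : ℝ) t, p (t + s • h) = p t + s • D t + s ^ 2 • q)
    (hf : Integrable f (vHaar F d)) (hf' : Integrable f' (vHaar F d))
    (hfD : Integrable (fun t => f t * L (D t)) (vHaar F d))
    (hder : ∀ t, HasLineDerivAt ℝ f (f' t) t h) :
    ∫ t, f t * L (D t) * (ψ (p t) : ℂ) ∂(vHaar F d) =
      - ∫ t, f' t * (ψ (p t) : ℂ) ∂(vHaar F d) := by
  have hψder : ∀ t, HasLineDerivAt ℝ (fun t => (ψ (p t) : ℂ)) (L (D t) * (ψ (p t) : ℂ)) t h := by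
    intro t
    have e : (fun s : ℝ => (ψ (p (t + s • h)) : ℂ)) =
        fun s : ℝ => (ψ (p t) : ℂ) * Complex.exp ((s : ℂ) * L (D t) + (s : ℂ) ^ 2 * L q) := by
      funext s
      rw [hexp, AddChar.map_add_eq_mul, AddChar.map_add_eq_mul, Circle.coe_mul, Circle.coe_mul,
        mul_assoc, hL (s • D t), hL (s ^ 2 • q), ← Complex.exp_add, map_smul, map_smul,
        Complex.real_smul, Complex.real_smul, Complex.ofReal_pow]
    have h1 : HasDerivAt (fun s : ℝ => (s : ℂ) * L (D t) + (s : ℂ) ^ 2 * L q) (L (D t)) 0 := by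
      have h2 : HasDerivAt (fun s : ℝ => (s : ℂ)) 1 0 := Complex.ofRealCLM.hasDerivAt
      have h3 := (h2.mul_const (L (D t))).add ((h2.pow 2).mul_const (L q))
      refine h3.congr_deriv ?_
      simp
    rw [HasLineDerivAt, e]
    refine (h1.cexp.const_mul (ψ (p t) : ℂ)).congr_deriv ?_
    simp
    ring
  have hB := integral_bilinear_hasLineDerivAt_right_eq_neg_left_of_integrable (μ := vHaar F d)
    (B := ContinuousLinearMap.mul ℝ ℂ) (f := f) (f' := f') (g := fun t => (ψ (p t) : ℂ))
    (g' := fun t => L (D t) * (ψ (p t) : ℂ)) (v := h)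
    (integrable_mul_psi hψ hf' hp)
    (by
      have := integrable_mul_psi hψ hfD hp
      simpa only [ContinuousLinearMap.mul_apply', mul_assoc] using this)
    (integrable_mul_psi hψ hf hp) (fun t _ => hder t) (fun t _ => hψder t)
  simpa only [ContinuousLinearMap.mul_apply', mul_assoc] using hB

/-- A real-linear form on `V` which is a multiple of a coordinate of `J v`. -/
def coordForm (L : F →L[ℝ] ℂ) (J : ∀ i, Matrix (Fin (d i)) (Fin (d i)) F) (i : Fin 3) (j : Fin (d i))
    (β : F) : V F d →L[ℝ] ℂ :=
  L ∘L (ContinuousLinearMap.mul ℝ F β) ∘L (∑ k, (ContinuousLinearMap.mul ℝ F (J i j k)) ∘L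
    (ContinuousLinearMap.proj (R := ℝ) (φ := fun _ : Fin (d i) => F) k) ∘L
    (ContinuousLinearMap.proj (R := ℝ) (φ := fun i : Fin 3 => (Fin (d i) → F)) i))

theorem coordForm_apply (L : F →L[ℝ] ℂ) (J : ∀ i, Matrix (Fin (d i)) (Fin (d i)) F) (i : Fin 3)
    (j : Fin (d i)) (β : F) (t : V F d) :
    coordForm L J i j β t = L (β * ∑ k, J i j k * t i k) := by
  simp [coordForm, _root_.sum_apply]
  rw [Finset.mul_sum, map_sum]

theorem smul_single_single (s : ℝ) (i : Fin 3) (j : Fin (d i)) (α : F) :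
    s • (Pi.single i (Pi.single j α) : V F d) = Pi.single i (Pi.single j ((s : F) * α)) := by
  rw [← Pi.single_smul, ← Pi.single_smul, RCLike.real_smul_eq_coe_mul]

theorem phase_single (J : ∀ i, Matrix (Fin (d i)) (Fin (d i)) F) (x : Fin 3 → F)
    (y : V F d) (i : Fin 3) (j : Fin (d i)) (z : F) :
    phase J x y (Pi.single i (Pi.single j z)) = x i * (z * ((2 : F)⁻¹ * J i j j) * z) + y i j * z := by
  rw [phase, Finset.sum_add_distrib, sum_dotProduct_single]
  congr 1
  rw [Finset.sum_eq_single i]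
  · rw [Pi.single_eq_same, quad, bil]
    simp
    left
    ring
  · intro k _ hk
    rw [Pi.single_eq_of_ne hk]
    simp [quad, bil]
  · simp

theorem sum_single_vecMul (J : ∀ i, Matrix (Fin (d i)) (Fin (d i)) F) (x : Fin 3 → F)
    (t : V F d) (i : Fin 3) (j : Fin (d i)) (z : F) :
    ∑ k, (x k • ((Pi.single i (Pi.single j z) : V F d) k ᵥ* J k)) ⬝ᵥ t k =
      x i * (z * ∑ k, J i j k * t i k) := by
  rw [Finset.sum_eq_single i]
  · rw [Pi.single_eq_same, smul_dotProduct, smul_eq_mul, single_vecMul, smul_dotProduct]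
    rfl
  · intro k _ hk
    rw [Pi.single_eq_of_ne hk]
    simp
  · simp

/-- The derivative of a Schwartz function in the direction `h`. -/
def schwartzDeriv (h : V F d) (f : 𝓢(V F d, ℂ)) : 𝓢(V F d, ℂ) := ∂_{h} f

theorem hasLineDerivAt_schwartz (h : V F d) (f : 𝓢(V F d, ℂ)) (t : V F d) :
    HasLineDerivAt ℝ f (schwartzDeriv h f t) t h :=
  (f.hasFDerivAt t).hasLineDerivAt h

theorem integral_linear_three {X : Type*} [MeasurableSpace X] {μ : Measure X} {f g h : X → ℂ}
    (hf : Integrable f μ) (hg : Integrable g μ) (hh : Integrable h μ) (a b c : ℂ) :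
    ∫ t, (a * f t + b * g t + c * h t) ∂μ = a * ∫ t, f t ∂μ + b * ∫ t, g t ∂μ + c * ∫ t, h t ∂μ := by
  have hab : Integrable (fun t => a * f t + b * g t) μ := (hf.const_mul a).add (hg.const_mul b)
  rw [integral_add hab (hh.const_mul c), integral_add (hf.const_mul a) (hg.const_mul b),
    integral_const_mul, integral_const_mul, integral_const_mul]

theorem norm_oscInt_ibp {ψ : AddChar F Circle} (hψ : Continuous ψ) {L : F →L[ℝ] ℂ}
    (hL : ∀ z, (ψ z : ℂ) = Complex.exp (L z)) {J : ∀ i, Matrix (Fin (d i)) (Fin (d i)) F}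
    (hJ : ∀ i, (J i).IsSymm) (f : 𝓢(V F d, ℂ)) (x : Fin 3 → F) (y : V F d) (i : Fin 3)
    (j : Fin (d i)) (α : F) :
    ‖L (α * y i j)‖ * ‖oscInt ψ J f x y‖ ≤
      ‖oscInt ψ J (schwartzDeriv (Pi.single i (Pi.single j α)) f) x y‖ + ‖x i‖ *
        (‖oscInt ψ J (SchwartzMap.smulLeftCLM ℂ (coordForm L J i j α) f) x y‖ +
        ‖oscInt ψ J (SchwartzMap.smulLeftCLM ℂ (coordForm L J i j (RCLike.I * α)) f) x y‖) := by
  set h : V F d := Pi.single i (Pi.single j α) with hh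
  have hg : ∀ β, (fun t => coordForm L J i j β t).HasTemperateGrowth := fun β =>
    ContinuousLinearMap.hasTemperateGrowth _
  have hm : ∀ β t, SchwartzMap.smulLeftCLM ℂ (coordForm L J i j β) f t =
      f t * L (β * ∑ k, J i j k * t i k) := fun β t => by
    rw [SchwartzMap.smulLeftCLM_apply_apply (hg β), smul_eq_mul, coordForm_apply, mul_comm]
  have hLx : ∀ τ : F, L (x i * (α * τ)) = (RCLike.re (x i) : ℂ) * L (α * τ) +
      (RCLike.im (x i) : ℂ) * L (RCLike.I * α * τ) := by
    intro τ
    have : x i * (α * τ) = RCLike.re (x i) • (α * τ) + RCLike.im (x i) • (RCLike.I * α * τ) := by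
      conv_lhs => rw [← RCLike.re_add_im (x i)]
      rw [RCLike.real_smul_eq_coe_mul, RCLike.real_smul_eq_coe_mul]
      ring
    rw [this, map_add, map_smul, map_smul, Complex.real_smul, Complex.real_smul]
  have hfD : ∀ t, f t * L (x i * (α * ∑ k, J i j k * t i k) + α * y i j) =
      (RCLike.re (x i) : ℂ) * SchwartzMap.smulLeftCLM ℂ (coordForm L J i j α) f t +
      (RCLike.im (x i) : ℂ) * SchwartzMap.smulLeftCLM ℂ (coordForm L J i j (RCLike.I * α)) f t +
      L (α * y i j) * f t := by
    intro t
    rw [map_add, hLx, hm, hm]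
    ring
  have hi1 := (SchwartzMap.smulLeftCLM ℂ (coordForm L J i j α) f).integrable (μ := vHaar F d)
  have hi2 := (SchwartzMap.smulLeftCLM ℂ (coordForm L J i j (RCLike.I * α)) f).integrable (μ := vHaar F d)
  have hi3 : Integrable (fun t => schwartzDeriv h f t) (vHaar F d) :=
    (schwartzDeriv h f).integrable (μ := vHaar F d)
  have hcp := continuous_phase_right J x y
  have key := integral_lineDeriv_mul_psi hψ hL (f := f) (f' := schwartzDeriv h f) (p := phase J x y)
    (D := fun t => x i * (α * ∑ k, J i j k * t i k) + α * y i j) (h := h)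
    (q := x i * (α * ((2 : F)⁻¹ * J i j j) * α)) hcp
    (by
      intro s t
      rw [hh, smul_single_single, phase_add hJ, phase_single, sum_single_vecMul,
        RCLike.real_smul_eq_coe_mul, RCLike.real_smul_eq_coe_mul]
      push_cast
      ring)
    f.integrable hi3
    (by
      simp only [hfD]
      exact ((hi1.const_mul _).add (hi2.const_mul _)).add (f.integrable.const_mul _))
    (hasLineDerivAt_schwartz h f)
  have key2 : (RCLike.re (x i) : ℂ) * oscInt ψ J (SchwartzMap.smulLeftCLM ℂ (coordForm L J i j α) f) x y +
      (RCLike.im (x i) : ℂ) * oscInt ψ J (SchwartzMap.smulLeftCLM ℂ (coordForm L J i j (RCLike.I * α)) f) x y +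
      L (α * y i j) * oscInt ψ J f x y = - oscInt ψ J (schwartzDeriv h f) x y := by
    refine Eq.trans ?_ key
    simp only [hfD, add_mul, mul_assoc]
    exact (integral_linear_three (integrable_mul_psi hψ hi1 hcp) (integrable_mul_psi hψ hi2 hcp)
      (integrable_mul_psi hψ (f.integrable (μ := vHaar F d)) hcp) _ _ _).symm
  have e : L (α * y i j) * oscInt ψ J f x y = - oscInt ψ J (schwartzDeriv h f) x y -
      ((RCLike.re (x i) : ℂ) * oscInt ψ J (SchwartzMap.smulLeftCLM ℂ (coordForm L J i j α) f) x y +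
      (RCLike.im (x i) : ℂ) * oscInt ψ J (SchwartzMap.smulLeftCLM ℂ (coordForm L J i j (RCLike.I * α)) f) x y) := by
    rw [← key2]; ring
  rw [← norm_mul, e]
  refine (norm_sub_le _ _).trans (add_le_add (norm_neg _).le ((norm_add_le _ _).trans ?_))
  rw [mul_add, norm_mul, norm_mul, Complex.norm_real, Complex.norm_real]
  exact add_le_add (mul_le_mul_of_nonneg_right (RCLike.norm_re_le_norm _) (norm_nonneg _))
    (mul_le_mul_of_nonneg_right (RCLike.norm_im_le_norm _) (norm_nonneg _))

theorem sum_norm_form_le {L : F →L[ℝ] ℂ} {C : ℝ} (hC : 0 ≤ C)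
    (h : ∀ y : F, ‖y‖ ≤ C * (‖L y‖ + ‖L (RCLike.I * y)‖)) {n : Type*} [Fintype n] (y : n → F) :
    ‖y‖ ≤ C * ∑ k : n × Bool, ‖L ((if k.2 then RCLike.I else 1) * y k.1)‖ := by
  rw [pi_norm_le_iff_of_nonneg (mul_nonneg hC (Finset.sum_nonneg fun _ _ => norm_nonneg _))]
  intro j
  refine (h (y j)).trans (mul_le_mul_of_nonneg_left ?_ hC)
  rw [Fintype.sum_prod_type]
  refine le_trans (le_of_eq ?_) (Finset.single_le_sum (f := fun j => ∑ b : Bool,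
    ‖L ((if b then RCLike.I else 1) * y j)‖) (fun _ _ => Finset.sum_nonneg fun _ _ => norm_nonneg _)
    (Finset.mem_univ j))
  simp [add_comm]

theorem psi_form_ne_zero {ψ : AddChar F Circle} (hψ1 : ψ ≠ 1) {L : F →L[ℝ] ℂ}
    (hL : ∀ z, (ψ z : ℂ) = Complex.exp (L z)) : L ≠ 0 := by
  rintro rfl
  apply hψ1
  ext z
  have := hL z
  simp at this
  simp [this]

theorem weight_step {l w x T A₁ A₂ A₃ E W C₁ C₂ C₃ : ℝ} (h : l * T ≤ A₁ + x * (A₂ + A₃))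
    (hw : 1 ≤ w) (hx : x ≤ w) (hA₁ : 0 ≤ A₁) (hA₂ : 0 ≤ A₂) (hA₃ : 0 ≤ A₃) (hE : 0 ≤ E)
    (h1 : A₁ * E ≤ C₁ * W) (h2 : A₂ * E ≤ C₂ * W) (h3 : A₃ * E ≤ C₃ * W) :
    l / w * T * E ≤ (C₁ + (C₂ + C₃)) * W := by
  have hb : l / w * T ≤ A₁ + (A₂ + A₃) := by
    rw [div_mul_eq_mul_div, div_le_iff₀ (by positivity)]
    calc _ ≤ A₁ + x * (A₂ + A₃) := h
      _ ≤ A₁ * w + w * (A₂ + A₃) := by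
        gcongr
        exact le_mul_of_one_le_right hA₁ hw
      _ = _ := by ring
  calc l / w * T * E ≤ (A₁ + (A₂ + A₃)) * E := mul_le_mul_of_nonneg_right hb hE
    _ = A₁ * E + (A₂ * E + A₃ * E) := by ring
    _ ≤ C₁ * W + (C₂ * W + C₃ * W) := add_le_add h1 (add_le_add h2 h3)
    _ = _ := by ring

/-- Integrations by parts improve a bound for oscillatory integrals. -/
theorem weightBound_oscInt {ψ : AddChar F Circle} (hψ : Continuous ψ) (hψ1 : ψ ≠ 1)
    {J : ∀ i, Matrix (Fin (d i)) (Fin (d i)) F} (hJ : ∀ i, (J i).IsSymm)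
    {W : (Fin 3 → F) × V F d → ℝ}
    (h : WeightBound (fun (f : 𝓢(V F d, ℂ)) p => ‖oscInt ψ J f p.1 p.2‖) W fun _ => 1)
    (m : Fin 3 → ℕ) :
    WeightBound (fun (f : 𝓢(V F d, ℂ)) p => ‖oscInt ψ J f p.1 p.2‖) W
      fun p => ∏ i, (1 + ‖p.2 i‖ / max 1 ‖p.1 i‖) ^ m i := by
  obtain ⟨L, hL⟩ := exists_psi_eq_exp hψ
  obtain ⟨C, hC, hCle⟩ := exists_norm_le_of_ne_zero (psi_form_ne_zero hψ1 hL)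
  refine WeightBound.prod (R := fun i p => 1 + ‖p.2 i‖ / max 1 ‖p.1 i‖) ?_
    (fun i p => by positivity) h m
  intro i E hE hb
  refine hb.of_sum (fun f p => norm_nonneg _) hE (κ := Fin (d i) × Bool)
    (S := fun k p => ‖L ((if k.2 then RCLike.I else 1) * p.2 i k.1)‖ / max 1 ‖p.1 i‖) hC ?_ ?_
  · intro p
    rw [← Finset.sum_div, ← mul_div_assoc]
    gcongr
    exact sum_norm_form_le hC hCle (p.2 i)
  · intro k f
    set α : F := if k.2 then RCLike.I else 1
    obtain ⟨C₁, hC₁, h1⟩ := hb (schwartzDeriv (Pi.single i (Pi.single k.1 α)) f)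
    obtain ⟨C₂, hC₂, h2⟩ := hb (SchwartzMap.smulLeftCLM ℂ (coordForm L J i k.1 α) f)
    obtain ⟨C₃, hC₃, h3⟩ := hb (SchwartzMap.smulLeftCLM ℂ (coordForm L J i k.1 (RCLike.I * α)) f)
    refine ⟨C₁ + (C₂ + C₃), by positivity, fun p => ?_⟩
    exact weight_step (norm_oscInt_ibp hψ hL hJ f p.1 p.2 i k.1 α) (le_max_left _ _)
      (le_max_right _ _) (norm_nonneg _) (norm_nonneg _) (norm_nonneg _) (hE p) (h1 p) (h2 p) (h3 p)

end ArchWeil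

end TripleQuad
end

noncomputable section

namespace TripleQuad

section ArchCorr

open scoped SchwartzMap LineDeriv

variable {F : Type*} [RCLike F] {d : Fin 3 → ℕ}

theorem exists_schwartz_pow_le (f : 𝓢(V F d, ℂ)) (N : ℕ) :
    ∃ C : ℝ, 0 ≤ C ∧ ∀ t, (1 + ‖t‖) ^ N * ‖f t‖ ≤ C := by
  refine ⟨2 ^ N * (Finset.Iic (N, 0)).sup (fun m => SchwartzMap.seminorm ℝ m.1 m.2) f,
    mul_nonneg (by positivity) (apply_nonneg _ _), fun t => ?_⟩
  have := SchwartzMap.one_add_le_sup_seminorm_apply (𝕜 := ℝ) (m := (N, 0)) (k := N) (n := 0) le_rfl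
    le_rfl f t
  simpa using this

theorem integrable_schwartz_pow (f : 𝓢(V F d, ℂ)) (N : ℕ) :
    Integrable (fun t => (1 + ‖t‖) ^ N * ‖f t‖) (vHaar F d) := by
  have h1 := ((f.integrable_pow_mul (vHaar F d) N).add
    (f.integrable (μ := vHaar F d)).norm).const_mul (2 ^ (N - 1))
  refine h1.mono' ?_ (Filter.Eventually.of_forall fun t => ?_)
  · have : Continuous fun t : V F d => (1 + ‖t‖) ^ N * ‖f t‖ := by
      have := f.continuous
      fun_prop
    exact this.aestronglyMeasurable
  · rw [Real.norm_of_nonneg (by positivity)]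
    calc (1 + ‖t‖) ^ N * ‖f t‖ ≤ 2 ^ (N - 1) * (1 ^ N + ‖t‖ ^ N) * ‖f t‖ := by
          gcongr
          exact add_pow_le zero_le_one (norm_nonneg _) N
      _ = _ := by simp; ring

theorem integrable_shift_mul_conj (f g : 𝓢(V F d, ℂ)) (u : V F d) :
    Integrable (fun s => f (s + u) * starRingEnd ℂ (g s)) (vHaar F d) := by
  obtain ⟨C, hC, hf⟩ := exists_schwartz_pow_le f 0
  have hg : Integrable (fun s => starRingEnd ℂ (g s)) (vHaar F d) :=
    g.integrable.mono (RCLike.continuous_conj.comp g.continuous).aestronglyMeasurable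
      (Filter.Eventually.of_forall fun s => (RCLike.norm_conj _).le)
  refine hg.bdd_mul (c := C) ?_ (Filter.Eventually.of_forall fun s => ?_)
  · exact (f.continuous.comp (continuous_id.add continuous_const)).aestronglyMeasurable
  · simpa using hf (s + u)

theorem exists_norm_corr_shift_le {ψ : AddChar F Circle} (f g : 𝓢(V F d, ℂ)) (N : ℕ) :
    ∃ C : ℝ, 0 ≤ C ∧ ∀ u ξ, ‖corr ψ f g u ξ‖ * (1 + ‖u‖) ^ N ≤ C := by
  obtain ⟨C, hC, hf⟩ := exists_schwartz_pow_le f N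
  refine ⟨C * ∫ s, (1 + ‖s‖) ^ N * ‖g s‖ ∂(vHaar F d),
    mul_nonneg hC (integral_nonneg fun s => by positivity), fun u ξ => ?_⟩
  have h1 : ‖corr ψ f g u ξ‖ ≤ ∫ s, ‖f (s + u) * starRingEnd ℂ (g s)‖ ∂(vHaar F d) := by
    refine (norm_integral_le_integral_norm _).trans (le_of_eq ?_)
    congr 1
    funext s
    rw [norm_mul _ (ψ _ : ℂ), norm_psi, mul_one]
  refine (mul_le_mul_of_nonneg_right h1 (by positivity)).trans ?_
  rw [← integral_mul_const, ← integral_const_mul]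
  refine integral_mono ((integrable_shift_mul_conj f g u).norm.mul_const _)
    ((integrable_schwartz_pow g N).const_mul _) fun s => ?_
  have h2 : 1 + ‖u‖ ≤ (1 + ‖s + u‖) * (1 + ‖s‖) := by
    have : ‖u‖ ≤ ‖s + u‖ + ‖s‖ := by
      calc ‖u‖ = ‖(s + u) - s‖ := by rw [add_sub_cancel_left]
        _ ≤ _ := norm_sub_le _ _
    nlinarith [norm_nonneg s, norm_nonneg (s + u), mul_nonneg (norm_nonneg s) (norm_nonneg (s + u))]
  simp only [norm_mul, RCLike.norm_conj]
  calc ‖f (s + u)‖ * ‖g s‖ * (1 + ‖u‖) ^ N ≤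
      ‖f (s + u)‖ * ‖g s‖ * ((1 + ‖s + u‖) * (1 + ‖s‖)) ^ N := by gcongr
    _ = ((1 + ‖s + u‖) ^ N * ‖f (s + u)‖) * ((1 + ‖s‖) ^ N * ‖g s‖) := by rw [mul_pow]; ring
    _ ≤ _ := mul_le_mul_of_nonneg_right (hf _) (by positivity)

theorem norm_corr_ibp {ψ : AddChar F Circle} (hψ : Continuous ψ) {L : F →L[ℝ] ℂ}
    (hL : ∀ z, (ψ z : ℂ) = Complex.exp (L z)) (f g : 𝓢(V F d, ℂ)) (u ξ : V F d) (i : Fin 3)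
    (j : Fin (d i)) (α : F) :
    ‖L (α * ξ i j)‖ * ‖corr ψ f g u ξ‖ ≤
      ‖corr ψ (schwartzDeriv (Pi.single i (Pi.single j α)) f) g u ξ‖ +
        ‖corr ψ f (schwartzDeriv (Pi.single i (Pi.single j α)) g) u ξ‖ := by
  set h : V F d := Pi.single i (Pi.single j α) with hh
  have hi0 := integrable_shift_mul_conj f g u
  have hi1 := integrable_shift_mul_conj (schwartzDeriv h f) g u
  have hi2 := integrable_shift_mul_conj f (schwartzDeriv h g) u
  have hcp : Continuous fun s : V F d => ∑ k, ξ k ⬝ᵥ s k := by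
    unfold dotProduct
    fun_prop
  have hder : ∀ s, HasLineDerivAt ℝ (fun s => f (s + u) * starRingEnd ℂ (g s))
      (schwartzDeriv h f (s + u) * starRingEnd ℂ (g s) +
        f (s + u) * starRingEnd ℂ (schwartzDeriv h g s)) s h := by
    intro s
    have h1 : HasDerivAt (fun r : ℝ => f (s + r • h + u)) (schwartzDeriv h f (s + u)) 0 := by
      have := hasLineDerivAt_schwartz h f (s + u)
      rw [HasLineDerivAt] at this
      simpa only [add_right_comm] using this
    have h2 : HasDerivAt (fun r : ℝ => starRingEnd ℂ (g (s + r • h)))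
        (starRingEnd ℂ (schwartzDeriv h g s)) 0 := HasDerivAt.star (hasLineDerivAt_schwartz h g s)
    rw [HasLineDerivAt]
    refine (h1.mul h2).congr_deriv ?_
    simp
  have key := integral_lineDeriv_mul_psi hψ hL (D := fun _ => α * ξ i j) (q := 0) hcp
    (by
      intro r s
      rw [hh, smul_single_single]
      simp only [Pi.add_apply, dotProduct_add, Finset.sum_add_distrib]
      rw [sum_dotProduct_single, RCLike.real_smul_eq_coe_mul, smul_zero, add_zero]
      ring) hi0 (hi1.add hi2) (hi0.mul_const _) hder
  have key2 : L (α * ξ i j) * corr ψ f g u ξ = - (corr ψ (schwartzDeriv h f) g u ξ +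
      corr ψ f (schwartzDeriv h g) u ξ) := by
    rw [corr, corr, corr, ← integral_const_mul, ← integral_add (integrable_mul_psi hψ hi1 hcp)
      (integrable_mul_psi hψ hi2 hcp)]
    refine Eq.trans ?_ (key.trans ?_)
    · congr 1
      funext s
      ring
    · congr 2
      funext s
      exact add_mul _ _ _
  rw [← norm_mul, key2, norm_neg]
  exact norm_add_le _ _

theorem weightBound_corr {ψ : AddChar F Circle} (hψ : Continuous ψ) (hψ1 : ψ ≠ 1)
    {W : V F d × V F d → ℝ}
    (h : WeightBound (fun (τ : 𝓢(V F d, ℂ) × 𝓢(V F d, ℂ)) p => ‖corr ψ τ.1 τ.2 p.1 p.2‖) W fun _ => 1)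
    (m : Fin 3 → ℕ) :
    WeightBound (fun (τ : 𝓢(V F d, ℂ) × 𝓢(V F d, ℂ)) p => ‖corr ψ τ.1 τ.2 p.1 p.2‖) W
      fun p => ∏ i, (1 + ‖p.2 i‖) ^ m i := by
  obtain ⟨L, hL⟩ := exists_psi_eq_exp hψ
  obtain ⟨C, hC, hCle⟩ := exists_norm_le_of_ne_zero (psi_form_ne_zero hψ1 hL)
  refine WeightBound.prod (R := fun i p => 1 + ‖p.2 i‖) ?_ (fun i p => by positivity) h m
  intro i E hE hb
  refine hb.of_sum (fun τ p => norm_nonneg _) hE (κ := Fin (d i) × Bool)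
    (S := fun k p => ‖L ((if k.2 then RCLike.I else 1) * p.2 i k.1)‖) hC ?_ ?_
  · intro p
    gcongr
    exact sum_norm_form_le hC hCle (p.2 i)
  · intro k τ
    set α : F := if k.2 then RCLike.I else 1
    obtain ⟨C₁, hC₁, h1⟩ := hb (schwartzDeriv (Pi.single i (Pi.single k.1 α)) τ.1, τ.2)
    obtain ⟨C₂, hC₂, h2⟩ := hb (τ.1, schwartzDeriv (Pi.single i (Pi.single k.1 α)) τ.2)
    refine ⟨C₁ + C₂, by positivity, fun p => ?_⟩
    refine (mul_le_mul_of_nonneg_right (norm_corr_ibp hψ hL τ.1 τ.2 p.1 p.2 i k.1 α) (hE p)).trans ?_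
    rw [add_mul, add_mul]
    exact add_le_add (h1 p) (h2 p)

theorem max_one_vabs_pow_le {n : Type*} [Fintype n] (x : n → F) (m : ℕ) :
    (max 1 (vabs x)) ^ m ≤ (1 + ‖x‖) ^ (Module.finrank ℝ F * m) := by
  rw [pow_mul]
  refine pow_le_pow_left₀ (by positivity) (max_le (one_le_pow₀ (by simp)) ?_) m
  exact (vabs_le_norm_pow x).trans (pow_le_pow_left₀ (norm_nonneg _) (by simp) _)

theorem exists_norm_corr_le_arch {ψ : AddChar F Circle} (hψ : Continuous ψ) (hψ1 : ψ ≠ 1)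
    (f : 𝓢(V F d, ℂ)) :
    ∃ C : ℝ, 0 ≤ C ∧ ∀ u ξ, ‖corr ψ f f u ξ‖ ≤ C * ∏ i, (((max 1 (vabs (u i))) ^ (2 * d i))⁻¹ *
      ((max 1 (vabs (ξ i))) ^ (2 * d i))⁻¹) := by
  have hbase : WeightBound (fun (τ : 𝓢(V F d, ℂ) × 𝓢(V F d, ℂ)) (p : V F d × V F d) =>
      ‖corr ψ τ.1 τ.2 p.1 p.2‖) (fun p => ∏ i, ((max 1 (vabs (p.1 i))) ^ (2 * d i))⁻¹)
      fun _ => 1 := by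
    intro τ
    obtain ⟨C, hC, h⟩ := exists_norm_corr_shift_le (ψ := ψ) τ.1 τ.2
      (∑ i, Module.finrank ℝ F * (2 * d i))
    refine ⟨C, hC, fun p => ?_⟩
    show _ * 1 ≤ C * ∏ i, ((max 1 (vabs (p.1 i))) ^ (2 * d i))⁻¹
    rw [mul_one, Finset.prod_inv_distrib, ← div_eq_mul_inv,
      le_div_iff₀ (Finset.prod_pos fun i _ => by positivity)]
    refine le_trans (mul_le_mul_of_nonneg_left ?_ (norm_nonneg _)) (h p.1 p.2)
    rw [← Finset.prod_pow_eq_pow_sum]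
    refine Finset.prod_le_prod (fun i _ => by positivity) fun i _ => ?_
    refine (max_one_vabs_pow_le _ _).trans ?_
    gcongr
    exact norm_le_pi_norm p.1 i
  obtain ⟨C, hC, h⟩ := weightBound_corr hψ hψ1 hbase (fun i => Module.finrank ℝ F * (2 * d i)) (f, f)
  refine ⟨C, hC, fun u ξ => ?_⟩
  rw [Finset.prod_mul_distrib, ← mul_assoc, Finset.prod_inv_distrib (f := fun i =>
    (max 1 (vabs (ξ i))) ^ (2 * d i)), ← div_eq_mul_inv,
    le_div_iff₀ (Finset.prod_pos fun i _ => by positivity)]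
  refine le_trans (mul_le_mul_of_nonneg_left ?_ (norm_nonneg _)) (h (u, ξ))
  exact Finset.prod_le_prod (fun i _ => by positivity) fun i _ => max_one_vabs_pow_le _ _

theorem one_add_vabs_div_pow_le {n : Type*} [Fintype n] (x : F) (y : n → F) (m : ℕ) :
    (1 + vabs y / max 1 (nabs x)) ^ m ≤ (1 + ‖y‖ / max 1 ‖x‖) ^ (Module.finrank ℝ F * m) := by
  rw [pow_mul]
  refine pow_le_pow_left₀ (add_nonneg zero_le_one (div_nonneg (vabs_nonneg _) (by positivity))) ?_ m
  have hk : Module.finrank ℝ F ≠ 0 := Module.finrank_pos.ne'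
  have e : max 1 (nabs x) = (max 1 ‖x‖) ^ Module.finrank ℝ F := by
    rw [nabs_eq_norm_pow]
    rcases le_total 1 ‖x‖ with h | h
    · rw [max_eq_right h, max_eq_right (one_le_pow₀ h)]
    · rw [max_eq_left h, max_eq_left (pow_le_one₀ (norm_nonneg _) h), one_pow]
  calc 1 + vabs y / max 1 (nabs x) ≤ 1 ^ Module.finrank ℝ F + (‖y‖ / max 1 ‖x‖) ^ Module.finrank ℝ F := by
        rw [e, div_pow, one_pow]
        gcongr
        exact vabs_le_norm_pow y
    _ ≤ _ := pow_add_pow_le zero_le_one (by positivity) hk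

theorem exists_norm_weil_le_arch {ψ : AddChar F Circle} (hψ : Continuous ψ) (hψ1 : ψ ≠ 1)
    {J : ∀ i, Matrix (Fin (d i)) (Fin (d i)) F} (hJ : ∀ i, (J i).IsSymm ∧ (J i).det ≠ 0)
    (f : 𝓢(V F d, ℂ)) (m : ℕ) :
    ∃ C : ℝ, 0 ≤ C ∧ ∀ g : G F, (∀ i, g i 1 0 ≠ 0) → ∀ v, ‖weil ψ J g f v‖ ≤
      C * ∏ i, ((nabs (big (rowSL (g i)))) ^ (-((d i : ℝ) / 2)) *
        ((1 + vabs (v i) / nabs (big (rowSL (g i)))) ^ m)⁻¹) := by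
  have hbase : WeightBound (fun (f : 𝓢(V F d, ℂ)) (p : (Fin 3 → F) × V F d) =>
      ‖oscInt ψ J f p.1 p.2‖) (fun p => ∏ i, (max 1 (nabs (p.1 i))) ^ (-((d i : ℝ) / 2)))
      fun _ => 1 := by
    intro f
    obtain ⟨C, hC, h⟩ := exists_norm_oscInt_le hψ hJ (f.integrable (μ := vHaar F d))
      (exists_norm_corr_le_arch hψ hψ1 f)
    exact ⟨C, hC, fun p => by rw [mul_one]; exact h p.1 p.2⟩
  obtain ⟨C, hC, h⟩ := weightBound_oscInt hψ hψ1 (fun i => (hJ i).1) hbase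
    (fun _ => Module.finrank ℝ F * m) f
  refine exists_norm_weil_le hψ (fun i => (hJ i).2) (f.integrable (μ := vHaar F d)) m
    ⟨C, hC, fun x y => ?_⟩
  refine le_trans (mul_le_mul_of_nonneg_left ?_ (norm_nonneg _)) (h (x, y))
  refine Finset.prod_le_prod (fun i _ => pow_nonneg (add_nonneg zero_le_one
    (div_nonneg (vabs_nonneg _) (by positivity))) _) fun i _ => one_add_vabs_div_pow_le _ _ _

end ArchCorr

end TripleQuad
end

noncomputable section

namespace TripleQuad

section KFinite

open Filter Topology

variable {F : Type*} [NontriviallyNormedField F]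

theorem exists_norm_translate_le {f : Sp6 F → ℂ} (hf : Continuous f) {K : Set (Sp6 F)}
    (hK : IsCompact K) (hfin : IsKFinite K f) :
    ∃ (t : Finset (Sp6 F)) (B : ℝ), 0 ≤ B ∧ (∀ l ∈ t, l ∈ K) ∧
      ∀ k ∈ K, ∀ g, ‖f (g * k)‖ ≤ B * ∑ l ∈ t, ‖f (g * l)‖ := by
  classical
  set T : K → Sp6 F → ℂ := fun k g => f (g * k) with hT
  set W := Submodule.span ℂ (Set.range T) with hW
  have : FiniteDimensional ℂ W := hfin
  obtain ⟨s, hs, hspan⟩ := (Submodule.fg_span_iff_fg_span_finset_subset _).mp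
    ((Submodule.fg_iff_finiteDimensional W).mpr hfin)
  choose κ hκ using fun x : s => hs x.2
  let e : s → W := fun x => ⟨x, Submodule.subset_span (hs x.2)⟩
  let Φ : (s → ℂ) →ₗ[ℂ] W := Fintype.linearCombination ℂ e
  have hΦ : LinearMap.range Φ = ⊤ := by
    rw [Fintype.range_linearCombination]
    apply Submodule.map_injective_of_injective W.injective_subtype
    rw [Submodule.map_span, Submodule.map_top, Submodule.range_subtype]
    refine Eq.trans ?_ hspan.symm
    congr 1
    ext x
    simp only [e, Set.mem_image, Set.mem_range, Submodule.subtype_apply, Finset.mem_coe]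
    constructor
    · rintro ⟨_, ⟨y, rfl⟩, rfl⟩
      exact y.2
    · exact fun hx => ⟨_, ⟨⟨x, hx⟩, rfl⟩, rfl⟩
  obtain ⟨R, hR⟩ := LinearMap.exists_rightInverse_of_surjective Φ hΦ
  let w : K → W := fun k => ⟨T k, Submodule.subset_span ⟨k, rfl⟩⟩
  have hw : Continuous w := by
    refine Continuous.subtype_mk (continuous_pi fun g => ?_) _
    exact hf.comp (continuous_const.mul continuous_subtype_val)
  have hRw : Continuous fun k => R (w k) := (LinearMap.continuous_of_finiteDimensional R).comp hw
  have : CompactSpace K := isCompact_iff_compactSpace.mp hK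
  obtain ⟨B, hB⟩ := isCompact_univ.exists_bound_of_continuousOn hRw.continuousOn
  have hB' : ∀ k x, ‖R (w k) x‖ ≤ max B 0 := fun k x =>
    (norm_le_pi_norm _ x).trans ((hB k (Set.mem_univ _)).trans (le_max_left _ _))
  have hexp : ∀ (k : K) (g : Sp6 F), f (g * (k : Sp6 F)) = ∑ x, R (w k) x * f (g * (κ x : Sp6 F)) := by
    intro k g
    have h1 : Φ (R (w k)) = w k := LinearMap.congr_fun hR (w k)
    have h2 := congrFun (congrArg Subtype.val h1) g
    have h3 : ((Φ (R (w k)) : W) : Sp6 F → ℂ) g = ∑ x, R (w k) x * (e x : Sp6 F → ℂ) g := by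
      simp [Φ, Fintype.linearCombination_apply]
    rw [h3] at h2
    refine h2.symm.trans (Finset.sum_congr rfl fun x _ => ?_)
    rw [show (e x : Sp6 F → ℂ) = T (κ x) from (hκ x).symm]
  refine ⟨Finset.univ.image fun x => (κ x : Sp6 F), max B 0 * Fintype.card s,
    by positivity, ?_, fun k hk g => ?_⟩
  · intro l hl
    obtain ⟨x, -, rfl⟩ := Finset.mem_image.mp hl
    exact (κ x).2
  rw [hexp ⟨k, hk⟩ g]
  calc _ ≤ ∑ x : s, ‖R (w ⟨k, hk⟩) x * f (g * (κ x : Sp6 F))‖ := norm_sum_le _ _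
    _ ≤ ∑ x : s, max B 0 * ∑ l ∈ Finset.univ.image fun x => (κ x : Sp6 F), ‖f (g * l)‖ := by
      refine Finset.sum_le_sum fun x _ => ?_
      rw [norm_mul]
      refine mul_le_mul (hB' _ x) ?_ (norm_nonneg _) (le_max_right _ _)
      exact Finset.single_le_sum (f := fun l => ‖f (g * l)‖) (fun _ _ => norm_nonneg _)
        (Finset.mem_image_of_mem _ (Finset.mem_univ x))
    _ = _ := by
      rw [Finset.sum_const, nsmul_eq_mul, Finset.card_univ]
      ring

/-- Finitely many points separate the elements of a finite-dimensional space of functions. -/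
theorem exists_finset_separating {X : Type*} (W : Submodule ℂ (X → ℂ)) [FiniteDimensional ℂ W] :
    ∃ t : Finset X, ∀ w ∈ W, (∀ x ∈ t, w x = 0) → w = 0 := by
  classical
  let ev : X → Module.Dual ℂ W := fun x => (LinearMap.proj x) ∘ₗ W.subtype
  obtain ⟨s, hs, hspan⟩ := (Submodule.fg_span_iff_fg_span_finset_subset (Set.range ev)).mp
    ((Submodule.fg_iff_finiteDimensional (Submodule.span ℂ (Set.range ev))).mpr inferInstance)
  choose κ hκ using fun x : s => hs x.2
  refine ⟨Finset.univ.image κ, fun w hw h => ?_⟩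
  have h1 : Submodule.span ℂ (s : Set (Module.Dual ℂ W)) ≤
      LinearMap.ker (Module.Dual.eval ℂ W ⟨w, hw⟩) := by
    rw [Submodule.span_le]
    intro x hx
    have := h (κ ⟨x, hx⟩) (Finset.mem_image_of_mem _ (Finset.mem_univ _))
    change x ⟨w, hw⟩ = 0
    have e : x = ev (κ ⟨x, hx⟩) := (hκ ⟨x, hx⟩).symm
    rw [e]
    exact this
  funext x
  have : ev x ∈ LinearMap.ker (Module.Dual.eval ℂ W ⟨w, hw⟩) :=
    h1 (hspan ▸ Submodule.subset_span ⟨x, rfl⟩)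
  exact this

theorem eventually_translate_eq {f : Sp6 F → ℂ} (hf : IsLocallyConstant f) {K : Set (Sp6 F)}
    (hK : K ∈ 𝓝 1) (hfin : IsKFinite K f) : ∀ᶠ k in 𝓝 (1 : Sp6 F), ∀ g, f (g * k) = f g := by
  set T : K → Sp6 F → ℂ := fun k g => f (g * k) with hT
  have : FiniteDimensional ℂ (Submodule.span ℂ (Set.range T)) := hfin
  obtain ⟨t, ht⟩ := exists_finset_separating (Submodule.span ℂ (Set.range T))
  have h1 : ∀ᶠ k in 𝓝 (1 : Sp6 F), ∀ g ∈ t, f (g * k) = f (g * 1) := by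
    rw [Filter.eventually_all_finset]
    intro g _
    have : IsLocallyConstant fun k : Sp6 F => f (g * k) :=
      hf.comp_continuous (continuous_const.mul continuous_id)
    exact this.eventually_eq 1
  filter_upwards [h1, hK] with k hk hkK g
  have hmem : T ⟨k, hkK⟩ - T ⟨1, mem_of_mem_nhds hK⟩ ∈ Submodule.span ℂ (Set.range T) :=
    Submodule.sub_mem _ (Submodule.subset_span ⟨_, rfl⟩) (Submodule.subset_span ⟨_, rfl⟩)
  have := congrFun (ht _ hmem fun g hg => by simpa [T, sub_eq_zero] using hk g hg) g
  simpa [T, sub_eq_zero] using this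

end KFinite

section Sp6Int

open Filter Topology

variable {F : Type*} [NontriviallyNormedField F]

theorem isClosed_symplectic :
    IsClosed ((Matrix.symplecticGroup (Fin 3) F : Submonoid _) :
      Set (Matrix (Fin 3 ⊕ Fin 3) (Fin 3 ⊕ Fin 3) F)) := by
  have : ((Matrix.symplecticGroup (Fin 3) F : Submonoid _) :
      Set (Matrix (Fin 3 ⊕ Fin 3) (Fin 3 ⊕ Fin 3) F)) =
      {A | A * Matrix.J (Fin 3) F * Aᵀ = Matrix.J (Fin 3) F} := by
    ext A
    exact SymplecticGroup.mem_iff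
  rw [this]
  exact isClosed_eq (by fun_prop) continuous_const

theorem isCompact_sp6_bounded [ProperSpace F] (R : ℝ) :
    IsCompact {k : Sp6 F | ∀ i j, ‖(k : Matrix (Fin 3 ⊕ Fin 3) (Fin 3 ⊕ Fin 3) F) i j‖ ≤ R} := by
  have hemb : Topology.IsClosedEmbedding (Subtype.val : Sp6 F → Matrix (Fin 3 ⊕ Fin 3) (Fin 3 ⊕ Fin 3) F) :=
    isClosed_symplectic.isClosedEmbedding_subtypeVal
  have hc : IsCompact (Set.univ.pi fun _ : Fin 3 ⊕ Fin 3 => Set.univ.pi fun _ : Fin 3 ⊕ Fin 3 =>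
      Metric.closedBall (0 : F) R) :=
    isCompact_univ_pi fun _ => isCompact_univ_pi fun _ => isCompact_closedBall _ _
  have := hemb.isCompact_preimage hc
  convert this using 1
  ext k
  exact ⟨fun h i _ j _ => mem_closedBall_zero_iff.mpr (h i j),
    fun h i j => mem_closedBall_zero_iff.mp (h i trivial j trivial)⟩

theorem isCompact_sp6Int [ProperSpace F] : IsCompact (sp6Int F) := isCompact_sp6_bounded 1

theorem sp6Int_mem_nhds [IsUltrametricDist F] : sp6Int F ∈ 𝓝 (1 : Sp6 F) := by
  have hc : ∀ i j, Continuous fun k : Sp6 F => (k : Matrix (Fin 3 ⊕ Fin 3) (Fin 3 ⊕ Fin 3) F) i j :=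
    fun i j => (continuous_subtype_val).matrix_elem i j
  have h : ∀ i j, ∀ᶠ k : Sp6 F in 𝓝 1, ‖(k : Matrix (Fin 3 ⊕ Fin 3) (Fin 3 ⊕ Fin 3) F) i j‖ ≤ 1 := by
    intro i j
    have h1 : ∀ᶠ k : Sp6 F in 𝓝 1, (k : Matrix (Fin 3 ⊕ Fin 3) (Fin 3 ⊕ Fin 3) F) i j ∈
        Metric.ball (((1 : Sp6 F) : Matrix (Fin 3 ⊕ Fin 3) (Fin 3 ⊕ Fin 3) F) i j) 1 :=
      (hc i j).continuousAt (Metric.ball_mem_nhds _ one_pos)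
    filter_upwards [h1] with k hk
    rw [mem_ball_iff_norm] at hk
    have h2 : ‖((1 : Sp6 F) : Matrix (Fin 3 ⊕ Fin 3) (Fin 3 ⊕ Fin 3) F) i j‖ ≤ 1 := by
      rw [OneMemClass.coe_one, Matrix.one_apply]
      split_ifs <;> simp
    calc _ = ‖((k : Matrix (Fin 3 ⊕ Fin 3) (Fin 3 ⊕ Fin 3) F) i j -
          ((1 : Sp6 F) : Matrix (Fin 3 ⊕ Fin 3) (Fin 3 ⊕ Fin 3) F) i j) +
          ((1 : Sp6 F) : Matrix (Fin 3 ⊕ Fin 3) (Fin 3 ⊕ Fin 3) F) i j‖ := by rw [sub_add_cancel]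
      _ ≤ max _ _ := IsUltrametricDist.norm_add_le_max _ _
      _ ≤ 1 := max_le hk.le h2
  filter_upwards [Filter.eventually_all.mpr fun i => Filter.eventually_all.mpr (h i)] with k hk
  exact hk

end Sp6Int

end TripleQuad
end

noncomputable section

namespace TripleQuad

section MulHaar

variable {F : Type*} [NontriviallyNormedField F] [ProperSpace F] [MeasurableSpace F] [BorelSpace F]

theorem measurableEmbedding_unitsVal : MeasurableEmbedding (Units.val : Fˣ → F) where
  injective := Units.val_injective
  measurable := Measurable.of_comap_le le_rfl
  measurableSet_image' := by
    rintro _ ⟨t, ht, rfl⟩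
    have : (Units.val : Fˣ → F) '' (Units.val ⁻¹' t) = t ∩ {0}ᶜ := by
      rw [Set.image_preimage_eq_inter_range]
      congr 1
      ext x
      exact ⟨by rintro ⟨u, rfl⟩; exact u.ne_zero, fun h => ⟨Units.mk0 x h, rfl⟩⟩
    rw [this]
    exact ht.inter (measurableSet_singleton _).compl

theorem mulHaar_apply (E : Set Fˣ) (hE : MeasurableSet E) :
    mulHaar F E = ∫⁻ x in (Units.val : Fˣ → F) '' E, ENNReal.ofReal (nabs x)⁻¹ ∂Measure.addHaar := by
  rw [mulHaar, measurableEmbedding_unitsVal.comap_apply,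
    withDensity_apply _ (measurableEmbedding_unitsVal.measurableSet_image' hE)]

theorem mulHaar_preimage_mul (b : Fˣ) {E : Set Fˣ} (hE : MeasurableSet E) :
    mulHaar F ((fun a => b * a) ⁻¹' E) = mulHaar F E := by
  have hmb : Measurable fun a : Fˣ => b * a := by
    refine measurable_comap_iff.mpr ?_
    have h1 : Measurable fun a : Fˣ => (b : F) * (a : F) :=
      (continuous_const_mul (b : F)).measurable.comp measurableEmbedding_unitsVal.measurable
    exact h1
  have hE1 := measurableEmbedding_unitsVal.measurableSet_image' hE
  have hE2 := measurableEmbedding_unitsVal.measurableSet_image' (hmb hE)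
  rw [mulHaar_apply _ hE, mulHaar_apply _ (hmb hE), ← lintegral_indicator hE1,
    ← lintegral_indicator hE2]
  have hb0 : 0 < nabs (b : F) := nabs_pos b.ne_zero
  have key := lintegral_mul_left_addHaar (Measure.addHaar : Measure F) b.ne_zero
    (fun x => ((Units.val : Fˣ → F) '' E).indicator (fun x => ENNReal.ofReal (nabs x)⁻¹) x)
  have e : ∀ x : F, ((Units.val : Fˣ → F) '' ((fun a => b * a) ⁻¹' E)).indicator
      (fun x => ENNReal.ofReal (nabs x)⁻¹) x = ENNReal.ofReal (nabs (b : F)) *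
      ((Units.val : Fˣ → F) '' E).indicator (fun x => ENNReal.ofReal (nabs x)⁻¹) (b * x) := by
    intro x
    have hiff : x ∈ (Units.val : Fˣ → F) '' ((fun a => b * a) ⁻¹' E) ↔
        (b : F) * x ∈ (Units.val : Fˣ → F) '' E := by
      constructor
      · rintro ⟨a, ha, rfl⟩
        exact ⟨b * a, ha, rfl⟩
      · rintro ⟨a, ha, hax⟩
        refine ⟨b⁻¹ * a, ?_, ?_⟩
        · simpa using ha
        · simp [hax]
    by_cases hx : x ∈ (Units.val : Fˣ → F) '' ((fun a => b * a) ⁻¹' E)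
    · rw [Set.indicator_of_mem hx, Set.indicator_of_mem (hiff.mp hx), ← ENNReal.ofReal_mul hb0.le,
        nabs_mul, mul_inv, mul_inv_cancel_left₀ hb0.ne']
    · rw [Set.indicator_of_notMem hx, Set.indicator_of_notMem fun h => hx (hiff.mpr h), mul_zero]
  simp only [e]
  rw [lintegral_const_mul' _ _ ENNReal.ofReal_ne_top, key, ← mul_assoc, ← ENNReal.ofReal_mul hb0.le,
    mul_inv_cancel₀ hb0.ne', ENNReal.ofReal_one, one_mul]

instance borelSpace_units : BorelSpace Fˣ :=
  measurableEmbedding_unitsVal.borelSpace Units.isEmbedding_val₀.isInducing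

theorem isCompact_unit_sphere : IsCompact {u : Fˣ | ‖(u : F)‖ = 1} := by
  rw [Units.isEmbedding_val₀.isCompact_iff]
  have : (Units.val : Fˣ → F) '' {u : Fˣ | ‖(u : F)‖ = 1} = Metric.sphere 0 1 := by
    ext x
    simp only [Set.mem_image, Set.mem_ofPred_eq, mem_sphere_zero_iff_norm]
    constructor
    · rintro ⟨u, hu, rfl⟩
      exact hu
    · intro hx
      have hx0 : x ≠ 0 := by rintro rfl; simp at hx
      exact ⟨Units.mk0 x hx0, hx, rfl⟩
  rw [this]
  exact isCompact_sphere _ _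

theorem mulHaar_unit_sphere_lt_top : mulHaar F {u : Fˣ | ‖(u : F)‖ = 1} < ⊤ := by
  have hm : MeasurableSet {u : Fˣ | ‖(u : F)‖ = 1} := isCompact_unit_sphere.isClosed.measurableSet
  rw [mulHaar_apply _ hm]
  have h1 : ∀ x ∈ (Units.val : Fˣ → F) '' {u : Fˣ | ‖(u : F)‖ = 1},
      ENNReal.ofReal (nabs x)⁻¹ = 1 := by
    rintro _ ⟨u, hu, rfl⟩
    have : nabs (u : F) = nabs (1 : F) := le_antisymm (nabs_le_of_norm_le (by rw [norm_one]; exact hu.le))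
      (nabs_le_of_norm_le (by rw [norm_one]; exact hu.ge))
    rw [this, nabs_one, inv_one, ENNReal.ofReal_one]
  rw [setLIntegral_congr_fun (measurableEmbedding_unitsVal.measurableSet_image' hm) h1,
    setLIntegral_one]
  refine (measure_mono ?_).trans_lt (isCompact_closedBall (0 : F) 1).measure_lt_top
  rintro _ ⟨u, hu, rfl⟩
  exact mem_closedBall_zero_iff.mpr hu.le

theorem mulHaar_pos_of_isOpen {S : Set Fˣ} (hS : IsOpen S) (hne : S.Nonempty) : 0 < mulHaar F S := by
  rw [mulHaar_apply _ hS.measurableSet]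
  have ho : IsOpen ((Units.val : Fˣ → F) '' S) := Units.isOpenEmbedding_val.isOpenMap _ hS
  have hpos : 0 < (Measure.addHaar : Measure F) ((Units.val : Fˣ → F) '' S) :=
    ho.measure_pos _ (hne.image _)
  have hme : Measurable fun x : F => ENNReal.ofReal (nabs x)⁻¹ := measurable_nabs.inv.ennreal_ofReal
  rw [setLIntegral_pos_iff hme]
  refine hpos.trans_le (measure_mono ?_)
  rintro _ ⟨u, hu, rfl⟩
  refine ⟨?_, u, hu, rfl⟩
  simpa using nabs_pos u.ne_zero

end MulHaar

section Shells

variable {F : Type*} [NontriviallyNormedField F] [ProperSpace F] [MeasurableSpace F] [BorelSpace F]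

/-- The elements whose norm is the `k`-th power of that of `ϖ`. -/
def shell (ϖ : F) (k : ℤ) : Set Fˣ := {a | ‖(a : F)‖ = ‖ϖ‖ ^ k}

theorem measurableSet_shell (ϖ : F) (k : ℤ) : MeasurableSet (shell ϖ k) :=
  (measurableSet_singleton (‖ϖ‖ ^ k)).preimage
    (continuous_norm.comp Units.continuous_val).measurable

theorem exists_mem_shell {ϖ : F} (hϖ : IsUniformizer ϖ) (a : Fˣ) : ∃ k, a ∈ shell ϖ k := by
  obtain ⟨h0, h1, h2⟩ := hϖ
  have hpos : 0 < ‖ϖ‖ := norm_pos_iff.mpr h0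
  obtain ⟨k, hk1, hk2⟩ := exists_mem_Ioc_zpow (norm_pos_iff.mpr a.ne_zero) ((one_lt_inv₀ hpos).mpr h1)
  refine ⟨-(k + 1), ?_⟩
  rw [_root_.inv_zpow'] at hk1 hk2
  have hz : 0 < ‖ϖ‖ ^ (-(k + 1)) := zpow_pos hpos _
  refine le_antisymm hk2 (not_lt.mp fun hlt => ?_)
  have h3 := h2 ((a : F) * ϖ ^ (k + 1)) (by
    rw [norm_mul, norm_zpow]
    calc _ < ‖ϖ‖ ^ (-(k + 1)) * ‖ϖ‖ ^ (k + 1) := mul_lt_mul_of_pos_right hlt (zpow_pos hpos _)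
      _ = 1 := by rw [← zpow_add₀ hpos.ne']; simp)
  rw [norm_mul, norm_zpow] at h3
  have h4 : ‖(a : F)‖ ≤ ‖ϖ‖ ^ (-k) := by
    calc ‖(a : F)‖ = ‖(a : F)‖ * ‖ϖ‖ ^ (k + 1) * ‖ϖ‖ ^ (-(k + 1)) := by
          rw [mul_assoc, ← zpow_add₀ hpos.ne']; simp
      _ ≤ ‖ϖ‖ * ‖ϖ‖ ^ (-(k + 1)) := mul_le_mul_of_nonneg_right h3 hz.le
      _ = _ := by rw [← zpow_one_add₀ hpos.ne']; congr 1; ring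
  exact absurd h4 (not_le.mpr hk1)

theorem zpow_mem_shell {ϖ : F} (h0 : ϖ ≠ 0) (k : ℤ) : (Units.mk0 ϖ h0) ^ k ∈ shell ϖ k := by
  rw [shell, Set.mem_ofPred_eq, Units.val_zpow_eq_zpow_val, norm_zpow]
  rfl

theorem iUnion_shell {ϖ : F} (hϖ : IsUniformizer ϖ) : ⋃ k, shell ϖ k = Set.univ :=
  Set.eq_univ_of_forall fun a => Set.mem_iUnion.mpr (exists_mem_shell hϖ a)

theorem disjoint_shell {ϖ : F} (hϖ : IsUniformizer ϖ) :
    Pairwise (Function.onFun Disjoint (shell ϖ)) := by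
  intro k l hkl
  rw [Function.onFun, Set.disjoint_left]
  intro a hk hl
  exact hkl (zpow_right_injective₀ (norm_pos_iff.mpr hϖ.1) hϖ.2.1.ne (hk.symm.trans hl))

theorem nabs_of_mem_shell {ϖ : F} {k : ℤ} {a : Fˣ} (ha : a ∈ shell ϖ k) :
    nabs (a : F) = nabs ϖ ^ k := by
  have : ‖(a : F)‖ = ‖ϖ ^ k‖ := by rw [norm_zpow]; exact ha
  rw [← nabs_zpow]
  exact le_antisymm (nabs_le_of_norm_le this.le) (nabs_le_of_norm_le this.ge)

theorem mem_shell_iff {ϖ : F} {k : ℤ} {a : Fˣ} (ha : a ∈ shell ϖ k) (b : Fˣ) :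
    b ∈ shell ϖ k ↔ ‖((a⁻¹ * b : Fˣ) : F)‖ = 1 := by
  rw [shell, Set.mem_ofPred_eq, Units.val_mul, Units.val_inv_eq_inv_val, norm_mul, norm_inv,
    inv_mul_eq_one₀ (norm_ne_zero_iff.mpr a.ne_zero)]
  rw [shell, Set.mem_ofPred_eq] at ha
  rw [ha, eq_comm]

end Shells

section FiniteFourier

variable {F : Type*} [NontriviallyNormedField F] [ProperSpace F] [MeasurableSpace F] [BorelSpace F]

theorem mem_of_mem_zpowers_sup {ϖ : F} (hϖ : IsUniformizer ϖ) {S : Subgroup Fˣ}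
    (hS1 : ∀ u ∈ S, ‖(u : F)‖ = 1) {a : Fˣ} (ha : a ∈ Subgroup.zpowers (Units.mk0 ϖ hϖ.1) ⊔ S)
    (h : ‖(a : F)‖ = 1) : a ∈ S := by
  obtain ⟨_, ⟨k, rfl⟩, u, hu, rfl⟩ := Subgroup.mem_sup.mp ha
  have h1 : ‖ϖ‖ ^ k = ‖ϖ‖ ^ (0 : ℤ) := by
    simpa [hS1 u hu] using h
  have hk := zpow_right_injective₀ (norm_pos_iff.mpr hϖ.1) hϖ.2.1.ne h1
  subst hk
  simpa using hu

theorem finite_quotient {ϖ : F} (hϖ : IsUniformizer ϖ) {S : Subgroup Fˣ} (hS : IsOpen (S : Set Fˣ)) :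
    Finite (Fˣ ⧸ (Subgroup.zpowers (Units.mk0 ϖ hϖ.1) ⊔ S)) := by
  set H := Subgroup.zpowers (Units.mk0 ϖ hϖ.1) ⊔ S
  have hH : IsOpen (H : Set Fˣ) := Subgroup.isOpen_mono le_sup_right hS
  have : DiscreteTopology (Fˣ ⧸ H) := QuotientGroup.discreteTopology hH
  have hc : IsCompact ((QuotientGroup.mk : Fˣ → Fˣ ⧸ H) '' {u : Fˣ | ‖(u : F)‖ = 1}) :=
    isCompact_unit_sphere.image QuotientGroup.continuous_mk
  have hu : (QuotientGroup.mk : Fˣ → Fˣ ⧸ H) '' {u : Fˣ | ‖(u : F)‖ = 1} = Set.univ := by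
    refine Set.eq_univ_of_forall fun x => ?_
    obtain ⟨a, rfl⟩ := QuotientGroup.mk_surjective x
    obtain ⟨k, hk⟩ := exists_mem_shell hϖ a
    refine ⟨((Units.mk0 ϖ hϖ.1) ^ k)⁻¹ * a, ?_, ?_⟩
    · exact (mem_shell_iff (zpow_mem_shell hϖ.1 k) a).mp hk
    · rw [QuotientGroup.eq]
      apply (le_sup_left : Subgroup.zpowers (Units.mk0 ϖ hϖ.1) ≤ H)
      refine ⟨k, ?_⟩
      simp
  rw [hu] at hc
  exact Set.finite_univ_iff.mp hc.finite_of_discrete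

/-- Orthogonality of the characters of a finite commutative group. -/
theorem exists_characters_sum (A : Type*) [AddCommGroup A] [Fintype A] [DecidableEq A] :
    ∃ (ι : Type) (_ : Fintype ι) (θ : ι → A → ℂ), (∀ i, θ i 0 = 1) ∧
      (∀ i x y, θ i (x + y) = θ i x * θ i y) ∧ (∀ i x, ‖θ i x‖ = 1) ∧
      ∀ x, ∑ i, θ i x = if x = 0 then (Fintype.card A : ℂ) else 0 := by
  let e := Finite.equivFin (AddChar A ℂ)
  refine ⟨Fin (Nat.card (AddChar A ℂ)), inferInstance, fun i => e.symm i,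
    fun i => (e.symm i).map_zero_eq_one, fun i x y => (e.symm i).map_add_eq_mul _ _,
    fun i x => (e.symm i).norm_apply _, fun x => ?_⟩
  rw [← AddChar.sum_apply_eq_ite x]
  exact Equiv.sum_comp e.symm (fun θ => θ x)

/-- A function on `Fˣ` invariant under an open group of units is bounded, on each shell, by its
integrals against finitely many characters. -/
theorem exists_characters_bound {ϖ : F} (hϖ : IsUniformizer ϖ) {S : Subgroup Fˣ}
    (hS : IsOpen (S : Set Fˣ)) (hS1 : ∀ u ∈ S, ‖(u : F)‖ = 1) :
    ∃ (ι : Type) (_ : Fintype ι) (χ : ι → Fˣ →* ℂˣ) (B : ℝ), 0 ≤ B ∧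
      (∀ i, Continuous (χ i) ∧ χ i (Units.mk0 ϖ hϖ.1) = 1) ∧
      ∀ φ : Fˣ → ℂ, (∀ u ∈ S, ∀ a, φ (a * u) = φ a) →
        ∀ k, (∀ i, IntegrableOn (fun a => (χ i a : ℂ) * φ a) (shell ϖ k) (mulHaar F)) →
        ∀ a ∈ shell ϖ k, ‖φ a‖ ≤ B * ∑ i, ‖∫ b in shell ϖ k, (χ i b : ℂ) * φ b ∂(mulHaar F)‖ := by
  classical
  set H := Subgroup.zpowers (Units.mk0 ϖ hϖ.1) ⊔ S with hHdef
  have hH : IsOpen (H : Set Fˣ) := Subgroup.isOpen_mono le_sup_right hS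
  have hfin : Finite (Fˣ ⧸ H) := finite_quotient hϖ hS
  have hdisc : DiscreteTopology (Fˣ ⧸ H) := QuotientGroup.discreteTopology hH
  have : Fintype (Additive (Fˣ ⧸ H)) := Fintype.ofFinite _
  obtain ⟨ι, _, θ, hθ0, hθadd, hθn, hθsum⟩ := exists_characters_sum (Additive (Fˣ ⧸ H))
  let χ₀ : ι → (Fˣ ⧸ H) →* ℂˣ := fun i => MonoidHom.toHomUnits
    { toFun := fun x => θ i (Additive.ofMul x)
      map_one' := hθ0 i
      map_mul' := fun x y => hθadd i _ _ }
  let χ₁ : ι → Fˣ →* ℂˣ := fun i => (χ₀ i).comp (QuotientGroup.mk' H)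
  have hχ₁ : ∀ i a, (χ₁ i a : ℂ) = θ i (Additive.ofMul (a : Fˣ ⧸ H)) := fun i a => rfl
  have hsum : ∀ a : Fˣ, ∑ i, (χ₁ i a : ℂ) =
      if a ∈ H then (Fintype.card (Additive (Fˣ ⧸ H)) : ℂ) else 0 := by
    intro a
    have h2 : (Additive.ofMul (a : Fˣ ⧸ H)) = 0 ↔ a ∈ H := by
      rw [← QuotientGroup.eq_one_iff]
      exact Iff.rfl
    simp only [hχ₁, hθsum, h2]
  set vol := (mulHaar F).real (S : Set Fˣ) with hvol
  have hvfin : mulHaar F (S : Set Fˣ) < ⊤ :=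
    (measure_mono fun u hu => hS1 u hu).trans_lt mulHaar_unit_sphere_lt_top
  have hvpos : 0 < vol := ENNReal.toReal_pos (mulHaar_pos_of_isOpen hS ⟨1, S.one_mem⟩).ne' hvfin.ne
  have hcard : 0 < (Fintype.card (Additive (Fˣ ⧸ H)) : ℝ) := by exact_mod_cast Fintype.card_pos
  refine ⟨ι, inferInstance, χ₁,
    ((Fintype.card (Additive (Fˣ ⧸ H)) : ℝ) * vol)⁻¹, by positivity, fun i => ⟨?_, ?_⟩, ?_⟩
  · exact (continuous_of_discreteTopology (f := χ₀ i)).comp QuotientGroup.continuous_mk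
  · have : ((Units.mk0 ϖ hϖ.1 : Fˣ) : Fˣ ⧸ H) = 1 :=
      (QuotientGroup.eq_one_iff _).mpr ((le_sup_left : _ ≤ H) (Subgroup.mem_zpowers _))
    rw [show χ₁ i (Units.mk0 ϖ hϖ.1) = χ₀ i ((Units.mk0 ϖ hϖ.1 : Fˣ) : Fˣ ⧸ H)
      from rfl, this, map_one]
  · intro φ hφ k hint a ha
    have hnorm : ∀ θ (b : Fˣ), ‖(χ₁ θ b : ℂ)‖ = 1 := fun θ b => by rw [hχ₁]; exact hθn _ _
    have hkey : ∑ i, (χ₁ i a⁻¹ : ℂ) * ∫ b in shell ϖ k, (χ₁ i b : ℂ) * φ b ∂(mulHaar F)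
        = (Fintype.card (Additive (Fˣ ⧸ H)) : ℂ) * (vol : ℂ) * φ a := by
      simp only [← integral_const_mul]
      rw [← integral_finsetSum _ fun i _ => (hint i).const_mul _]
      have hpre : MeasurableSet ((fun b => a⁻¹ * b) ⁻¹' (S : Set Fˣ)) :=
        (hS.preimage (continuous_const.mul continuous_id)).measurableSet
      have e1 : ∀ b ∈ shell ϖ k, ∑ i, (χ₁ i a⁻¹ : ℂ) * ((χ₁ i b : ℂ) * φ b) =
          ((fun b => a⁻¹ * b) ⁻¹' (S : Set Fˣ)).indicator (fun _ => (Fintype.card (Additive (Fˣ ⧸ H)) : ℂ) * φ a) b := by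
        intro b hb
        have h1 : ∑ i, (χ₁ i a⁻¹ : ℂ) * ((χ₁ i b : ℂ) * φ b) =
            (∑ i, (χ₁ i (a⁻¹ * b) : ℂ)) * φ b := by
          rw [Finset.sum_mul]
          refine Finset.sum_congr rfl fun i _ => ?_
          rw [map_mul, Units.val_mul, mul_assoc]
        rw [h1, hsum]
        by_cases hbS : b ∈ (fun b => a⁻¹ * b) ⁻¹' (S : Set Fˣ)
        · rw [if_pos ((le_sup_right : S ≤ H) (show a⁻¹ * b ∈ S from hbS)), Set.indicator_of_mem hbS]
          congr 1
          have := hφ _ (show a⁻¹ * b ∈ S from hbS) a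
          rwa [mul_inv_cancel_left] at this
        · rw [if_neg fun h => hbS (mem_of_mem_zpowers_sup hϖ hS1 h ((mem_shell_iff ha b).mp hb)),
            Set.indicator_of_notMem hbS, zero_mul]
      rw [setIntegral_congr_fun (measurableSet_shell ϖ k) e1, setIntegral_indicator hpre,
        setIntegral_const]
      have e2 : shell ϖ k ∩ (fun b => a⁻¹ * b) ⁻¹' (S : Set Fˣ) = (fun b => a⁻¹ * b) ⁻¹' (S : Set Fˣ) := by
        refine Set.inter_eq_right.mpr fun b hb => (mem_shell_iff ha b).mpr (hS1 _ hb)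
      rw [e2, measureReal_def, mulHaar_preimage_mul _ hS.measurableSet, ← measureReal_def, ← hvol,
        Complex.real_smul]
      ring
    have hφa : φ a = ((Fintype.card (Additive (Fˣ ⧸ H)) : ℂ) * (vol : ℂ))⁻¹ *
        ∑ i, (χ₁ i a⁻¹ : ℂ) * ∫ b in shell ϖ k, (χ₁ i b : ℂ) * φ b ∂(mulHaar F) := by
      rw [hkey, inv_mul_cancel_left₀]
      exact mul_ne_zero (by exact_mod_cast hcard.ne') (by exact_mod_cast hvpos.ne')
    rw [hφa, norm_mul, norm_inv, norm_mul, Complex.norm_natCast, Complex.norm_of_nonneg hvpos.le]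
    gcongr
    refine (norm_sum_le _ _).trans (Finset.sum_le_sum fun i _ => ?_)
    rw [norm_mul, hnorm, one_mul]

end FiniteFourier

end TripleQuad
end

noncomputable section

namespace TripleQuad

section Laurent

/-- The coefficients of a Laurent series that vanishes on a circle are zero. -/
theorem laurent_coeff_eq_zero {d : ℤ → ℂ} {ρ : ℝ} (hρ : 0 < ρ)
    (h : ∀ X : ℂ, ‖X‖ = ρ → HasSum (fun k => d k * X ^ k) 0) (j : ℤ) : d j = 0 := by
  have hsum : Summable fun k => ‖d k‖ * ρ ^ k := by
    have := (h ρ (by simp [abs_of_pos hρ])).summable.norm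
    simpa [abs_of_pos hρ] using this
  have hcirc : ∀ θ : ℝ, ‖circleMap 0 ρ θ‖ = ρ := fun θ => by simp [abs_of_pos hρ]
  have hne : ∀ θ : ℝ, circleMap 0 ρ θ ≠ 0 := fun θ => by
    rw [← norm_pos_iff, hcirc]; exact hρ
  have hcont : Continuous fun θ : ℝ => circleMap 0 ρ θ := continuous_circleMap 0 ρ
  have key := intervalIntegral.hasSum_integral_of_dominated_convergence (μ := volume) (a := 0)
    (b := 2 * Real.pi) (F := fun k θ => circleMap 0 ρ θ ^ (-j) * (d k * circleMap 0 ρ θ ^ k))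
    (f := fun _ => 0) (fun k _ => ρ ^ (-j) * (‖d k‖ * ρ ^ k))
    (fun k => (Continuous.aestronglyMeasurable (by
      exact (hcont.zpow₀ _ fun θ => Or.inl (hne θ)).mul
        (continuous_const.mul (hcont.zpow₀ _ fun θ => Or.inl (hne θ))))))
    (fun k => Filter.Eventually.of_forall fun θ _ => by
      rw [norm_mul, norm_mul, norm_zpow, norm_zpow, hcirc])
    (Filter.Eventually.of_forall fun θ _ => hsum.mul_left _) (by simp)
    (Filter.Eventually.of_forall fun θ _ => by
      have := (h _ (hcirc θ)).mul_left (circleMap 0 ρ θ ^ (-j))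
      simpa using this)
  have hint : ∀ k, ∫ θ in (0 : ℝ)..2 * Real.pi, circleMap 0 ρ θ ^ (-j) * (d k * circleMap 0 ρ θ ^ k) =
      if k = j then d j * (2 * Real.pi) else 0 := by
    intro k
    have e1 : ∀ θ : ℝ, circleMap 0 ρ θ ^ (-j) * (d k * circleMap 0 ρ θ ^ k) =
        d k * (Complex.I⁻¹ * (deriv (circleMap 0 ρ) θ • (circleMap 0 ρ θ - 0) ^ (k - j - 1))) := by
      intro θ
      have h0 := hne θ
      rw [deriv_circleMap, smul_eq_mul, sub_zero, zpow_sub₀ h0, zpow_sub₀ h0, _root_.zpow_neg, zpow_one]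
      have hI := Complex.I_ne_zero
      have hz : circleMap 0 ρ θ ^ j ≠ 0 := zpow_ne_zero _ h0
      field_simp
    simp only [e1, intervalIntegral.integral_const_mul]
    change d k * (Complex.I⁻¹ * ∮ z in C(0, ρ), (z - 0) ^ (k - j - 1)) = _
    by_cases hk : k = j
    · subst hk
      rw [if_pos rfl]
      have : ∮ z in C(0, ρ), (z - 0) ^ (k - k - 1) = 2 * Real.pi * Complex.I := by
        have := circleIntegral.integral_sub_center_inv (0 : ℂ) hρ.ne'
        simpa [_root_.zpow_neg_one] using this
      rw [this]
      have hI := Complex.I_ne_zero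
      field_simp
    · rw [if_neg hk, circleIntegral.integral_sub_zpow_of_ne (by omega)]
      simp
  simp only [hint] at key
  have h2 := key.unique (hasSum_ite_eq j _)
  have hpi : (2 * Real.pi : ℂ) ≠ 0 := by exact_mod_cast Real.two_pi_pos.ne'
  rw [intervalIntegral.integral_zero, eq_comm, mul_eq_zero] at h2
  exact h2.resolve_right hpi

/-- A solution of a contracting recurrence. -/
theorem recurrence_bound {c e : ℤ → ℂ} {β ρ B E : ℝ} {j : ℕ} (hj : 0 < j) (hβ0 : 0 ≤ β) (hβ1 : β < 1)
    (hρ0 : 0 < ρ) (hρ1 : ρ ≤ 1) (hB : ∀ k, ‖c k‖ * ρ ^ k ≤ B) {A : ℤ}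
    (hrec : ∀ k, c k = β * c (k - j) + e k) (he0 : ∀ k < A, e k = 0) (heE : ∀ k, ‖e k‖ ≤ E) :
    (∀ k < A, c k = 0) ∧ ∀ k, ‖c k‖ ≤ E / (1 - β) := by
  have h0 : ∀ k < A, c k = 0 := by
    intro k hk
    have hiter : ∀ n : ℕ, c k = (β : ℂ) ^ n * c (k - n * j) := by
      intro n
      induction n with
      | zero => simp
      | succ n ih =>
        rw [ih, hrec (k - n * j), he0 _ (by nlinarith [Int.natCast_nonneg n, Int.natCast_nonneg j]),
          add_zero, pow_succ, mul_assoc]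
        congr 3
        push_cast
        ring
    have hle : ∀ n : ℕ, ‖c k‖ ≤ β ^ n * (B * ρ ^ (-k)) := by
      intro n
      rw [hiter n, norm_mul, norm_pow, Complex.norm_of_nonneg hβ0]
      refine mul_le_mul_of_nonneg_left ?_ (pow_nonneg hβ0 n)
      have h1 := hB (k - n * j)
      have h2 : ρ ^ k ≤ ρ ^ (k - n * j) :=
        zpow_le_zpow_right_of_le_one₀ hρ0 hρ1 (by nlinarith [Int.natCast_nonneg n, Int.natCast_nonneg j])
      rw [_root_.zpow_neg, ← div_eq_mul_inv, le_div_iff₀ (zpow_pos hρ0 k)]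
      exact (mul_le_mul_of_nonneg_left h2 (norm_nonneg _)).trans h1
    have hlim : Filter.Tendsto (fun n : ℕ => β ^ n * (B * ρ ^ (-k))) Filter.atTop (nhds 0) := by
      simpa using (tendsto_pow_atTop_nhds_zero_of_lt_one hβ0 hβ1).mul_const (B * ρ ^ (-k))
    exact norm_le_zero_iff.mp (ge_of_tendsto' hlim hle)
  refine ⟨h0, fun k => ?_⟩
  have hE : 0 ≤ E := (norm_nonneg _).trans (heE 0)
  have hpos : 0 < 1 - β := by linarith
  have hnat : ∀ n : ℕ, ∀ k : ℤ, k < A + n → ‖c k‖ ≤ E / (1 - β) := by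
    intro n
    induction n with
    | zero =>
      intro k hk
      rw [h0 k (by simpa using hk), norm_zero]
      positivity
    | succ n ih =>
      intro k hk
      have h1 := ih (k - j) (by push_cast at hk; omega)
      rw [hrec]
      calc _ ≤ ‖(β : ℂ) * c (k - j)‖ + ‖e k‖ := norm_add_le _ _
        _ ≤ β * (E / (1 - β)) + E := by
          rw [norm_mul, Complex.norm_of_nonneg hβ0]
          exact add_le_add (mul_le_mul_of_nonneg_left h1 hβ0) (heE k)
        _ = _ := by field_simp; ring
  exact hnat (k - A + 1).toNat k (by omega)

theorem hasSum_laurentPolynomial (p : Polynomial ℂ) (m : ℕ) {X : ℂ} (hX : X ≠ 0) :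
    HasSum (fun k : ℤ => (if 0 ≤ k + m then p.coeff (k + m).toNat else 0) * X ^ k)
      (p.eval X / X ^ m) := by
  have hinj : Function.Injective fun n : ℕ => (n : ℤ) - m := fun a b h => by simpa using h
  have h0 : ∀ k ∉ Set.range fun n : ℕ => (n : ℤ) - m,
      (if 0 ≤ k + m then p.coeff (k + m).toNat else 0) * X ^ k = 0 := by
    intro k hk
    rw [if_neg, zero_mul]
    intro h
    exact hk ⟨(k + m).toNat, by simp [Int.toNat_of_nonneg h]⟩
  rw [← hinj.hasSum_iff h0]
  have e : (fun k : ℤ => (if 0 ≤ k + m then p.coeff (k + m).toNat else 0) * X ^ k) ∘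
      (fun n : ℕ => (n : ℤ) - m) = fun n : ℕ => p.coeff n * X ^ n / X ^ m := by
    funext n
    simp only [Function.comp_apply, sub_add_cancel, Int.natCast_nonneg, if_true, Int.toNat_natCast]
    rw [zpow_sub₀ hX, zpow_natCast, zpow_natCast, mul_div_assoc]
  rw [e, Polynomial.eval_eq_sum_range, Finset.sum_div]
  refine hasSum_sum_of_ne_finset_zero fun n hn => ?_
  rw [Polynomial.coeff_eq_zero_of_natDegree_lt (by simpa [Nat.lt_succ_iff] using hn)]
  simp

theorem hasSum_sub_shift {c : ℤ → ℂ} {S X : ℂ} (hX : X ≠ 0) (h : HasSum (fun k => c k * X ^ k) S)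
    (β : ℂ) (j : ℕ) : HasSum (fun k => (c k - β * c (k - j)) * X ^ k) (S * (1 - β * X ^ j)) := by
  have h1 := ((Equiv.subRight (j : ℤ)).hasSum_iff).mpr h
  have h2 := h.sub ((h1.mul_right (X ^ j)).mul_left β)
  rw [show S * (1 - β * X ^ j) = S - β * (S * X ^ j) by ring]
  have e : (fun k : ℤ => (c k - β * c (k - j)) * X ^ k) =
      fun k => c k * X ^ k - β * (c (k - j) * X ^ (k - j) * X ^ j) := by
    funext k
    rw [mul_assoc (c (k - j)), ← zpow_natCast, ← zpow_add₀ hX, sub_add_cancel]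
    ring
  rw [e]
  exact h2

/-- The coefficients of a Laurent series whose product with `(1 - α X)(1 - β X²)` is a Laurent
polynomial are bounded, and vanish for small index. -/
theorem laurent_coeff_bounded {c : ℤ → ℂ} {M : ℂ → ℂ} {α β : ℝ} (hα0 : 0 ≤ α) (hα1 : α < 1)
    (hβ0 : 0 ≤ β) (hβ1 : β < 1) {ρ : ℝ} (hρ0 : 0 < ρ) (hρ1 : ρ ≤ 1) (p : Polynomial ℂ) (m : ℕ)
    (hc : ∀ X : ℂ, ‖X‖ = ρ → HasSum (fun k => c k * X ^ k) (M X))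
    (hM : ∀ X : ℂ, ‖X‖ = ρ → M X * ((1 - α * X) * (1 - β * X ^ 2)) = p.eval X / X ^ m) :
    ∃ (A : ℤ) (E : ℝ), (∀ k < A, c k = 0) ∧ ∀ k, ‖c k‖ ≤ E := by
  have hne : ∀ X : ℂ, ‖X‖ = ρ → X ≠ 0 := fun X hX => by rw [← norm_pos_iff, hX]; exact hρ0
  set b : ℤ → ℂ := fun k => c k - β * c (k - (2 : ℕ)) with hb
  set e : ℤ → ℂ := fun k => b k - α * b (k - (1 : ℕ)) with he
  have hbs : ∀ X : ℂ, ‖X‖ = ρ → HasSum (fun k => b k * X ^ k) (M X * (1 - β * X ^ 2)) := by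
    intro X hX
    exact hasSum_sub_shift (hne X hX) (hc X hX) β 2
  have hes : ∀ X : ℂ, ‖X‖ = ρ → HasSum (fun k => e k * X ^ k) (p.eval X / X ^ m) := by
    intro X hX
    rw [← hM X hX, mul_comm (1 - (α : ℂ) * X), ← mul_assoc]
    have := hasSum_sub_shift (hne X hX) (hbs X hX) α 1
    rwa [pow_one] at this
  have hcoef : ∀ k, e k = if 0 ≤ k + m then p.coeff (k + m).toNat else 0 := by
    intro k
    have := laurent_coeff_eq_zero (d := fun k => e k - if 0 ≤ k + m then p.coeff (k + m).toNat else 0)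
      hρ0 (fun X hX => by
        have := (hes X hX).sub (hasSum_laurentPolynomial p m (hne X hX))
        simpa only [sub_mul, sub_self] using this) k
    exact sub_eq_zero.mp this
  have he0 : ∀ k < (-m : ℤ), e k = 0 := fun k hk => by rw [hcoef, if_neg (by omega)]
  have heE : ∀ k, ‖e k‖ ≤ ∑ n ∈ Finset.range (p.natDegree + 1), ‖p.coeff n‖ := by
    intro k
    rw [hcoef]
    split_ifs with h
    · by_cases hn : (k + m).toNat ∈ Finset.range (p.natDegree + 1)
      · exact Finset.single_le_sum (f := fun n => ‖p.coeff n‖) (fun _ _ => norm_nonneg _) hn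
      · rw [Polynomial.coeff_eq_zero_of_natDegree_lt (by simpa [Nat.lt_succ_iff] using hn), norm_zero]
        exact Finset.sum_nonneg fun _ _ => norm_nonneg _
    · rw [norm_zero]
      exact Finset.sum_nonneg fun _ _ => norm_nonneg _
  have hbd : ∀ c : ℤ → ℂ, Summable (fun k => c k * (ρ : ℂ) ^ k) → ∃ B, ∀ k, ‖c k‖ * ρ ^ k ≤ B := by
    intro c h
    refine ⟨∑' k, ‖c k * (ρ : ℂ) ^ k‖, fun k => ?_⟩
    have := h.norm.le_tsum k fun _ _ => norm_nonneg _
    simpa [abs_of_pos hρ0] using this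
  have hρn : ‖(ρ : ℂ)‖ = ρ := by simp [abs_of_pos hρ0]
  obtain ⟨B₁, hB₁⟩ := hbd b (hbs _ hρn).summable
  obtain ⟨B₂, hB₂⟩ := hbd c (hc _ hρn).summable
  obtain ⟨h1, h2⟩ := recurrence_bound one_pos hα0 hα1 hρ0 hρ1 hB₁
    (fun k => by simp only [he]; ring) he0 heE
  obtain ⟨h3, h4⟩ := recurrence_bound two_pos hβ0 hβ1 hρ0 hρ1 hB₂
    (fun k => by simp only [hb]; ring) h1 h2
  exact ⟨_, _, h3, h4⟩

end Laurent

end TripleQuad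
end

noncomputable section

namespace TripleQuad

section Levi

variable {F : Type*} [NontriviallyNormedField F]

theorem continuous_levi : Continuous (levi : Fˣ → Sp6 F) := by
  have h1 : Continuous fun a : Fˣ => (a : F) := Units.continuous_val
  have h2 : Continuous fun a : Fˣ => (a : F)⁻¹ := by
    have := Units.continuous_val.comp (continuous_inv (G := Fˣ))
    simpa [Function.comp_def] using this
  refine Continuous.subtype_mk (Continuous.matrix_fromBlocks (Continuous.matrix_diagonal ?_)
    continuous_const continuous_const (Continuous.matrix_diagonal ?_)) _
  · refine continuous_pi fun i => ?_
    fin_cases i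
    · exact h1
    · exact continuous_const
    · exact continuous_const
  · refine continuous_pi fun i => ?_
    fin_cases i
    · exact h2
    · exact continuous_const
    · exact continuous_const

theorem levi_mul (a b : Fˣ) : levi (a * b) = levi a * levi b := by
  apply Subtype.ext
  change fromBlocks _ _ _ _ = fromBlocks _ _ _ _ * fromBlocks _ _ _ _
  rw [fromBlocks_multiply]
  simp only [Matrix.mul_zero, Matrix.zero_mul, add_zero, zero_add, diagonal_mul_diagonal]
  congr 2
  · funext i
    fin_cases i <;> simp
  · funext i
    fin_cases i <;> simp [mul_comm]

theorem levi_one : levi (1 : Fˣ) = 1 := by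
  have h := levi_mul (1 : Fˣ) 1
  rw [mul_one] at h
  exact mul_left_cancel (h.symm.trans (mul_one _).symm)

theorem levi_inv (a : Fˣ) : levi a⁻¹ = (levi a)⁻¹ := by
  rw [eq_inv_iff_mul_eq_one, ← levi_mul, inv_mul_cancel, levi_one]

end Levi

section NonArchMellin

variable {F : Type*} [NontriviallyNormedField F] [ProperSpace F] [MeasurableSpace F] [BorelSpace F]

theorem exists_LNA_eq {ϖ : F} (hϖ : ϖ ≠ 0) (χ : Fˣ → ℂ) (h1 : χ (Units.mk0 ϖ hϖ) = 1) :
    ∃ ε : ℝ, 0 ≤ ε ∧ ε ≤ 1 ∧ ∀ s, LNA ϖ χ s = (1 - ε * (nabs ϖ : ℂ) ^ s)⁻¹ := by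
  by_cases h : ∀ u : Fˣ, ‖(u : F)‖ = 1 → χ u = 1
  · exact ⟨1, zero_le_one, le_rfl, fun s => by simp [LNA, hϖ, if_pos h, h1]⟩
  · exact ⟨0, le_rfl, zero_le_one, fun s => by simp [LNA, hϖ, if_neg h]⟩

theorem exists_cpow_eq {r : ℝ} (hr0 : 0 < r) (hr1 : r < 1) (σ : ℝ) {X : ℂ} (hX : ‖X‖ = r ^ σ) :
    ∃ s : ℂ, s.re = σ ∧ (r : ℂ) ^ s = X := by
  have hlog : Real.log r < 0 := Real.log_neg hr0 hr1
  have hX0 : X ≠ 0 := by rw [← norm_pos_iff, hX]; positivity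
  refine ⟨Complex.log X / (Real.log r : ℂ), ?_, ?_⟩
  · rw [Complex.div_ofReal_re, Complex.log_re, hX, Real.log_rpow hr0, mul_div_cancel_right₀ _ hlog.ne]
  · rw [Complex.cpow_def_of_ne_zero (by exact_mod_cast hr0.ne'), ← Complex.ofReal_log hr0.le,
      mul_div_cancel₀ _ (by exact_mod_cast hlog.ne), Complex.exp_log hX0]

theorem ofReal_zpow_cpow {r : ℝ} (hr : 0 < r) (k : ℤ) (s : ℂ) :
    ((r ^ k : ℝ) : ℂ) ^ s = ((r : ℂ) ^ s) ^ k := by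
  have h1 : ((r ^ k : ℝ) : ℂ) ≠ 0 := by exact_mod_cast (zpow_pos hr k).ne'
  rw [Complex.cpow_def_of_ne_zero h1, Complex.cpow_def_of_ne_zero (by exact_mod_cast hr.ne'),
    ← Complex.ofReal_log (zpow_pos hr k).le, ← Complex.ofReal_log hr.le, Real.log_zpow,
    ← Complex.exp_int_mul]
  push_cast
  congr 1
  ring

theorem mellinIntegrand_of_mem_shell {ϖ : F} (hϖ : ϖ ≠ 0) (f : Sp6 F → ℂ) (χ : Fˣ → ℂ) (s : ℂ) (g : Sp6 F)
    {k : ℤ} {a : Fˣ} (ha : a ∈ shell ϖ k) :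
    mellinIntegrand f χ s g a = (((nabs ϖ ^ k) ^ 2 : ℝ) : ℂ) * ((nabs ϖ : ℂ) ^ s) ^ k *
      (χ a * f ((levi a)⁻¹ * g)) := by
  rw [mellinIntegrand, nabs_of_mem_shell ha, ofReal_zpow_cpow (nabs_pos hϖ)]
  ring

theorem mellin_coeff_bounded {ϖ : F} (hϖ : IsUniformizer ϖ) {f : Sp6 F → ℂ} {χ : Fˣ →* ℂˣ}
    (hχ : χ (Units.mk0 ϖ hϖ.1) = 1) {σ : ℝ} (hconv : ConvergesRightOf f (fun a => (χ a : ℂ)) σ)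
    {g : Sp6 F} (hL : IsLaurentMultiple ϖ σ (aIdNA ϖ fun a => (χ a : ℂ))
      (fun s => mellin f (fun a => (χ a : ℂ)) s g)) :
    (∀ k, IntegrableOn (fun a => (χ a : ℂ) * f ((levi a)⁻¹ * g)) (shell ϖ k) (mulHaar F)) ∧
    ∃ (A : ℤ) (E : ℝ), (∀ k < A, ∫ a in shell ϖ k, (χ a : ℂ) * f ((levi a)⁻¹ * g) ∂(mulHaar F) = 0) ∧
      ∀ k, (nabs ϖ ^ k) ^ 2 * ‖∫ a in shell ϖ k, (χ a : ℂ) * f ((levi a)⁻¹ * g) ∂(mulHaar F)‖ ≤ E := by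
  have hr0 : 0 < nabs ϖ := nabs_pos hϖ.1
  have hr1 : nabs ϖ < 1 := nabs_lt_one_of_norm_lt hϖ.2.1
  have hrn : ∀ s : ℂ, (nabs ϖ : ℂ) ^ s ≠ 0 := fun s => by
    rw [Complex.cpow_ne_zero_iff]; left; exact_mod_cast hr0.ne'
  set σ' := max σ 0 + 1
  have hσ' : σ < σ' := (le_max_left _ _).trans_lt (lt_add_one _)
  have hσ0 : 0 ≤ σ' := add_nonneg (le_max_right _ _) zero_le_one
  set S : ℤ → ℂ := fun k => ∫ a in shell ϖ k, (χ a : ℂ) * f ((levi a)⁻¹ * g) ∂(mulHaar F) with hS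
  set c : ℤ → ℂ := fun k => (((nabs ϖ ^ k) ^ 2 : ℝ) : ℂ) * S k with hc
  have hsum : ∀ s : ℂ, σ < s.re → HasSum (fun k => c k * ((nabs ϖ : ℂ) ^ s) ^ k)
      (mellin f (fun a => (χ a : ℂ)) s g) := by
    intro s hs
    have h1 := hasSum_integral_iUnion (fun k => measurableSet_shell ϖ k) (disjoint_shell hϖ)
      (f := mellinIntegrand f (fun a => (χ a : ℂ)) s g) (μ := mulHaar F)
      (by rw [iUnion_shell hϖ]; exact (hconv s hs g).1.integrableOn)
    rw [iUnion_shell hϖ, setIntegral_univ] at h1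
    have e : (fun k => c k * ((nabs ϖ : ℂ) ^ s) ^ k) =
        fun k => ∫ a in shell ϖ k, mellinIntegrand f (fun a => (χ a : ℂ)) s g a ∂(mulHaar F) := by
      funext k
      rw [setIntegral_congr_fun (measurableSet_shell ϖ k) fun a ha =>
        mellinIntegrand_of_mem_shell hϖ.1 f _ s g ha, integral_const_mul]
      simp only [hc, hS]
      ring
    rw [e]
    exact h1
  obtain ⟨ε₁, hε₁0, hε₁1, hε₁⟩ := exists_LNA_eq hϖ.1 (fun a => (χ a : ℂ)) (by simp [hχ])
  obtain ⟨ε₂, hε₂0, hε₂1, hε₂⟩ := exists_LNA_eq hϖ.1 (fun a => (χ a : ℂ) ^ 2) (by simp [hχ])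
  obtain ⟨p, m, hp⟩ := hL
  have hlt : ∀ ε : ℝ, 0 ≤ ε → ε ≤ 1 → ε * nabs ϖ ^ 2 < 1 := fun ε h0 h1 =>
    (mul_le_of_le_one_left (by positivity) h1).trans_lt (pow_lt_one₀ hr0.le hr1 two_ne_zero)
  have hρ1 : nabs ϖ ^ σ' ≤ 1 := Real.rpow_le_one hr0.le hr1.le hσ0
  have hX : ∀ X : ℂ, ‖X‖ = nabs ϖ ^ σ' → ∃ s : ℂ, σ < s.re ∧ (nabs ϖ : ℂ) ^ s = X := by
    intro X hX
    obtain ⟨s, hs, hsX⟩ := exists_cpow_eq hr0 hr1 σ' hX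
    exact ⟨s, by rw [hs]; exact hσ', hsX⟩
  obtain ⟨A, E, hA, hE⟩ := laurent_coeff_bounded (c := c) (M := fun X => ∑' k, c k * X ^ k)
    (mul_nonneg hε₁0 (sq_nonneg (nabs ϖ))) (hlt _ hε₁0 hε₁1) (mul_nonneg hε₂0 (sq_nonneg (nabs ϖ)))
    (hlt _ hε₂0 hε₂1) (Real.rpow_pos_of_pos hr0 σ') hρ1 p m
    (fun X hXn => by
      obtain ⟨s, hs, rfl⟩ := hX X hXn
      exact (hsum s hs).summable.hasSum)
    (fun X hXn => by
      obtain ⟨s, hs, rfl⟩ := hX X hXn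
      have hn : ∀ (ε : ℝ) (j : ℕ), 0 ≤ ε → ε ≤ 1 →
          1 - ((ε * nabs ϖ ^ 2 : ℝ) : ℂ) * ((nabs ϖ : ℂ) ^ s) ^ j ≠ 0 := by
        intro ε j h0 h1 h
        have h2 : ‖((ε * nabs ϖ ^ 2 : ℝ) : ℂ) * ((nabs ϖ : ℂ) ^ s) ^ j‖ < 1 := by
          rw [norm_mul, norm_pow, hXn, Complex.norm_of_nonneg (by positivity)]
          exact (mul_le_of_le_one_right (by positivity) (pow_le_one₀ (by positivity) hρ1)).trans_lt
            (hlt ε h0 h1)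
        rw [← sub_eq_zero.mp h, norm_one] at h2
        exact lt_irrefl _ h2
      rw [(hsum s hs).tsum_eq]
      have h := hp s hs
      simp only at h
      have hc0 : (nabs ϖ : ℂ) ≠ 0 := by exact_mod_cast hr0.ne'
      have e1 : (nabs ϖ : ℂ) ^ (s + 2) = (nabs ϖ : ℂ) ^ 2 * (nabs ϖ : ℂ) ^ s := by
        rw [Complex.cpow_add _ _ hc0, mul_comm]
        norm_cast
      have e2 : (nabs ϖ : ℂ) ^ (2 * s + 2) = (nabs ϖ : ℂ) ^ 2 * ((nabs ϖ : ℂ) ^ s) ^ 2 := by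
        rw [Complex.cpow_add _ _ hc0, Complex.cpow_ofNat_mul, mul_comm]
        norm_cast
      have hn1 := hn ε₁ 1 hε₁0 hε₁1
      have hn2 := hn ε₂ 2 hε₂0 hε₂1
      rw [pow_one] at hn1
      rw [h, aIdNA, hε₁, hε₂, e1, e2]
      push_cast at hn1 hn2 ⊢
      rw [← mul_assoc (ε₁ : ℂ), ← mul_assoc (ε₂ : ℂ), mul_assoc _ (_ * _), mul_mul_mul_comm (_⁻¹),
        inv_mul_cancel₀ hn1, inv_mul_cancel₀ hn2, mul_one, mul_one])
  refine ⟨fun k => ?_, A, E, fun k hk => ?_, fun k => ?_⟩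
  · have h1 : IntegrableOn (mellinIntegrand f (fun a => (χ a : ℂ)) (σ' : ℂ) g) (shell ϖ k) (mulHaar F) :=
      (hconv (σ' : ℂ) (by simpa using hσ') g).1.integrableOn
    have h2 := h1.congr_fun (fun a ha => mellinIntegrand_of_mem_shell hϖ.1 f _ _ g ha)
      (measurableSet_shell ϖ k)
    rw [IntegrableOn, integrable_const_mul_iff] at h2
    · exact h2
    · refine (mul_ne_zero ?_ (zpow_ne_zero _ (hrn _))).isUnit
      exact_mod_cast (pow_pos (zpow_pos hr0 k) 2).ne'
  · have h1 := hA k hk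
    exact (mul_eq_zero.mp h1).resolve_left (by exact_mod_cast (pow_pos (zpow_pos hr0 k) 2).ne')
  · have h1 := hE k
    rwa [hc, norm_mul, Complex.norm_of_nonneg (by positivity)] at h1

theorem exists_schwartz_levi_le {ϖ : F} (hϖ : IsUniformizer ϖ) [IsUltrametricDist F] {f : Sp6 F → ℂ}
    (hf : IsSchwartzBKNA ϖ (sp6Int F) f) (g : Sp6 F) :
    ∃ C : ℝ, 0 ≤ C ∧ ∀ δ : Fˣ, ‖f (levi δ * g)‖ ≤ C * nabs (δ : F) ^ 2 ∧
      (f (levi δ * g) ≠ 0 → 1 ≤ C * nabs (δ : F)) := by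
  have hr0 : 0 < nabs ϖ := nabs_pos hϖ.1
  have hr1 : nabs ϖ < 1 := nabs_lt_one_of_norm_lt hϖ.2.1
  set φ : Fˣ → ℂ := fun a => f ((levi a)⁻¹ * g) with hφ
  let S : Subgroup Fˣ :=
    { carrier := {u | ‖(u : F)‖ = 1 ∧ ∀ a, φ (a * u) = φ a}
      mul_mem' := fun {u v} hu hv => ⟨by rw [Units.val_mul, norm_mul, hu.1, hv.1, mul_one],
        fun a => by rw [← mul_assoc, hv.2, hu.2]⟩
      one_mem' := ⟨by simp, by simp⟩
      inv_mem' := fun {u} hu => ⟨by rw [Units.val_inv_eq_inv_val, norm_inv, hu.1, inv_one],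
        fun a => by rw [← hu.2 (a * u⁻¹), inv_mul_cancel_right]⟩ }
  have hSopen : IsOpen (S : Set Fˣ) := by
    refine Subgroup.isOpen_of_mem_nhds (g := 1) S ?_
    have hc : Continuous fun u : Fˣ => g⁻¹ * (levi u⁻¹ * g) :=
      continuous_const.mul ((continuous_levi.comp continuous_inv).mul continuous_const)
    have h1 := hc.tendsto 1
    rw [inv_one, levi_one, one_mul, inv_mul_cancel] at h1
    have h2 := h1.eventually (eventually_translate_eq hf.smooth sp6Int_mem_nhds hf.kFinite)
    have h3 : ∀ᶠ u : Fˣ in nhds 1, ‖(u : F)‖ = 1 := by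
      have hc1 : Continuous fun u : Fˣ => (u : F) := Units.continuous_val
      have h4 := hc1.tendsto 1
      have h5 : ∀ᶠ u : Fˣ in nhds 1, (u : F) ∈ Metric.ball (1 : F) 1 :=
        h4 (Metric.ball_mem_nhds _ one_pos)
      filter_upwards [h5] with u hu
      rw [mem_ball_iff_norm] at hu
      have h6 : ‖((u : F) - 1) + 1‖ = max ‖(u : F) - 1‖ ‖(1 : F)‖ :=
        IsUltrametricDist.norm_add_eq_max_of_norm_ne_norm (by rw [norm_one]; exact hu.ne)
      rw [sub_add_cancel, norm_one, max_eq_right hu.le] at h6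
      exact h6
    filter_upwards [h2, h3] with u hu hu1
    refine ⟨hu1, fun a => ?_⟩
    have := hu ((levi a)⁻¹ * g)
    refine Eq.trans ?_ this
    simp only [hφ]
    rw [levi_mul, _root_.mul_inv_rev, levi_inv, mul_assoc (levi a)⁻¹, mul_inv_cancel_left, ← mul_assoc,
      ← levi_inv, ← levi_inv, ← levi_mul, ← levi_mul, mul_comm]
  obtain ⟨ι, _, χ, B, hB, hχ, hbd⟩ := exists_characters_bound hϖ hSopen (fun u hu => hu.1)
  have hbd := hbd φ (fun u hu a => hu.2 a)
  choose σ hσ using fun i => hf.excellent (χ i) (hχ i).1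
  have hcoef := fun i => mellin_coeff_bounded hϖ (hχ i).2 (hσ i).1 ((hσ i).2 g).1
  choose hint A E hA hE using hcoef
  have hE0 : ∀ i, 0 ≤ E i := fun i => le_trans (by positivity) (hE i 0)
  obtain ⟨A₀, hA₀⟩ : ∃ A₀ : ℤ, ∀ i, A₀ ≤ A i := by
    obtain ⟨A₀, hA₀⟩ := (Set.finite_range A).bddBelow
    exact ⟨A₀, fun i => hA₀ ⟨i, rfl⟩⟩
  have hδ : ∀ δ : Fˣ, f (levi δ * g) = φ δ⁻¹ := fun δ => by simp only [hφ]; rw [levi_inv, inv_inv]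
  refine ⟨max (B * ∑ i, E i) (nabs ϖ ^ A₀), le_max_of_le_right (by positivity), fun δ => ?_⟩
  obtain ⟨k, hk⟩ := exists_mem_shell hϖ δ⁻¹
  have hb := hbd k (fun i => hint i k) δ⁻¹ hk
  have hnk : nabs ϖ ^ k = (nabs (δ : F))⁻¹ := by
    rw [← nabs_of_mem_shell hk, Units.val_inv_eq_inv_val, nabs_inv]
  have hδ0 : 0 < nabs (δ : F) := nabs_pos δ.ne_zero
  rw [hδ]
  constructor
  · calc ‖φ δ⁻¹‖ ≤ B * ∑ i, ‖∫ b in shell ϖ k, (χ i b : ℂ) * φ b ∂(mulHaar F)‖ := hb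
      _ ≤ B * ∑ i, E i * nabs (δ : F) ^ 2 := by
        gcongr with i
        have := hE i k
        rw [hnk, inv_pow, inv_mul_le_iff₀ (by positivity)] at this
        rw [mul_comm]
        exact this
      _ = (B * ∑ i, E i) * nabs (δ : F) ^ 2 := by rw [← Finset.sum_mul, mul_assoc]
      _ ≤ _ := by gcongr; exact le_max_left _ _
  · intro hne
    have hkA : A₀ ≤ k := by
      by_contra hlt
      push Not at hlt
      apply hne
      rw [← norm_le_zero_iff]
      refine hb.trans (le_of_eq ?_)
      rw [Finset.sum_eq_zero, mul_zero]
      intro i _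
      rw [hA i k (hlt.trans_le (hA₀ i)), norm_zero]
    have h1 : nabs ϖ ^ k ≤ nabs ϖ ^ A₀ := zpow_le_zpow_right_of_le_one₀ hr0 hr1.le hkA
    rw [hnk, inv_le_iff_one_le_mul₀ hδ0] at h1
    exact h1.trans (mul_le_mul_of_nonneg_right (le_max_right _ _) hδ0.le)

theorem exists_schwartz_levi_uniform {ϖ : F} (hϖ : IsUniformizer ϖ) [IsUltrametricDist F]
    {f : Sp6 F → ℂ} (hf : IsSchwartzBKNA ϖ (sp6Int F) f) :
    ∃ C : ℝ, 0 ≤ C ∧ ∀ (δ : Fˣ), ∀ w ∈ sp6Int F, ‖f (levi δ * w)‖ ≤ C * nabs (δ : F) ^ 2 ∧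
      (f (levi δ * w) ≠ 0 → 1 ≤ C * nabs (δ : F)) := by
  obtain ⟨t, B, hB, -, ht⟩ := exists_norm_translate_le hf.smooth.continuous isCompact_sp6Int hf.kFinite
  choose C hC hCl using fun l => exists_schwartz_levi_le hϖ hf l
  have hsum : 0 ≤ ∑ l ∈ t, C l := Finset.sum_nonneg fun l _ => hC l
  refine ⟨max B 1 * ∑ l ∈ t, C l, by positivity, fun δ w hw => ⟨?_, fun hne => ?_⟩⟩
  · calc _ ≤ B * ∑ l ∈ t, ‖f (levi δ * l)‖ := ht w hw _
      _ ≤ max B 1 * ∑ l ∈ t, C l * nabs (δ : F) ^ 2 := by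
        refine mul_le_mul (le_max_left _ _) (Finset.sum_le_sum fun l _ => (hCl l δ).1)
          (Finset.sum_nonneg fun _ _ => norm_nonneg _) (by positivity)
      _ = _ := by rw [← Finset.sum_mul, mul_assoc]
  · have hex : ∃ l ∈ t, f (levi δ * l) ≠ 0 := by
      by_contra hall
      push Not at hall
      apply hne
      rw [← norm_le_zero_iff]
      refine (ht w hw _).trans (le_of_eq ?_)
      rw [Finset.sum_eq_zero fun l hl => by rw [hall l hl, norm_zero], mul_zero]
    obtain ⟨l, hl, hlne⟩ := hex
    refine ((hCl l δ).2 hlne).trans (mul_le_mul_of_nonneg_right ?_ (nabs_nonneg _))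
    calc C l ≤ ∑ l ∈ t, C l := Finset.single_le_sum (fun l _ => hC l) hl
      _ ≤ _ := le_mul_of_one_le_left hsum (le_max_right _ _)

end NonArchMellin

end TripleQuad
end

noncomputable section

namespace TripleQuad

section RealBounds

theorem exists_pow_le_of_chart {u₀ u₁ u₂ τ D : ℝ} (h₀ : 0 < u₀) (h₁ : 0 < u₁) (h₂ : 0 < u₂)
    (hτ : τ ≤ D) (hD₀ : u₀ ^ 2 ≤ D) (hD₁ : u₁ ^ 2 ≤ D) (hD₂ : u₂ ^ 2 ≤ D) (n : ℕ) :
    ∃ B, 0 < B ∧ B ≤ u₀ ∧ B ≤ u₁ ∧ B ≤ u₂ ∧ B * u₀ ≤ u₁ * u₂ ∧ ∃ k ∈ ({2, n + 2, n + 6} : Set ℕ),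
      (u₀ * u₁ * u₂ / D) ^ k ≤ (u₀ * u₁ * u₂) ^ 2 * ((max 1 τ) ^ 2)⁻¹ * (min 1 B) ^ n := by
  set A := u₀ * u₁ * u₂ with hA
  have hA0 : 0 < A := by positivity
  set M := max u₀ (max u₁ u₂)
  have hM0 : u₀ ≤ M := le_max_left _ _
  have hM1 : u₁ ≤ M := (le_max_left _ _).trans (le_max_right _ _)
  have hM2 : u₂ ≤ M := (le_max_right _ _).trans (le_max_right _ _)
  have hM : 0 < M := h₀.trans_le hM0
  have hDM : M ^ 2 ≤ D := by
    rcases max_choice u₀ (max u₁ u₂) with h | h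
    · rw [show M = u₀ from h]; exact hD₀
    · rcases max_choice u₁ u₂ with h' | h'
      · rw [show M = u₁ from h.trans h']; exact hD₁
      · rw [show M = u₂ from h.trans h']; exact hD₂
  have hDpos : 0 < D := (pow_pos hM 2).trans_le hDM
  have h12 : u₁ * u₂ ≤ M ^ 2 := by rw [sq]; exact mul_le_mul hM1 hM2 h₂.le hM.le
  have h01 : u₀ * u₁ ≤ M ^ 2 := by rw [sq]; exact mul_le_mul hM0 hM1 h₁.le hM.le
  have h02 : u₀ * u₂ ≤ M ^ 2 := by rw [sq]; exact mul_le_mul hM0 hM2 h₂.le hM.le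
  have h00 : u₀ * u₀ ≤ M ^ 2 := by rw [sq]; exact mul_le_mul hM0 hM0 h₀.le hM.le
  have hM2pos : 0 < M ^ 2 := by positivity
  have hB0 : A / M ^ 2 ≤ u₀ := by
    rw [div_le_iff₀ hM2pos]; nlinarith [mul_le_mul_of_nonneg_left h12 h₀.le]
  have hB1 : A / M ^ 2 ≤ u₁ := by
    rw [div_le_iff₀ hM2pos]; nlinarith [mul_le_mul_of_nonneg_left h02 h₁.le]
  have hB2 : A / M ^ 2 ≤ u₂ := by
    rw [div_le_iff₀ hM2pos]; nlinarith [mul_le_mul_of_nonneg_left h01 h₂.le]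
  refine ⟨A / M ^ 2, by positivity, hB0, hB1, hB2, ?_, ?_⟩
  · rw [div_mul_eq_mul_div, div_le_iff₀ hM2pos]
    nlinarith [mul_le_mul_of_nonneg_left h00 (mul_pos h₁ h₂).le]
  set B := A / M ^ 2 with hB
  have hBpos : 0 < B := by positivity
  have hBM : B ≤ M := hB0.trans hM0
  set X := A / D with hX
  have hX0 : 0 < X := by positivity
  have hXB : X ≤ B := div_le_div_of_nonneg_left hA0.le hM2pos hDM
  have hXτ : 0 < τ → X ≤ A / τ := fun h => div_le_div_of_nonneg_left hA0.le h hτ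
  have hmax : 0 < max 1 τ := lt_max_of_lt_left one_pos
  have hsq : X ≤ A / max 1 τ → X ^ 2 ≤ A ^ 2 * ((max 1 τ) ^ 2)⁻¹ := by
    intro h
    rw [← div_eq_mul_inv, ← div_pow]
    exact pow_le_pow_left₀ hX0.le h 2
  rcases le_total 1 B with hB1' | hB1'
  · refine ⟨2, by simp, ?_⟩
    rw [min_eq_left hB1', one_pow, mul_one]
    refine hsq (div_le_div_of_nonneg_left hA0.le hmax (max_le ?_ hτ))
    exact (one_le_pow₀ (hB1'.trans hBM)).trans hDM
  · rw [min_eq_right hB1']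
    have hpow : X ≤ A / max 1 τ → X ^ (n + 2) ≤ A ^ 2 * ((max 1 τ) ^ 2)⁻¹ * B ^ n := by
      intro h
      rw [pow_add, mul_comm]
      exact mul_le_mul (hsq h) (pow_le_pow_left₀ hX0.le hXB n) (by positivity) (by positivity)
    rcases le_total 1 M with hM1' | hM1'
    · refine ⟨n + 2, by simp, hpow (div_le_div_of_nonneg_left hA0.le hmax (max_le ?_ hτ))⟩
      exact (one_le_pow₀ hM1').trans hDM
    · rcases le_total 1 τ with hτ1 | hτ1
      · refine ⟨n + 2, by simp, hpow ?_⟩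
        rw [max_eq_right hτ1]
        exact hXτ (one_pos.trans_le hτ1)
      · refine ⟨n + 6, by simp, ?_⟩
        rw [max_eq_left hτ1, one_pow, inv_one, mul_one]
        have hAM : A ≤ M ^ 3 := by
          calc A = u₀ * u₁ * u₂ := hA
            _ ≤ M ^ 2 * M := mul_le_mul h01 hM2 h₂.le hM2pos.le
            _ = M ^ 3 := by ring
        have hB6 : B ^ 6 ≤ A ^ 2 := by
          rw [hB, div_pow, div_le_iff₀ (by positivity)]
          calc A ^ 6 = A ^ 2 * A ^ 4 := by ring
            _ ≤ A ^ 2 * (M ^ 3) ^ 4 := by gcongr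
            _ = _ := by ring
        calc X ^ (n + 6) ≤ B ^ (n + 6) := pow_le_pow_left₀ hX0.le hXB _
          _ = B ^ 6 * B ^ n := by ring
          _ ≤ _ := by gcongr

theorem scaled_weight_le {R x e : ℝ} (hR : 0 < R) (hx : 0 ≤ x) (he : 0 < e) {N m : ℕ}
    (hm : 2 + e + N ≤ m) :
    (R * x) ^ (-(2 + e)) * ((max 1 (R * x)) ^ N)⁻¹ * ((1 + R / (R * x)) ^ m)⁻¹ ≤
      R ^ (-(2 + e)) * ((max 1 R) ^ N)⁻¹ * (max 1 x) ^ (-(2 + e)) := by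
  rcases hx.eq_or_lt with rfl | hx
  · rw [mul_zero, Real.zero_rpow (by linarith), zero_mul, zero_mul]
    positivity
  have hdiv : R / (R * x) = x⁻¹ := by field_simp
  rw [hdiv, Real.mul_rpow hR.le hx.le]
  have h1 : max 1 R ≤ max 1 (R * x) * (1 + x⁻¹) := by
    have hxi : 0 < x⁻¹ := inv_pos.mpr hx
    refine max_le ?_ ?_
    · nlinarith [le_max_left 1 (R * x)]
    · calc R = R * x * x⁻¹ := by field_simp
        _ ≤ max 1 (R * x) * (1 + x⁻¹) := mul_le_mul (le_max_right _ _) (by linarith) hxi.le (by positivity)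
  have h2 : ((max 1 (R * x)) ^ N)⁻¹ ≤ ((max 1 R) ^ N)⁻¹ * (1 + x⁻¹) ^ N := by
    rw [inv_mul_eq_div, le_div_iff₀ (by positivity), inv_mul_le_iff₀ (by positivity), ← mul_pow]
    exact pow_le_pow_left₀ (by positivity) h1 N
  have hNm : N ≤ m := by
    have : (N : ℝ) ≤ m := by linarith
    exact_mod_cast this
  have h3 : x ^ (-(2 + e)) * ((1 + x⁻¹) ^ (m - N))⁻¹ ≤ (max 1 x) ^ (-(2 + e)) := by
    rcases le_total 1 x with h | h
    · rw [max_eq_right h]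
      refine mul_le_of_le_one_right (by positivity) (inv_le_one_of_one_le₀ (one_le_pow₀ ?_))
      have : 0 < x⁻¹ := inv_pos.mpr hx
      linarith
    · rw [max_eq_left h, Real.one_rpow, ← div_eq_mul_inv, div_le_one (by positivity)]
      calc x ^ (-(2 + e)) = x⁻¹ ^ (2 + e) := by rw [Real.rpow_neg hx.le, Real.inv_rpow hx.le]
        _ ≤ x⁻¹ ^ ((m - N : ℕ) : ℝ) := by
          refine Real.rpow_le_rpow_of_exponent_le ((one_le_inv₀ hx).mpr h) ?_
          rw [Nat.cast_sub hNm]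
          linarith
        _ = x⁻¹ ^ (m - N) := Real.rpow_natCast _ _
        _ ≤ _ := by gcongr; linarith
  have hp : 0 < (1 + x⁻¹) ^ N := by positivity
  calc R ^ (-(2 + e)) * x ^ (-(2 + e)) * ((max 1 (R * x)) ^ N)⁻¹ * ((1 + x⁻¹) ^ m)⁻¹
      ≤ R ^ (-(2 + e)) * x ^ (-(2 + e)) * (((max 1 R) ^ N)⁻¹ * (1 + x⁻¹) ^ N) * ((1 + x⁻¹) ^ m)⁻¹ := by
        gcongr
    _ = R ^ (-(2 + e)) * ((max 1 R) ^ N)⁻¹ * (x ^ (-(2 + e)) * ((1 + x⁻¹) ^ (m - N))⁻¹) := by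
        rw [← Nat.sub_add_cancel hNm, pow_add, mul_inv, Nat.add_sub_cancel]
        field_simp
    _ ≤ _ := by gcongr

theorem scaled_min_weight_le {s x e : ℝ} (hs : 0 < s) (hx : 0 ≤ x) (he : 0 < e) {n : ℕ}
    (hn : 2 + e ≤ n) :
    (s⁻¹ * x) ^ (-(2 + e)) * (min 1 (s * (s⁻¹ * x))) ^ n ≤ s ^ (2 + e) * (max 1 x) ^ (-(2 + e)) := by
  rcases hx.eq_or_lt with rfl | hx
  · rw [mul_zero, Real.zero_rpow (by linarith), zero_mul]
    positivity
  rw [mul_inv_cancel_left₀ hs.ne', Real.mul_rpow (by positivity) hx.le, Real.inv_rpow hs.le,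
    ← Real.rpow_neg hs.le, neg_neg, mul_assoc]
  refine mul_le_mul_of_nonneg_left ?_ (by positivity)
  rcases le_total 1 x with h | h
  · rw [max_eq_right h, min_eq_left h, one_pow, mul_one]
  · rw [max_eq_left h, min_eq_right h, Real.one_rpow, Real.rpow_neg hx.le, inv_mul_le_iff₀ (by positivity),
      mul_one, ← Real.rpow_natCast]
    exact Real.rpow_le_rpow_of_exponent_ge hx h hn

end RealBounds

section PlaneIntegrals

variable {F : Type*} [NontriviallyNormedField F] [ProperSpace F] [MeasurableSpace F] [BorelSpace F]

theorem measurable_big : Measurable (big : F × F → F) :=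
  Measurable.ite (measurableSet_le measurable_snd.norm measurable_fst.norm) measurable_fst measurable_snd

theorem measurable_nabs_big : Measurable fun p : F × F => nabs (big p) :=
  measurable_nabs.comp measurable_big

theorem nabs_big_eq_max (p : F × F) : nabs (big p) = max (nabs p.1) (nabs p.2) := by
  rw [big]
  split_ifs with h
  · rw [max_eq_left (nabs_le_of_norm_le h)]
  · rw [max_eq_right (nabs_le_of_norm_le (not_le.mp h).le)]

variable (F) in
/-- Haar measure on the plane. -/
def planeHaar : Measure (F × F) := (Measure.addHaar : Measure F).prod Measure.addHaar

instance : SigmaFinite (planeHaar F) := by unfold planeHaar; infer_instance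

theorem lintegral_plane_lt_top {e : ℝ} (he : 0 < e) :
    ∫⁻ p, ENNReal.ofReal ((max 1 (nabs (big p))) ^ (-(2 + e))) ∂(planeHaar F) < ⊤ := by
  have hq : 1 < 1 + e / 2 := by linarith
  have h1 := lintegral_max_one_rpow_lt_top (Measure.addHaar : Measure F) hq
  have hm : Measurable fun x : F => ENNReal.ofReal ((max 1 (nabs x)) ^ (-(1 + e / 2))) :=
    ((measurable_const.max measurable_nabs).pow_const _).ennreal_ofReal
  calc ∫⁻ p, ENNReal.ofReal ((max 1 (nabs (big p))) ^ (-(2 + e))) ∂(planeHaar F)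
      ≤ ∫⁻ p : F × F, ENNReal.ofReal ((max 1 (nabs p.1)) ^ (-(1 + e / 2))) *
          ENNReal.ofReal ((max 1 (nabs p.2)) ^ (-(1 + e / 2))) ∂(planeHaar F) := by
        refine lintegral_mono fun p => ?_
        rw [← ENNReal.ofReal_mul (by positivity)]
        refine ENNReal.ofReal_le_ofReal ?_
        rw [show -(2 + e) = -(1 + e / 2) + -(1 + e / 2) by ring, Real.rpow_add (by positivity), nabs_big_eq_max]
        refine mul_le_mul ?_ ?_ (by positivity) (by positivity)
        · exact Real.rpow_le_rpow_of_nonpos (by positivity) (max_le_max le_rfl (le_max_left _ _)) (by linarith)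
        · exact Real.rpow_le_rpow_of_nonpos (by positivity) (max_le_max le_rfl (le_max_right _ _)) (by linarith)
    _ = _ := lintegral_prod_mul hm.aemeasurable hm.aemeasurable
    _ < ⊤ := ENNReal.mul_lt_top h1 h1

theorem lintegral_plane_scale {b : F} (hb : b ≠ 0) {e c : ℝ} (hc : 0 ≤ c) {G : ℝ → ℝ≥0∞}
    (hGm : Measurable G)
    (hG : ∀ x, 0 ≤ x → G (nabs b * x) ≤ ENNReal.ofReal (c * (max 1 x) ^ (-(2 + e)))) :
    ∫⁻ p, G (nabs (big p)) ∂(planeHaar F) ≤ ENNReal.ofReal (nabs b ^ 2 * c) *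
      ∫⁻ p, ENNReal.ofReal ((max 1 (nabs (big p))) ^ (-(2 + e))) ∂(planeHaar F) := by
  have hb0 := nabs_pos hb
  have h1 := lintegral_prod_mul_left_addHaar (Measure.addHaar : Measure F) hb
    (φ := fun p => G (nabs (big p))) (hGm.comp measurable_nabs_big)
  have h2 : ∀ p : F × F, nabs (big (b * p.1, b * p.2)) = nabs b * nabs (big p) := fun p => by
    rw [nabs_big_eq_max, nabs_big_eq_max, nabs_mul, nabs_mul, mul_max_of_nonneg _ _ hb0.le]
  have h3 : ∫⁻ p, G (nabs (big p)) ∂(planeHaar F) =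
      ENNReal.ofReal (nabs b ^ 2) * ∫⁻ p, G (nabs b * nabs (big p)) ∂(planeHaar F) := by
    simp only [h2] at h1
    rw [planeHaar, h1, ← mul_assoc, ← ENNReal.ofReal_mul (by positivity), ← mul_pow,
      mul_inv_cancel₀ hb0.ne', one_pow, ENNReal.ofReal_one, one_mul]
  rw [h3, ENNReal.ofReal_mul (by positivity), mul_assoc]
  gcongr
  rw [← lintegral_const_mul' _ _ ENNReal.ofReal_ne_top]
  refine lintegral_mono fun p => (hG _ (nabs_nonneg _)).trans ?_
  rw [ENNReal.ofReal_mul hc]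

/-- The weight whose integral over the plane gives the decay in one variable. -/
def planeWeight (e : ℝ) (N m : ℕ) (R x : ℝ) : ℝ :=
  x ^ (-(2 + e)) * ((max 1 x) ^ N)⁻¹ * ((1 + R / x) ^ m)⁻¹

theorem measurable_planeWeight (e : ℝ) (N m : ℕ) (R : ℝ) : Measurable (planeWeight e N m R) := by
  have h1 : Measurable fun x : ℝ => x ^ (-(2 + e)) := measurable_id.pow_const _
  unfold planeWeight
  fun_prop

theorem planeWeight_nonneg {e : ℝ} {N m : ℕ} {R x : ℝ} (hR : 0 ≤ R) (hx : 0 ≤ x) :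
    0 ≤ planeWeight e N m R x := by unfold planeWeight; positivity

theorem lintegral_planeWeight_le {e : ℝ} (he : 0 < e) {N m : ℕ} (hm : 2 + e + N ≤ m) {b : F} (hb : b ≠ 0) :
    ∫⁻ p, ENNReal.ofReal (planeWeight e N m (nabs b) (nabs (big p))) ∂(planeHaar F) ≤
      ENNReal.ofReal (nabs b ^ (-e) * ((max 1 (nabs b)) ^ N)⁻¹) *
      ∫⁻ p, ENNReal.ofReal ((max 1 (nabs (big p))) ^ (-(2 + e))) ∂(planeHaar F) := by
  have hb0 := nabs_pos hb
  refine (lintegral_plane_scale hb (c := nabs b ^ (-(2 + e)) * ((max 1 (nabs b)) ^ N)⁻¹) (by positivity)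
    (measurable_planeWeight e N m (nabs b)).ennreal_ofReal
    fun x hx => ENNReal.ofReal_le_ofReal (scaled_weight_le hb0 hx he hm)).trans (le_of_eq ?_)
  congr 2
  rw [← mul_assoc, ← Real.rpow_natCast, ← Real.rpow_add hb0]
  congr 2
  push_cast
  ring

theorem lintegral_min_weight_le {e : ℝ} (he : 0 < e) {n : ℕ} (hn : 2 + e ≤ n) {b : F} (hb : b ≠ 0) :
    ∫⁻ p, ENNReal.ofReal (nabs (big p) ^ (-(2 + e)) * (min 1 ((nabs b)⁻¹ * nabs (big p))) ^ n) ∂(planeHaar F) ≤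
      ENNReal.ofReal (nabs b ^ (-e)) *
      ∫⁻ p, ENNReal.ofReal ((max 1 (nabs (big p))) ^ (-(2 + e))) ∂(planeHaar F) := by
  have hb0 := nabs_pos hb
  have hGm : Measurable fun x : ℝ => ENNReal.ofReal (x ^ (-(2 + e)) * (min 1 ((nabs b)⁻¹ * x)) ^ n) := by
    have h1 : Measurable fun x : ℝ => x ^ (-(2 + e)) := measurable_id.pow_const _
    fun_prop
  refine (lintegral_plane_scale hb (e := e) (c := (nabs b)⁻¹ ^ (2 + e)) (by positivity) hGm
    fun x hx => ENNReal.ofReal_le_ofReal ?_).trans (le_of_eq ?_)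
  · have := scaled_min_weight_le (inv_pos.mpr hb0) hx he hn
    rwa [inv_inv] at this
  congr 2
  rw [Real.inv_rpow hb0.le, ← Real.rpow_neg hb0.le, ← Real.rpow_natCast, ← Real.rpow_add hb0]
  congr 1
  push_cast
  ring

theorem lintegral_pi_three {X : Type*} [MeasurableSpace X] (μ : Measure X) [SigmaFinite μ]
    {G : X → X → X → ℝ≥0∞} (hG : Measurable fun q : X × X × X => G q.1 q.2.1 q.2.2) :
    ∫⁻ p : Fin 3 → X, G (p 0) (p 1) (p 2) ∂(Measure.pi fun _ => μ) =
      ∫⁻ y, ∫⁻ z, ∫⁻ x, G x y z ∂μ ∂μ ∂μ := by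
  have h1 := measurePreserving_piFinSuccAbove (fun _ : Fin 3 => μ) 0
  have h2 := measurePreserving_piFinTwo (fun _ : Fin 2 => μ)
  have h3 := (MeasurePreserving.id μ).prod h2
  have e1 : ∀ p : Fin 3 → X, G (p 0) (p 1) (p 2) =
      (fun q : X × X × X => G q.1 q.2.1 q.2.2) ((Prod.map id (MeasurableEquiv.piFinTwo fun _ => X))
        (MeasurableEquiv.piFinSuccAbove (fun _ => X) 0 p)) := fun p => rfl
  simp only [e1]
  refine ((h3.comp h1).lintegral_comp hG).trans ?_
  rw [lintegral_prod_symm _ hG.aemeasurable]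
  have hGz : Measurable fun q : X × X => ∫⁻ x, G x q.1 q.2 ∂μ := by
    have := hG.comp (measurable_swap (α := X × X) (β := X))
    exact this.lintegral_prod_right'
  exact lintegral_prod _ hGz.aemeasurable

end PlaneIntegrals

end TripleQuad
end

noncomputable section

namespace TripleQuad

section MainEstimate

variable {F : Type*} [NontriviallyNormedField F] [ProperSpace F] [CharZero F] [MeasurableSpace F] [BorelSpace F]
variable {d : Fin 3 → ℕ}

/-- Decay of `f` along the Levi subgroup, uniformly on a set of representatives of the cosets. -/
def LeviDecay (f : Sp6 F → ℂ) : Prop :=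
  ∀ n : ℕ, 2 ≤ n → ∃ C : ℝ, 0 ≤ C ∧ ∀ (δ : Fˣ) (Z : Matrix (Fin 3) (Fin 3) F) (hZ : Z.IsSymm) (k : G F),
    (∀ i j, ‖Z i j‖ ≤ 1) → (∀ i j l, ‖k i j l‖ ≤ 1) →
      ‖f (levi δ * (lowerUnip Z hZ * embG F k))‖ ≤ C * nabs (δ : F) ^ n

/-- Decay of the Weil representation. -/
def WeilDecay (ψ : AddChar F Circle) (J : ∀ i, Matrix (Fin (d i)) (Fin (d i)) F) (f : V F d → ℂ) : Prop :=
  ∀ m : ℕ, ∃ C : ℝ, 0 ≤ C ∧ ∀ g : G F, (∀ i, g i 1 0 ≠ 0) → ∀ v, ‖weil ψ J g f v‖ ≤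
    C * ∏ i, ((nabs (big (rowSL (g i)))) ^ (-((d i : ℝ) / 2)) *
      ((1 + vabs (v i) / nabs (big (rowSL (g i)))) ^ m)⁻¹)

theorem exists_norm_gamma0_le {f : Sp6 F → ℂ} (hX : IsFunctionOnX f) (hf : LeviDecay f) (n : ℕ) :
    ∃ C : ℝ, 0 ≤ C ∧ ∀ g : G F, ∃ B : ℝ, 0 < B ∧
      (∀ i, B ≤ (nabs (big (rowSL (g i))))⁻¹) ∧
      B ≤ nabs (big (rowSL (g 0))) * (nabs (big (rowSL (g 1))) * nabs (big (rowSL (g 2))))⁻¹ ∧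
      ‖f (gamma0 F * embG F g)‖ ≤ C * (((max 1 (nabs (∑ i, unipCoord (g i)))) ^ 2)⁻¹ *
        ((∏ i, (nabs (big (rowSL (g i))))⁻¹) ^ 2 * (min 1 B) ^ n)) := by
  obtain ⟨C₁, hC₁, h1⟩ := hf 2 le_rfl
  obtain ⟨C₂, hC₂, h2⟩ := hf (n + 2) (by omega)
  obtain ⟨C₃, hC₃, h3⟩ := hf (n + 6) (by omega)
  refine ⟨C₁ + C₂ + C₃, by positivity, fun g => ?_⟩
  obtain ⟨p, hp, δ, D, Z, hZ, k, hdec, hZ1, hk1, hδ, hT, ha⟩ := exists_gamma0_decomp g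
  set r : Fin 3 → ℝ := fun i => nabs (big (rowSL (g i))) with hr
  have hr0 : ∀ i, 0 < r i := fun i => nabs_pos (big_ne_zero (rowSL_ne_zero _))
  have hu : ∀ i, nabs (diagCoord (g i) : F) = (r i)⁻¹ := fun i => by rw [diagCoord_val, nabs_inv]
  have hnδ : nabs (δ : F) = (r 0)⁻¹ * (r 1)⁻¹ * (r 2)⁻¹ / nabs (D : F) := by
    have : nabs (((∏ i, diagCoord (g i)) * D⁻¹ : Fˣ) : F) = (r 0)⁻¹ * (r 1)⁻¹ * (r 2)⁻¹ / nabs (D : F) := by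
      rw [Units.val_mul, nabs_mul, Units.coe_prod, nabs_prod, Fin.prod_univ_three, hu, hu, hu,
        Units.val_inv_eq_inv_val, nabs_inv, div_eq_mul_inv]
    rcases hδ with rfl | rfl
    · exact this
    · rw [Units.val_neg, nabs_neg]
      exact this
  have ha' : ∀ i, (r i)⁻¹ ^ 2 ≤ nabs (D : F) := fun i => by
    have := nabs_le_of_norm_le (ha i)
    rwa [Units.val_pow_eq_pow_val, nabs_pow, hu] at this
  obtain ⟨B, hB, hB0, hB1, hB2, hB3, l, hl, hle⟩ := exists_pow_le_of_chart (inv_pos.mpr (hr0 0))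
    (inv_pos.mpr (hr0 1)) (inv_pos.mpr (hr0 2)) (nabs_le_of_norm_le hT) (ha' 0) (ha' 1) (ha' 2) n
  refine ⟨B, hB, fun i => ?_, ?_, ?_⟩
  · fin_cases i
    · exact hB0
    · exact hB1
    · exact hB2
  · rw [← le_div_iff₀ (inv_pos.mpr (hr0 0)), div_inv_eq_mul, ← mul_inv, mul_comm] at hB3
    exact hB3
  · rw [hdec, hX p hp]
    have hY : 0 ≤ nabs (δ : F) ^ l := pow_nonneg (nabs_nonneg _) l
    have hb : ‖f (levi δ * (lowerUnip Z hZ * embG F k))‖ ≤ (C₁ + C₂ + C₃) * nabs (δ : F) ^ l := by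
      rcases hl with rfl | rfl | hl
      · exact (h1 δ Z hZ k hZ1 hk1).trans (mul_le_mul_of_nonneg_right (by linarith) hY)
      · exact (h2 δ Z hZ k hZ1 hk1).trans (mul_le_mul_of_nonneg_right (by linarith) hY)
      · rw [Set.mem_singleton_iff] at hl
        subst hl
        exact (h3 δ Z hZ k hZ1 hk1).trans (mul_le_mul_of_nonneg_right (by linarith) hY)
    refine hb.trans (mul_le_mul_of_nonneg_left ?_ (by positivity))
    rw [hnδ, Fin.prod_univ_three]
    refine hle.trans (le_of_eq ?_)
    ring

theorem min_one_le_inv_max {B r : ℝ} (h : B ≤ r⁻¹) : min 1 B ≤ (max 1 r)⁻¹ := by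
  rcases le_total 1 r with h1 | h1
  · rw [max_eq_right h1]
    exact (min_le_right _ _).trans h
  · rw [max_eq_left h1, inv_one]
    exact min_le_left _ _

theorem inv_sq_mul_rpow {r e : ℝ} (hr : 0 < r) : r⁻¹ ^ 2 * r ^ (-e) = r ^ (-(2 + e)) := by
  rw [inv_pow, ← Real.rpow_natCast, ← Real.rpow_neg hr.le, ← Real.rpow_add hr]
  congr 1
  push_cast
  ring

theorem lintegral_max_one_sq_lt_top :
    ∫⁻ t : F, ENNReal.ofReal (((max 1 (nabs t)) ^ 2)⁻¹) ∂Measure.addHaar < ⊤ := by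
  have := lintegral_max_one_rpow_lt_top (Measure.addHaar : Measure F) (q := 2) (by norm_num)
  refine lt_of_le_of_lt (lintegral_mono fun t => ENNReal.ofReal_le_ofReal (le_of_eq ?_)) this
  rw [Real.rpow_neg (by positivity)]
  norm_cast

theorem exists_lintegral_quotient_le {μG : Measure (G F)} [μG.IsHaarMeasure] {μN : Measure (N0 F)}
    [μN.IsHaarMeasure] {μ : Measure (N0G F)} (hμ : IsQuotientMeasure μG μN μ) :
    ∃ C : ℝ≥0∞, C ≠ ⊤ ∧ ∀ (h : N0G F → ℝ≥0∞) (c : ℝ) (w : F × F → F × F → F × F → ℝ≥0∞), 0 ≤ c →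
      (Measurable fun q : (F × F) × (F × F) × (F × F) => w q.1 q.2.1 q.2.2) →
      (∀ x : N0G F, (∀ i, x.out i 1 0 ≠ 0) →
        h x ≤ ENNReal.ofReal (c * ((max 1 (nabs (∑ i, unipCoord (x.out i)))) ^ 2)⁻¹) *
          w (rowSL (x.out 0)) (rowSL (x.out 1)) (rowSL (x.out 2))) →
      ∫⁻ x, h x ∂μ ≤ C * ENNReal.ofReal c *
        ∫⁻ y, ∫⁻ z, ∫⁻ x, w x y z ∂(planeHaar F) ∂(planeHaar F) ∂(planeHaar F) := by
  obtain ⟨C, hC, h1⟩ := lintegral_quotient_le hμ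
  refine ⟨C * ∫⁻ t : F, ENNReal.ofReal (((max 1 (nabs t)) ^ 2)⁻¹) ∂Measure.addHaar,
    ENNReal.mul_ne_top hC lintegral_max_one_sq_lt_top.ne, fun h c w hc hw hle => ?_⟩
  have hmt : Measurable fun t : F => ENNReal.ofReal (c * ((max 1 (nabs t)) ^ 2)⁻¹) :=
    (((measurable_const.max measurable_nabs).pow_const 2).inv.const_mul c).ennreal_ofReal
  have hwp : Measurable fun p : Fin 3 → F × F => w (p 0) (p 1) (p 2) := by
    have := hw.comp ((measurable_pi_apply 0).prodMk ((measurable_pi_apply 1).prodMk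
      (measurable_pi_apply 2)) : Measurable fun p : Fin 3 → F × F => (p 0, p 1, p 2))
    exact this
  refine (h1 h (fun t p => ENNReal.ofReal (c * ((max 1 (nabs t)) ^ 2)⁻¹) * w (p 0) (p 1) (p 2))
    ((hmt.comp measurable_fst).mul (hwp.comp measurable_snd)) hle).trans (le_of_eq ?_)
  have e1 : ∀ p : Fin 3 → F × F, ∫⁻ t : F, ENNReal.ofReal (c * ((max 1 (nabs t)) ^ 2)⁻¹) *
      w (p 0) (p 1) (p 2) ∂Measure.addHaar = (ENNReal.ofReal c *
      ∫⁻ t : F, ENNReal.ofReal (((max 1 (nabs t)) ^ 2)⁻¹) ∂Measure.addHaar) * w (p 0) (p 1) (p 2) := by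
    intro p
    rw [lintegral_mul_const _ hmt]
    simp only [ENNReal.ofReal_mul hc]
    rw [lintegral_const_mul' _ _ ENNReal.ofReal_ne_top]
  simp only [e1]
  rw [lintegral_const_mul _ hwp, show rowsMeasure F = Measure.pi fun _ => planeHaar F from rfl,
    lintegral_pi_three (planeHaar F) hw]
  ring

variable {ψ : AddChar F Circle} {J : ∀ i, Matrix (Fin (d i)) (Fin (d i)) F} {f₁ : Sp6 F → ℂ} {f₂ : V F d → ℂ}
  {μG : Measure (G F)} [μG.IsHaarMeasure] {μN : Measure (N0 F)} [μN.IsHaarMeasure] {μ : Measure (N0G F)}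

theorem exists_vabs_eq_nabs {n : Type*} [Fintype n] {x : n → F} (hx : x ≠ 0) :
    ∃ b : F, b ≠ 0 ∧ nabs b = vabs x := by
  obtain ⟨i₀, -⟩ := Function.ne_iff.mp hx
  have : Nonempty n := ⟨i₀⟩
  obtain ⟨j, hj⟩ := exists_eq_ciSup_of_finite (f := fun j => nabs (x j))
  refine ⟨x j, fun h => ?_, hj⟩
  have h0 := vabs_pos hx
  rw [vabs, ← hj, h, nabs_zero] at h0
  exact lt_irrefl _ h0

theorem ofReal_mul_toReal {C : ℝ≥0∞} (hC : C ≠ ⊤) {a : ℝ} :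
    C * ENNReal.ofReal a = ENNReal.ofReal (C.toReal * a) := by
  rw [ENNReal.ofReal_mul ENNReal.toReal_nonneg, ENNReal.ofReal_toReal hC]

/-- The estimate at points with nonzero coordinates. -/
theorem exists_absInt_le (hd : ∀ i, 0 < d i) (hμ : IsQuotientMeasure μG μN μ) (hX : IsFunctionOnX f₁)
    (h1 : LeviDecay f₁) (h2 : WeilDecay ψ J f₂) (N : ℕ) :
    ∃ C : ℝ, 0 ≤ C ∧ ∀ v : V F d, (∀ i, v i ≠ 0) → absInt ψ J μ f₁ f₂ v ≤
      ENNReal.ofReal (C * ∏ i, (vabs (v i) ^ (-((d i : ℝ) / 2)) * ((max 1 (vabs (v i))) ^ N)⁻¹)) := by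
  have he : ∀ i, 0 < (d i : ℝ) / 2 := fun i => by have := hd i; positivity
  set m : ℕ := 2 + N + ∑ i, d i with hm
  have hmle : ∀ i, 2 + (d i : ℝ) / 2 + N ≤ m := fun i => by
    have h3 : (d i : ℝ) ≤ ∑ i, (d i : ℝ) :=
      Finset.single_le_sum (f := fun i => (d i : ℝ)) (fun _ _ => by positivity) (Finset.mem_univ i)
    have h4 := he i
    rw [hm]
    push_cast
    linarith
  obtain ⟨C₀, hC₀, h0⟩ := exists_lintegral_quotient_le hμ
  obtain ⟨C₁, hC₁, h1⟩ := exists_norm_gamma0_le hX h1 (N + N + N)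
  obtain ⟨C₂, hC₂, h2⟩ := h2 m
  set K : Fin 3 → ℝ≥0∞ := fun i =>
    ∫⁻ p, ENNReal.ofReal ((max 1 (nabs (big p))) ^ (-(2 + (d i : ℝ) / 2))) ∂(planeHaar F)
  have hK : ∀ i, K i ≠ ⊤ := fun i => (lintegral_plane_lt_top (he i)).ne
  have hctop : C₀ * ENNReal.ofReal (C₁ * C₂) * (K 0 * K 1 * K 2) ≠ ⊤ :=
    ENNReal.mul_ne_top (ENNReal.mul_ne_top hC₀ ENNReal.ofReal_ne_top)
      (ENNReal.mul_ne_top (ENNReal.mul_ne_top (hK 0) (hK 1)) (hK 2))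
  refine ⟨(C₀ * ENNReal.ofReal (C₁ * C₂) * (K 0 * K 1 * K 2)).toReal, ENNReal.toReal_nonneg,
    fun v hv => ?_⟩
  have hvR : ∀ i, 0 ≤ vabs (v i) := fun i => vabs_nonneg _
  set w : Fin 3 → F × F → ℝ≥0∞ := fun i p =>
    ENNReal.ofReal (planeWeight ((d i : ℝ) / 2) N m (vabs (v i)) (nabs (big p))) with hw
  have hwm : ∀ i, Measurable (w i) := fun i =>
    ((measurable_planeWeight _ N m _).comp measurable_nabs_big).ennreal_ofReal
  set a : Fin 3 → ℝ := fun i => vabs (v i) ^ (-((d i : ℝ) / 2)) * ((max 1 (vabs (v i))) ^ N)⁻¹ with ha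
  have ha0 : ∀ i, 0 ≤ a i := fun i => mul_nonneg (Real.rpow_nonneg (hvR i) _) (by positivity)
  have hint : ∀ i, ∫⁻ p, w i p ∂(planeHaar F) ≤ ENNReal.ofReal (a i) * K i := by
    intro i
    obtain ⟨b, hb, hbv⟩ := exists_vabs_eq_nabs (hv i)
    have := lintegral_planeWeight_le (he i) (hmle i) hb
    rw [hbv] at this
    exact this
  have key := h0 (fun x => ‖integrand ψ J f₁ f₂ v x.out‖ₑ) (C₁ * C₂) (fun x y z => w 0 x * (w 1 y * w 2 z))
    (by positivity)
    (((hwm 0).comp measurable_fst).mul (((hwm 1).comp (measurable_fst.comp measurable_snd)).mul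
      ((hwm 2).comp (measurable_snd.comp measurable_snd)))) (by
      intro x hx
      obtain ⟨B, hB, hBr, -, hf⟩ := h1 x.out
      have hwl := h2 x.out hx v
      set g := x.out
      set r : Fin 3 → ℝ := fun i => nabs (big (rowSL (g i))) with hr
      have hr0 : ∀ i, 0 < r i := fun i => nabs_pos (big_ne_zero (rowSL_ne_zero _))
      simp only [hw]
      rw [← ENNReal.ofReal_mul (planeWeight_nonneg (hvR 1) (hr0 1).le),
        ← ENNReal.ofReal_mul (planeWeight_nonneg (hvR 0) (hr0 0).le),
        ← ENNReal.ofReal_mul (by positivity), ← ofReal_norm]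
      refine ENNReal.ofReal_le_ofReal ?_
      rw [integrand, norm_mul]
      refine (mul_le_mul hf hwl (norm_nonneg _) (by positivity)).trans ?_
      have hmin : ∀ i, (min 1 B) ^ N ≤ ((max 1 (r i)) ^ N)⁻¹ := fun i => by
        rw [← inv_pow]
        exact pow_le_pow_left₀ (le_min zero_le_one hB.le) (min_one_le_inv_max (hBr i)) N
      have hb0 : 0 ≤ (min 1 B) ^ N := pow_nonneg (le_min zero_le_one hB.le) N
      have hmin3 : (min 1 B) ^ (N + N + N) ≤
          ((max 1 (r 0)) ^ N)⁻¹ * ((max 1 (r 1)) ^ N)⁻¹ * ((max 1 (r 2)) ^ N)⁻¹ := by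
        rw [pow_add, pow_add]
        exact mul_le_mul (mul_le_mul (hmin 0) (hmin 1) hb0 (by positivity)) (hmin 2) hb0 (by positivity)
      have hq : ∀ i, 0 ≤ ((1 + vabs (v i) / r i) ^ m)⁻¹ := fun i =>
        inv_nonneg.mpr (pow_nonneg (add_nonneg zero_le_one (div_nonneg (hvR i) (hr0 i).le)) m)
      have hpw : ∀ i, planeWeight ((d i : ℝ) / 2) N m (vabs (v i)) (r i) =
          (r i)⁻¹ ^ 2 * r i ^ (-((d i : ℝ) / 2)) * ((max 1 (r i)) ^ N)⁻¹ *
            ((1 + vabs (v i) / r i) ^ m)⁻¹ := fun i => by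
        rw [inv_sq_mul_rpow (hr0 i), planeWeight]
      have hr' : ∀ i, nabs (big (rowSL (g i))) = r i := fun _ => rfl
      simp only [Fin.prod_univ_three, hpw, hr']
      have hrp : ∀ i, 0 ≤ r i ^ (-((d i : ℝ) / 2)) := fun i => Real.rpow_nonneg (hr0 i).le _
      have hri : ∀ i, 0 ≤ (r i)⁻¹ := fun i => inv_nonneg.mpr (hr0 i).le
      have h01 := hq 0
      have h02 := hq 1
      have h03 := hq 2
      have h04 := hrp 0
      have h05 := hrp 1
      have h06 := hrp 2
      calc _ = (C₁ * C₂ * ((max 1 (nabs (∑ i, unipCoord (g i)))) ^ 2)⁻¹ * ((r 0)⁻¹ ^ 2 * (r 1)⁻¹ ^ 2 * (r 2)⁻¹ ^ 2) *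
            ((r 0 ^ (-((d 0 : ℝ) / 2)) * ((1 + vabs (v 0) / r 0) ^ m)⁻¹) *
              (r 1 ^ (-((d 1 : ℝ) / 2)) * ((1 + vabs (v 1) / r 1) ^ m)⁻¹) *
              (r 2 ^ (-((d 2 : ℝ) / 2)) * ((1 + vabs (v 2) / r 2) ^ m)⁻¹))) * (min 1 B) ^ (N + N + N) := by ring
        _ ≤ _ := mul_le_mul_of_nonneg_left hmin3 (by positivity)
        _ = _ := by ring)
  refine key.trans ?_
  have e1 : ∫⁻ y, ∫⁻ z, ∫⁻ x, w 0 x * (w 1 y * w 2 z) ∂(planeHaar F) ∂(planeHaar F) ∂(planeHaar F) =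
      (∫⁻ x, w 0 x ∂(planeHaar F)) * ((∫⁻ y, w 1 y ∂(planeHaar F)) * ∫⁻ z, w 2 z ∂(planeHaar F)) := by
    simp only [lintegral_mul_const _ (hwm 0), lintegral_const_mul _ ((hwm 2).const_mul _),
      lintegral_const_mul _ (hwm 2), lintegral_mul_const _ (hwm 1), lintegral_const_mul _ ((hwm 1).mul_const _)]
  rw [e1]
  calc _ ≤ C₀ * ENNReal.ofReal (C₁ * C₂) * ((ENNReal.ofReal (a 0) * K 0) *
        ((ENNReal.ofReal (a 1) * K 1) * (ENNReal.ofReal (a 2) * K 2))) := by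
        gcongr
        · exact hint 0
        · exact hint 1
        · exact hint 2
    _ = C₀ * ENNReal.ofReal (C₁ * C₂) * (K 0 * K 1 * K 2) * ENNReal.ofReal (∏ i, a i) := by
        rw [Fin.prod_univ_three, ENNReal.ofReal_mul (mul_nonneg (ha0 0) (ha0 1)), ENNReal.ofReal_mul (ha0 0)]
        ring
    _ = _ := ofReal_mul_toReal hctop

theorem rpow_mul_planeWeight {r : ℝ} (hr : 0 < r) (e₀ e : ℝ) (N m : ℕ) (R : ℝ) :
    r ^ (-e₀) * planeWeight e N m R r = planeWeight (e + e₀) N m R r := by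
  rw [planeWeight, planeWeight, ← mul_assoc, ← mul_assoc, ← Real.rpow_add hr]
  congr 3
  ring

set_option maxHeartbeats 400000 in
/-- The estimate at points with vanishing first coordinate. -/
theorem exists_absInt_le_of_eq_zero (hd : ∀ i, 0 < d i) (hμ : IsQuotientMeasure μG μN μ)
    (hX : IsFunctionOnX f₁) (h1 : LeviDecay f₁) (h2 : WeilDecay ψ J f₂) (N : ℕ) :
    ∃ C : ℝ, 0 ≤ C ∧ ∀ v : V F d, v 0 = 0 → v 1 ≠ 0 → v 2 ≠ 0 → absInt ψ J μ f₁ f₂ v ≤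
      ENNReal.ofReal (C * (vabs (v 1) ^ (-((d 1 : ℝ) / 2 + (d 0 : ℝ) / 2)) * ((max 1 (vabs (v 1))) ^ N)⁻¹ *
        (vabs (v 2) ^ (-((d 2 : ℝ) / 2 + (d 0 : ℝ) / 2)) * ((max 1 (vabs (v 2))) ^ N)⁻¹))) := by
  have he : ∀ i, 0 < (d i : ℝ) / 2 := fun i => by have := hd i; positivity
  set m : ℕ := 2 + N + ∑ i, d i with hm
  have hdle : ∀ i, (d i : ℝ) ≤ ∑ i, (d i : ℝ) := fun i =>
      Finset.single_le_sum (f := fun i => (d i : ℝ)) (fun _ _ => by positivity) (Finset.mem_univ i)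
  have hmle : ∀ i, 2 + ((d i : ℝ) / 2 + (d 0 : ℝ) / 2) + N ≤ m := fun i => by
    have h3 := hdle i
    have h4 := hdle 0
    rw [hm]
    push_cast
    linarith
  obtain ⟨C₀, hC₀, h0⟩ := exists_lintegral_quotient_le hμ
  obtain ⟨C₁, hC₁, h1⟩ := exists_norm_gamma0_le hX h1 (2 + d 0 + N + N)
  obtain ⟨C₂, hC₂, h2⟩ := h2 m
  set K : ℝ → ℝ≥0∞ := fun e =>
    ∫⁻ p, ENNReal.ofReal ((max 1 (nabs (big p))) ^ (-(2 + e))) ∂(planeHaar F)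
  have hK : ∀ e, 0 < e → K e ≠ ⊤ := fun e he => (lintegral_plane_lt_top he).ne
  set ed : Fin 3 → ℝ := fun i => (d i : ℝ) / 2 + (d 0 : ℝ) / 2 with hed
  have hed0 : ∀ i, 0 < ed i := fun i => add_pos (he i) (he 0)
  have hctop : C₀ * ENNReal.ofReal (C₁ * C₂) * (K ((d 0 : ℝ) / 2) * (K (ed 1) * K (ed 2))) ≠ ⊤ :=
    ENNReal.mul_ne_top (ENNReal.mul_ne_top hC₀ ENNReal.ofReal_ne_top)
      (ENNReal.mul_ne_top (hK _ (he 0)) (ENNReal.mul_ne_top (hK _ (hed0 1)) (hK _ (hed0 2))))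
  refine ⟨(C₀ * ENNReal.ofReal (C₁ * C₂) * (K ((d 0 : ℝ) / 2) * (K (ed 1) * K (ed 2)))).toReal,
    ENNReal.toReal_nonneg, fun v hv0 hv1 hv2 => ?_⟩
  have hvR : ∀ i, 0 ≤ vabs (v i) := fun i => vabs_nonneg _
  set w : ℝ → Fin 3 → F × F → ℝ≥0∞ := fun e i p =>
    ENNReal.ofReal (planeWeight e N m (vabs (v i)) (nabs (big p))) with hw
  have hwm : ∀ e i, Measurable (w e i) := fun e i =>
    ((measurable_planeWeight _ N m _).comp measurable_nabs_big).ennreal_ofReal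
  set w₀ : F × F → F × F → F × F → ℝ≥0∞ := fun x y z =>
    ENNReal.ofReal (nabs (big x) ^ (-(2 + (d 0 : ℝ) / 2)) *
      (min 1 ((nabs (big y) * nabs (big z))⁻¹ * nabs (big x))) ^ (2 + d 0)) with hw₀
  have hw₀m : Measurable fun q : (F × F) × (F × F) × (F × F) => w₀ q.1 q.2.1 q.2.2 := by
    have m1 : Measurable fun q : (F × F) × (F × F) × (F × F) => nabs (big q.1) :=
      measurable_nabs_big.comp measurable_fst
    have m2 : Measurable fun q : (F × F) × (F × F) × (F × F) => nabs (big q.2.1) :=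
      measurable_nabs_big.comp (measurable_fst.comp measurable_snd)
    have m3 : Measurable fun q : (F × F) × (F × F) × (F × F) => nabs (big q.2.2) :=
      measurable_nabs_big.comp (measurable_snd.comp measurable_snd)
    exact ((m1.pow_const _).mul ((measurable_const.min ((m2.mul m3).inv.mul m1)).pow_const _)).ennreal_ofReal
  set a : Fin 3 → ℝ := fun i => vabs (v i) ^ (-(ed i)) * ((max 1 (vabs (v i))) ^ N)⁻¹ with ha
  have ha0 : ∀ i, 0 ≤ a i := fun i => mul_nonneg (Real.rpow_nonneg (hvR i) _) (by positivity)
  have hint : ∀ i, v i ≠ 0 → ∫⁻ p, w (ed i) i p ∂(planeHaar F) ≤ ENNReal.ofReal (a i) * K (ed i) := by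
    intro i hvi
    obtain ⟨b, hb, hbv⟩ := exists_vabs_eq_nabs hvi
    have := lintegral_planeWeight_le (hed0 i) (hmle i) hb
    rw [hbv] at this
    exact this
  have key := h0 (fun x => ‖integrand ψ J f₁ f₂ v x.out‖ₑ) (C₁ * C₂)
    (fun x y z => w₀ x y z * (w ((d 1 : ℝ) / 2) 1 y * w ((d 2 : ℝ) / 2) 2 z))
    (by positivity)
    (hw₀m.mul (((hwm _ 1).comp (measurable_fst.comp measurable_snd)).mul
      ((hwm _ 2).comp (measurable_snd.comp measurable_snd)))) (by
      intro x hx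
      obtain ⟨B, hB, hBr, hB0, hf⟩ := h1 x.out
      have hwl := h2 x.out hx v
      set g := x.out
      set r : Fin 3 → ℝ := fun i => nabs (big (rowSL (g i))) with hr
      have hr0 : ∀ i, 0 < r i := fun i => nabs_pos (big_ne_zero (rowSL_ne_zero _))
      have hr' : ∀ i, nabs (big (rowSL (g i))) = r i := fun _ => rfl
      simp only [hw, hw₀]
      have hmn : 0 ≤ min 1 ((r 1 * r 2)⁻¹ * r 0) :=
        le_min zero_le_one (mul_nonneg (inv_nonneg.mpr (mul_nonneg (hr0 1).le (hr0 2).le)) (hr0 0).le)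
      have hrp0 : ∀ i (e : ℝ), 0 ≤ r i ^ e := fun i e => Real.rpow_nonneg (hr0 i).le _
      rw [← ENNReal.ofReal_mul (planeWeight_nonneg (hvR 1) (hr0 1).le),
        ← ENNReal.ofReal_mul (mul_nonneg (hrp0 0 _) (pow_nonneg hmn _)),
        ← ENNReal.ofReal_mul (by positivity), ← ofReal_norm]
      refine ENNReal.ofReal_le_ofReal ?_
      rw [integrand, norm_mul]
      refine (mul_le_mul hf hwl (norm_nonneg _) (by positivity)).trans ?_
      have hmin : ∀ i, (min 1 B) ^ N ≤ ((max 1 (r i)) ^ N)⁻¹ := fun i => by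
        rw [← inv_pow]
        exact pow_le_pow_left₀ (le_min zero_le_one hB.le) (min_one_le_inv_max (hBr i)) N
      have hminB : (min 1 B) ^ (2 + d 0) ≤ (min 1 ((r 1 * r 2)⁻¹ * r 0)) ^ (2 + d 0) := by
        refine pow_le_pow_left₀ (le_min zero_le_one hB.le) (min_le_min_left 1 ?_) _
        rw [mul_comm]
        exact hB0
      have hb0 : ∀ N, 0 ≤ (min 1 B) ^ N := fun N => pow_nonneg (le_min zero_le_one hB.le) N
      have hmin3 : (min 1 B) ^ (2 + d 0 + N + N) ≤
          (min 1 ((r 1 * r 2)⁻¹ * r 0)) ^ (2 + d 0) * ((max 1 (r 1)) ^ N)⁻¹ * ((max 1 (r 2)) ^ N)⁻¹ := by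
        rw [pow_add, pow_add]
        have p1 := pow_nonneg hmn (2 + d 0)
        exact mul_le_mul (mul_le_mul hminB (hmin 1) (hb0 _) p1) (hmin 2) (hb0 _) (by positivity)
      have hq : ∀ i, 0 ≤ ((1 + vabs (v i) / r i) ^ m)⁻¹ := fun i =>
        inv_nonneg.mpr (pow_nonneg (add_nonneg zero_le_one (div_nonneg (hvR i) (hr0 i).le)) m)
      have hpw : ∀ i, planeWeight ((d i : ℝ) / 2) N m (vabs (v i)) (r i) =
          (r i)⁻¹ ^ 2 * r i ^ (-((d i : ℝ) / 2)) * ((max 1 (r i)) ^ N)⁻¹ *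
            ((1 + vabs (v i) / r i) ^ m)⁻¹ := fun i => by
        rw [inv_sq_mul_rpow (hr0 i), planeWeight]
      have hv0' : ((1 + vabs (v 0) / r 0) ^ m)⁻¹ = 1 := by
        have h3 : vabs (0 : Fin (d 0) → F) = 0 := by simp [vabs]
        rw [hv0, h3, zero_div, add_zero, one_pow, inv_one]
      simp only [Fin.prod_univ_three, hpw, hr', ← inv_sq_mul_rpow (hr0 0), hv0']
      have hri : ∀ i, 0 ≤ (r i)⁻¹ := fun i => inv_nonneg.mpr (hr0 i).le
      have h02 := hq 1
      have h03 := hq 2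
      have h04 := hrp0 0 (-((d 0 : ℝ) / 2))
      have h05 := hrp0 1 (-((d 1 : ℝ) / 2))
      have h06 := hrp0 2 (-((d 2 : ℝ) / 2))
      calc _ = (C₁ * C₂ * ((max 1 (nabs (∑ i, unipCoord (g i)))) ^ 2)⁻¹ * ((r 0)⁻¹ ^ 2 * (r 1)⁻¹ ^ 2 * (r 2)⁻¹ ^ 2) *
            (r 0 ^ (-((d 0 : ℝ) / 2)) *
              (r 1 ^ (-((d 1 : ℝ) / 2)) * ((1 + vabs (v 1) / r 1) ^ m)⁻¹) *
              (r 2 ^ (-((d 2 : ℝ) / 2)) * ((1 + vabs (v 2) / r 2) ^ m)⁻¹))) * (min 1 B) ^ (2 + d 0 + N + N) := by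
            ring
        _ ≤ _ := mul_le_mul_of_nonneg_left hmin3 (by positivity)
        _ = _ := by
            ring)
  refine key.trans ?_
  have hinner : ∀ y z, ∫⁻ x, w₀ x y z * (w ((d 1 : ℝ) / 2) 1 y * w ((d 2 : ℝ) / 2) 2 z) ∂(planeHaar F) ≤
      K ((d 0 : ℝ) / 2) * (w (ed 1) 1 y * w (ed 2) 2 z) := by
    intro y z
    have hxm : Measurable fun x => w₀ x y z := ((measurable_nabs_big.pow_const _).mul
      ((measurable_const.min (measurable_nabs_big.const_mul _)).pow_const _)).ennreal_ofReal
    rw [lintegral_mul_const _ hxm]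
    have hzero : ∀ i p, big p = 0 → w ((d i : ℝ) / 2) i p = 0 := fun i p hp => by
      have h3 := he i
      simp only [hw, hp, nabs_zero, planeWeight]
      rw [Real.zero_rpow (by linarith), zero_mul, zero_mul, ENNReal.ofReal_zero]
    by_cases hy : big y = 0
    · rw [hzero 1 y hy, zero_mul, mul_zero]
      exact zero_le
    by_cases hz : big z = 0
    · rw [hzero 2 z hz, mul_zero, mul_zero]
      exact zero_le
    have hle := lintegral_min_weight_le (he 0) (n := 2 + d 0) (by push_cast; linarith [he 0]) (mul_ne_zero hy hz)
    rw [nabs_mul] at hle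
    refine (mul_le_mul_left hle _).trans (le_of_eq ?_)
    have hstep : ∀ i p, big p ≠ 0 → w (ed i) i p =
        ENNReal.ofReal (nabs (big p) ^ (-((d 0 : ℝ) / 2))) * w ((d i : ℝ) / 2) i p := fun i p hp => by
      simp only [hw, hed]
      rw [← ENNReal.ofReal_mul (Real.rpow_nonneg (nabs_nonneg _) _), rpow_mul_planeWeight (nabs_pos hp)]
    rw [hstep 1 y hy, hstep 2 z hz, Real.mul_rpow (nabs_nonneg _) (nabs_nonneg _),
      ENNReal.ofReal_mul (Real.rpow_nonneg (nabs_nonneg _) _)]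
    simp only [K]
    ring
  have e1 : ∫⁻ y, ∫⁻ z, K ((d 0 : ℝ) / 2) * (w (ed 1) 1 y * w (ed 2) 2 z) ∂(planeHaar F) ∂(planeHaar F) =
      K ((d 0 : ℝ) / 2) * ((∫⁻ y, w (ed 1) 1 y ∂(planeHaar F)) * ∫⁻ z, w (ed 2) 2 z ∂(planeHaar F)) := by
    simp only [lintegral_const_mul _ ((hwm _ 2).const_mul _), lintegral_const_mul _ (hwm _ 2),
      lintegral_const_mul _ ((hwm _ 1).mul_const _), lintegral_mul_const _ (hwm _ 1)]
  calc _ ≤ C₀ * ENNReal.ofReal (C₁ * C₂) * ∫⁻ y, ∫⁻ z, K ((d 0 : ℝ) / 2) * (w (ed 1) 1 y * w (ed 2) 2 z)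
          ∂(planeHaar F) ∂(planeHaar F) := by
        gcongr with y z
        exact hinner y z
    _ ≤ C₀ * ENNReal.ofReal (C₁ * C₂) * (K ((d 0 : ℝ) / 2) *
        ((ENNReal.ofReal (a 1) * K (ed 1)) * (ENNReal.ofReal (a 2) * K (ed 2)))) := by
        rw [e1]
        gcongr
        · exact hint 1 hv1
        · exact hint 2 hv2
    _ = C₀ * ENNReal.ofReal (C₁ * C₂) * (K ((d 0 : ℝ) / 2) * (K (ed 1) * K (ed 2))) * ENNReal.ofReal (a 1 * a 2) := by
        rw [ENNReal.ofReal_mul (ha0 1)]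
        ring
    _ = _ := ofReal_mul_toReal hctop

end MainEstimate

end TripleQuad
end

noncomputable section

namespace TripleQuad

section Convergence

variable {F : Type*} [NontriviallyNormedField F]

theorem gamma0_N0_mul {f : Sp6 F → ℂ} (hX : IsFunctionOnX f) {n : G F} (hn : n ∈ N0 F) (g : G F) :
    f (gamma0 F * embG F (n * g)) = f (gamma0 F * embG F g) := by
  obtain ⟨t, ht0, ht⟩ := hn
  have hn1 : n = borelElt t 1 := by
    funext i
    rw [ht, borelElt, Pi.one_apply]
    have : diagSL (1 : Fˣ) = 1 := by
      ext j k
      fin_cases j <;> fin_cases k <;> simp [diagSL]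
    rw [this, mul_one]
  have h1 : (1 : G F) = borelElt 0 1 := by
    funext i
    ext j k
    rw [borelElt_apply]
    fin_cases j <;> fin_cases k <;> simp
  have hemb1 : embG F (1 : G F) = 1 := by
    apply Subtype.ext
    change fromBlocks _ _ _ _ = _
    simp
  have hrow : lowerRows (gamma0 F * embG F n) =
      fromBlocks 0 0 0 !![1, t 1, t 2; 0, 1, 0; 0, 0, 1] * lowerRows (gamma0 F) := by
    have h0 : lowerRows (gamma0 F) = lowerRows (gamma0 F * embG F (borelElt 0 1)) := by
      rw [← h1, hemb1, mul_one]
    have ht' : t 0 = -(t 1) + -(t 2) := by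
      rw [Fin.sum_univ_three] at ht0
      linear_combination ht0
    rw [h0, hn1, lowerRows_gamma0_borelElt, lowerRows_gamma0_borelElt, fromBlocks_multiply]
    congr 1
    · simp
    · simp
    · ext i j
      fin_cases i <;> fin_cases j <;> simp [Matrix.mul_apply, Fin.sum_univ_three]
    · ext i j
      fin_cases i <;> fin_cases j <;> simp [Matrix.mul_apply, Fin.sum_univ_three, ht']
  obtain ⟨p, hp, he⟩ := exists_commP_mul_levi (a := 1) (by simp [det_fin_three]) hrow
  rw [levi_one, one_mul] at he
  rw [embG_mul, ← mul_assoc, he, mul_assoc, hX p hp]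

variable [ProperSpace F] [CharZero F] [MeasurableSpace F] [BorelSpace F] {d : Fin 3 → ℕ}
  {ψ : AddChar F Circle} {J : ∀ i, Matrix (Fin (d i)) (Fin (d i)) F} {f₁ : Sp6 F → ℂ} {f₂ : V F d → ℂ}
  {μG : Measure (G F)} [μG.IsHaarMeasure] {μN : Measure (N0 F)} [μN.IsHaarMeasure] {μ : Measure (N0G F)}

theorem out_mk_apply_one (g : G F) (i : Fin 3) :
    (Quotient.mk (QuotientGroup.rightRel (N0 F)) g).out i 1 0 = g i 1 0 := by
  obtain ⟨n, hn, h⟩ := out_mk_eq g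
  rw [h]
  exact congrArg Prod.fst (rowSL_N0_mul hn g i)

theorem ae_out_ne_zero (hμ : IsQuotientMeasure μG μN μ) :
    ∀ᵐ x ∂μ, ∀ i, x.out i 1 0 ≠ 0 := by
  obtain ⟨C, -, h⟩ := lintegral_quotient_le hμ
  have hms : MeasurableSet {x : N0G F | ¬ ∀ i, x.out i 1 0 ≠ 0} := by
    rw [measurableSet_quotient]
    have : (Quotient.mk'' ⁻¹' {x : N0G F | ¬ ∀ i, x.out i 1 0 ≠ 0} : Set (G F)) =
        (⋂ i, {g : G F | g i 1 0 ≠ 0})ᶜ := by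
      ext g
      simp only [Set.mem_preimage, Set.mem_ofPred_eq, Set.mem_compl_iff, Set.mem_iInter]
      rw [← not_iff_not, not_not, not_not]
      exact forall_congr' fun i => by rw [← out_mk_apply_one g i]
    rw [this]
    exact (MeasurableSet.iInter fun i =>
      (measurable_entryG i 1 0) (measurableSet_singleton 0).compl).compl
  rw [ae_iff, ← lintegral_indicator_one hms]
  refine le_antisymm ?_ zero_le
  refine (h _ (fun _ _ => 0) measurable_const fun x hx => ?_).trans (by simp)
  rw [Set.indicator_of_notMem (by simpa using hx)]

theorem continuous_embG : Continuous (embG F) := by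
  refine Continuous.subtype_mk ?_ _
  refine Continuous.matrix_fromBlocks ?_ ?_ ?_ ?_ <;>
  · refine Continuous.matrix_diagonal (continuous_pi fun i => ?_)
    exact (continuous_entry _ _).comp (continuous_apply i)

theorem aestronglyMeasurable_integrand (hμ : IsQuotientMeasure μG μN μ) (hψ : Continuous ψ)
    (hX : IsFunctionOnX f₁) (hf₁ : Continuous f₁) (hf₂ : Integrable f₂ (vHaar F d)) {v : V F d} (hv : v ∈ Ysm J) :
    AEStronglyMeasurable (fun x : N0G F => integrand ψ J f₁ f₂ v x.out) μ := by
  classical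
  obtain ⟨c, hc⟩ := exists_weil_eq hψ J
  set Φ : G F → ℂ := fun g => f₁ (gamma0 F * embG F g) * (c * (weilFactor ψ J g v *
      oscInt ψ J f₂ (fun i => g i 1 1 / g i 1 0) (weilY J g v))) with hΦ
  have hΦm : Measurable Φ :=
    (hf₁.comp (continuous_const.mul continuous_embG)).measurable.mul
      ((measurable_weil_formula hψ J hf₂ v).const_mul _)
  set S : Set (G F) := {g : G F | ∀ i, g i 1 0 ≠ 0} with hSdef
  have hmem : ∀ g, g ∈ S ↔ ∀ i, g i 1 0 ≠ 0 := fun g => by rw [hSdef, Set.mem_ofPred_eq]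
  have hS : MeasurableSet S := by
    rw [hSdef, Set.ofPred_forall]
    exact MeasurableSet.iInter fun i => (measurable_entryG i 1 0) (measurableSet_singleton 0).compl
  have hm := hΦm.indicator hS
  have hΦg : ∀ g : G F, (∀ i, g i 1 0 ≠ 0) → Φ g = integrand ψ J f₁ f₂ v g := fun g hg => by
    rw [integrand, hc f₂ hf₂ g hg]
    simp only [hΦ, mul_assoc]
  have hΨ : Measurable fun x : N0G F => S.indicator Φ x.out := by
    refine measurable_from_quotient.mpr ?_
    convert hm using 1
    funext g
    obtain ⟨n, hn, h⟩ := out_mk_eq g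
    change Set.indicator _ Φ (Quotient.mk (QuotientGroup.rightRel (N0 F)) g).out = _
    by_cases hg : ∀ i, g i 1 0 ≠ 0
    · have hg' : ∀ i, (Quotient.mk (QuotientGroup.rightRel (N0 F)) g).out i 1 0 ≠ 0 := fun i => by
        rw [out_mk_apply_one]; exact hg i
      rw [Set.indicator_of_mem ((hmem _).mpr hg'), Set.indicator_of_mem ((hmem _).mpr hg), hΦg _ hg', hΦg _ hg, h, integrand, integrand,
        gamma0_N0_mul hX hn, weil_N0_mul hψ hf₂ hv hn hg]
    · have hg' : ¬ ∀ i, (Quotient.mk (QuotientGroup.rightRel (N0 F)) g).out i 1 0 ≠ 0 := fun h => hg fun i => by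
        rw [← out_mk_apply_one]; exact h i
      rw [Set.indicator_of_notMem (mt (hmem _).mp hg'), Set.indicator_of_notMem (mt (hmem _).mp hg)]
  refine ⟨_, hΨ.stronglyMeasurable, ?_⟩
  filter_upwards [ae_out_ne_zero hμ] with x hx
  rw [Set.indicator_of_mem ((hmem _).mpr hx), hΦg _ hx]

/-- A finite bound for the integral of the absolute value gives convergence and the same bound for
the integral. -/
theorem converges_of_absInt_le (hμ : IsQuotientMeasure μG μN μ) (hψ : Continuous ψ)
    (hX : IsFunctionOnX f₁) (hf₁ : Continuous f₁) (hf₂ : Integrable f₂ (vHaar F d)) {v : V F d} {B : ℝ} (hB : 0 ≤ B)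
    (h : absInt ψ J μ f₁ f₂ v ≤ ENNReal.ofReal B) :
    absInt ψ J μ f₁ f₂ v ≤ ENNReal.ofReal B ∧
      (v ∈ Ysm J → IConverges ψ J μ f₁ f₂ v ∧ ‖intI ψ J μ f₁ f₂ v‖ ≤ B) := by
  refine ⟨h, fun hv => ⟨⟨aestronglyMeasurable_integrand hμ hψ hX hf₁ hf₂ hv,
    h.trans_lt ENNReal.ofReal_lt_top⟩, ?_⟩⟩
  rw [← ENNReal.ofReal_le_ofReal_iff hB, ofReal_norm]
  exact (enorm_integral_le_lintegral_enorm _).trans h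

end Convergence

section NonArchimedeanCase

variable {F : Type*} [NontriviallyNormedField F] [ProperSpace F] [IsUltrametricDist F] [CharZero F]
  [MeasurableSpace F] [BorelSpace F] {d : Fin 3 → ℕ}

theorem embG_mem_sp6Int {k : G F} (hk : ∀ i j l, ‖k i j l‖ ≤ 1) : embG F k ∈ sp6Int F := by
  rintro (i | i) (j | j) <;>
  · simp only [embG, fromBlocks_apply₁₁, fromBlocks_apply₁₂, fromBlocks_apply₂₁, fromBlocks_apply₂₂,
      diagonal_apply]
    split_ifs
    · exact hk _ _ _
    · simp

theorem lowerUnip_mem_sp6Int {Z : Matrix (Fin 3) (Fin 3) F} (hZ : Z.IsSymm) (h : ∀ i j, ‖Z i j‖ ≤ 1) :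
    lowerUnip Z hZ ∈ sp6Int F := by
  rintro (i | i) (j | j) <;>
  simp only [lowerUnip, fromBlocks_apply₁₁, fromBlocks_apply₁₂, fromBlocks_apply₂₁, fromBlocks_apply₂₂,
      one_apply, Matrix.zero_apply]
  · split_ifs <;> simp
  · simp
  · exact h i j
  · split_ifs <;> simp

theorem mul_mem_sp6Int {g h : Sp6 F} (hg : g ∈ sp6Int F) (hh : h ∈ sp6Int F) : g * h ∈ sp6Int F := by
  intro i j
  change ‖∑ l, g.1 i l * h.1 l j‖ ≤ 1
  refine IsUltrametricDist.norm_sum_le_of_forall_le_of_nonneg zero_le_one fun l _ => ?_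
  rw [norm_mul]
  exact mul_le_one₀ (hg i l) (norm_nonneg _) (hh l j)

theorem leviDecay_of_schwartz {ϖ : F} (hϖ : IsUniformizer ϖ) {f : Sp6 F → ℂ}
    (hf : IsSchwartzBKNA ϖ (sp6Int F) f) : LeviDecay f := by
  obtain ⟨C, hC, h⟩ := exists_schwartz_levi_uniform hϖ hf
  intro n hn
  obtain ⟨n, rfl⟩ := Nat.exists_eq_add_of_le hn
  refine ⟨C * C ^ n, by positivity, fun δ Z hZ k hZ1 hk1 => ?_⟩
  obtain ⟨h1, h2⟩ := h δ _ (mul_mem_sp6Int (lowerUnip_mem_sp6Int hZ hZ1) (embG_mem_sp6Int hk1))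
  have h0 := nabs_nonneg (δ : F)
  by_cases h3 : f (levi δ * (lowerUnip Z hZ * embG F k)) = 0
  · rw [h3, norm_zero]
    positivity
  · refine h1.trans ?_
    calc C * nabs (δ : F) ^ 2 ≤ C * nabs (δ : F) ^ 2 * (C * nabs (δ : F)) ^ n :=
          le_mul_of_one_le_right (by positivity) (one_le_pow₀ (h2 h3))
      _ = _ := by ring

theorem exists_row_bound_of_schwartz {ϖ : F} (hϖ : IsUniformizer ϖ) {f : Sp6 F → ℂ}
    (hf : IsSchwartzBKNA ϖ (sp6Int F) f) :
    ∃ C : ℝ, 0 ≤ C ∧ ∀ g : G F, f (gamma0 F * embG F g) ≠ 0 → ∀ i, nabs (big (rowSL (g i))) ≤ C := by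
  obtain ⟨C, hC, h⟩ := exists_schwartz_levi_uniform hϖ hf
  refine ⟨C, hC, fun g hg => ?_⟩
  obtain ⟨p, hp, δ, D, Z, hZ, k, hdec, hZ1, hk1, hδ, -, ha⟩ := exists_gamma0_decomp g
  rw [hdec, hf.onX p hp] at hg
  have h1 := (h δ _ (mul_mem_sp6Int (lowerUnip_mem_sp6Int hZ hZ1) (embG_mem_sp6Int hk1))).2 hg
  set u : Fin 3 → ℝ := fun i => nabs (diagCoord (g i) : F) with hu
  have hu0 : ∀ i, 0 < u i := fun i => nabs_pos (Units.ne_zero _)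
  have hD : 0 < nabs (D : F) := nabs_pos (Units.ne_zero _)
  have hnδ : nabs (δ : F) * nabs (D : F) = u 0 * u 1 * u 2 := by
    have h2 : nabs ((δ * D : Fˣ) : F) = nabs ((∏ i, diagCoord (g i) : Fˣ) : F) := by
      rcases hδ with rfl | rfl
      · rw [inv_mul_cancel_right]
      · rw [neg_mul, Units.val_neg, nabs_neg, inv_mul_cancel_right]
    rw [Units.val_mul, nabs_mul, Units.coe_prod, nabs_prod, Fin.prod_univ_three] at h2
    exact h2
  have hle : ∀ i, u i ^ 2 ≤ nabs (D : F) := fun i => by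
    have h2 := nabs_le_of_norm_le (ha i)
    rwa [Units.val_pow_eq_pow_val, nabs_pow] at h2
  have hle2 : ∀ i j, u i * u j ≤ nabs (D : F) := fun i j => by nlinarith [hle i, hle j, sq_nonneg (u i - u j)]
  have hmain : ∀ i, 1 ≤ C * u i := fun i => by
    have h2 : nabs (δ : F) * nabs (D : F) ≤ u i * nabs (D : F) := by
      rw [hnδ]
      fin_cases i
      · calc _ = u 0 * (u 1 * u 2) := by ring
          _ ≤ _ := mul_le_mul_of_nonneg_left (hle2 1 2) (hu0 0).le
      · calc _ = u 1 * (u 0 * u 2) := by ring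
          _ ≤ _ := mul_le_mul_of_nonneg_left (hle2 0 2) (hu0 1).le
      · calc _ = u 2 * (u 0 * u 1) := by ring
          _ ≤ _ := mul_le_mul_of_nonneg_left (hle2 0 1) (hu0 2).le
    exact h1.trans (mul_le_mul_of_nonneg_left (le_of_mul_le_mul_right h2 hD) hC)
  intro i
  have h2 := hmain i
  have h3 : u i = (nabs (big (rowSL (g i))))⁻¹ := by rw [hu]; simp only [diagCoord_val, nabs_inv]
  rw [h3, ← div_eq_mul_inv, one_le_div (nabs_pos (big_ne_zero (rowSL_ne_zero _)))] at h2
  exact h2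

variable {ψ : AddChar F Circle} {J : ∀ i, Matrix (Fin (d i)) (Fin (d i)) F}
  {μG : Measure (G F)} [μG.IsHaarMeasure] {μN : Measure (N0 F)} [μN.IsHaarMeasure] {μ : Measure (N0G F)}

/-- The integrals vanish outside a compact set. -/
theorem exists_isCompact_support {ϖ : F} (hϖ : IsUniformizer ϖ) {f₁ : Sp6 F → ℂ}
    (hf₁ : IsSchwartzBKNA ϖ (sp6Int F) f₁) (hμ : IsQuotientMeasure μG μN μ) (hψ : Continuous ψ)
    (hψ1 : ψ ≠ 1) (hJ : ∀ i, (J i).IsSymm ∧ (J i).det ≠ 0)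
    {f₂ : V F d → ℂ} (hf : IsLocallyConstant f₂) (hc : HasCompactSupport f₂) :
    ∃ S : Set (V F d), IsCompact S ∧ ∀ v ∉ S, absInt ψ J μ f₁ f₂ v = 0 ∧ intI ψ J μ f₁ f₂ v = 0 := by
  obtain ⟨C, hC, h1⟩ := exists_row_bound_of_schwartz hϖ hf₁
  obtain ⟨C', hC', h2⟩ := exists_weil_support hψ hψ1 hJ hf hc
  obtain ⟨R, hR, h3⟩ := exists_norm_bound_of_nabs_le (F := F) (C' * C)
  refine ⟨Metric.closedBall 0 R, isCompact_closedBall _ _, fun v hv => ?_⟩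
  have h0 : (fun x : N0G F => integrand ψ J f₁ f₂ v x.out) =ᵐ[μ] 0 := by
    filter_upwards [ae_out_ne_zero hμ] with x hx
    by_contra hne
    obtain ⟨hne1, hne2⟩ := mul_ne_zero_iff.mp hne
    refine hv (mem_closedBall_zero_iff.mpr ?_)
    refine (pi_norm_le_iff_of_nonneg hR.le).mpr fun i => (pi_norm_le_iff_of_nonneg hR.le).mpr fun j => h3 _ ?_
    exact (nabs_le_vabs _ _).trans ((h2 _ hx v hne2 i).trans
      (mul_le_mul_of_nonneg_left (h1 _ hne1 i) hC'.le))
  refine ⟨?_, integral_eq_zero_of_ae h0⟩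
  rw [absInt, lintegral_congr_ae (g := 0) ?_, Pi.zero_def, lintegral_zero]
  filter_upwards [h0] with x hx
  rw [hx, Pi.zero_apply, Pi.zero_apply, enorm_zero]

end NonArchimedeanCase

end TripleQuad
end

noncomputable section

namespace TripleQuad

theorem rpow_mul_inv_max_le {R : ℝ} (hR : 0 < R) (e : ℝ) :
    R ^ (-e) * ((max 1 R) ^ 1)⁻¹ ≤ R ^ (-1 - e) := by
  rw [show -1 - e = -e + -1 by ring, Real.rpow_add hR, Real.rpow_neg_one, pow_one]
  exact mul_le_mul_of_nonneg_left (inv_anti₀ hR (le_max_right _ _)) (Real.rpow_nonneg hR.le _)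

theorem rpow_mul_inv_max_pow_le {R e e' : ℝ} (hR : 0 < R) (he : 0 ≤ e) (hee : e' ≤ -e) {M N : ℕ} (hM : M ≤ N) :
    R ^ (-e) * ((max 1 R) ^ N)⁻¹ ≤ max R 1 ^ (-(M : ℝ)) * min R 1 ^ e' := by
  rcases le_total R 1 with h | h
  · rw [max_eq_left h, max_eq_right h, min_eq_left h, one_pow, inv_one, mul_one, Real.one_rpow, one_mul]
    exact Real.rpow_le_rpow_of_exponent_ge hR h hee
  · rw [max_eq_right h, max_eq_left h, min_eq_right h, Real.one_rpow, mul_one, Real.rpow_neg hR.le (M : ℝ),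
      Real.rpow_natCast]
    calc _ ≤ 1 * (R ^ M)⁻¹ := by
          refine mul_le_mul (Real.rpow_le_one_of_one_le_of_nonpos h (by linarith)) ?_ (by positivity) zero_le_one
          exact inv_anti₀ (by positivity) (pow_le_pow_right₀ h hM)
      _ = _ := one_mul _

theorem ne_zero_of_mem_Vprime {F : Type*} [Zero F] {d : Fin 3 → ℕ} {v : V F d} (hv : v ∈ Vprime F d)
    (h0 : v 0 = 0) : v 1 ≠ 0 ∧ v 2 ≠ 0 := by
  obtain ⟨i, j, hij, hi, hj⟩ := hv
  fin_cases i <;> fin_cases j <;> simp_all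

section Bounds

variable {F : Type*} [NontriviallyNormedField F] [ProperSpace F] [CharZero F] [MeasurableSpace F] [BorelSpace F]
  {d : Fin 3 → ℕ} {ψ : AddChar F Circle} {J : ∀ i, Matrix (Fin (d i)) (Fin (d i)) F} {f₁ : Sp6 F → ℂ} {f₂ : V F d → ℂ}
  {μG : Measure (G F)} [μG.IsHaarMeasure] {μN : Measure (N0 F)} [μN.IsHaarMeasure] {μ : Measure (N0G F)}

theorem bounds_nonarch (hd : ∀ i, 0 < d i) (hμ : IsQuotientMeasure μG μN μ) (hψ : Continuous ψ)
    (hX : IsFunctionOnX f₁) (hc : Continuous f₁) (hi : Integrable f₂ (vHaar F d))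
    (h1 : LeviDecay f₁) (h2 : WeilDecay ψ J f₂) :
    ∃ C : ℝ,
        (∀ v ∈ Vprime F d, (∀ i, v i ≠ 0) →
          absInt ψ J μ f₁ f₂ v ≤
              ENNReal.ofReal (C * ∏ i, vabs (v i) ^ (-1 - (d i : ℝ) / 2)) ∧
          (v ∈ Ysm J → IConverges ψ J μ f₁ f₂ v ∧
            ‖intI ψ J μ f₁ f₂ v‖ ≤ C * ∏ i, vabs (v i) ^ (-1 - (d i : ℝ) / 2))) ∧
        (∀ v ∈ Vprime F d, v 0 = 0 →
          absInt ψ J μ f₁ f₂ v ≤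
              ENNReal.ofReal (C * (vabs (v 1) ^ (-(d 1 : ℝ) / 2 - (d 0 : ℝ) / 2) *
                vabs (v 2) ^ (-(d 2 : ℝ) / 2 - (d 0 : ℝ) / 2))) ∧
          (v ∈ Ysm J → IConverges ψ J μ f₁ f₂ v ∧
            ‖intI ψ J μ f₁ f₂ v‖ ≤ C * (vabs (v 1) ^ (-(d 1 : ℝ) / 2 - (d 0 : ℝ) / 2) *
                vabs (v 2) ^ (-(d 2 : ℝ) / 2 - (d 0 : ℝ) / 2)))) := by
  obtain ⟨C₁, hC₁, hA⟩ := exists_absInt_le hd hμ hX h1 h2 1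
  obtain ⟨C₂, hC₂, hB⟩ := exists_absInt_le_of_eq_zero hd hμ hX h1 h2 0
  have hr : ∀ (v : V F d) i (e : ℝ), 0 ≤ vabs (v i) ^ e := fun v i e => Real.rpow_nonneg (vabs_nonneg _) _
  refine ⟨C₁ + C₂, fun v _ hv => ?_, fun v hv hv0 => ?_⟩
  · have hp : 0 ≤ ∏ i, vabs (v i) ^ (-1 - (d i : ℝ) / 2) := Finset.prod_nonneg fun i _ => hr v i _
    refine converges_of_absInt_le hμ hψ hX hc hi (by positivity) ((hA v hv).trans (ENNReal.ofReal_le_ofReal ?_))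
    refine mul_le_mul (by linarith) (Finset.prod_le_prod (fun i _ => mul_nonneg (hr v i _) (by positivity))
      fun i _ => rpow_mul_inv_max_le (vabs_pos (hv i)) _)
      (Finset.prod_nonneg fun i _ => mul_nonneg (hr v i _) (by positivity)) (by positivity)
  · obtain ⟨hv1, hv2⟩ := ne_zero_of_mem_Vprime hv hv0
    have hp := mul_nonneg (hr v 1 (-(d 1 : ℝ) / 2 - (d 0 : ℝ) / 2)) (hr v 2 (-(d 2 : ℝ) / 2 - (d 0 : ℝ) / 2))
    refine converges_of_absInt_le hμ hψ hX hc hi (by positivity) ((hB v hv0 hv1 hv2).trans (ENNReal.ofReal_le_ofReal ?_))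
    have he : ∀ i, -((d i : ℝ) / 2 + (d 0 : ℝ) / 2) = -(d i : ℝ) / 2 - (d 0 : ℝ) / 2 := fun i => by ring
    rw [pow_zero, pow_zero, inv_one, mul_one, mul_one, he, he]
    exact mul_le_mul_of_nonneg_right (by linarith) hp

theorem bounds_arch_ne_zero (hd : ∀ i, 0 < d i) (hμ : IsQuotientMeasure μG μN μ) (hψ : Continuous ψ)
    (hX : IsFunctionOnX f₁) (hc : Continuous f₁) (hi : Integrable f₂ (vHaar F d))
    (h1 : LeviDecay f₁) (h2 : WeilDecay ψ J f₂) (N : Fin 3 → ℕ) :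
    ∃ C : ℝ, ∀ v ∈ Vprime F d, (∀ i, v i ≠ 0) →
        absInt ψ J μ f₁ f₂ v ≤
            ENNReal.ofReal (C * ∏ i, (max (vabs (v i)) 1 ^ (-(N i : ℝ)) *
              min (vabs (v i)) 1 ^ (-1 - (d i : ℝ) / 2))) ∧
        (v ∈ Ysm J → IConverges ψ J μ f₁ f₂ v ∧
          ‖intI ψ J μ f₁ f₂ v‖ ≤ C * ∏ i, (max (vabs (v i)) 1 ^ (-(N i : ℝ)) *
              min (vabs (v i)) 1 ^ (-1 - (d i : ℝ) / 2))) := by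
  obtain ⟨C, hC, hA⟩ := exists_absInt_le hd hμ hX h1 h2 (∑ i, N i)
  have hr : ∀ (v : V F d) i (e : ℝ), 0 ≤ vabs (v i) ^ e := fun v i e => Real.rpow_nonneg (vabs_nonneg _) _
  have hm : ∀ (v : V F d) i (e : ℝ), 0 ≤ min (vabs (v i)) 1 ^ e := fun v i e =>
    Real.rpow_nonneg (le_min (vabs_nonneg _) zero_le_one) _
  have hM : ∀ (v : V F d) i (e : ℝ), 0 ≤ max (vabs (v i)) 1 ^ e := fun v i e =>
    Real.rpow_nonneg (le_max_of_le_right zero_le_one) _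
  refine ⟨C, fun v _ hv => ?_⟩
  refine converges_of_absInt_le hμ hψ hX hc hi (mul_nonneg hC (Finset.prod_nonneg fun i _ =>
    mul_nonneg (hM v i _) (hm v i _))) ((hA v hv).trans (ENNReal.ofReal_le_ofReal ?_))
  refine mul_le_mul_of_nonneg_left (Finset.prod_le_prod (fun i _ => mul_nonneg (hr v i _) (by positivity))
      fun i _ => ?_) hC
  exact rpow_mul_inv_max_pow_le (vabs_pos (hv i)) (by positivity) (by linarith)
    (Finset.single_le_sum (fun _ _ => Nat.zero_le _) (Finset.mem_univ i))

theorem bounds_arch_eq_zero (hd : ∀ i, 0 < d i) (hμ : IsQuotientMeasure μG μN μ) (hψ : Continuous ψ)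
    (hX : IsFunctionOnX f₁) (hc : Continuous f₁) (hi : Integrable f₂ (vHaar F d))
    (h1 : LeviDecay f₁) (h2 : WeilDecay ψ J f₂) (N₂ N₃ : ℕ) :
    ∃ C : ℝ, ∀ v ∈ Vprime F d, v 0 = 0 →
        absInt ψ J μ f₁ f₂ v ≤
            ENNReal.ofReal (C *
              ((max (vabs (v 1)) 1 ^ (-(N₂ : ℝ)) *
                min (vabs (v 1)) 1 ^ (-(d 0 : ℝ) / 2 - (d 1 : ℝ) / 2)) *
              (max (vabs (v 2)) 1 ^ (-(N₃ : ℝ)) *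
                min (vabs (v 2)) 1 ^ (-(d 0 : ℝ) / 2 - (d 2 : ℝ) / 2)))) ∧
        (v ∈ Ysm J → IConverges ψ J μ f₁ f₂ v ∧
          ‖intI ψ J μ f₁ f₂ v‖ ≤ C *
              ((max (vabs (v 1)) 1 ^ (-(N₂ : ℝ)) *
                min (vabs (v 1)) 1 ^ (-(d 0 : ℝ) / 2 - (d 1 : ℝ) / 2)) *
              (max (vabs (v 2)) 1 ^ (-(N₃ : ℝ)) *
                min (vabs (v 2)) 1 ^ (-(d 0 : ℝ) / 2 - (d 2 : ℝ) / 2)))) := by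
  obtain ⟨C, hC, hA⟩ := exists_absInt_le_of_eq_zero hd hμ hX h1 h2 (N₂ + N₃)
  have hr : ∀ (v : V F d) i (e : ℝ), 0 ≤ vabs (v i) ^ e := fun v i e => Real.rpow_nonneg (vabs_nonneg _) _
  have hm : ∀ (v : V F d) i (e : ℝ), 0 ≤ min (vabs (v i)) 1 ^ e := fun v i e =>
    Real.rpow_nonneg (le_min (vabs_nonneg _) zero_le_one) _
  have hM : ∀ (v : V F d) i (e : ℝ), 0 ≤ max (vabs (v i)) 1 ^ e := fun v i e =>
    Real.rpow_nonneg (le_max_of_le_right zero_le_one) _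
  refine ⟨C, fun v hv hv0 => ?_⟩
  obtain ⟨hv1, hv2⟩ := ne_zero_of_mem_Vprime hv hv0
  refine converges_of_absInt_le hμ hψ hX hc hi (mul_nonneg hC (mul_nonneg (mul_nonneg (hM v 1 _) (hm v 1 _))
    (mul_nonneg (hM v 2 _) (hm v 2 _)))) ((hA v hv0 hv1 hv2).trans (ENNReal.ofReal_le_ofReal ?_))
  refine mul_le_mul_of_nonneg_left (mul_le_mul ?_ ?_ (mul_nonneg (hr v 2 _) (by positivity))
    (mul_nonneg (hM v 1 _) (hm v 1 _))) hC
  · exact rpow_mul_inv_max_pow_le (vabs_pos hv1) (by positivity) (by linarith) (Nat.le_add_right _ _)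
  · exact rpow_mul_inv_max_pow_le (vabs_pos hv2) (by positivity) (by linarith) (Nat.le_add_left _ _)

end Bounds

theorem continuous_of_isSmoothArch {F : Type*} [RCLike F] {f : Sp6 F → ℂ} (hf : IsSmoothArch f) : Continuous f := by
  rw [continuous_iff_continuousAt]
  intro g
  obtain ⟨U, φ, hU, hg, hφ, h⟩ := hf g
  have hc : Continuous fun h : Sp6 F => fun i j => h.1 i j := continuous_subtype_val
  have h1 : ContinuousAt (fun h : Sp6 F => φ fun i j => h.1 i j) g :=
    ContinuousAt.comp (f := fun h : Sp6 F => fun i j => h.1 i j)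
      (hφ.continuousOn.continuousAt (hU.mem_nhds hg)) hc.continuousAt
  refine h1.congr ?_
  filter_upwards [hc.continuousAt.preimage_mem_nhds (hU.mem_nhds hg)] with k hk
  exact (h k hk).symm

end TripleQuad
end

noncomputable section

namespace TripleQuad

section VerticalLines

open Filter Topology Complex

/-- Two vertical line integrals of a holomorphic function decaying in the strip are equal. -/
theorem integral_vertical_eq {E : ℂ → ℂ} {A B C : ℝ} (hAB : A ≤ B)
    (hd : ∀ z : ℂ, A ≤ z.re → z.re ≤ B → DifferentiableAt ℂ E z)
    (hb : ∀ z : ℂ, A ≤ z.re → z.re ≤ B → ‖E z‖ ≤ C * (1 + z.im ^ 2)⁻¹) :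
    ∫ y : ℝ, E (A + y * I) = ∫ y : ℝ, E (B + y * I) := by
  have hline : ∀ x : ℝ, A ≤ x → x ≤ B → Integrable fun y : ℝ => E (x + y * I) := by
    intro x hx1 hx2
    refine (integrable_inv_one_add_sq.const_mul C).mono' ?_ (Eventually.of_forall fun y => ?_)
    · refine Continuous.aestronglyMeasurable (continuous_iff_continuousAt.mpr fun y => ?_)
      have h1 : ContinuousAt E ((x : ℂ) + y * I) := (hd _ (by simpa using hx1) (by simpa using hx2)).continuousAt
      exact ContinuousAt.comp (f := fun y : ℝ => (x : ℂ) + y * I) h1 (by fun_prop)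
    · have := hb ((x : ℂ) + y * I) (by simpa using hx1) (by simpa using hx2)
      simpa using this
  have hlim : ∀ x : ℝ, A ≤ x → x ≤ B →
      Tendsto (fun T : ℝ => ∫ y in (-T)..T, E (x + y * I)) atTop (𝓝 (∫ y : ℝ, E (x + y * I))) :=
    fun x hx1 hx2 => intervalIntegral_tendsto_integral (hline x hx1 hx2) tendsto_neg_atTop_atBot tendsto_id
  have hhor : ∀ T x : ℝ, ∀ s : ℝ, s ^ 2 = T ^ 2 → A ≤ x → x ≤ B → ‖E (x + s * I)‖ ≤ C * (1 + T ^ 2)⁻¹ := by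
    intro T x s hs hx1 hx2
    have := hb ((x : ℂ) + s * I) (by simpa using hx1) (by simpa using hx2)
    simpa [hs] using this
  have hdiff : ∀ T : ℝ, ‖(∫ y in (-T)..T, E (B + y * I)) - ∫ y in (-T)..T, E (A + y * I)‖ ≤
      2 * (C * (1 + T ^ 2)⁻¹ * (B - A)) := by
    intro T
    have h := Complex.integral_boundary_rect_eq_zero_of_differentiableOn E ((A : ℂ) + (-T : ℝ) * I) ((B : ℂ) + T * I)
      (fun z hz => by
        have hz1 := hz.1
        simp only [Set.mem_preimage, add_re, ofReal_re, mul_re, I_re, mul_zero, ofReal_im, I_im, mul_one,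
          sub_zero, add_zero, sub_self, Set.uIcc_of_le hAB] at hz1
        exact (hd z hz1.1 hz1.2).differentiableWithinAt)
    simp only [add_re, ofReal_re, mul_re, I_re, mul_zero, ofReal_im, I_im, mul_one, sub_zero, add_zero, sub_self,
      add_im, mul_im, zero_add] at h
    have h1 : ‖∫ x in A..B, E (x + (-T : ℝ) * I)‖ ≤ C * (1 + T ^ 2)⁻¹ * |B - A| :=
      intervalIntegral.norm_integral_le_of_norm_le_const fun x hx => by
        rw [Set.uIoc_of_le hAB] at hx
        exact hhor T x (-T) (by ring) hx.1.le hx.2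
    have h2 : ‖∫ x in A..B, E (x + T * I)‖ ≤ C * (1 + T ^ 2)⁻¹ * |B - A| :=
      intervalIntegral.norm_integral_le_of_norm_le_const fun x hx => by
        rw [Set.uIoc_of_le hAB] at hx
        exact hhor T x T rfl hx.1.le hx.2
    rw [abs_of_nonneg (by linarith)] at h1 h2
    have h3 : I • ((∫ y in (-T)..T, E (B + y * I)) - ∫ y in (-T)..T, E (A + y * I)) =
        (∫ x in A..B, E (x + T * I)) - ∫ x in A..B, E (x + (-T : ℝ) * I) := by
      rw [smul_sub]
      linear_combination h
    calc _ = ‖I • ((∫ y in (-T)..T, E (B + y * I)) - ∫ y in (-T)..T, E (A + y * I))‖ := by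
          rw [norm_smul, norm_I, one_mul]
      _ ≤ _ := by
          rw [h3]
          refine (norm_sub_le _ _).trans ?_
          linarith
  have h0 : Tendsto (fun T : ℝ => 2 * (C * (1 + T ^ 2)⁻¹ * (B - A))) atTop (𝓝 0) := by
    have h1 : Tendsto (fun T : ℝ => (1 + T ^ 2)⁻¹) atTop (𝓝 0) :=
      tendsto_inv_atTop_zero.comp (tendsto_atTop_add_const_left _ _ (tendsto_pow_atTop two_ne_zero))
    simpa using ((h1.const_mul C).mul_const (B - A)).const_mul 2
  have h1 := squeeze_zero_norm hdiff h0
  have h2 := (hlim B hAB le_rfl).sub (hlim A le_rfl hAB)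
  exact (sub_eq_zero.mp (tendsto_nhds_unique h2 h1)).symm

/-- A function whose Mellin transform continues to the left with quadratic decay is bounded by the
corresponding power. -/
theorem norm_le_of_mellin_continuation {Ψ : ℝ → ℂ} {H : ℂ → ℂ} {A B C : ℝ} (hAB : A ≤ B)
    (hM : MellinConvergent Ψ B) (hH : ∀ y : ℝ, _root_.mellin Ψ (B + y * I) = H (B + y * I))
    (hd : ∀ z : ℂ, A ≤ z.re → z.re ≤ B → DifferentiableAt ℂ H z)
    (hb : ∀ z : ℂ, A ≤ z.re → z.re ≤ B → ‖H z‖ ≤ C * (1 + z.im ^ 2)⁻¹)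
    (hc : ∀ x, 0 < x → ContinuousAt Ψ x) {x : ℝ} (hx : 0 < x) :
    ‖Ψ x‖ ≤ C * x ^ (-A) := by
  have hx0 : (x : ℂ) ≠ 0 := ofReal_ne_zero.mpr hx.ne'
  have hC : 0 ≤ C := by
    have := (norm_nonneg _).trans (hb (A : ℂ) (by simp) (by simpa using hAB))
    simpa using this
  have hxn : ∀ z : ℂ, ‖(x : ℂ) ^ (-z)‖ = x ^ (-z.re) := fun z => by
    rw [Complex.norm_cpow_eq_rpow_re_of_pos hx, neg_re]
  set M := x ^ (-A) + x ^ (-B) with hMdef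
  have hMle : ∀ t, A ≤ t → t ≤ B → x ^ (-t) ≤ M := fun t h1 h2 => by
    have p1 := Real.rpow_nonneg hx.le (-A)
    have p2 := Real.rpow_nonneg hx.le (-B)
    rcases le_total 1 x with h | h
    · exact (Real.rpow_le_rpow_of_exponent_le h (neg_le_neg h1)).trans (by linarith)
    · exact (Real.rpow_le_rpow_of_exponent_ge hx h (neg_le_neg h2)).trans (by linarith)
  have hshift := integral_vertical_eq (E := fun z => (x : ℂ) ^ (-z) * H z) (C := M * C) hAB
    (fun z h1 h2 => ((differentiableAt_id.neg.const_cpow (Or.inl hx0))).mul (hd z h1 h2))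
    (fun z h1 h2 => by
      rw [norm_mul, hxn, mul_assoc]
      exact mul_le_mul (hMle _ h1 h2) (hb z h1 h2) (norm_nonneg _) (by positivity))
  have hvert : VerticalIntegrable (_root_.mellin Ψ) B := by
    have h1 : Integrable fun y : ℝ => H (B + y * I) := by
      refine (integrable_inv_one_add_sq.const_mul C).mono' ?_ (Eventually.of_forall fun y => ?_)
      · refine Continuous.aestronglyMeasurable (continuous_iff_continuousAt.mpr fun y => ?_)
        have h1 : ContinuousAt H ((B : ℂ) + y * I) := (hd _ (by simpa using hAB) (by simp)).continuousAt
        exact ContinuousAt.comp (f := fun y : ℝ => (B : ℂ) + y * I) h1 (by fun_prop)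
      · have := hb ((B : ℂ) + y * I) (by simpa using hAB) (by simp)
        simpa using this
    exact h1.congr (Eventually.of_forall fun y => (hH y).symm)
  rw [← mellinInv_mellin_eq B Ψ hx hM hvert (hc x hx), mellinInv]
  simp only [hH, smul_eq_mul]
  rw [← hshift, norm_smul]
  have h1 : ‖∫ y : ℝ, (x : ℂ) ^ (-((A : ℂ) + y * I)) * H (A + y * I)‖ ≤ ∫ y : ℝ, x ^ (-A) * C * (1 + y ^ 2)⁻¹ := by
    refine norm_integral_le_of_norm_le (integrable_inv_one_add_sq.const_mul _) (Eventually.of_forall fun y => ?_)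
    rw [norm_mul, hxn, mul_assoc]
    have := hb ((A : ℂ) + y * I) (by simp) (by simpa using hAB)
    simp only [add_re, ofReal_re, mul_re, I_re, mul_zero, ofReal_im, I_im, mul_one, sub_zero, add_zero, sub_self,
      add_im, mul_im, zero_add] at this ⊢
    exact mul_le_mul_of_nonneg_left this (Real.rpow_nonneg hx.le _)
  rw [integral_const_mul, integral_univ_inv_one_add_sq] at h1
  have h2 : ‖(1 / (2 * Real.pi) : ℝ)‖ = (2 * Real.pi)⁻¹ := by
    rw [one_div, norm_inv, Real.norm_of_nonneg (by positivity)]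
  have h3 : 0 ≤ x ^ (-A) * C := mul_nonneg (Real.rpow_nonneg hx.le _) hC
  rw [h2]
  calc _ ≤ (2 * Real.pi)⁻¹ * (x ^ (-A) * C * Real.pi) := mul_le_mul_of_nonneg_left h1 (by positivity)
    _ = (x ^ (-A) * C) / 2 := by field_simp
    _ ≤ _ := by linarith

end VerticalLines

end TripleQuad
end

noncomputable section

namespace TripleQuad

section PolarCoordinates

open scoped Pointwise

variable {F : Type*} [RCLike F]

variable (F) in
/-- The rotation invariant measure on the unit sphere of `F`. -/
def sphereHaar : Measure (Metric.sphere (0 : F) 1) := (Measure.addHaar : Measure F).toSphere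

instance : IsFiniteMeasure (sphereHaar F) := by unfold sphereHaar; infer_instance

instance : (sphereHaar F).IsOpenPosMeasure := by unfold sphereHaar; infer_instance

theorem finrank_pos_rclike : 0 < Module.finrank ℝ F := Module.finrank_pos

/-- Integration over `F^×` in polar coordinates. -/
theorem mulHaar_polar {Φ : F → ℂ} (hΦ : Integrable (fun a : Fˣ => Φ a) (mulHaar F)) :
    IntegrableOn (fun r : ℝ => (r : ℂ)⁻¹ * ∫ u : Metric.sphere (0 : F) 1, Φ (r • (u : F)) ∂(sphereHaar F)) (Set.Ioi 0) ∧
    ∫ a : Fˣ, Φ a ∂(mulHaar F) =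
      ∫ r in Set.Ioi (0 : ℝ), (r : ℂ)⁻¹ * ∫ u : Metric.sphere (0 : F) 1, Φ (r • (u : F)) ∂(sphereHaar F) := by
  have hρ : Measurable fun x : F => ENNReal.ofReal (nabs x)⁻¹ := measurable_nabs.inv.ennreal_ofReal
  have hρt : ∀ ν : Measure F, ∀ᵐ x ∂ν, ENNReal.ofReal (nabs x)⁻¹ < ⊤ := fun ν =>
    Filter.Eventually.of_forall fun _ => ENNReal.ofReal_lt_top
  have hrange : Set.range (Units.val : Fˣ → F) = {0}ᶜ := by
    ext x
    exact ⟨by rintro ⟨u, rfl⟩; exact u.ne_zero, fun h => ⟨Units.mk0 x h, rfl⟩⟩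
  have h0 : MeasurableSet ({0}ᶜ : Set F) := (measurableSet_singleton _).compl
  have hmap : (mulHaar F).map Units.val =
      ((Measure.addHaar : Measure F).restrict {0}ᶜ).withDensity fun x => ENNReal.ofReal (nabs x)⁻¹ := by
    rw [mulHaar, measurableEmbedding_unitsVal.map_comap, hrange, restrict_withDensity h0]
  set G : F → ℂ := fun x => (ENNReal.ofReal (nabs x)⁻¹).toReal • Φ x with hG
  have mp := (Measure.addHaar : Measure F).measurePreserving_homeomorphUnitSphereProd
  set e := homeomorphUnitSphereProd F
  have mp' : MeasurePreserving e.symm ((sphereHaar F).prod (Measure.volumeIoiPow (Module.finrank ℝ F - 1)))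
      ((Measure.addHaar : Measure F).comap Subtype.val) := mp.symm e.toMeasurableEquiv
  have hemb : MeasurableEmbedding e.symm := e.symm.measurableEmbedding
  have hI1 : Integrable G ((Measure.addHaar : Measure F).restrict {0}ᶜ) := by
    rw [← integrable_withDensity_iff_integrable_smul' hρ (hρt _), ← hmap,
      measurableEmbedding_unitsVal.integrable_map_iff]
    exact hΦ
  have hI2 : Integrable (fun p => G (e.symm p : ({0}ᶜ : Set F)))
      ((sphereHaar F).prod (Measure.volumeIoiPow (Module.finrank ℝ F - 1))) := by
    rw [← map_comap_subtype_coe h0, (MeasurableEmbedding.subtype_coe h0).integrable_map_iff] at hI1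
    exact (mp'.integrable_comp_emb hemb).mpr hI1
  have hE : ∫ a : Fˣ, Φ a ∂(mulHaar F) = ∫ p, G (e.symm p : ({0}ᶜ : Set F))
      ∂((sphereHaar F).prod (Measure.volumeIoiPow (Module.finrank ℝ F - 1))) := by
    rw [← measurableEmbedding_unitsVal.integral_map, hmap,
      integral_withDensity_eq_integral_toReal_smul hρ (hρt _), ← map_comap_subtype_coe h0,
      (MeasurableEmbedding.subtype_coe h0).integral_map]
    exact (mp'.integral_comp hemb _).symm
  have hpow : Measurable fun r : Set.Ioi (0 : ℝ) => ENNReal.ofReal (r.1 ^ (Module.finrank ℝ F - 1)) :=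
    (measurable_subtype_coe.pow_const _).ennreal_ofReal
  have hpt : ∀ r : Set.Ioi (0 : ℝ), (ENNReal.ofReal (r.1 ^ (Module.finrank ℝ F - 1))).toReal •
      ∫ u : Metric.sphere (0 : F) 1, G (e.symm (u, r) : ({0}ᶜ : Set F)) ∂(sphereHaar F) =
      ((r : ℝ) : ℂ)⁻¹ * ∫ u : Metric.sphere (0 : F) 1, Φ ((r : ℝ) • (u : F)) ∂(sphereHaar F) := by
    intro r
    have hr : 0 < (r : ℝ) := r.2
    have h1 : ∀ u : Metric.sphere (0 : F) 1, G (e.symm (u, r) : ({0}ᶜ : Set F)) =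
        (((r : ℝ) ^ Module.finrank ℝ F)⁻¹ : ℝ) • Φ ((r : ℝ) • (u : F)) := fun u => by
      have h2 : ((e.symm (u, r) : ({0}ᶜ : Set F)) : F) = (r : ℝ) • (u : F) := rfl
      have h3 : ‖(u : F)‖ = 1 := norm_eq_of_mem_sphere u
      rw [hG]
      simp only [h2]
      rw [nabs_eq_norm_pow, norm_smul, h3, mul_one, Real.norm_of_nonneg hr.le, ENNReal.toReal_ofReal (by positivity)]
    simp only [h1]
    rw [integral_smul, ENNReal.toReal_ofReal (by positivity), smul_smul, Complex.real_smul]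
    congr 1
    rw [← Complex.ofReal_inv]
    congr 1
    obtain ⟨m, hm⟩ := Nat.exists_eq_succ_of_ne_zero (finrank_pos_rclike (F := F)).ne'
    rw [hm, Nat.succ_sub_one, pow_succ, mul_inv, ← mul_assoc, mul_inv_cancel₀ (by positivity), one_mul]
  refine ⟨?_, ?_⟩
  · have h1 := hI2.integral_prod_right
    rw [Measure.volumeIoiPow, integrable_withDensity_iff_integrable_smul' hpow
      (Filter.Eventually.of_forall fun _ => ENNReal.ofReal_lt_top)] at h1
    simp only [hpt] at h1
    rw [IntegrableOn, ← map_comap_subtype_coe measurableSet_Ioi,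
      (MeasurableEmbedding.subtype_coe measurableSet_Ioi).integrable_map_iff]
    exact h1
  · rw [hE, integral_prod_symm _ hI2, Measure.volumeIoiPow, integral_withDensity_eq_integral_toReal_smul hpow
      (Filter.Eventually.of_forall fun _ => ENNReal.ofReal_lt_top)]
    simp only [hpt]
    exact integral_subtype_comap measurableSet_Ioi fun r : ℝ =>
      (r : ℂ)⁻¹ * ∫ u : Metric.sphere (0 : F) 1, Φ (r • (u : F)) ∂(sphereHaar F)

/-- Rotation of the unit sphere. -/
def rotate (u₀ : Metric.sphere (0 : F) 1) (u : Metric.sphere (0 : F) 1) : Metric.sphere (0 : F) 1 :=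
  ⟨u₀ * u, by
    have h1 := norm_eq_of_mem_sphere u₀
    have h2 := norm_eq_of_mem_sphere u
    simp [h1, h2]⟩

theorem continuous_rotate (u₀ : Metric.sphere (0 : F) 1) : Continuous (rotate u₀) :=
  (continuous_const.mul continuous_subtype_val).subtype_mk _

theorem measurePreserving_rotate (u₀ : Metric.sphere (0 : F) 1) :
    MeasurePreserving (rotate u₀) (sphereHaar F) (sphereHaar F) := by
  refine ⟨(continuous_rotate u₀).measurable, ?_⟩
  ext s hs
  have hu : (u₀ : F) ≠ 0 := Metric.ne_of_mem_sphere u₀.2 one_ne_zero |> fun h => by simpa using h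
  rw [Measure.map_apply (continuous_rotate u₀).measurable hs, sphereHaar,
    Measure.toSphere_apply' _ ((continuous_rotate u₀).measurable hs), Measure.toSphere_apply' _ hs]
  congr 1
  have h1 : Set.Ioo (0 : ℝ) 1 • ((↑) '' s : Set F) =
      (fun x => (u₀ : F) * x) '' (Set.Ioo (0 : ℝ) 1 • ((↑) '' (rotate u₀ ⁻¹' s) : Set F)) := by
    ext x
    simp only [Set.mem_smul, Set.mem_image, Set.mem_preimage]
    constructor
    · rintro ⟨r, hr, _, ⟨u, hu', rfl⟩, rfl⟩
      have hinv : ‖(u₀ : F)⁻¹ * u‖ = 1 := by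
        rw [norm_mul, norm_inv, norm_eq_of_mem_sphere u₀, norm_eq_of_mem_sphere u]; simp
      have hrot : rotate u₀ ⟨(u₀ : F)⁻¹ * u, by simpa using hinv⟩ = u := by
        apply Subtype.ext
        simp [rotate, mul_inv_cancel_left₀ hu]
      refine ⟨r • ((u₀ : F)⁻¹ * u), ⟨r, hr, _, ⟨⟨(u₀ : F)⁻¹ * u, by simpa using hinv⟩, by rw [hrot]; exact hu', rfl⟩, rfl⟩, ?_⟩
      rw [mul_smul_comm, mul_inv_cancel_left₀ hu]
    · rintro ⟨_, ⟨r, hr, _, ⟨u, hu', rfl⟩, rfl⟩, rfl⟩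
      exact ⟨r, hr, _, ⟨_, hu', rfl⟩, by simp [rotate, mul_smul_comm]⟩
  have h2 := measure_smul_set (Measure.addHaar : Measure F) hu (Set.Ioo (0 : ℝ) 1 • ((↑) '' (rotate u₀ ⁻¹' s) : Set F))
  rw [h1]
  have h3 : nabs (u₀ : F) = 1 := by rw [nabs_eq_norm_pow, norm_eq_of_mem_sphere u₀, one_pow]
  rw [h3, ENNReal.ofReal_one, one_mul] at h2
  exact h2.symm

end PolarCoordinates

end TripleQuad
end

noncomputable section

namespace TripleQuad

section SphereFourier

variable {F : Type*} [RCLike F]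

/-- The embedding of `F` in `ℂ`. -/
def toC (x : F) : ℂ := (RCLike.re x : ℝ) + (RCLike.im x : ℝ) * Complex.I

theorem toC_re (x : F) : (toC x).re = RCLike.re x := by simp [toC]

theorem toC_im (x : F) : (toC x).im = RCLike.im x := by simp [toC]

theorem toC_mul (x y : F) : toC (x * y) = toC x * toC y := by
  apply Complex.ext <;> simp [toC_re, toC_im]

theorem toC_smul (r : ℝ) (x : F) : toC (r • x) = r * toC x := by
  apply Complex.ext <;> simp [toC_re, toC_im, RCLike.smul_re, RCLike.smul_im]

theorem norm_toC (x : F) : ‖toC x‖ = ‖x‖ := by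
  rw [← sq_eq_sq₀ (norm_nonneg _) (norm_nonneg _), ← Complex.normSq_eq_norm_sq, ← RCLike.normSq_eq_def',
    Complex.normSq_apply, RCLike.normSq_apply, toC_re, toC_im]

theorem continuous_toC : Continuous (toC : F → ℂ) := by
  unfold toC
  exact (Complex.continuous_ofReal.comp RCLike.continuous_re).add
    ((Complex.continuous_ofReal.comp RCLike.continuous_im).mul continuous_const)

theorem toC_injective : Function.Injective (toC : F → ℂ) := fun x y h => by
  apply RCLike.ext
  · rw [← toC_re, ← toC_re, h]
  · rw [← toC_im, ← toC_im, h]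

theorem toC_sphere_ne_zero (u : Metric.sphere (0 : F) 1) : toC (u : F) ≠ 0 := by
  rw [← norm_pos_iff, norm_toC, norm_eq_of_mem_sphere u]
  exact one_pos

theorem continuous_toC_zpow (k : ℤ) : Continuous fun u : Metric.sphere (0 : F) 1 => toC (u : F) ^ k :=
  (continuous_toC.comp continuous_subtype_val).zpow₀ k fun u => Or.inl (toC_sphere_ne_zero u)

theorem integrable_sphere {g : Metric.sphere (0 : F) 1 → ℂ} (hg : Continuous g) : Integrable g (sphereHaar F) :=
  hg.integrable_of_hasCompactSupport (HasCompactSupport.of_compactSpace g)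

/-- A continuous function on the sphere with vanishing Fourier coefficients is zero. -/
theorem eq_zero_of_fourier_eq_zero {g : Metric.sphere (0 : F) 1 → ℂ} (hg : Continuous g)
    (h : ∀ k : ℤ, ∫ u, toC (u : F) ^ k * g u ∂(sphereHaar F) = 0) : g = 0 := by
  let E : C(Metric.sphere (0 : F) 1, ℂ) := ⟨fun u => toC (u : F), continuous_toC.comp continuous_subtype_val⟩
  let L : C(Metric.sphere (0 : F) 1, ℂ) →ₗ[ℂ] ℂ :=
    { toFun := fun φ => ∫ u, φ u * g u ∂(sphereHaar F)
      map_add' := fun φ₁ φ₂ => by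
        simp only [ContinuousMap.add_apply, add_mul]
        exact integral_add (integrable_sphere (φ₁.continuous.mul hg)) (integrable_sphere (φ₂.continuous.mul hg))
      map_smul' := fun c φ => by
        simp only [ContinuousMap.smul_apply, smul_eq_mul, mul_assoc, RingHom.id_apply]
        exact integral_const_mul _ _ }
  have hLc : Continuous L := by
    let gc : C(Metric.sphere (0 : F) 1, ℂ) := ⟨g, hg⟩
    refine (L.mkContinuous (‖gc‖ * (sphereHaar F).real Set.univ) fun φ => ?_).continuous
    refine (norm_integral_le_of_norm_le_const (C := ‖φ‖ * ‖gc‖) (Filter.Eventually.of_forall fun u => ?_)).trans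
      (le_of_eq (by ring))
    rw [norm_mul]
    exact mul_le_mul (φ.norm_coe_le_norm u) (gc.norm_coe_le_norm u) (norm_nonneg _) (norm_nonneg _)
  have hsep : (StarAlgebra.adjoin ℂ {E}).toSubalgebra.SeparatesPoints := by
    intro u v huv
    refine ⟨E, ⟨E, StarAlgebra.subset_adjoin ℂ _ (Set.mem_singleton E), rfl⟩, fun he => huv ?_⟩
    exact Subtype.ext (toC_injective he)
  have hmon : ∀ φ ∈ Submonoid.closure ({E} ∪ star {E} : Set C(Metric.sphere (0 : F) 1, ℂ)),
      ∃ k : ℤ, ∀ u, φ u = toC (u : F) ^ k := by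
    intro φ hφ
    induction hφ using Submonoid.closure_induction with
    | mem x hx =>
      rcases hx with hx | hx
      · rw [Set.mem_singleton_iff] at hx
        exact ⟨1, fun u => by rw [hx, zpow_one]; rfl⟩
      · rw [Set.star_singleton, Set.mem_singleton_iff] at hx
        refine ⟨-1, fun u => ?_⟩
        rw [hx, _root_.zpow_neg_one]
        change star (toC (u : F)) = _
        rw [Complex.inv_def, Complex.normSq_eq_norm_sq, norm_toC, norm_eq_of_mem_sphere u]
        simp
    | one => exact ⟨0, fun u => by simp⟩
    | mul x y _ _ hx hy =>
      obtain ⟨k, hk⟩ := hx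
      obtain ⟨l, hl⟩ := hy
      exact ⟨k + l, fun u => by rw [ContinuousMap.mul_apply, hk, hl, zpow_add₀ (toC_sphere_ne_zero u)]⟩
  have hker : ∀ φ : C(Metric.sphere (0 : F) 1, ℂ), L φ = 0 := by
    intro φ
    have htop := ContinuousMap.starSubalgebra_topologicalClosure_eq_top_of_separatesPoints _ hsep
    have hcl : IsClosed {φ | L φ = 0} := isClosed_singleton.preimage hLc
    have hsub : ((StarAlgebra.adjoin ℂ {E} : StarSubalgebra ℂ C(Metric.sphere (0 : F) 1, ℂ)) : Set _) ⊆ {φ | L φ = 0} := by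
      intro φ hφ
      have h1 : φ ∈ Algebra.adjoin ℂ ({E} ∪ star {E} : Set C(Metric.sphere (0 : F) 1, ℂ)) := hφ
      rw [← Subalgebra.mem_toSubmodule, Algebra.adjoin_eq_span] at h1
      have h2 : Submodule.span ℂ (Submonoid.closure ({E} ∪ star {E} : Set C(Metric.sphere (0 : F) 1, ℂ)) : Set _) ≤
          LinearMap.ker L := by
        rw [Submodule.span_le]
        intro x hx
        obtain ⟨k, hk⟩ := hmon x hx
        change ∫ u, x u * g u ∂(sphereHaar F) = 0
        simp only [hk]
        exact h k
      exact h2 h1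
    have hmem : φ ∈ (StarAlgebra.adjoin ℂ {E} : StarSubalgebra ℂ C(Metric.sphere (0 : F) 1, ℂ)).topologicalClosure := by
      rw [htop]; trivial
    have h3 : φ ∈ closure ((StarAlgebra.adjoin ℂ {E} : StarSubalgebra ℂ C(Metric.sphere (0 : F) 1, ℂ)) : Set _) := hmem
    exact closure_minimal hsub hcl h3
  have h4 : ∫ u, star (g u) * g u ∂(sphereHaar F) = 0 := hker ⟨fun u => star (g u), hg.star⟩
  have h5 : ∀ u, star (g u) * g u = ((‖g u‖ ^ 2 : ℝ) : ℂ) := fun u => by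
    rw [Complex.star_def, ← Complex.normSq_eq_conj_mul_self, Complex.normSq_eq_norm_sq]
  simp only [h5] at h4
  have h6 : ∫ u, ‖g u‖ ^ 2 ∂(sphereHaar F) = 0 := by
    have h9 : ∫ u, ((‖g u‖ ^ 2 : ℝ) : ℂ) ∂(sphereHaar F) = ((∫ u, ‖g u‖ ^ 2 ∂(sphereHaar F) : ℝ) : ℂ) :=
      integral_ofReal
    rw [h9] at h4
    exact_mod_cast h4
  have hcn : Continuous fun u => ‖g u‖ ^ 2 := hg.norm.pow 2
  have hi : Integrable (fun u => ‖g u‖ ^ 2) (sphereHaar F) :=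
    hcn.integrable_of_hasCompactSupport (HasCompactSupport.of_compactSpace _)
  have h7 := (integral_eq_zero_iff_of_nonneg (fun u => sq_nonneg ‖g u‖) hi).mp h6
  have h8 := hcn.ae_eq_iff_eq (μ := sphereHaar F) continuous_const |>.mp h7
  funext u
  have h9 : ‖g u‖ ^ 2 = 0 := congrFun h8 u
  simpa using h9

variable (F) in
/-- The powers of some point of the sphere are dense in it. -/
theorem exists_sphere_generator : ∃ u₀ : Metric.sphere (0 : F) 1, ∀ j : ℤ, toC (u₀ : F) ^ j = 1 →
    ∀ u : Metric.sphere (0 : F) 1, toC (u : F) ^ j = 1 := by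
  rcases RCLike.I_eq_zero_or_im_I_eq_one (K := F) with hI | hI
  · refine ⟨⟨-1, by simp⟩, fun j hj u => ?_⟩
    have h1 : toC (-1 : F) = -1 := by apply Complex.ext <;> simp [toC_re, toC_im]
    rw [h1] at hj
    have him : (toC (u : F)).im = 0 := by
      rw [toC_im, ← RCLike.I_im, hI]
      simp
    have hsq : (toC (u : F)) ^ 2 = 1 := by
      have h2 := norm_toC (u : F)
      rw [norm_eq_of_mem_sphere u] at h2
      have h3 : toC (u : F) = ((toC (u : F)).re : ℂ) := by apply Complex.ext <;> simp [him]
      rw [h3, Complex.norm_real, Real.norm_eq_abs] at h2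
      rw [h3]
      have h4 : (toC (u : F)).re ^ 2 = 1 := by rw [← sq_abs, h2, one_pow]
      exact_mod_cast h4
    rcases Int.even_or_odd j with ⟨m, rfl⟩ | hodd
    · rw [← two_mul, _root_.zpow_mul]
      have : toC (u : F) ^ (2 : ℤ) = 1 := by exact_mod_cast hsq
      rw [this, _root_.one_zpow]
    · rw [hodd.neg_one_zpow] at hj
      norm_num at hj
  · set z : F := (Real.cos 1 : F) + (Real.sin 1 : F) * RCLike.I with hz
    have htz : toC z = Complex.exp Complex.I := by
      rw [← one_mul Complex.I, ← Complex.ofReal_one, Complex.exp_mul_I]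
      apply Complex.ext
      · rw [toC_re, hz]
        simp [Complex.cos_ofReal_re, Complex.sin_ofReal_re, Complex.sin_ofReal_im, Complex.cos_ofReal_im, -Complex.ofReal_one]
      · rw [toC_im, hz]
        simp [hI, Complex.cos_ofReal_re, Complex.sin_ofReal_re, Complex.sin_ofReal_im, Complex.cos_ofReal_im, -Complex.ofReal_one]
    have hnz : ‖z‖ = 1 := by
      rw [← norm_toC, htz]
      have := Complex.norm_exp_ofReal_mul_I 1
      simpa using this
    refine ⟨⟨z, by simpa using hnz⟩, fun j hj u => ?_⟩
    have h1 : j = 0 := by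
      change toC z ^ j = 1 at hj
      rw [htz, ← Complex.exp_int_mul, Complex.exp_eq_one_iff] at hj
      obtain ⟨m, hm⟩ := hj
      have h2 : (j : ℂ) = m * (2 * Real.pi) := by
        have : (j : ℂ) * Complex.I = (m * (2 * Real.pi)) * Complex.I := by rw [hm]; ring
        exact mul_right_cancel₀ Complex.I_ne_zero this
      have h3 : (j : ℝ) = m * (2 * Real.pi) := by exact_mod_cast h2
      by_contra hj0
      have hm0 : m ≠ 0 := by
        rintro rfl
        apply hj0
        simpa using h3
      have hirr : Irrational (((2 * m : ℤ) : ℝ) * Real.pi) := irrational_pi.intCast_mul (by simpa using hm0)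
      refine hirr ⟨j, ?_⟩
      push_cast
      rw [h3]
      ring
    rw [h1, zpow_zero]

end SphereFourier

end TripleQuad
end

noncomputable section

namespace TripleQuad

section FiniteFourier

variable {F : Type*} [RCLike F]

/-- The Fourier coefficient of a function on the unit sphere. -/
def sphereCoeff (k : ℤ) (g : Metric.sphere (0 : F) 1 → ℂ) : ℂ :=
  ∫ u, toC (u : F) ^ k * g u ∂(sphereHaar F)

theorem continuous_zpow_mul (k : ℤ) {g : Metric.sphere (0 : F) 1 → ℂ} (hg : Continuous g) :
    Continuous fun u : Metric.sphere (0 : F) 1 => toC (u : F) ^ k * g u := (continuous_toC_zpow k).mul hg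

theorem sphereCoeff_sum {ι : Type*} (s : Finset ι) (k : ℤ) (c : ι → ℂ) {g : ι → Metric.sphere (0 : F) 1 → ℂ}
    (hg : ∀ i, Continuous (g i)) :
    sphereCoeff k (fun u => ∑ i ∈ s, c i * g i u) = ∑ i ∈ s, c i * sphereCoeff k (g i) := by
  simp only [sphereCoeff, Finset.mul_sum]
  have hi : ∀ i ∈ s, Integrable (fun u : Metric.sphere (0 : F) 1 => toC (u : F) ^ k * (c i * g i u)) (sphereHaar F) := fun i _ =>
    integrable_sphere (continuous_zpow_mul k (g := fun u => c i * g i u) (continuous_const.mul (hg i)))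
  rw [integral_finsetSum _ hi]
  refine Finset.sum_congr rfl fun i _ => ?_
  rw [← integral_const_mul]
  congr 1
  funext u
  ring

theorem sphereCoeff_congr {k l : ℤ} (h : ∀ u : Metric.sphere (0 : F) 1, toC (u : F) ^ (k + -l) = 1)
    (g : Metric.sphere (0 : F) 1 → ℂ) : sphereCoeff l g = sphereCoeff k g := by
  rw [sphereCoeff, sphereCoeff]
  congr 1
  funext u
  have h4 := h u
  rw [zpow_add₀ (toC_sphere_ne_zero u), _root_.zpow_neg,
    mul_inv_eq_one₀ (zpow_ne_zero _ (toC_sphere_ne_zero u))] at h4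
  rw [h4]

theorem integral_rotate (u₀ : Metric.sphere (0 : F) 1) {g : Metric.sphere (0 : F) 1 → ℂ} (hg : Continuous g) :
    ∫ u, g (rotate u₀ u) ∂(sphereHaar F) = ∫ u, g u ∂(sphereHaar F) := by
  conv_rhs => rw [← (measurePreserving_rotate u₀).map_eq]
  exact (integral_map (continuous_rotate u₀).measurable.aemeasurable hg.aestronglyMeasurable).symm

theorem sphereCoeff_rotate (u₀ : Metric.sphere (0 : F) 1) (k : ℤ) {g : Metric.sphere (0 : F) 1 → ℂ}
    (hg : Continuous g) :
    sphereCoeff k (fun u => g (rotate u₀ u)) = (toC (u₀ : F) ^ k)⁻¹ * sphereCoeff k g := by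
  have h0 : toC (u₀ : F) ^ k ≠ 0 := zpow_ne_zero k (toC_sphere_ne_zero u₀)
  rw [eq_inv_mul_iff_mul_eq₀ h0, sphereCoeff, sphereCoeff, ← integral_rotate u₀ (continuous_zpow_mul k hg),
    ← integral_const_mul]
  congr 1
  funext u
  change _ = toC ((u₀ : F) * u) ^ k * _
  rw [toC_mul, mul_zpow, mul_assoc]

theorem continuous_rotate_iterate (u₀ : Metric.sphere (0 : F) 1) (j : ℕ) : Continuous (rotate u₀)^[j] :=
  (continuous_rotate u₀).iterate j

theorem sphereCoeff_rotate_iterate (u₀ : Metric.sphere (0 : F) 1) (k : ℤ) {g : Metric.sphere (0 : F) 1 → ℂ}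
    (hg : Continuous g) (j : ℕ) :
    sphereCoeff k (fun u => g ((rotate u₀)^[j] u)) = ((toC (u₀ : F) ^ k)⁻¹) ^ j * sphereCoeff k g := by
  induction j with
  | zero => simp
  | succ j ih =>
    simp only [Function.iterate_succ, Function.comp_apply]
    rw [sphereCoeff_rotate u₀ k (g := fun u => g ((rotate u₀)^[j] u)) (hg.comp (continuous_rotate_iterate u₀ j)),
      ih, pow_succ']
    ring

theorem sphereCoeff_zpow {u₀ : Metric.sphere (0 : F) 1}
    (hu₀ : ∀ j : ℤ, toC (u₀ : F) ^ j = 1 → ∀ u : Metric.sphere (0 : F) 1, toC (u : F) ^ j = 1) (k l : ℤ) :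
    sphereCoeff k (fun u : Metric.sphere (0 : F) 1 => toC (u : F) ^ l) =
      if toC (u₀ : F) ^ (k + l) = 1 then ((sphereHaar F).real Set.univ : ℂ) else 0 := by
  have h1 : sphereCoeff k (fun u : Metric.sphere (0 : F) 1 => toC (u : F) ^ l) =
      ∫ u : Metric.sphere (0 : F) 1, toC (u : F) ^ (k + l) ∂(sphereHaar F) := by
    rw [sphereCoeff]
    congr 1
    funext u
    rw [zpow_add₀ (toC_sphere_ne_zero u)]
  rw [h1]
  split_ifs with h
  · simp only [hu₀ _ h]
    rw [integral_const]
    simp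
  · have h2 := integral_rotate u₀ (continuous_toC_zpow (F := F) (k + l))
    have h3 : ∀ u : Metric.sphere (0 : F) 1, toC (rotate u₀ u : F) ^ (k + l) =
        toC (u₀ : F) ^ (k + l) * toC (u : F) ^ (k + l) := fun u => by
      change toC ((u₀ : F) * u) ^ (k + l) = _
      rw [toC_mul, mul_zpow]
    simp only [h3] at h2
    rw [integral_const_mul] at h2
    have h4 : (toC (u₀ : F) ^ (k + l) - 1) * ∫ u : Metric.sphere (0 : F) 1, toC (u : F) ^ (k + l) ∂(sphereHaar F) = 0 := by
      rw [sub_mul, one_mul, h2, sub_self]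
    exact (mul_eq_zero.mp h4).resolve_left (sub_ne_zero.mpr h)

/-- A continuous function whose rotates satisfy a linear relation is controlled by finitely many of
its Fourier coefficients. -/
theorem exists_finset_sphereCoeff {u₀ : Metric.sphere (0 : F) 1}
    (hu₀ : ∀ j : ℤ, toC (u₀ : F) ^ j = 1 → ∀ u : Metric.sphere (0 : F) 1, toC (u : F) ^ j = 1)
    {p : Polynomial ℂ} (hp : p ≠ 0) :
    ∃ T : Finset ℤ, ∀ g : Metric.sphere (0 : F) 1 → ℂ, Continuous g →
      (∀ u, ∑ j ∈ Finset.range (p.natDegree + 1), p.coeff j * g ((rotate u₀)^[j] u) = 0) →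
      ∀ u, ‖g u‖ ≤ ((sphereHaar F).real Set.univ)⁻¹ * ∑ k ∈ T, ‖sphereCoeff k g‖ := by
  classical
  set R := p.roots.toFinset.filter fun ζ => ∃ k : ℤ, (toC (u₀ : F) ^ k)⁻¹ = ζ with hR
  choose! κ hκ using fun (ζ : ℂ) (h : ∃ k : ℤ, (toC (u₀ : F) ^ k)⁻¹ = ζ) => h
  have hκR : ∀ ζ ∈ R, (toC (u₀ : F) ^ (κ ζ))⁻¹ = ζ := fun ζ hζ => hκ ζ (Finset.mem_filter.mp hζ).2
  have hinj : Set.InjOn κ R := fun a ha b hb hab => by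
    rw [← hκR a ha, ← hκR b hb, hab]
  refine ⟨R.image κ, fun g hg hrel u => ?_⟩
  have hroot : ∀ k, sphereCoeff k g ≠ 0 → (toC (u₀ : F) ^ k)⁻¹ ∈ R := by
    intro k hk
    have h1 : sphereCoeff k (fun u => ∑ j ∈ Finset.range (p.natDegree + 1), p.coeff j * g ((rotate u₀)^[j] u)) =
        p.eval ((toC (u₀ : F) ^ k)⁻¹) * sphereCoeff k g := by
      rw [sphereCoeff_sum _ k (fun j => p.coeff j) (g := fun j u => g ((rotate u₀)^[j] u))
          fun j => hg.comp (continuous_rotate_iterate u₀ j),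
        Polynomial.eval_eq_sum_range, Finset.sum_mul]
      refine Finset.sum_congr rfl fun j _ => ?_
      rw [mul_assoc, ← sphereCoeff_rotate_iterate u₀ k hg j]
    simp only [hrel] at h1
    have h2 : sphereCoeff k (fun _ : Metric.sphere (0 : F) 1 => (0 : ℂ)) = 0 := by simp [sphereCoeff]
    rw [h2, eq_comm, mul_eq_zero, or_iff_left hk] at h1
    exact Finset.mem_filter.mpr ⟨by rw [Multiset.mem_toFinset, Polynomial.mem_roots hp]; exact h1, k, rfl⟩
  set σ : ℂ := ((sphereHaar F).real Set.univ : ℂ) with hσ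
  have hσ0 : (sphereHaar F).real Set.univ ≠ 0 := by
    rw [measureReal_def, ENNReal.toReal_ne_zero]
    refine ⟨?_, measure_ne_top _ _⟩
    exact isOpen_univ.measure_ne_zero _ ⟨u₀, trivial⟩
  have hσc : σ ≠ 0 := by rw [hσ]; exact_mod_cast hσ0
  set S : Metric.sphere (0 : F) 1 → ℂ := fun u =>
    ∑ k ∈ R.image κ, σ⁻¹ * sphereCoeff k g * toC (u : F) ^ (-k) with hS
  have hSc : Continuous S := continuous_finsetSum _ fun k _ => continuous_const.mul (continuous_toC_zpow _)
  have hcoef : ∀ k, sphereCoeff k S = sphereCoeff k g := by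
    intro k
    have h1 : sphereCoeff k S = ∑ l ∈ R.image κ, σ⁻¹ * sphereCoeff l g *
        (if toC (u₀ : F) ^ (k + -l) = 1 then σ else 0) := by
      rw [hS, sphereCoeff_sum _ k (fun l => σ⁻¹ * sphereCoeff l g) fun l => continuous_toC_zpow (-l)]
      simp only [sphereCoeff_zpow hu₀, hσ]
    rw [h1, Finset.sum_image hinj]
    have hz : ∀ ζ ∈ R, toC (u₀ : F) ^ (k + -(κ ζ)) = 1 ↔ ζ = (toC (u₀ : F) ^ k)⁻¹ := fun ζ hζ => by
      rw [zpow_add₀ (toC_sphere_ne_zero u₀), _root_.zpow_neg, hκR ζ hζ]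
      exact ⟨eq_inv_of_mul_eq_one_right, fun h => by
        rw [h, mul_inv_cancel₀ (zpow_ne_zero k (toC_sphere_ne_zero u₀))]⟩
    by_cases hk : sphereCoeff k g = 0
    · rw [hk]
      refine Finset.sum_eq_zero fun ζ hζ => ?_
      split_ifs with h2
      · rw [sphereCoeff_congr (hu₀ _ h2) g, hk, mul_zero, zero_mul]
      · rw [mul_zero]
    · have hmem := hroot k hk
      rw [Finset.sum_eq_single_of_mem _ hmem]
      · have h2 := (hz _ hmem).mpr rfl
        rw [if_pos h2]
        rw [sphereCoeff_congr (hu₀ _ h2) g, mul_right_comm, inv_mul_cancel₀ hσc, one_mul]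
      · intro ζ hζ hne
        rw [if_neg (mt (hz ζ hζ).mp hne), mul_zero]
  have hzero := eq_zero_of_fourier_eq_zero (g := fun u => g u - S u) (hg.sub hSc) fun k => by
    have h1 := hcoef k
    rw [sphereCoeff, sphereCoeff] at h1
    simp only [mul_sub]
    rw [integral_sub (integrable_sphere (continuous_zpow_mul k hg))
      (integrable_sphere (continuous_zpow_mul k hSc)), h1, sub_self]
  have hgu : g u = S u := sub_eq_zero.mp (congrFun hzero u)
  rw [hgu, hS, Finset.mul_sum]
  refine (norm_sum_le _ _).trans (Finset.sum_le_sum fun k _ => le_of_eq ?_)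
  rw [norm_mul, norm_mul, norm_inv, hσ, Complex.norm_real, Real.norm_of_nonneg measureReal_nonneg, norm_zpow,
    norm_toC, norm_eq_of_mem_sphere u, _root_.one_zpow, mul_one]

end FiniteFourier

end TripleQuad
end

noncomputable section

namespace TripleQuad

section ArchimedeanFactors

open Complex

theorem differentiableAt_Gammaℝ {s : ℂ} (hs : 0 < s.re) : DifferentiableAt ℂ Gammaℝ s := by
  have h1 := differentiable_Gammaℝ_inv s
  have h2 := h1.inv (inv_ne_zero (Gammaℝ_ne_zero_of_re_pos hs))
  simpa [Pi.inv_def] using h2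

theorem differentiableAt_Gammaℂ {s : ℂ} (hs : 0 < s.re) : DifferentiableAt ℂ Gammaℂ s := by
  have h1 := differentiable_Gammaℂ_inv s
  have h0 : Gammaℂ s ≠ 0 := by
    rw [Gammaℂ_def]
    have h2 : (2 * (Real.pi : ℂ)) ≠ 0 := by simp [Real.pi_ne_zero]
    exact mul_ne_zero (mul_ne_zero two_ne_zero (by simp [Complex.cpow_eq_zero_iff, h2]))
      (Complex.Gamma_ne_zero_of_re_pos hs)
  have h2 := h1.inv (inv_ne_zero h0)
  simpa [Pi.inv_def] using h2

variable (F : Type*) [RCLike F]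

theorem differentiableAt_LArch (k : ℤ) {s : ℂ} (hs : 0 < s.re) : DifferentiableAt ℂ (LArch F k 0) s := by
  unfold LArch
  split_ifs
  · have h1 : 0 ≤ (((k % 2 : ℤ) : ℂ)).re := by
      rw [intCast_re]
      exact_mod_cast Int.emod_nonneg k (by norm_num)
    refine DifferentiableAt.comp (f := fun s : ℂ => s + 0 + ((k % 2 : ℤ) : ℂ)) s
      (differentiableAt_Gammaℝ ?_) (by fun_prop)
    rw [add_re, add_zero]
    linarith
  · have h1 : 0 ≤ (((|k| : ℤ) : ℂ) / 2).re := by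
      rw [show (((|k| : ℤ) : ℂ) / 2) = (((|k| : ℤ) / 2 : ℝ) : ℂ) by
      rw [ofReal_div, ofReal_intCast, ofReal_ofNat], ofReal_re]
      positivity
    refine DifferentiableAt.comp (f := fun s : ℂ => s + 0 + ((|k| : ℤ) : ℂ) / 2) s
      (differentiableAt_Gammaℂ ?_) (by fun_prop)
    rw [add_re, add_zero]
    linarith

theorem differentiableAt_aIdArch (k : ℤ) {s : ℂ} (hs : -1 < s.re) : DifferentiableAt ℂ (aIdArch F k 0) s := by
  unfold aIdArch
  refine DifferentiableAt.mul ?_ ?_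
  · refine DifferentiableAt.comp (f := fun s : ℂ => s + 2) s (differentiableAt_LArch F k ?_) (by fun_prop)
    simp
    linarith
  · rw [mul_zero]
    refine DifferentiableAt.comp (f := fun s : ℂ => 2 * s + 2) s (differentiableAt_LArch F (2 * k) ?_) (by fun_prop)
    simp
    linarith

/-- The decay in vertical strips to the right of `0` of an excellent section. -/
theorem exists_excellent_bound {k : ℤ} {σ : ℝ} {Φ : ℂ → ℂ} (h : IsExcellentContinuation σ (aIdArch F k 0) Φ)
    {A B : ℝ} (hA : 0 ≤ A) :
    ∃ (E : ℂ → ℂ) (C : ℝ), (∀ s : ℂ, σ < s.re → Φ s = E s) ∧ (∀ s : ℂ, 0 ≤ s.re → DifferentiableAt ℂ E s) ∧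
      ∀ s : ℂ, A ≤ s.re → s.re ≤ B → ‖E s‖ * (1 + s.im ^ 2) ≤ C := by
  obtain ⟨g, hg, hΦ, hbd⟩ := h
  obtain ⟨C, hC⟩ := hbd A B ((Polynomial.X + Polynomial.C 1) ^ 2) fun s h1 _ => by
    have han : AnalyticAt ℂ (aIdArch F k 0) s := by
      have hop : IsOpen {z : ℂ | -1 < z.re} := isOpen_lt continuous_const continuous_re
      refine DifferentiableOn.analyticAt (s := {z : ℂ | -1 < z.re}) (fun z hz =>
        (differentiableAt_aIdArch F k hz).differentiableWithinAt) (hop.mem_nhds ?_)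
      change -1 < s.re
      linarith
    refine AnalyticAt.meromorphicOrderAt_nonneg (AnalyticAt.mul ?_ han)
    exact (Polynomial.differentiable _).analyticAt s
  refine ⟨fun s => g s * aIdArch F k 0 s, C, hΦ, fun s hs =>
    (hg s).mul (differentiableAt_aIdArch F k (by linarith)), fun s h1 h2 => ?_⟩
  have h3 := hC s h1 h2
  simp only [Polynomial.eval_pow, Polynomial.eval_add, Polynomial.eval_X, Polynomial.eval_C, norm_mul, norm_pow] at h3
  refine le_trans ?_ h3
  rw [norm_mul, mul_comm]
  refine mul_le_mul_of_nonneg_right ?_ (by positivity)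
  rw [← Complex.normSq_eq_norm_sq, Complex.normSq_apply]
  simp only [add_re, one_re, add_im, one_im, add_zero]
  nlinarith

end ArchimedeanFactors

section RadialDecay

variable {F : Type*} [RCLike F]

theorem continuousOn_sphereCoeff (k : ℤ) {Φ : F → ℂ} (hc : ContinuousOn Φ {0}ᶜ) {r : ℝ} (hr : 0 < r) :
    ContinuousAt (fun r : ℝ => sphereCoeff k fun u : Metric.sphere (0 : F) 1 => Φ (r • (u : F))) r := by
  have hcont : Continuous fun p : ℝ × Metric.sphere (0 : F) 1 => toC (p.2 : F) ^ k * Φ (Real.exp p.1 • (p.2 : F)) := by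
    refine ((continuous_toC_zpow k).comp continuous_snd).mul ?_
    refine hc.comp_continuous ?_ fun p => ?_
    · exact (Real.continuous_exp.comp continuous_fst).smul (continuous_subtype_val.comp continuous_snd)
    · have h1 : (p.2 : F) ≠ 0 := fun h0 => by
        have := norm_eq_of_mem_sphere p.2
        rw [h0, norm_zero] at this
        exact zero_ne_one this
      exact smul_ne_zero (Real.exp_pos _).ne' h1
  have h1 : Continuous fun t : ℝ => sphereCoeff k fun u : Metric.sphere (0 : F) 1 => Φ (Real.exp t • (u : F)) := by
    have := continuous_parametric_integral_of_continuous (μ := sphereHaar F)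
      (f := fun (t : ℝ) (u : Metric.sphere (0 : F) 1) => toC (u : F) ^ k * Φ (Real.exp t • (u : F)))
      hcont isCompact_univ
    simp only [Measure.restrict_univ] at this
    exact this
  have h2 : ContinuousAt (fun r : ℝ => sphereCoeff k fun u : Metric.sphere (0 : F) 1 => Φ (Real.exp (Real.log r) • (u : F))) r :=
    ContinuousAt.comp (f := Real.log) h1.continuousAt (Real.continuousAt_log hr.ne')
  refine h2.congr ?_
  filter_upwards [lt_mem_nhds hr] with t ht
  rw [Real.exp_log ht]

/-- The integrand of the Mellin transform as a function on `F`. -/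
def mellinKernel (k : ℤ) (s : ℂ) (Φ : F → ℂ) (x : F) : ℂ :=
  ((nabs x ^ 2 : ℝ) : ℂ) * ((toC x / (‖x‖ : ℂ)) ^ k * (nabs x : ℂ) ^ s) * Φ x

theorem mellinKernel_smul (k : ℤ) (s : ℂ) (Φ : F → ℂ) {r : ℝ} (hr : 0 < r) (u : Metric.sphere (0 : F) 1) :
    (r : ℂ)⁻¹ * mellinKernel k s Φ (r • (u : F)) =
      (r : ℂ) ^ ((Module.finrank ℝ F : ℂ) * (s + 2) - 1) * (toC (u : F) ^ k * Φ (r • (u : F))) := by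
  have hr0 : (r : ℂ) ≠ 0 := Complex.ofReal_ne_zero.mpr hr.ne'
  have h1 : ‖r • (u : F)‖ = r := by rw [norm_smul, norm_eq_of_mem_sphere u, mul_one, Real.norm_of_nonneg hr.le]
  have h2 : toC (r • (u : F)) / ((‖r • (u : F)‖ : ℝ) : ℂ) = toC (u : F) := by
    rw [h1, toC_smul, mul_div_cancel_left₀ _ hr0]
  have h3 : nabs (r • (u : F)) = r ^ Module.finrank ℝ F := by rw [nabs_eq_norm_pow, h1]
  have h4 : (r : ℂ) ^ ((Module.finrank ℝ F : ℂ) * (s + 2) - 1) =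
      (r : ℂ)⁻¹ * (((r ^ Module.finrank ℝ F) ^ 2 : ℝ) : ℂ) * (((r ^ Module.finrank ℝ F : ℝ) : ℂ) ^ s) := by
    have h5 := ofReal_zpow_cpow hr (Module.finrank ℝ F : ℤ) s
    rw [zpow_natCast, zpow_natCast] at h5
    rw [h5, Complex.cpow_sub _ _ hr0, Complex.cpow_one, Complex.cpow_nat_mul, Complex.cpow_add _ _ hr0,
      Complex.cpow_ofNat]
    push_cast
    field_simp
    rw [mul_pow]
    ring
  rw [mellinKernel, h2, h3, h4]
  ring

variable (F) in
theorem finrank_cast_pos : 0 < (Module.finrank ℝ F : ℝ) := by exact_mod_cast finrank_pos_rclike (F := F)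

/-- Decay of the Fourier components of a function with an excellent Mellin transform. -/
theorem exists_norm_sphereCoeff_le {Φ : F → ℂ} (hc : ContinuousOn Φ {0}ᶜ) {k : ℤ} {σ : ℝ}
    (hint : ∀ s : ℂ, σ < s.re → Integrable (fun a : Fˣ => mellinKernel k s Φ a) (mulHaar F))
    (hexc : IsExcellentContinuation σ (aIdArch F k 0) fun s => ∫ a : Fˣ, mellinKernel k s Φ a ∂(mulHaar F))
    {n : ℕ} (hn : 2 ≤ n) :
    ∃ C : ℝ, ∀ r : ℝ, 0 < r → ‖sphereCoeff k fun u : Metric.sphere (0 : F) 1 => Φ (r • (u : F))‖ ≤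
      C * ((r ^ Module.finrank ℝ F) ^ n)⁻¹ := by
  set D : ℝ := (Module.finrank ℝ F : ℝ) with hD
  have hD0 : 0 < D := finrank_cast_pos F
  have hD1 : 1 ≤ D := by rw [hD]; exact_mod_cast finrank_pos_rclike (F := F)
  have hDc : (D : ℂ) ≠ 0 := Complex.ofReal_ne_zero.mpr hD0.ne'
  have hn2 : (2 : ℝ) ≤ n := by exact_mod_cast hn
  set A : ℝ := n - 2
  set B : ℝ := max A (σ + 1)
  obtain ⟨E, C, hE, hEd, hEb⟩ := exists_excellent_bound F hexc (A := A) (B := B) (by simp only [A]; linarith)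
  set Ψ : ℝ → ℂ := fun r => sphereCoeff k fun u : Metric.sphere (0 : F) 1 => Φ (r • (u : F)) with hΨ
  have hcongr : ∀ s : ℂ, ∀ r ∈ Set.Ioi (0 : ℝ),
      (r : ℂ)⁻¹ * ∫ u : Metric.sphere (0 : F) 1, mellinKernel k s Φ (r • (u : F)) ∂(sphereHaar F) =
        (r : ℂ) ^ ((D : ℂ) * (s + 2) - 1) • Ψ r := by
    intro s r hr
    rw [← integral_const_mul]
    simp only [mellinKernel_smul k s Φ hr]
    rw [integral_const_mul, smul_eq_mul, hD, Complex.ofReal_natCast]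
    rfl
  have hconv : ∀ s : ℂ, σ < s.re → MellinConvergent Ψ ((D : ℂ) * (s + 2)) ∧
      _root_.mellin Ψ ((D : ℂ) * (s + 2)) = E s := by
    intro s hs
    obtain ⟨h1, h2⟩ := mulHaar_polar (hint s hs)
    refine ⟨h1.congr_fun (hcongr s) measurableSet_Ioi, ?_⟩
    rw [← hE s hs, h2, _root_.mellin]
    exact (setIntegral_congr_fun measurableSet_Ioi (hcongr s)).symm
  have hz : ∀ z : ℂ, z = (D : ℂ) * ((z / D - 2) + 2) := fun z => by
    rw [sub_add_cancel, mul_div_cancel₀ _ hDc]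
  have hre : ∀ z : ℂ, (z / D - 2).re = z.re / D - 2 := fun z => by simp
  have him : ∀ z : ℂ, (z / D - 2).im = z.im / D := fun z => by simp
  have hAB : A ≤ B := le_max_left _ _
  have hBσ : σ < B := (lt_add_one σ).trans_le (le_max_right _ _)
  have hC : 0 ≤ C := (by positivity : (0 : ℝ) ≤ ‖E (A : ℂ)‖ * (1 + ((A : ℂ)).im ^ 2)).trans
    (hEb (A : ℂ) (by simp) (by simpa using hAB))
  have hstrip : ∀ z : ℂ, D * (A + 2) ≤ z.re → z.re ≤ D * (B + 2) →
      A ≤ (z / D - 2).re ∧ (z / D - 2).re ≤ B := fun z h1 h2 => by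
    rw [hre]
    constructor
    · rw [le_sub_iff_add_le, le_div_iff₀ hD0]; linarith
    · rw [sub_le_iff_le_add, div_le_iff₀ hD0]; linarith
  have hBre : ∀ y : ℝ, σ < (((D * (B + 2) : ℝ) + y * Complex.I : ℂ) / D - 2).re := fun y => by
    rw [hre]
    simp only [Complex.add_re, Complex.ofReal_re, Complex.mul_re, Complex.I_re, mul_zero, Complex.ofReal_im,
      Complex.I_im, mul_one, sub_zero, add_zero, sub_self]
    rw [mul_div_cancel_left₀ _ hD0.ne']
    linarith
  refine ⟨D ^ 2 * C, fun r hr => ?_⟩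
  have key := norm_le_of_mellin_continuation (Ψ := Ψ) (H := fun z => E (z / D - 2)) (A := D * (A + 2))
    (B := D * (B + 2)) (C := D ^ 2 * C) (mul_le_mul_of_nonneg_left (by linarith) hD0.le) ?_ ?_ ?_ ?_
    (fun x hx => continuousOn_sphereCoeff k hc hx) hr
  · refine key.trans (le_of_eq ?_)
    have h1 : D * (A + 2) = ((Module.finrank ℝ F * n : ℕ) : ℝ) := by
      simp only [A, hD]
      push_cast
      ring
    rw [h1, Real.rpow_neg hr.le, Real.rpow_natCast, pow_mul]
  · have h1 := (hconv (((D * (B + 2) : ℝ) : ℂ) / D - 2) (by have := hBre 0; simpa using this)).1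
    rwa [← hz] at h1
  · intro y
    have h1 := (hconv _ (hBre y)).2
    rwa [← hz] at h1
  · intro z h1 h2
    refine DifferentiableAt.comp (f := fun z : ℂ => z / D - 2) z (hEd _ ?_) (by fun_prop)
    have := (hstrip z h1 h2).1
    simp only [A] at this
    linarith
  · intro z h1 h2
    have h3 := hEb _ (hstrip z h1 h2).1 (hstrip z h1 h2).2
    rw [him] at h3
    rw [← div_eq_mul_inv, le_div_iff₀ (by positivity)]
    refine le_trans ?_ (mul_le_mul_of_nonneg_left h3 (sq_nonneg D))
    rw [mul_left_comm]
    refine mul_le_mul_of_nonneg_left ?_ (norm_nonneg _)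
    rw [mul_add, ← mul_pow, mul_div_cancel₀ _ hD0.ne']
    nlinarith

/-- Decay of a function with excellent Mellin transforms whose rotates span a finite-dimensional
space. -/
theorem exists_norm_le_of_excellent {Φ : F → ℂ} (hc : ContinuousOn Φ {0}ᶜ) {u₀ : Metric.sphere (0 : F) 1}
    (hu₀ : ∀ j : ℤ, toC (u₀ : F) ^ j = 1 → ∀ u : Metric.sphere (0 : F) 1, toC (u : F) ^ j = 1)
    {p : Polynomial ℂ} (hp : p ≠ 0)
    (hrel : ∀ x : F, x ≠ 0 → ∑ j ∈ Finset.range (p.natDegree + 1), p.coeff j * Φ (x * (u₀ : F) ^ j) = 0)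
    (hexc : ∀ k : ℤ, ∃ σ : ℝ,
      (∀ s : ℂ, σ < s.re → Integrable (fun a : Fˣ => mellinKernel k s Φ a) (mulHaar F)) ∧
      IsExcellentContinuation σ (aIdArch F k 0) fun s => ∫ a : Fˣ, mellinKernel k s Φ a ∂(mulHaar F))
    {n : ℕ} (hn : 2 ≤ n) :
    ∃ C : ℝ, ∀ x : F, x ≠ 0 → ‖Φ x‖ ≤ C * (nabs x ^ n)⁻¹ := by
  have hC : ∀ k : ℤ, ∃ C : ℝ, ∀ r : ℝ, 0 < r →
      ‖sphereCoeff k fun u : Metric.sphere (0 : F) 1 => Φ (r • (u : F))‖ ≤ C * ((r ^ Module.finrank ℝ F) ^ n)⁻¹ := by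
    intro k
    obtain ⟨σ, h1, h2⟩ := hexc k
    exact exists_norm_sphereCoeff_le hc h1 h2 hn
  choose C hC using hC
  obtain ⟨T, hT⟩ := exists_finset_sphereCoeff hu₀ hp
  have hiter : ∀ (j : ℕ) (u : Metric.sphere (0 : F) 1), ((rotate u₀)^[j] u : F) = u * (u₀ : F) ^ j := by
    intro j u
    induction j with
    | zero => simp
    | succ j ih =>
      rw [Function.iterate_succ_apply']
      change (u₀ : F) * _ = _
      rw [ih, pow_succ]
      ring
  refine ⟨((sphereHaar F).real Set.univ)⁻¹ * ∑ k ∈ T, C k, fun x hx => ?_⟩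
  have hr : 0 < ‖x‖ := norm_pos_iff.mpr hx
  have hsph : ∀ u : Metric.sphere (0 : F) 1, ‖x‖ • (u : F) ≠ 0 := fun u h0 => by
    have h1 : ‖‖x‖ • (u : F)‖ = ‖x‖ := by rw [norm_smul, norm_eq_of_mem_sphere u, mul_one, norm_norm]
    rw [h0, norm_zero] at h1
    exact hr.ne h1
  have hgc : Continuous fun u : Metric.sphere (0 : F) 1 => Φ (‖x‖ • (u : F)) :=
    hc.comp_continuous (continuous_const.smul continuous_subtype_val) hsph
  have hu : ‖‖x‖⁻¹ • x‖ = 1 := by rw [norm_smul, norm_inv, norm_norm, inv_mul_cancel₀ hr.ne']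
  have key := hT _ hgc (fun u => by
    have h1 := hrel _ (hsph u)
    simpa only [hiter, smul_mul_assoc] using h1) ⟨‖x‖⁻¹ • x, by simpa using hu⟩
  have hx1 : ‖x‖ • (‖x‖⁻¹ • x) = x := by rw [smul_smul, mul_inv_cancel₀ hr.ne', one_smul]
  simp only [hx1] at key
  refine key.trans ?_
  rw [mul_assoc, Finset.sum_mul]
  refine mul_le_mul_of_nonneg_left (Finset.sum_le_sum fun k _ => ?_) (inv_nonneg.mpr measureReal_nonneg)
  rw [nabs_eq_norm_pow]
  exact hC k _ hr

end RadialDecay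

end TripleQuad
end

noncomputable section
namespace TripleQuad

section FixedPoint

variable {F : Type*} [RCLike F]

/-- A sequence in a finite-dimensional space satisfies a polynomial relation. -/
theorem exists_polynomial_relation {W : Type*} [AddCommGroup W] [Module ℂ W] [FiniteDimensional ℂ W]
    (w : ℕ → W) : ∃ p : Polynomial ℂ, p ≠ 0 ∧ ∑ j ∈ Finset.range (p.natDegree + 1), p.coeff j • w j = 0 := by
  set L := (Polynomial.basisMonomials ℂ).constr ℂ w with hL
  have hni : ¬ Function.Injective L := fun h =>
    Polynomial.not_finite (R := ℂ) (Module.Finite.of_injective L h)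
  rw [← LinearMap.ker_eq_bot, Submodule.eq_bot_iff] at hni
  push Not at hni
  obtain ⟨p, hp, hp0⟩ := hni
  refine ⟨p, hp0, ?_⟩
  have h1 : L p = 0 := hp
  rw [p.as_sum_range, map_sum] at h1
  rw [← h1]
  refine Finset.sum_congr rfl fun j _ => ?_
  have h2 : Polynomial.monomial j (p.coeff j) = p.coeff j • Polynomial.basisMonomials ℂ j := by
    rw [Polynomial.coe_basisMonomials, Polynomial.smul_monomial, smul_eq_mul, mul_one]
  rw [h2, map_smul, hL, Module.Basis.constr_basis]

/-- A Schwartz function decays along the torus through a point that the unit circle of the torus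
normalizes into `K`. -/
theorem exists_norm_levi_mul_le {K : Subgroup (Sp6 F)} {f : Sp6 F → ℂ}
    (hf : IsSchwartzBKArch (K : Set (Sp6 F)) f) {x : Sp6 F}
    (hx : ∀ u : Fˣ, ‖(u : F)‖ = 1 → x⁻¹ * levi u * x ∈ K) {n : ℕ} (hn : 2 ≤ n) :
    ∃ C : ℝ, ∀ δ : Fˣ, ‖f (levi δ * x)‖ ≤ C * nabs (δ : F) ^ n := by
  classical
  have hfc := continuous_of_isSmoothArch hf.smooth
  set Φ : F → ℂ := fun a => if h : a = 0 then 0 else f ((levi (Units.mk0 a h))⁻¹ * x) with hΦ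
  have hΦu (a : Fˣ) : Φ a = f ((levi a)⁻¹ * x) := by
    rw [hΦ]
    simp only [a.ne_zero, dif_neg, not_false_eq_true, Units.mk0_val]
  have hc : ContinuousOn Φ {0}ᶜ := by
    rw [continuousOn_iff_continuous_domRestrict]
    let e := unitsHomeomorphNeZero (G₀ := F)
    have h1 : Continuous fun a : {a : F // a ≠ 0} => f (levi (e.symm a)⁻¹ * x) :=
      hfc.comp ((continuous_levi.comp (continuous_inv.comp e.symm.continuous)).mul continuous_const)
    refine h1.congr fun a => ?_
    rw [levi_inv, ← hΦu]
    exact congrArg (fun z : {a : F // a ≠ 0} => Φ z) (e.apply_symm_apply a)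
  obtain ⟨u₀, hu₀⟩ := exists_sphere_generator F
  have hu1 : ‖(u₀ : F)‖ = 1 := by simp
  have hu0 : (u₀ : F) ≠ 0 := norm_ne_zero_iff.mp (by rw [hu1]; exact one_ne_zero)
  set v : Fˣ := Units.mk0 (u₀ : F) hu0 with hv
  set κ : Sp6 F := x⁻¹ * (levi v)⁻¹ * x with hκ
  have hκK : κ ∈ K := by
    rw [hκ, ← levi_inv]
    exact hx _ (by simp [hv, hu1])
  set T : K → Sp6 F → ℂ := fun k g => f (g * k) with hT
  have : FiniteDimensional ℂ (Submodule.span ℂ (Set.range T)) := hf.kFinite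
  obtain ⟨p, hp, hrel⟩ := exists_polynomial_relation
    fun j : ℕ => (⟨T ⟨κ ^ j, K.pow_mem hκK j⟩, Submodule.subset_span ⟨_, rfl⟩⟩ :
      Submodule.span ℂ (Set.range T))
  have hκj (j : ℕ) : κ ^ j = x⁻¹ * (levi (v ^ j))⁻¹ * x := by
    induction j with
    | zero => simp [show levi (1 : Fˣ) = 1 from levi_one]
    | succ j ih =>
      rw [pow_succ, ih, hκ, pow_succ, mul_comm (v ^ j), levi_mul]
      group
  obtain ⟨C, hC⟩ := exists_norm_le_of_excellent hc hu₀ hp (fun y hy => by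
    have h := congrFun (congrArg Subtype.val hrel) ((levi (Units.mk0 y hy))⁻¹ * x)
    simp only [AddSubmonoidClass.coe_finsetSum, Submodule.coe_smul, Finset.sum_apply, Pi.smul_apply,
      smul_eq_mul, ZeroMemClass.coe_zero, Pi.zero_apply] at h
    rw [← h]
    refine Finset.sum_congr rfl fun j _ => ?_
    have e : y * (u₀ : F) ^ j = ((Units.mk0 y hy * v ^ j : Fˣ) : F) := by simp [hv]
    rw [e, hΦu, hT, mul_comm (Units.mk0 y hy), levi_mul]
    simp only [hκj]
    congr 2
    group) (fun k => by
    obtain ⟨σ, h1, h2⟩ := hf.excellent k 0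
    have e (s : ℂ) : (fun a : Fˣ => mellinKernel k s Φ a) = mellinIntegrand f (archChar F k 0) s x := by
      funext a
      rw [mellinKernel, hΦu, mellinIntegrand, archChar, Complex.cpow_zero, mul_one]
      rfl
    refine ⟨σ, fun s hs => ?_, ?_⟩
    · rw [e]
      exact (h1 s hs x).1
    · simp only [e]
      exact (h2 x).1) hn
  refine ⟨C, fun δ => ?_⟩
  have := hC ((δ⁻¹ : Fˣ) : F) (Units.ne_zero _)
  rwa [hΦu, levi_inv, inv_inv, Units.val_inv_eq_inv_val, nabs_inv, inv_pow, inv_inv] at this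

end FixedPoint

end TripleQuad
end

noncomputable section
namespace TripleQuad

section PositiveDefinite

open scoped ComplexOrder

variable {F : Type*} [RCLike F] {m : Type*} [Fintype m] [DecidableEq m]

open scoped MatrixOrder in
theorem exists_posDef_sqrt {H : Matrix m m F} (hH : H.PosDef) :
    ∃ R : Matrix m m F, R.PosDef ∧ R * R = H ∧ ∀ T : Matrix m m F, T.PosDef → T * T = H → T = R := by
  have h0 : 0 ≤ H := hH.posSemidef.nonneg
  have h1 : CFC.sqrt H * CFC.sqrt H = H := CFC.sqrt_mul_sqrt_self H h0
  have h2 : (CFC.sqrt H).PosSemidef := (CFC.sqrt_nonneg H).posSemidef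
  refine ⟨CFC.sqrt H, h2.posDef_iff_isUnit.mpr ?_, h1, fun T hT h => ?_⟩
  · have := hH.isUnit
    rw [← h1] at this
    exact isUnit_of_mul_isUnit_left this
  · exact (CFC.sqrt_unique h hT.posSemidef.nonneg).symm

theorem posDef_conj {A M : Matrix m m F} (hM : M.PosDef) (hA : IsUnit A) :
    (A * M * Aᴴ).PosDef :=
  (IsUnit.posDef_star_right_conjugate_iff hA).mpr hM

/-- The geometric mean of two positive definite matrices. -/
theorem exists_unique_geometricMean {h g : Matrix m m F} (hh : h.PosDef) (hg : g.PosDef) :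
    ∃ S : Matrix m m F, S.PosDef ∧ S * h⁻¹ * S = g ∧
      ∀ T : Matrix m m F, T.PosDef → T * h⁻¹ * T = g → T = S := by
  obtain ⟨B, hB, hBB, -⟩ := exists_posDef_sqrt hh
  have hBi : (B⁻¹)ᴴ = B⁻¹ := hB.inv.1
  have hd := (isUnit_iff_isUnit_det B).mp hB.isUnit
  have c1 (X : Matrix m m F) : B * (B⁻¹ * X) = X := mul_nonsing_inv_cancel_left B X hd
  have c2 (X : Matrix m m F) : B⁻¹ * (B * X) = X := nonsing_inv_mul_cancel_left B X hd
  have c3 : B⁻¹ * B = 1 := nonsing_inv_mul B hd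
  have hhi : h⁻¹ = B⁻¹ * B⁻¹ := by rw [← hBB, Matrix.mul_inv_rev]
  have hconj {X : Matrix m m F} (hX : X.PosDef) : (B⁻¹ * X * B⁻¹).PosDef := by
    have := posDef_conj hX hB.inv.isUnit
    rwa [hBi] at this
  obtain ⟨Q, hQ, hQQ, huniq⟩ := exists_posDef_sqrt (hconj hg)
  refine ⟨B * Q * B, ?_, ?_, fun T hT h => ?_⟩
  · have := posDef_conj hQ hB.isUnit
    rwa [hB.1.eq] at this
  · calc B * Q * B * h⁻¹ * (B * Q * B) = B * (Q * Q) * B := by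
          simp only [hhi, Matrix.mul_assoc, c1, c2]
      _ = g := by simp only [hQQ, Matrix.mul_assoc, c1, c3, Matrix.mul_one]
  · rw [← huniq _ (hconj hT) (by rw [← h, hhi]; simp only [Matrix.mul_assoc])]
    simp only [Matrix.mul_assoc, c1, c3, Matrix.mul_one]

end PositiveDefinite

section Symplectic

open scoped ComplexOrder

variable {F : Type*} [RCLike F]

local notation "M₆" => Matrix (Fin 3 ⊕ Fin 3) (Fin 3 ⊕ Fin 3) F

local notation "J₆" => Matrix.J (Fin 3) F

/-- The action of `Sp₆(F)` on Hermitian forms. -/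
def hermAct (g : Sp6 F) (S : M₆) : M₆ := g.1 * S * g.1ᴴ

theorem hermAct_mul (g h : Sp6 F) (S : M₆) : hermAct (g * h) S = hermAct g (hermAct h S) := by
  simp only [hermAct, Submonoid.coe_mul, conjTranspose_mul, Matrix.mul_assoc]

theorem hermAct_one (S : M₆) : hermAct 1 S = S := by
  simp [hermAct]

theorem isUnit_val (g : Sp6 F) : IsUnit g.1 :=
  (isUnit_iff_isUnit_det _).mpr (SymplecticGroup.symplectic_det g.2)

/-- The dual Hermitian form transported by the symplectic form. -/
def hermDual (S : M₆) : M₆ := J₆ * Sᵀ⁻¹ * J₆ᴴ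

theorem J_conjTranspose : J₆ᴴ = -J₆ := by
  simp [J, fromBlocks_conjTranspose, fromBlocks_neg]

theorem hermDual_posDef {S : M₆} (hS : S.PosDef) : (hermDual S).PosDef :=
  posDef_conj hS.transpose.inv ((isUnit_iff_isUnit_det _).mpr (isUnit_det_J _ _))

theorem hermDual_hermAct (g : Sp6 F) (S : M₆) :
    hermDual (hermAct g S) = hermAct g (hermDual S) := by
  have hg : g.1 * J₆ * g.1ᵀ = J₆ := SymplecticGroup.mem_iff.mp g.2
  have hu : IsUnit g.1ᵀ.det := by rw [det_transpose]; exact SymplecticGroup.symplectic_det g.2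
  have hv : IsUnit (g.1ᴴ)ᵀ.det := by
    rw [det_transpose, det_conjTranspose]; exact (SymplecticGroup.symplectic_det g.2).star
  have h1 : J₆ * g.1ᵀ⁻¹ = g.1 * J₆ := by
    rw [← hg, Matrix.mul_assoc (_ * _), mul_nonsing_inv _ hu, Matrix.mul_one, hg]
  have h2 : (g.1ᴴ)ᵀ * J₆ᴴ * g.1ᴴ = J₆ᴴ := by
    have := congrArg conjTranspose hg
    simp only [conjTranspose_mul] at this
    rw [← Matrix.mul_assoc] at this
    exact this
  have h3 : (g.1ᴴ)ᵀ⁻¹ * J₆ᴴ = J₆ᴴ * g.1ᴴ := by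
    calc (g.1ᴴ)ᵀ⁻¹ * J₆ᴴ = (g.1ᴴ)ᵀ⁻¹ * ((g.1ᴴ)ᵀ * (J₆ᴴ * g.1ᴴ)) := by rw [← Matrix.mul_assoc (g.1ᴴ)ᵀ, h2]
      _ = J₆ᴴ * g.1ᴴ := nonsing_inv_mul_cancel_left _ _ hv
  rw [hermDual, hermAct, hermAct, transpose_mul, transpose_mul, Matrix.mul_inv_rev, Matrix.mul_inv_rev,
    hermDual, ← Matrix.mul_assoc J₆, ← Matrix.mul_assoc J₆, h1, Matrix.mul_assoc _ _ J₆ᴴ, h3]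
  simp only [Matrix.mul_assoc]

/-- A compact group of symplectic matrices preserving a positive definite Hermitian form preserves a
symplectic one. -/
theorem exists_symplectic_form {K : Set (Sp6 F)} {h : M₆} (hh : h.PosDef)
    (hK : ∀ k ∈ K, hermAct k h = h) :
    ∃ S : M₆, S.PosDef ∧ S * J₆ * Sᵀ = J₆ ∧ ∀ k ∈ K, hermAct k S = S := by
  obtain ⟨S, hS, hSg, huniq⟩ := exists_unique_geometricMean hh (hermDual_posDef hh)
  have hdS : IsUnit Sᵀ.det := (isUnit_iff_isUnit_det _).mp hS.transpose.isUnit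
  have hJ (X : M₆) : J₆ * (J₆ * X) = -X := by rw [← Matrix.mul_assoc, J_squared, neg_mul, Matrix.one_mul]
  refine ⟨S, hS, ?_, fun k hk => huniq _ (posDef_conj hS (isUnit_val k)) ?_⟩
  · have h1 : Sᵀ * hᵀ⁻¹ * Sᵀ = -(J₆ * h⁻¹ * J₆) := by
      have := congrArg transpose hSg
      rw [transpose_mul, transpose_mul, transpose_nonsing_inv, ← Matrix.mul_assoc, hermDual,
        J_conjTranspose, mul_neg, transpose_neg, transpose_mul, transpose_mul, transpose_nonsing_inv,
        transpose_transpose, J_transpose] at this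
      rw [this]
      simp only [neg_mul, mul_neg, neg_neg, Matrix.mul_assoc]
    have h2 : hermDual S = S := by
      refine huniq _ (hermDual_posDef hS) ?_
      have h3 : Sᵀ⁻¹ * (J₆ * h⁻¹ * J₆) * Sᵀ⁻¹ = -hᵀ⁻¹ := by
        rw [← neg_eq_iff_eq_neg.mpr h1, mul_neg, neg_mul, Matrix.mul_assoc, Matrix.mul_assoc (_ * _),
          mul_nonsing_inv _ hdS, Matrix.mul_one, nonsing_inv_mul_cancel_left _ _ hdS]
      calc hermDual S * h⁻¹ * hermDual S = J₆ * (Sᵀ⁻¹ * (J₆ * h⁻¹ * J₆) * Sᵀ⁻¹) * J₆ := by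
            simp only [hermDual, J_conjTranspose, Matrix.mul_assoc, mul_neg, neg_mul, neg_neg]
        _ = hermDual h := by rw [h3, hermDual, J_conjTranspose]; simp only [mul_neg, neg_mul]
    calc S * J₆ * Sᵀ = hermDual S * J₆ * Sᵀ := by rw [h2]
      _ = J₆ := by
        rw [hermDual, J_conjTranspose, mul_neg, neg_mul, neg_mul, Matrix.mul_assoc (J₆ * _), J_squared,
          mul_neg, neg_mul, neg_neg, Matrix.mul_one, Matrix.mul_assoc, nonsing_inv_mul _ hdS, Matrix.mul_one]
  · have h1 : k.1ᴴ * h⁻¹ * k.1 = h⁻¹ := by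
      have h2 := congrArg Inv.inv (hK k hk)
      have hu : IsUnit k.1ᴴ.det := by
        rw [det_conjTranspose]; exact (SymplecticGroup.symplectic_det k.2).star
      rw [hermAct, Matrix.mul_inv_rev, Matrix.mul_inv_rev] at h2
      rw [← h2, mul_nonsing_inv_cancel_left _ _ hu, Matrix.mul_assoc,
        nonsing_inv_mul _ (SymplecticGroup.symplectic_det k.2), Matrix.mul_one, h2]
    calc hermAct k S * h⁻¹ * hermAct k S = k.1 * (S * (k.1ᴴ * h⁻¹ * k.1) * S) * k.1ᴴ := by
          simp only [hermAct, Matrix.mul_assoc]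
      _ = hermDual h := by
          rw [h1, hSg, ← hermAct, ← hermDual_hermAct k, hK k hk]

end Symplectic

end TripleQuad
end

noncomputable section
namespace TripleQuad

section Maximal

open scoped ComplexOrder

variable {F : Type*} [RCLike F]

local notation "M₆" => Matrix (Fin 3 ⊕ Fin 3) (Fin 3 ⊕ Fin 3) F

local notation "J₆" => Matrix.J (Fin 3) F

instance : IsTopologicalGroup (Sp6 F) where
  continuous_inv := by
    refine Continuous.subtype_mk (f := fun g : Sp6 F => (-J₆) * g.1ᵀ * J₆) ?_ _
    have : Continuous fun g : Sp6 F => g.1 := continuous_subtype_val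
    fun_prop

open scoped Matrix.Norms.Elementwise in
theorem exists_invariant_posDef {K : Subgroup (Sp6 F)} (hK : IsCompact (K : Set (Sp6 F))) :
    ∃ h : M₆, h.PosDef ∧ ∀ k ∈ K, hermAct k h = h := by
  have : CompactSpace K := isCompact_iff_compactSpace.mp hK
  let _ : MeasurableSpace K := borel K
  have : BorelSpace K := ⟨rfl⟩
  set μ : Measure K := Measure.haar
  set φ : K → M₆ := fun k => hermAct k.1 1 with hφ
  have hφc : Continuous φ := by
    have : Continuous fun k : K => k.1.1 := continuous_subtype_val.comp continuous_subtype_val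
    simp only [hφ, hermAct]
    fun_prop
  have : @CompleteSpace M₆ (inferInstance : PseudoMetricSpace M₆).toUniformSpace := FiniteDimensional.complete ℝ M₆
  have hlin {E : Type _} [NormedAddCommGroup E] [NormedSpace ℝ E] [CompleteSpace E] (L : M₆ →ₗ[ℝ] E) :
      L (∫ k, φ k ∂μ) = ∫ k, L (φ k) ∂μ :=
    ((LinearMap.toContinuousLinearMap L).integral_comp_comm (hφc.integrable_of_hasCompactSupport (.of_compactSpace φ))).symm
  refine ⟨∫ k, φ k ∂μ, ?_, fun l hl => ?_⟩
  · have hφp (k : K) : (φ k).PosDef := posDef_conj PosDef.one (isUnit_val k.1)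
    refine PosDef.of_dotProduct_mulVec_pos ?_ fun x hx => ?_
    · let L : M₆ →ₗ[ℝ] M₆ :=
        { toFun := conjTranspose
          map_add' := conjTranspose_add
          map_smul' := fun c X => by simp }
      change L (∫ k, φ k ∂μ) = _
      rw [hlin]
      exact integral_congr_ae (ae_of_all _ fun k => (hφp k).1)
    · let L : M₆ →ₗ[ℝ] F :=
        { toFun := fun X => star x ⬝ᵥ (X *ᵥ x)
          map_add' := fun X Y => by rw [add_mulVec, dotProduct_add]
          map_smul' := fun c X => by rw [smul_mulVec, dotProduct_smul, RingHom.id_apply] }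
      change 0 < L (∫ k, φ k ∂μ)
      have hpos (k : K) : 0 < L (φ k) := (hφp k).dotProduct_mulVec_pos hx
      have h1 (k : K) : L (φ k) = ((RCLike.re (L (φ k)) : ℝ) : F) :=
        ((RCLike.pos_iff_exists_ofReal.mp (hpos k)).elim fun r hr => by rw [← hr.2, RCLike.ofReal_re])
      have hLc : Continuous fun k => RCLike.re (L (φ k)) :=
        RCLike.continuous_re.comp ((LinearMap.continuous_of_finiteDimensional L).comp hφc)
      rw [hlin, integral_congr_ae (ae_of_all _ h1), integral_ofReal, RCLike.ofReal_pos,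
        integral_pos_iff_support_of_nonneg (fun k => (RCLike.pos_iff.mp (hpos k)).1.le) (hLc.integrable_of_hasCompactSupport (.of_compactSpace _))]
      rw [Set.eq_univ_of_forall fun k => Function.mem_support.mpr (RCLike.pos_iff.mp (hpos k)).1.ne']
      exact Measure.measure_univ_pos.mpr (NeZero.ne μ)
  · let L : M₆ →ₗ[ℝ] M₆ := LinearMap.mulLeft ℝ l.1 ∘ₗ LinearMap.mulRight ℝ l.1ᴴ
    have h1 : hermAct l (∫ k, φ k ∂μ) = L (∫ k, φ k ∂μ) := Matrix.mul_assoc _ _ _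
    rw [h1, hlin]
    rw [← integral_mul_left_eq_self φ (⟨l, hl⟩ : K)]
    refine integral_congr_ae (ae_of_all _ fun k => ?_)
    simp only [hφ, Subgroup.coe_mul, hermAct_mul]
    exact (Matrix.mul_assoc l.1 (hermAct k.1 1) l.1ᴴ).symm

/-- Every point of `Sp₆(F)` is equivalent, under the Siegel parabolic subgroup, to one that carries
a given symplectic positive definite form to the standard one. -/
theorem exists_iwasawa {S : M₆} (hS : S.PosDef) (hSJ : S * J₆ * Sᵀ = J₆) (g : Sp6 F) :
    ∃ (x : Sp6 F) (B : Matrix (Fin 3) (Fin 3) F), hermAct x S = 1 ∧ IsUnit B.det ∧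
      lowerRows x = fromBlocks 0 0 0 B * lowerRows g ∧
      B * (g.1.submatrix Sum.inr id * S * (g.1.submatrix Sum.inr id)ᴴ) * Bᴴ = 1 := by
  set L := g.1.submatrix Sum.inr id with hL
  have hLinj : Function.Injective L.vecMul := by
    intro a b hab
    have h1 : (Sum.elim (0 : Fin 3 → F) a) ᵥ* g.1 = (Sum.elim (0 : Fin 3 → F) b) ᵥ* g.1 := by
      funext j
      simpa [vecMul, dotProduct, hL] using congrFun hab j
    have h2 := vecMul_injective_iff_isUnit.mpr (isUnit_val g) h1
    exact funext fun i => congrFun h2 (Sum.inr i)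
  have hH : (L * S * Lᴴ).PosDef := hS.mul_mul_conjTranspose_same hLinj
  obtain ⟨R, hR, hRR, -⟩ := exists_posDef_sqrt hH
  have hRd := (isUnit_iff_isUnit_det R).mp hR.isUnit
  have hBd : IsUnit R⁻¹.det := isUnit_nonsing_inv_det R hRd
  have hB : R⁻¹ * (L * S * Lᴴ) * R⁻¹ᴴ = 1 := by
    rw [hR.inv.1.eq, ← hRR, nonsing_inv_mul_cancel_left _ _ hRd, mul_nonsing_inv _ hRd]
  have hLJ : L * J₆ * Lᵀ = 0 := by
    have h1 : (g.1 * J₆ * g.1ᵀ).submatrix Sum.inr Sum.inr = (J₆).submatrix (Sum.inr : Fin 3 → _) Sum.inr := by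
      rw [SymplecticGroup.mem_iff.mp g.2]
    have h2 : (J₆).submatrix (Sum.inr : Fin 3 → _) Sum.inr = 0 := rfl
    rw [h2] at h1
    exact h1
  obtain ⟨L', hL'⟩ : ∃ L', L' = R⁻¹ * L := ⟨_, rfl⟩
  obtain ⟨P, hP⟩ : ∃ P, P = S * L'ᴴ := ⟨_, rfl⟩
  have e1 : L' * P = 1 := by
    rw [← hB, hP, hL', conjTranspose_mul]; simp only [Matrix.mul_assoc]
  have e2 : L' * J₆ * L'ᵀ = 0 := by
    have : L' * J₆ * L'ᵀ = R⁻¹ * (L * J₆ * Lᵀ) * R⁻¹ᵀ := by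
      rw [hL', transpose_mul]; simp only [Matrix.mul_assoc]
    rw [this, hLJ, Matrix.mul_zero, Matrix.zero_mul]
  have e3 : (L'ᴴ)ᵀ * J₆ * L'ᴴ = 0 := by
    have := congrArg conjTranspose e2
    rw [conjTranspose_mul, conjTranspose_mul, J_conjTranspose, Matrix.neg_mul, Matrix.mul_neg, conjTranspose_zero,
      neg_eq_zero, ← Matrix.mul_assoc] at this
    exact this
  have e4 : Sᵀ * J₆ * S = J₆ := by
    have := SymplecticGroup.mem_iff'.mp (SymplecticGroup.mem_iff.mpr hSJ)
    exact this
  have e5 : Pᵀ * J₆ * P = 0 := by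
    rw [← e3]
    calc Pᵀ * J₆ * P = (L'ᴴ)ᵀ * (Sᵀ * J₆ * S) * L'ᴴ := by
          rw [hP, transpose_mul]; simp only [Matrix.mul_assoc]
      _ = _ := by rw [e4]
  have e1t : Pᵀ * L'ᵀ = 1 := by rw [← transpose_mul, e1, transpose_one]
  have hJ (n : Type) (X : Matrix (Fin 3 ⊕ Fin 3) n F) : J₆ * (J₆ * X) = -X := by
    rw [← Matrix.mul_assoc, J_squared, Matrix.neg_mul, Matrix.one_mul]
  obtain ⟨U, hU⟩ : ∃ U, U = Pᵀ * J₆ := ⟨_, rfl⟩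
  have hUt : Uᵀ = -(J₆ * P) := by rw [hU, transpose_mul, transpose_transpose, J_transpose, Matrix.neg_mul]
  set X : M₆ := fromRows U L' with hX
  have hXm : X ∈ Matrix.symplecticGroup (Fin 3) F := by
    rw [SymplecticGroup.mem_iff, hX, transpose_fromRows, fromRows_mul, fromRows_mul_fromCols, e2]
    have a1 : U * J₆ * Uᵀ = 0 := by
      rw [hUt, hU, Matrix.mul_assoc, Matrix.mul_assoc, Matrix.mul_neg, hJ, neg_neg, ← Matrix.mul_assoc, e5]
    have a2 : U * J₆ * L'ᵀ = -1 := by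
      rw [hU, Matrix.mul_assoc, Matrix.mul_assoc, hJ, Matrix.mul_neg, e1t]
    have a3 : L' * J₆ * Uᵀ = 1 := by
      rw [hUt, Matrix.mul_assoc, Matrix.mul_neg, hJ, neg_neg, e1]
    rw [a1, a2, a3]
    rfl
  have hXS : X * S * Xᴴ = 1 := by
    rw [hX, conjTranspose_fromRows_eq_fromCols_conjTranspose, fromRows_mul, fromRows_mul_fromCols]
    have hUS : U * S = (L'ᴴ)ᵀ * J₆ := by
      rw [hU, hP, transpose_mul, ← e4]
      simp only [Matrix.mul_assoc, e4]
    have a1 : U * S * L'ᴴ = 0 := by rw [hUS, e3]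
    have a2 : L' * S * Uᴴ = 0 := by
      have := congrArg conjTranspose a1
      rwa [conjTranspose_mul, conjTranspose_mul, conjTranspose_conjTranspose, hS.1.eq,
        conjTranspose_zero, ← Matrix.mul_assoc] at this
    have a3 : L' * S * L'ᴴ = 1 := by rw [Matrix.mul_assoc, ← hP, e1]
    have a4 : U * S * Uᴴ = 1 := by
      rw [hUS, hU, conjTranspose_mul, J_conjTranspose, Matrix.mul_assoc, Matrix.neg_mul, Matrix.mul_neg,
        hJ, neg_neg]
      have := congrArg (fun Y : Matrix (Fin 3) (Fin 3) F => Yᴴᵀ) e1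
      simp only [conjTranspose_mul, transpose_mul, conjTranspose_one, transpose_one] at this
      exact this
    rw [a1, a2, a3, a4, fromBlocks_one]
  refine ⟨⟨X, hXm⟩, R⁻¹, hXS, hBd, ?_, hB⟩
  have b1 : X.toBlocks₂₁ = R⁻¹ * g.1.toBlocks₂₁ := by rw [hX, hL']; rfl
  have b2 : X.toBlocks₂₂ = R⁻¹ * g.1.toBlocks₂₂ := by rw [hX, hL']; rfl
  rw [lowerRows_eq, lowerRows_eq, fromBlocks_multiply, b1, b2]
  simp

end Maximal

end TripleQuad
end

noncomputable section
namespace TripleQuad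

section ArchDecay

open scoped ComplexOrder

variable {F : Type*} [RCLike F]

local notation "M₆" => Matrix (Fin 3 ⊕ Fin 3) (Fin 3 ⊕ Fin 3) F

local notation "J₆" => Matrix.J (Fin 3) F

theorem continuous_hermAct (S : M₆) : Continuous fun g : Sp6 F => hermAct g S := by
  have : Continuous fun g : Sp6 F => g.1 := continuous_subtype_val
  simp only [hermAct]
  fun_prop

theorem hermAct_inv_of_eq {x : Sp6 F} {S T : M₆} (h : hermAct x S = T) : hermAct x⁻¹ T = S := by
  rw [← h, ← hermAct_mul, inv_mul_cancel, hermAct_one]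

/-- A maximal compact subgroup is the stabilizer of a symplectic positive definite form. -/
theorem exists_stabilizer_of_maximal {K : Subgroup (Sp6 F)}
    (hK : Maximal (fun H : Subgroup (Sp6 F) => IsCompact (H : Set (Sp6 F))) K) :
    ∃ S : M₆, S.PosDef ∧ S * J₆ * Sᵀ = J₆ ∧ ∀ k : Sp6 F, k ∈ K ↔ hermAct k S = S := by
  obtain ⟨h, hh, hinv⟩ := exists_invariant_posDef hK.1
  obtain ⟨S, hS, hSJ, hKS⟩ := exists_symplectic_form hh hinv
  obtain ⟨x, -, hx, -⟩ := exists_iwasawa hS hSJ 1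
  let KS : Subgroup (Sp6 F) :=
    { carrier := {k | hermAct k S = S}
      mul_mem' := fun {a b} ha hb => by
        change hermAct (a * b) S = S
        rw [hermAct_mul, show hermAct b S = S from hb, show hermAct a S = S from ha]
      one_mem' := hermAct_one S
      inv_mem' := fun {a} ha => hermAct_inv_of_eq ha }
  have hU : IsCompact {u : Sp6 F | hermAct u 1 = 1} := by
    refine (isCompact_sp6_bounded (F := F) 1).of_isClosed_subset
      (isClosed_eq (continuous_hermAct 1) continuous_const) fun u hu i j => ?_
    refine entry_norm_bound_of_unitary (mem_unitaryGroup_iff.mpr ?_) i j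
    have : u.1 * 1 * u.1ᴴ = 1 := hu
    rwa [Matrix.mul_one] at this
  have hKSc : IsCompact (KS : Set (Sp6 F)) := by
    have h1 : (KS : Set (Sp6 F)) = (fun u => x⁻¹ * u * x) '' {u : Sp6 F | hermAct u 1 = 1} := by
      ext k
      constructor
      · intro hk
        refine ⟨x * k * x⁻¹, ?_, by group⟩
        change hermAct (x * k * x⁻¹) 1 = 1
        rw [hermAct_mul, hermAct_inv_of_eq hx, hermAct_mul, show hermAct k S = S from hk, hx]
      · rintro ⟨u, hu, rfl⟩
        change hermAct (x⁻¹ * u * x) S = S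
        rw [hermAct_mul, hx, hermAct_mul, show hermAct u 1 = 1 from hu, hermAct_inv_of_eq hx]
    rw [h1]
    exact hU.image (by fun_prop)
  have hle : K ≤ KS := fun k hk => hKS k hk
  exact ⟨S, hS, hSJ, fun k => ⟨fun hk => hKS k hk, fun hk => hK.2 hKSc hle hk⟩⟩

theorem levi_unitary {u : Fˣ} (hu : ‖(u : F)‖ = 1) : hermAct (levi u) 1 = 1 := by
  have h1 : (u : F) * star (u : F) = 1 := by
    rw [RCLike.star_def, RCLike.mul_conj, hu]; simp
  have h2 : (u : F)⁻¹ * star (u : F)⁻¹ = 1 := by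
    rw [RCLike.star_def, RCLike.mul_conj, norm_inv, hu]; simp
  rw [hermAct, Matrix.mul_one, levi, fromBlocks_conjTranspose, fromBlocks_multiply]
  simp only [diagonal_conjTranspose, diagonal_mul_diagonal, conjTranspose_zero, Matrix.mul_zero,
    Matrix.zero_mul, add_zero, zero_add]
  rw [← fromBlocks_one, ← diagonal_one]
  congr 2 <;> funext i <;> fin_cases i <;> simp_all

/-- The Iwasawa decomposition of the points `levi δ * w`, with `w` in a bounded set. -/
theorem exists_bounded_iwasawa {S : M₆} (hS : S.PosDef) (hSJ : S * J₆ * Sᵀ = J₆) (R : ℝ) :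
    ∃ c : F, ∀ w : Sp6 F, (∀ i j, ‖w.1 i j‖ ≤ R) → ∃ (a : Fˣ) (x : Sp6 F), ‖(a : F)‖ ≤ ‖c‖ ∧
      hermAct x S = 1 ∧ ∀ δ : Fˣ, ∃ p ∈ commP F, levi δ * w = p * (levi (δ * a) * x) := by
  choose x B hx hB hrow hdet using exists_iwasawa hS hSJ
  set H : Sp6 F → F := fun w => (w.1.submatrix (Sum.inr : Fin 3 → _) id * S *
    (w.1.submatrix Sum.inr id)ᴴ).det with hH
  have hmul (w : Sp6 F) : ‖(B w).det‖ ^ 2 * ‖H w‖ = 1 := by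
    have := congrArg (fun Y => ‖det Y‖) (hdet w)
    simp only [det_mul (B w * _), det_mul (B w), det_conjTranspose, det_one, norm_mul, norm_star, norm_one] at this
    rw [← this]
    simp only [hH]
    ring
  have hHc : Continuous H := by
    have : Continuous fun g : Sp6 F => g.1 := continuous_subtype_val
    simp only [hH]
    fun_prop
  have hH0 (w : Sp6 F) : ‖H w‖ ≠ 0 := fun h => by simpa [h] using hmul w
  obtain ⟨C, hC⟩ := (isCompact_sp6_bounded (F := F) R).exists_bound_of_continuousOn
    (f := fun w => ‖H w‖⁻¹) (hHc.norm.inv₀ hH0).continuousOn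
  refine ⟨((max C 1 : ℝ) : F), fun w hw => ?_⟩
  have hBu := isUnit_iff_ne_zero.mp (hB w)
  refine ⟨Units.mk0 _ hBu, x w, ?_, hx w, fun δ => ?_⟩
  · have h1 := hC w hw
    rw [Real.norm_eq_abs, abs_of_nonneg (by positivity)] at h1
    have h2 : ‖(B w).det‖ ^ 2 ≤ C := by rwa [eq_inv_of_mul_eq_one_left (hmul w)]
    rw [Units.val_mk0, RCLike.norm_ofReal, abs_of_nonneg (by positivity)]
    nlinarith [le_max_left C 1, le_max_right C 1, norm_nonneg (B w).det]
  · refine exists_commP_mul_levi (A := diagonal ![(δ : F)⁻¹, 1, 1] * (B w)⁻¹) ?_ ?_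
    · rw [det_mul, det_diagonal, det_nonsing_inv, Ring.inverse_eq_inv']
      simp [Fin.prod_univ_three, mul_comm]
    · have h1 : lowerRows (levi δ) = fromBlocks 0 0 0 (diagonal ![(δ : F)⁻¹, 1, 1]) := by
        rw [lowerRows_eq]; rfl
      have h2 : lowerRows w = fromBlocks 0 0 0 (1 : Matrix (Fin 3) (Fin 3) F) * w.1 := rfl
      have h3 : lowerRows (levi δ) = fromBlocks 0 0 0 (diagonal ![(δ : F)⁻¹, 1, 1]) *
          fromBlocks 0 0 0 (1 : Matrix (Fin 3) (Fin 3) F) := by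
        rw [h1, fromBlocks_multiply]; simp
      rw [lowerRows_mul, h3, Matrix.mul_assoc, ← h2, hrow, ← Matrix.mul_assoc, fromBlocks_multiply]
      simp only [Matrix.mul_zero, Matrix.zero_mul, add_zero, zero_add, Matrix.mul_assoc,
        nonsing_inv_mul _ (hB w), Matrix.mul_one, ← h3, h1]

theorem norm_lowerUnip_embG_le {Z : Matrix (Fin 3) (Fin 3) F} {hZ : Z.IsSymm} {k : G F}
    (hZ1 : ∀ i j, ‖Z i j‖ ≤ 1) (hk : ∀ i j l, ‖k i j l‖ ≤ 1) (i j : Fin 3 ⊕ Fin 3) :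
    ‖(lowerUnip Z hZ * embG F k).1 i j‖ ≤ 6 := by
  have h1 : ∀ i j, ‖(lowerUnip Z hZ).1 i j‖ ≤ 1 := by
    rintro (i | i) (j | j) <;> simp [lowerUnip, one_apply, hZ1]
    · split_ifs <;> simp
    · split_ifs <;> simp
  have h2 : ∀ i j, ‖(embG F k).1 i j‖ ≤ 1 := by
    rintro (i | i) (j | j) <;> simp [embG, diagonal_apply] <;> split_ifs <;> simp [hk]
  rw [Submonoid.coe_mul, Matrix.mul_apply]
  calc _ ≤ ∑ l : Fin 3 ⊕ Fin 3, (1 : ℝ) := norm_sum_le_of_le _ fun l _ => by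
        rw [norm_mul]; exact mul_le_one₀ (h1 _ _) (norm_nonneg _) (h2 _ _)
    _ = 6 := by simp

theorem leviDecay_of_schwartz_arch {K : Subgroup (Sp6 F)}
    (hK : Maximal (fun H : Subgroup (Sp6 F) => IsCompact (H : Set (Sp6 F))) K) {f : Sp6 F → ℂ}
    (hf : IsSchwartzBKArch (K : Set (Sp6 F)) f) : LeviDecay f := by
  intro n hn
  obtain ⟨S, hS, hSJ, hKS⟩ := exists_stabilizer_of_maximal hK
  obtain ⟨c, hc⟩ := exists_bounded_iwasawa hS hSJ 6
  obtain ⟨x₀, -, hx₀, -⟩ := exists_iwasawa hS hSJ 1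
  have hfc : Continuous f := continuous_of_isSmoothArch hf.smooth
  have hKc : IsCompact (K : Set (Sp6 F)) := hK.1
  have hKf : IsKFinite (K : Set (Sp6 F)) f := hf.kFinite
  obtain ⟨t, D, hD, htK, ht⟩ := exists_norm_translate_le (F := F) hfc hKc hKf
  have hl (l : Sp6 F) : ∃ C : ℝ, l ∈ K → ∀ δ : Fˣ, ‖f (levi δ * (x₀ * l))‖ ≤ C * nabs (δ : F) ^ n := by
    by_cases hlK : l ∈ K
    · obtain ⟨C, hC⟩ := exists_norm_levi_mul_le hf (x := x₀ * l) (fun u hu => by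
        have h1 : hermAct (x₀ * l) S = 1 := by rw [hermAct_mul, (hKS l).mp hlK, hx₀]
        rw [hKS, hermAct_mul, h1, hermAct_mul, levi_unitary hu, hermAct_inv_of_eq h1]) hn
      exact ⟨C, fun _ => hC⟩
    · exact ⟨0, fun h => absurd h hlK⟩
  choose C hC using hl
  refine ⟨D * ∑ l ∈ t, |C l| * nabs c ^ n, 
    mul_nonneg hD (Finset.sum_nonneg fun l _ => mul_nonneg (abs_nonneg _) (pow_nonneg (nabs_nonneg c) n)), fun δ Z hZ k hZ1 hk => ?_⟩
  have hw := norm_lowerUnip_embG_le (hZ := hZ) hZ1 hk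
  obtain ⟨a, x, ha, hx, hdec⟩ := hc _ hw
  obtain ⟨p, hp, he⟩ := hdec δ
  have hkK : x₀⁻¹ * x ∈ K := by rw [hKS, hermAct_mul, hx, hermAct_inv_of_eq hx₀]
  have hx' : levi (δ * a) * x = levi (δ * a) * x₀ * (x₀⁻¹ * x) := by group
  rw [he, hf.onX p hp, hx']
  refine (ht _ hkK _).trans ?_
  rw [mul_assoc, Finset.sum_mul]
  refine mul_le_mul_of_nonneg_left (Finset.sum_le_sum fun l hlt => ?_) hD
  rw [mul_assoc]
  refine (hC l (htK l hlt) _).trans ?_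
  rw [Units.val_mul, nabs_mul, mul_assoc, mul_comm (nabs c ^ n), ← mul_pow]
  have h0 := nabs_nonneg (δ : F)
  have h1 := nabs_nonneg (a : F)
  exact mul_le_mul (le_abs_self _) (pow_le_pow_left₀ (by positivity)
    (mul_le_mul_of_nonneg_left (nabs_le_of_norm_le ha) h0) n) (by positivity) (abs_nonneg _)

end ArchDecay

end TripleQuad
end

theorem mainTheorem7 :
    -- the non-Archimedean case
    (∀ (F : Type*) [NontriviallyNormedField F] [ProperSpace F] [IsUltrametricDist F] [CharZero F]
      [MeasurableSpace F] [BorelSpace F] (ϖ : F) (_ : IsUniformizer ϖ)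
      (d : Fin 3 → ℕ) (_ : ∀ i, 0 < d i ∧ Even (d i))
      (J : ∀ i, Matrix (Fin (d i)) (Fin (d i)) F) (_ : ∀ i, (J i).IsSymm ∧ (J i).det ≠ 0)
      (ψ : AddChar F Circle) (_ : Continuous ψ) (_ : ψ ≠ 1)
      (μG : Measure (G F)) (_ : μG.IsHaarMeasure) (μN : Measure (N0 F)) (_ : μN.IsHaarMeasure)
      (μ : Measure (N0G F)) (_ : IsQuotientMeasure μG μN μ)
      (f₁ : Sp6 F → ℂ) (_ : IsSchwartzBKNA ϖ (sp6Int F) f₁)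
      (f₂ : V F d → ℂ) (_ : IsLocallyConstant f₂) (_ : HasCompactSupport f₂),
      (∃ C : ℝ,
        (∀ v ∈ Vprime F d, (∀ i, v i ≠ 0) →
          absInt ψ J μ f₁ f₂ v ≤
              ENNReal.ofReal (C * ∏ i, vabs (v i) ^ (-1 - (d i : ℝ) / 2)) ∧
          (v ∈ Ysm J → IConverges ψ J μ f₁ f₂ v ∧
            ‖intI ψ J μ f₁ f₂ v‖ ≤ C * ∏ i, vabs (v i) ^ (-1 - (d i : ℝ) / 2))) ∧
        (∀ v ∈ Vprime F d, v 0 = 0 →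
          absInt ψ J μ f₁ f₂ v ≤
              ENNReal.ofReal (C * (vabs (v 1) ^ (-(d 1 : ℝ) / 2 - (d 0 : ℝ) / 2) *
                vabs (v 2) ^ (-(d 2 : ℝ) / 2 - (d 0 : ℝ) / 2))) ∧
          (v ∈ Ysm J → IConverges ψ J μ f₁ f₂ v ∧
            ‖intI ψ J μ f₁ f₂ v‖ ≤ C * (vabs (v 1) ^ (-(d 1 : ℝ) / 2 - (d 0 : ℝ) / 2) *
                vabs (v 2) ^ (-(d 2 : ℝ) / 2 - (d 0 : ℝ) / 2))))) ∧
      ∃ S : Set (V F d), IsCompact S ∧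
        (∀ v ∈ Vprime F d, v ∉ S → absInt ψ J μ f₁ f₂ v = 0) ∧
        (∀ v ∈ Ysm J, v ∉ S → intI ψ J μ f₁ f₂ v = 0)) ∧
    -- the Archimedean case
    (∀ (F : Type*) [RCLike F]
      (d : Fin 3 → ℕ) (_ : ∀ i, 0 < d i ∧ Even (d i))
      (J : ∀ i, Matrix (Fin (d i)) (Fin (d i)) F) (_ : ∀ i, (J i).IsSymm ∧ (J i).det ≠ 0)
      (ψ : AddChar F Circle) (_ : Continuous ψ) (_ : ψ ≠ 1)
      (μG : Measure (G F)) (_ : μG.IsHaarMeasure) (μN : Measure (N0 F)) (_ : μN.IsHaarMeasure)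
      (μ : Measure (N0G F)) (_ : IsQuotientMeasure μG μN μ)
      (K : Subgroup (Sp6 F)) (_ : Maximal (fun H : Subgroup (Sp6 F) => IsCompact (H : Set (Sp6 F))) K)
      (f₁ : Sp6 F → ℂ) (_ : IsSchwartzBKArch (K : Set (Sp6 F)) f₁)
      (f₂ : SchwartzMap (V F d) ℂ),
      (∀ N : Fin 3 → ℕ, ∃ C : ℝ, ∀ v ∈ Vprime F d, (∀ i, v i ≠ 0) →
        absInt ψ J μ f₁ f₂ v ≤
            ENNReal.ofReal (C * ∏ i, (max (vabs (v i)) 1 ^ (-(N i : ℝ)) *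
              min (vabs (v i)) 1 ^ (-1 - (d i : ℝ) / 2))) ∧
        (v ∈ Ysm J → IConverges ψ J μ f₁ f₂ v ∧
          ‖intI ψ J μ f₁ f₂ v‖ ≤ C * ∏ i, (max (vabs (v i)) 1 ^ (-(N i : ℝ)) *
              min (vabs (v i)) 1 ^ (-1 - (d i : ℝ) / 2)))) ∧
      (∀ N₂ N₃ : ℕ, ∃ C : ℝ, ∀ v ∈ Vprime F d, v 0 = 0 →
        absInt ψ J μ f₁ f₂ v ≤
            ENNReal.ofReal (C *
              ((max (vabs (v 1)) 1 ^ (-(N₂ : ℝ)) *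
                min (vabs (v 1)) 1 ^ (-(d 0 : ℝ) / 2 - (d 1 : ℝ) / 2)) *
              (max (vabs (v 2)) 1 ^ (-(N₃ : ℝ)) *
                min (vabs (v 2)) 1 ^ (-(d 0 : ℝ) / 2 - (d 2 : ℝ) / 2)))) ∧
        (v ∈ Ysm J → IConverges ψ J μ f₁ f₂ v ∧
          ‖intI ψ J μ f₁ f₂ v‖ ≤ C *
              ((max (vabs (v 1)) 1 ^ (-(N₂ : ℝ)) *
                min (vabs (v 1)) 1 ^ (-(d 0 : ℝ) / 2 - (d 1 : ℝ) / 2)) *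
              (max (vabs (v 2)) 1 ^ (-(N₃ : ℝ)) *
                min (vabs (v 2)) 1 ^ (-(d 0 : ℝ) / 2 - (d 2 : ℝ) / 2)))))) := by
  refine ⟨?_, ?_⟩
  · intro F _ _ _ _ _ _ ϖ hϖ d hd J hJ ψ hψ hψ1 μG hμG μN hμN μ hμ f₁ hf₁ f₂ hf₂ hc
    have hdecay : WeilDecay ψ J f₂ := fun m => exists_norm_weil_le_nonarch hψ hψ1 hJ hf₂ hc m
    refine ⟨bounds_nonarch (fun i => (hd i).1) hμ hψ hf₁.onX hf₁.smooth.continuous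
      (integrable_of_locallyConstant hf₂ hc) (leviDecay_of_schwartz hϖ hf₁) hdecay, ?_⟩
    obtain ⟨S, hS, h⟩ := exists_isCompact_support hϖ hf₁ hμ hψ hψ1 hJ hf₂ hc
    exact ⟨S, hS, fun v _ hv => (h v hv).1, fun v _ hv => (h v hv).2⟩
  · intro F _ d hd J hJ ψ hψ hψ1 μG hμG μN hμN μ hμ K hK f₁ hf₁ f₂
    have hdecay : WeilDecay ψ J f₂ := fun m => exists_norm_weil_le_arch hψ hψ1 hJ f₂ m
    have hd' : ∀ i, 0 < d i := fun i => (hd i).1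
    have hc := continuous_of_isSmoothArch hf₁.smooth
    have hl := leviDecay_of_schwartz_arch hK hf₁
    exact ⟨bounds_arch_ne_zero hd' hμ hψ hf₁.onX hc f₂.integrable hl hdecay,
      bounds_arch_eq_zero hd' hμ hψ hf₁.onX hc f₂.integrable hl hdecay⟩
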